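/- **Theorem.** An instance of Knapsack with multiplicities consists of $n\ge 1$ items, where item $i$ has a size $s_i\in\mathbb{Z}_{\ge 1}$, a value $v_i\in\mathbb{Z}_{\ge 0}$ and a (binary encoded) multiplicity $u_i\in\mathbb{Z}_{\ge 0}$, together with a capacity $t\in\mathbb{Z}_{\ge 0}$; the task is to find $x\in\mathbb{Z}^n$ that maximizes $\sum_{i=1}^n v_ix_i$ subject to $0\le x_i\le u_i$ for all $i$ and $\sum_{i=1}^n s_ix_i\le t$. Let $s=\max_i s_i$ be the maximum item size. Knapsack with multiplicities can be solved deterministically in $O(n+s^3)$ time on the word RAM whose words can hold integers polynomial in the sum of the input's integers. Precisely: there are a deterministic word RAM program $P$ and constants $C$ and $k\ge 1$ such that for every such instance and every word size $w$ with $2^w\ge\bigl(n+t+\sum_{i=1}^n(s_i+v_i+u_i)\bigr)^k$, the program $P$, started with $n$, $t$ and all $s_i,v_i,u_i$ in memory (one word each), halts after at most $C\,(n+s^3)$ unit-cost steps (arithmetic and bitwise operations and comparisons on $w$-bit words, indirect loads and stores, jumps), with an optimal solution $x_1,\dots,x_n$ and its value in memory. -/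

import Mathlib

/-! ### The word RAM -/

namespace WordRAM

/-- Binary word operations, each of unit cost. -/
inductive BinOp where
  | add | sub | mul | div | mod
  | and | or | xor | shl | shr
  | lt | eq

/-- The result of an operation on two `w`-bit words, as a `w`-bit word. Arithmetic wraps around
modulo `2 ^ w`; `div` and `mod` are the natural-number quotient and remainder
(with `a / 0 = 0` and `a % 0 = a`); comparisons return `1` or `0`. -/
def BinOp.eval (w : ℕ) (o : BinOp) (a b : ℕ) : ℕ :=
  (match o with
    | .add => a + b
    | .sub => a + (2 ^ w - b)
    | .mul => a * b
    | .div => a / b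
    | .mod => a % b
    | .and => a &&& b
    | .or => a ||| b
    | .xor => a ^^^ b
    | .shl => a <<< b
    | .shr => a >>> b
    | .lt => if a < b then 1 else 0
    | .eq => if a = b then 1 else 0) % 2 ^ w

/-- Instructions. Registers are named by numbers (a program mentions only finitely many of them);
jump targets are positions in the program. -/
inductive Instr where
  /-- `reg d := c` -/
  | const (d c : ℕ)
  /-- `reg d := reg a` -/
  | mov (d a : ℕ)
  /-- `reg d := reg a o reg b` -/
  | bin (o : BinOp) (d a b : ℕ)
  /-- `reg d := mem[reg a]` -/
  | load (d a : ℕ)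
  /-- `mem[reg a] := reg b` -/
  | store (a b : ℕ)
  /-- unconditional jump to position `l` -/
  | jmp (l : ℕ)
  /-- jump to position `l` if `reg a = 0` -/
  | jz (a l : ℕ)
  /-- stop -/
  | halt

/-- A program is a finite list of instructions. -/
abbrev Program := List Instr

/-- A machine configuration: program counter, registers, memory. The numbers in registers and
memory are `w`-bit words, i.e. smaller than `2 ^ w`; so are, consequently, the addresses used. -/
@[ext] structure State where
  pc : ℕ
  reg : ℕ → ℕ
  mem : ℕ → ℕ

/-- The effect of one instruction on a machine with word size `w`. -/
def Instr.exec (w : ℕ) (ins : Instr) (σ : State) : State :=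
  match ins with
  | .const d c => ⟨σ.pc + 1, Function.update σ.reg d (c % 2 ^ w), σ.mem⟩
  | .mov d a => ⟨σ.pc + 1, Function.update σ.reg d (σ.reg a), σ.mem⟩
  | .bin o d a b => ⟨σ.pc + 1, Function.update σ.reg d (o.eval w (σ.reg a) (σ.reg b)), σ.mem⟩
  | .load d a => ⟨σ.pc + 1, Function.update σ.reg d (σ.mem (σ.reg a)), σ.mem⟩
  | .store a b => ⟨σ.pc + 1, σ.reg, Function.update σ.mem (σ.reg a) (σ.reg b)⟩
  | .jmp l => ⟨l, σ.reg, σ.mem⟩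
  | .jz a l => ⟨if σ.reg a = 0 then l else σ.pc + 1, σ.reg, σ.mem⟩
  | .halt => σ

/-- The machine has halted: the program counter is at a `halt` instruction or outside the
program. -/
def Halted (P : Program) (σ : State) : Prop :=
  P[σ.pc]? = some Instr.halt ∨ P[σ.pc]? = none

/-- One unit-cost step; a halted configuration does not change. -/
def step (w : ℕ) (P : Program) (σ : State) : State :=
  match P[σ.pc]? with
  | some ins => ins.exec w σ
  | none => σ

/-- Started in `σ`, the program `P` on a machine with word size `w` has halted after `T` steps, in
the configuration `τ`. -/
def HaltsIn (w : ℕ) (P : Program) (σ : State) (T : ℕ) (τ : State) : Prop :=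
  (step w P)^[T] σ = τ ∧ Halted P τ

end WordRAM

/-! ### Knapsack with multiplicities -/

/-- An instance with `n` items: the size, the value and the multiplicity (the number of available
copies) of each item, and the knapsack capacity. -/
structure Knapsack (n : ℕ) where
  size : Fin n → ℕ
  value : Fin n → ℕ
  mult : Fin n → ℕ
  capacity : ℕ

namespace Knapsack

variable {n : ℕ}

/-- `x i` is the number of copies of item `i` that are taken. -/
def Feasible (K : Knapsack n) (x : Fin n → ℕ) : Prop :=
  (∀ i, x i ≤ K.mult i) ∧ ∑ i, K.size i * x i ≤ K.capacity

def totalValue (K : Knapsack n) (x : Fin n → ℕ) : ℕ :=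
  ∑ i, K.value i * x i

def IsOptimal (K : Knapsack n) (x : Fin n → ℕ) : Prop :=
  K.Feasible x ∧ ∀ y, K.Feasible y → K.totalValue y ≤ K.totalValue x

/-- The maximum item size. -/
def maxSize (K : Knapsack n) : ℕ :=
  Finset.univ.sup K.size

/-- The sum of all integers of the input, the number of items included. -/
def inputSum (K : Knapsack n) : ℕ :=
  n + K.capacity + ∑ i, (K.size i + K.value i + K.mult i)

/-- The input as memory content: cell `0` holds the number of items, cell `1` the capacity, cells
`2 + 3 * i`, `3 + 3 * i`, `4 + 3 * i` the size, value and multiplicity of item `i` (counted from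
`0`), and all other cells are `0`. -/
def inputMem (K : Knapsack n) (a : ℕ) : ℕ :=
  if a = 0 then n
  else if a = 1 then K.capacity
  else if h : (a - 2) / 3 < n then
    if (a - 2) % 3 = 0 then K.size ⟨(a - 2) / 3, h⟩
    else if (a - 2) % 3 = 1 then K.value ⟨(a - 2) / 3, h⟩
    else K.mult ⟨(a - 2) / 3, h⟩
  else 0

/-- The initial configuration: the input is in memory, the registers are `0`. -/
def initState (K : Knapsack n) : WordRAM.State :=
  ⟨0, fun _ => 0, K.inputMem⟩

/-- The configuration `τ` holds a correct output: cell `0` holds the optimal value, and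
cells `1, …, n` hold an optimal solution. -/
def CorrectOutput (K : Knapsack n) (τ : WordRAM.State) : Prop :=
  ∃ x : Fin n → ℕ, K.IsOptimal x ∧ τ.mem 0 = K.totalValue x ∧
    ∀ i : Fin n, τ.mem (1 + (i : ℕ)) = x i

end Knapsack

/-! Fill the knapsack greedily by value per size, down to a threshold that weighted selection finds
in linear time. The greedy solution `p` is close to an optimal one. Let `z` be an optimal solution
that differs from `p` in as few copies as possible. If `z` had at least `s` copies that `p` lacks,
or conversely, then the prefix sums of the sizes of added and removed copies could be matched with
gaps below `s`, and two equal gaps would give a set of added and a set of removed copies of the same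
total size (`exists_common_increment`). Exchanging them does not lower the value, since added copies
lie at or below the greedy threshold and removed ones at or above it, and it brings `z` closer to
`p` (`IsGreedy.no_exchange`). So `z` adds fewer than `s` and drops fewer than `s` copies in total
(`IsGreedy.exists_optimal_close`).

Now group the items by size. If `p` takes `P` copies of size `j`, then `z` takes between `P - s` and
`P + s` of them, and the best ones may be assumed. So the best `P - s` copies are fixed as a base
and the next `2 * s` copies are listed in order of value (`ClassData`); only the number of listed
copies remains to be chosen for each size. A dynamic program runs through the sizes `1, …, s`; its
state is the free capacity relative to the greedy solution. Fewer than `s` copies of size at most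
`s` change in either direction, so a window of length `2 * s ^ 2` suffices
(`ClassFamily.exists_path`). For a fixed size `j` and a fixed residue modulo `j`, one step is a
max-plus convolution with a concave sequence (`gain_concave`), that is, the search for the row
maxima of a Monge matrix, which the reduce-and-interpolate scheme of SMAWK solves in linear time
(`rowMaxima_spec`). All residues together cost `O(s ^ 2)`, all sizes `O(s ^ 3)`. Leaving a list or
the capacity is not forbidden but penalized by more than all attainable value; this keeps the
matrices total and Monge, and no optimal path is penalized (`ClassFamily.optimal`).

On the machine side, the algorithm is written in a small structured language over natural numbers
whose cost counts loop iterations only. Absence of overflow is a side condition of its semantics.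
`Run.compile` turns an execution into a run of the machine whose length is at most the code length
times the number of iterations plus one. With `S` the sum of the input, rows of width `S ^ 8` and
values below `S ^ 24` are enough. -/

namespace WordRAM

/-! ### A structured language for the word RAM -/

/-- Expressions over numbered variables and two-dimensional arrays. -/
inductive Expr where
  | var (x : ℕ)
  | lit (c : ℕ)
  | bin (o : BinOp) (a b : Expr)
  | ld (k : ℕ) (i j : Expr)

inductive Cond where
  | lt (a b : Expr)
  | le (a b : Expr)
  | eq (a b : Expr)

inductive Cmd where
  | skip
  | set (x : ℕ) (e : Expr)
  | put (k : ℕ) (i j e : Expr)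
  | seq (c₁ c₂ : Cmd)
  | ite (b : Cond) (c₁ c₂ : Cmd)
  | whl (b : Cond) (c : Cmd)

prefix:max "§" => Expr.var
infix:60 " ::= " => Cmd.set
infixr:55 " ;; " => Cmd.seq
infix:58 " ≺ " => Cond.lt
infix:58 " ≼ " => Cond.le
infix:58 " ≗ " => Cond.eq

instance (c : ℕ) : OfNat Expr c := ⟨.lit c⟩
instance : Add Expr := ⟨.bin .add⟩
instance : Sub Expr := ⟨.bin .sub⟩
instance : Mul Expr := ⟨.bin .mul⟩
instance : Div Expr := ⟨.bin .div⟩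
instance : Mod Expr := ⟨.bin .mod⟩

/-- Values of the variables and of the array cells. -/
structure Store where
  var : ℕ → ℕ
  arr : ℕ → ℕ → ℕ → ℕ

def Store.set (σ : Store) (x v : ℕ) : Store :=
  ⟨fun y => if y = x then v else σ.var y, σ.arr⟩

def Store.put (σ : Store) (k i j v : ℕ) : Store :=
  ⟨σ.var, fun k' => if k' = k then
    (fun i' j' => if i' = i ∧ j' = j then v else σ.arr k' i' j') else σ.arr k'⟩

/-- The row width `W` of the arrays, the bound `B` for values, and whether arrays other than
the raw memory may be used. -/
structure Env where
  W : ℕ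
  B : ℕ
  live : Prop

/-- Only the five arithmetic operations are used in the structured language. The others get a junk
value and are ruled out by `BinOp.Safe`. -/
def BinOp.val : BinOp → ℕ → ℕ → ℕ
  | .add, a, b => a + b
  | .sub, a, b => a - b
  | .mul, a, b => a * b
  | .div, a, b => a / b
  | .mod, a, b => a % b
  | _, _, _ => 0

/-- The operation does not overflow or underflow. -/
def BinOp.Safe (B : ℕ) : BinOp → ℕ → ℕ → Prop
  | .add, a, b => a + b < B
  | .sub, a, b => b ≤ a
  | .mul, a, b => a * b < B
  | .div, _, _ => True
  | .mod, _, _ => True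
  | _, _, _ => False

def Expr.eval (σ : Store) : Expr → ℕ
  | .var x => σ.var x
  | .lit c => c
  | .bin o a b => o.val (a.eval σ) (b.eval σ)
  | .ld k i j => σ.arr k (i.eval σ) (j.eval σ)

/-- Array `0` is the raw memory and has a single column. The other arrays need `E.live`: their
addresses are computed from the row width, which has to be available in a register. -/
def Expr.Ok (E : Env) (σ : Store) : Expr → Prop
  | .var _ => True
  | .lit c => c < 64
  | .bin o a b => a.Ok E σ ∧ b.Ok E σ ∧ o.Safe E.B (a.eval σ) (b.eval σ)
  | .ld k i j => i.Ok E σ ∧ j.Ok E σ ∧ (if k = 0 then j.eval σ = 0 else E.live) ∧ k < 32 ∧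
      i.eval σ < E.W ∧ j.eval σ < E.W

def Cond.Holds (σ : Store) : Cond → Prop
  | .lt a b => a.eval σ < b.eval σ
  | .le a b => a.eval σ ≤ b.eval σ
  | .eq a b => a.eval σ = b.eval σ

def Cond.Ok (E : Env) (σ : Store) : Cond → Prop
  | .lt a b => a.Ok E σ ∧ b.Ok E σ
  | .le a b => a.Ok E σ ∧ b.Ok E σ
  | .eq a b => a.Ok E σ ∧ b.Ok E σ

section simps
variable (σ : Store) (E : Env)
@[simp] theorem Store.set_var (x v y) : (σ.set x v).var y = if y = x then v else σ.var y := rfl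
@[simp] theorem Store.set_arr (x v) : (σ.set x v).arr = σ.arr := rfl
@[simp] theorem Store.put_var (k i j v) : (σ.put k i j v).var = σ.var := rfl
@[simp] theorem Store.put_arr (k i j v k') : (σ.put k i j v).arr k' = if k' = k then
    (fun i' j' => if i' = i ∧ j' = j then v else σ.arr k' i' j') else σ.arr k' := rfl
@[simp] theorem Expr.eval_var (x) : (Expr.var x).eval σ = σ.var x := rfl
@[simp] theorem Expr.eval_lit (c : ℕ) :
    (no_index (OfNat.ofNat c) : Expr).eval σ = (OfNat.ofNat c : ℕ) := rfl
@[simp] theorem Expr.eval_ld (k i j) :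
    (Expr.ld k i j).eval σ = σ.arr k (i.eval σ) (j.eval σ) := rfl
@[simp] theorem Expr.eval_add (a b : Expr) : (a + b).eval σ = a.eval σ + b.eval σ := rfl
@[simp] theorem Expr.eval_sub (a b : Expr) : (a - b).eval σ = a.eval σ - b.eval σ := rfl
@[simp] theorem Expr.eval_mul (a b : Expr) : (a * b).eval σ = a.eval σ * b.eval σ := rfl
@[simp] theorem Expr.eval_div (a b : Expr) : (a / b).eval σ = a.eval σ / b.eval σ := rfl
@[simp] theorem Expr.eval_mod (a b : Expr) : (a % b).eval σ = a.eval σ % b.eval σ := rfl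
@[simp] theorem Expr.ok_var (x) : (Expr.var x).Ok E σ ↔ True := Iff.rfl
@[simp] theorem Expr.ok_lit (c : ℕ) :
    (no_index (OfNat.ofNat c) : Expr).Ok E σ ↔ (OfNat.ofNat c : ℕ) < 64 := Iff.rfl
@[simp] theorem Expr.ok_ld (k i j) : (Expr.ld k i j).Ok E σ ↔ i.Ok E σ ∧ j.Ok E σ ∧
    (if k = 0 then j.eval σ = 0 else E.live) ∧ k < 32 ∧ i.eval σ < E.W ∧ j.eval σ < E.W := Iff.rfl
@[simp] theorem Expr.ok_add (a b : Expr) :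
    (a + b).Ok E σ ↔ a.Ok E σ ∧ b.Ok E σ ∧ a.eval σ + b.eval σ < E.B := Iff.rfl
@[simp] theorem Expr.ok_sub (a b : Expr) :
    (a - b).Ok E σ ↔ a.Ok E σ ∧ b.Ok E σ ∧ b.eval σ ≤ a.eval σ := Iff.rfl
@[simp] theorem Expr.ok_mul (a b : Expr) :
    (a * b).Ok E σ ↔ a.Ok E σ ∧ b.Ok E σ ∧ a.eval σ * b.eval σ < E.B := Iff.rfl
@[simp] theorem Expr.ok_div (a b : Expr) : (a / b).Ok E σ ↔ a.Ok E σ ∧ b.Ok E σ :=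
  ⟨fun h => ⟨h.1, h.2.1⟩, fun h => ⟨h.1, h.2, trivial⟩⟩
@[simp] theorem Expr.ok_mod (a b : Expr) : (a % b).Ok E σ ↔ a.Ok E σ ∧ b.Ok E σ :=
  ⟨fun h => ⟨h.1, h.2.1⟩, fun h => ⟨h.1, h.2, trivial⟩⟩
@[simp] theorem Cond.holds_lt (a b) : (Cond.lt a b).Holds σ ↔ a.eval σ < b.eval σ := Iff.rfl
@[simp] theorem Cond.holds_le (a b) : (Cond.le a b).Holds σ ↔ a.eval σ ≤ b.eval σ := Iff.rfl
@[simp] theorem Cond.holds_eq (a b) : (Cond.eq a b).Holds σ ↔ a.eval σ = b.eval σ := Iff.rfl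
@[simp] theorem Cond.ok_lt (a b) : (Cond.lt a b).Ok E σ ↔ a.Ok E σ ∧ b.Ok E σ := Iff.rfl
@[simp] theorem Cond.ok_le (a b) : (Cond.le a b).Ok E σ ↔ a.Ok E σ ∧ b.Ok E σ := Iff.rfl
@[simp] theorem Cond.ok_eq (a b) : (Cond.eq a b).Ok E σ ↔ a.Ok E σ ∧ b.Ok E σ := Iff.rfl
end simps

/-! ### Semantics of the structured language and its program logic -/

/-- Big-step semantics; the cost counts the loop iterations. -/
inductive Run (E : Env) : Cmd → Store → ℕ → Store → Prop
  | skip (σ) : Run E .skip σ 0 σ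
  | set (σ x e) : e.Ok E σ → Run E (.set x e) σ 0 (σ.set x (e.eval σ))
  | put (σ k) (i j e : Expr) : (Expr.ld k i j).Ok E σ → e.Ok E σ →
      Run E (.put k i j e) σ 0 (σ.put k (i.eval σ) (j.eval σ) (e.eval σ))
  | seq {c₁ c₂ σ t₁ σ₁ t₂ σ₂} : Run E c₁ σ t₁ σ₁ → Run E c₂ σ₁ t₂ σ₂ →
      Run E (.seq c₁ c₂) σ (t₁ + t₂) σ₂
  | iteT {b c₁ c₂ σ t τ} : b.Ok E σ → b.Holds σ → Run E c₁ σ t τ → Run E (.ite b c₁ c₂) σ t τ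
  | iteF {b c₁ c₂ σ t τ} : b.Ok E σ → ¬ b.Holds σ → Run E c₂ σ t τ → Run E (.ite b c₁ c₂) σ t τ
  | whlT {b c σ t₁ σ₁ t₂ σ₂} : b.Ok E σ → b.Holds σ → Run E c σ t₁ σ₁ →
      Run E (.whl b c) σ₁ t₂ σ₂ → Run E (.whl b c) σ (t₁ + 1 + t₂) σ₂
  | whlF {b c σ} : b.Ok E σ → ¬ b.Holds σ → Run E (.whl b c) σ 0 σ

/-- Does the command assign to the variable? -/
def Cmd.wv (y : ℕ) : Cmd → Bool
  | .skip => false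
  | .set x _ => x == y
  | .put _ _ _ _ => false
  | .seq a b => a.wv y || b.wv y
  | .ite _ a b => a.wv y || b.wv y
  | .whl _ a => a.wv y

/-- Does the command write to the array? -/
def Cmd.wa (y : ℕ) : Cmd → Bool
  | .skip => false
  | .set _ _ => false
  | .put k _ _ _ => k == y
  | .seq a b => a.wa y || b.wa y
  | .ite _ a b => a.wa y || b.wa y
  | .whl _ a => a.wa y

/-- The frame property: `c` changes only variables and arrays that occur as targets in it. Since
`Cmd.wv` and `Cmd.wa` compute, each use for a concrete command is settled by `rfl` or `decide`. -/
structure Agree (c : Cmd) (σ τ : Store) : Prop where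
  v : ∀ x, c.wv x = false → τ.var x = σ.var x
  a : ∀ k, c.wa k = false → τ.arr k = σ.arr k

theorem Agree.refl (c σ) : Agree c σ σ := ⟨fun _ _ => rfl, fun _ _ => rfl⟩
theorem Agree.trans {c σ τ υ} (h : Agree c σ τ) (h' : Agree c τ υ) : Agree c σ υ :=
  ⟨fun x hx => (h'.v x hx).trans (h.v x hx), fun x hx => (h'.a x hx).trans (h.a x hx)⟩

theorem Run.agree {E c σ t τ} (h : Run E c σ t τ) : Agree c σ τ := by
  induction h with
  | skip => exact Agree.refl _ _
  | set σ x e _ =>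
    refine ⟨fun y hy => ?_, fun _ _ => rfl⟩
    have : ¬ y = x := fun h => by simp [Cmd.wv, h] at hy
    simp [this]
  | put σ k i j e _ _ =>
    refine ⟨fun _ _ => rfl, fun y hy => ?_⟩
    have : ¬ y = k := fun h => by simp [Cmd.wa, h] at hy
    simp [this]
  | seq _ _ h1 h2 =>
    refine ⟨fun y hy => ?_, fun y hy => ?_⟩
    · simp only [Cmd.wv, Bool.or_eq_false_iff] at hy
      rw [h2.v y hy.2, h1.v y hy.1]
    · simp only [Cmd.wa, Bool.or_eq_false_iff] at hy
      rw [h2.a y hy.2, h1.a y hy.1]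
  | iteT _ _ _ h =>
    refine ⟨fun y hy => ?_, fun y hy => ?_⟩
    · simp only [Cmd.wv, Bool.or_eq_false_iff] at hy; exact h.v y hy.1
    · simp only [Cmd.wa, Bool.or_eq_false_iff] at hy; exact h.a y hy.1
  | iteF _ _ _ h =>
    refine ⟨fun y hy => ?_, fun y hy => ?_⟩
    · simp only [Cmd.wv, Bool.or_eq_false_iff] at hy; exact h.v y hy.2
    · simp only [Cmd.wa, Bool.or_eq_false_iff] at hy; exact h.a y hy.2
  | whlT _ _ _ _ h1 h2 =>
    refine ⟨fun y hy => ?_, fun y hy => ?_⟩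
    · rw [h2.v y hy, h1.v y hy]
    · rw [h2.a y hy, h1.a y hy]
  | whlF => exact Agree.refl _ _

/-- The command terminates with a cost and a store that satisfy `Q`. -/
def wp (E : Env) (c : Cmd) (σ : Store) (Q : ℕ → Store → Prop) : Prop :=
  ∃ t τ, Run E c σ t τ ∧ Q t τ

section wp
variable {E : Env} {σ : Store} {Q : ℕ → Store → Prop}

@[simp] theorem wp_skip : wp E .skip σ Q ↔ Q 0 σ :=
  ⟨fun ⟨_, _, h, q⟩ => by cases h; exact q, fun h => ⟨_, _, .skip _, h⟩⟩
@[simp] theorem wp_set {x e} :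
    wp E (.set x e) σ Q ↔ e.Ok E σ ∧ Q 0 (σ.set x (e.eval σ)) :=
  ⟨fun ⟨_, _, h, q⟩ => by cases h; exact ⟨‹_›, q⟩, fun h => ⟨_, _, .set _ _ _ h.1, h.2⟩⟩
@[simp] theorem wp_put {k i j e} :
    wp E (.put k i j e) σ Q ↔ (Expr.ld k i j).Ok E σ ∧ e.Ok E σ ∧
      Q 0 (σ.put k (i.eval σ) (j.eval σ) (e.eval σ)) :=
  ⟨fun ⟨_, _, h, q⟩ => by cases h; exact ⟨‹_›, ‹_›, q⟩,
    fun h => ⟨_, _, .put _ _ _ _ _ h.1 h.2.1, h.2.2⟩⟩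
@[simp] theorem wp_seq {a b} : wp E (.seq a b) σ Q ↔
    wp E a σ (fun t τ => wp E b τ (fun t' τ' => Q (t + t') τ')) :=
  ⟨fun ⟨_, _, h, q⟩ => by cases h with | seq h1 h2 => exact ⟨_, _, h1, _, _, h2, q⟩,
    fun ⟨_, _, h1, _, _, h2, q⟩ => ⟨_, _, .seq h1 h2, q⟩⟩
@[simp] theorem wp_ite {b c₁ c₂} : wp E (.ite b c₁ c₂) σ Q ↔
    b.Ok E σ ∧ (b.Holds σ → wp E c₁ σ Q) ∧ (¬ b.Holds σ → wp E c₂ σ Q) := by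
  constructor
  · rintro ⟨_, _, h, q⟩
    cases h with
    | iteT h1 h2 h3 => exact ⟨h1, fun _ => ⟨_, _, h3, q⟩, fun h => absurd h2 h⟩
    | iteF h1 h2 h3 => exact ⟨h1, fun h => absurd h h2, fun _ => ⟨_, _, h3, q⟩⟩
  · rintro ⟨h1, h2, h3⟩
    by_cases hb : b.Holds σ
    · obtain ⟨t, τ, h, q⟩ := h2 hb
      exact ⟨t, τ, .iteT h1 hb h, q⟩
    · obtain ⟨t, τ, h, q⟩ := h3 hb
      exact ⟨t, τ, .iteF h1 hb h, q⟩

/-- The rule of consequence, which also hands the frame property to the new postcondition, so that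
specifications need not list what stays unchanged. -/
theorem wp.mono {c} {Q' : ℕ → Store → Prop} (h : wp E c σ Q)
    (hQ : ∀ t τ, Agree c σ τ → Q t τ → Q' t τ) : wp E c σ Q' :=
  let ⟨t, τ, r, q⟩ := h; ⟨t, τ, r, hQ t τ r.agree q⟩

/-- The measure `μ` has two roles: it proves termination and, as an amortized potential, it bounds
the total cost, since every iteration pays for its body and for itself. -/
theorem wp_whl {b c} (I : Store → Prop) (μ : Store → ℕ) (h0 : I σ)
    (hstep : ∀ τ, Agree c σ τ → I τ → b.Ok E τ ∧
      (b.Holds τ → wp E c τ (fun t τ' => I τ' ∧ t + 1 + μ τ' ≤ μ τ)))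
    (hQ : ∀ t τ, Agree c σ τ → I τ → ¬ b.Holds τ → t + μ τ ≤ μ σ → Q t τ) :
    wp E (.whl b c) σ Q := by
  suffices h : ∀ m τ, Agree c σ τ → I τ → μ τ = m →
      ∃ t υ, Run E (.whl b c) τ t υ ∧ Agree c σ υ ∧ I υ ∧ ¬ b.Holds υ ∧ t + μ υ ≤ μ τ by
    obtain ⟨t, υ, r, h1, h2, h3, h4⟩ := h _ σ (Agree.refl _ _) h0 rfl
    exact ⟨t, υ, r, hQ t υ h1 h2 h3 h4⟩
  intro m
  induction m using Nat.strong_induction_on with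
  | _ m ih =>
    intro τ hA hI hm
    obtain ⟨hok, hb⟩ := hstep τ hA hI
    by_cases h : b.Holds τ
    · obtain ⟨t, υ, r, hI', hle⟩ := hb h
      obtain ⟨t', υ', r', h1, h2, h3, h4⟩ := ih (μ υ) (by omega) υ (hA.trans r.agree) hI' rfl
      exact ⟨_, _, .whlT hok h r r', h1, h2, h3, by omega⟩
    · exact ⟨0, τ, .whlF hok h, hA, hI, h, by omega⟩

/-- A loop whose body increments the counter `i`. -/
theorem wp_for {i : ℕ} {e : Expr} {c : Cmd} (N : ℕ) (I : ℕ → Store → Prop) (C : ℕ → ℕ)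
    (hi : σ.var i = 0) (h0 : I 0 σ)
    (he : ∀ k τ, Agree c σ τ → I k τ → e.Ok E τ ∧ e.eval τ = N)
    (hstep : ∀ k τ, k < N → Agree c σ τ → τ.var i = k → I k τ →
      wp E c τ (fun t τ' => τ'.var i = k + 1 ∧ I (k + 1) τ' ∧ t ≤ C k))
    (hQ : ∀ t τ, Agree c σ τ → τ.var i = N → I N τ → t ≤ N + ∑ k ∈ Finset.range N, C k → Q t τ) :
    wp E (.whl (§i ≺ e) c) σ Q := by
  have key : ∀ k ≤ N, (∑ x ∈ Finset.range N, C x) =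
      ∑ x ∈ Finset.range k, C x + ∑ x ∈ Finset.Ico k N, C x := fun k hk =>
    (Finset.sum_range_add_sum_Ico C hk).symm
  refine wp_whl (fun τ => τ.var i ≤ N ∧ I (τ.var i) τ)
    (fun τ => (N - τ.var i) + ∑ x ∈ Finset.Ico (τ.var i) N, C x) ⟨by omega, by rwa [hi]⟩ ?_ ?_
  · rintro τ hA ⟨hle, hI⟩
    obtain ⟨h1, h2⟩ := he _ τ hA hI
    refine ⟨⟨trivial, h1⟩, fun hb => ?_⟩
    simp only [Cond.holds_lt, Expr.eval_var, h2] at hb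
    refine (hstep _ τ hb hA rfl hI).mono ?_
    rintro t τ' - ⟨e1, e2, e3⟩
    rw [e1]
    refine ⟨⟨by omega, e2⟩, ?_⟩
    rw [Finset.sum_eq_sum_Ico_succ_bot hb C]
    omega
  · rintro t τ hA ⟨hle, hI⟩ hb ht
    obtain ⟨h1, h2⟩ := he _ τ hA hI
    simp only [Cond.holds_lt, Expr.eval_var, h2] at hb
    have hN : τ.var i = N := by omega
    rw [hN] at hI
    refine hQ t τ hA hN hI ?_
    simp only [hi, hN] at ht
    simpa using ht

/-- A chain of loop iterations. -/
inductive Reach (E : Env) (b : Cond) (c : Cmd) : Store → ℕ → Store → Prop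
  | refl (σ : Store) : Reach E b c σ 0 σ
  | step {σ : Store} {t₁ σ₁ t₂ σ₂} : b.Ok E σ → b.Holds σ → Run E c σ t₁ σ₁ →
      Reach E b c σ₁ t₂ σ₂ → Reach E b c σ (t₁ + 1 + t₂) σ₂

theorem Reach.trans {b c σ t τ t' υ} (h : Reach E b c σ t τ) (h' : Reach E b c τ t' υ) :
    Reach E b c σ (t + t') υ := by
  induction h with
  | refl => simpa using h'
  | step h1 h2 h3 _ ih => rw [add_assoc]; exact .step h1 h2 h3 (ih h')

theorem Reach.agree {b c σ t τ} (h : Reach E b c σ t τ) : Agree c σ τ := by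
  induction h with
  | refl => exact Agree.refl _ _
  | step _ _ h3 _ ih => exact h3.agree.trans ih

/-- Chains serve for a loop that simulates a recursion: partial executions are composed by
`Reach.trans`, and only the end of the last one has to falsify the guard. -/
theorem Reach.run {b c σ t τ} (h : Reach E b c σ t τ) (h1 : b.Ok E τ) (h2 : ¬ b.Holds τ) :
    Run E (.whl b c) σ t τ := by
  induction h with
  | refl => exact .whlF h1 h2
  | step a1 a2 a3 _ ih => exact .whlT a1 a2 a3 (ih h1 h2)
end wp

end WordRAM

namespace WordRAM

/-! ### Compilation -/

/-- Replace the two indices in the temporaries `d`, `d + 1` by an address. -/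
def addrCode (k d : ℕ) : Program :=
  if k = 0 then [] else
    [.bin .mul (2 * d + 2) (2 * d + 2) 0, .bin .add (2 * d + 2) (2 * d + 2) (2 * d + 4),
     .const (2 * d + 4) 32, .bin .mul (2 * d + 2) (2 * d + 2) (2 * d + 4),
     .const (2 * d + 4) k, .bin .add (2 * d + 2) (2 * d + 2) (2 * d + 4),
     .bin .add (2 * d + 2) (2 * d + 2) 0]

/-- Variable `x` lives in the odd register `2 * x + 1`, the temporary of nesting depth `d` in the
even register `2 * d + 2`. Register `0` is reserved for the row width of the arrays. -/
def Expr.code : Expr → ℕ → Program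
  | .var x, d => [.mov (2 * d + 2) (2 * x + 1)]
  | .lit c, d => [.const (2 * d + 2) c]
  | .bin o a b, d => a.code d ++ b.code (d + 1) ++ [.bin o (2 * d + 2) (2 * d + 2) (2 * d + 4)]
  | .ld k i j, d => i.code d ++ j.code (d + 1) ++ addrCode k d ++
      [.load (2 * d + 2) (2 * d + 2)]

def Cond.code : Cond → Program
  | .lt a b => a.code 0 ++ b.code 1 ++ [.bin .lt 2 2 4]
  | .le a b => b.code 0 ++ a.code 1 ++ [.bin .lt 2 2 4, .const 4 0, .bin .eq 2 2 4]
  | .eq a b => a.code 0 ++ b.code 1 ++ [.bin .eq 2 2 4]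

/-- Jump targets are absolute, so the code of a command depends on its position; its length does
not, and is needed to compute the targets. -/
def Cmd.len : Cmd → ℕ
  | .skip => 0
  | .set _ e => (e.code 0).length + 1
  | .put k i j e =>
    (i.code 0 ++ j.code 1 ++ addrCode k 0 ++ e.code 1).length + 1
  | .seq a b => a.len + b.len
  | .ite b c₁ c₂ => b.code.length + 1 + c₁.len + 1 + c₂.len
  | .whl b c => b.code.length + 1 + c.len + 1

/-- The code of a command, to be placed at position `p` of a program. -/
def Cmd.code : Cmd → ℕ → Program
  | .skip, _ => []
  | .set x e, _ => e.code 0 ++ [.mov (2 * x + 1) 2]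
  | .put k i j e, _ => (i.code 0 ++ j.code 1 ++ addrCode k 0 ++ e.code 1) ++ [.store 2 4]
  | .seq a b, p => a.code p ++ b.code (p + a.len)
  | .ite b c₁ c₂, p => b.code ++ ([.jz 2 (p + b.code.length + 1 + c₁.len + 1)] ++
      (c₁.code (p + b.code.length + 1) ++ ([.jmp (p + b.code.length + 1 + c₁.len + 1 + c₂.len)] ++
      c₂.code (p + b.code.length + 1 + c₁.len + 1))))
  | .whl b c, p => b.code ++ ([.jz 2 (p + b.code.length + 1 + c.len + 1)] ++
      (c.code (p + b.code.length + 1) ++ [.jmp p]))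

theorem Cmd.length_code (c : Cmd) : ∀ p, (c.code p).length = c.len := by
  induction c with
  | skip => intro p; rfl
  | set x e => intro p; simp [Cmd.code, Cmd.len]
  | put k i j e => intro p; simp [Cmd.code, Cmd.len]; omega
  | seq a b ha hb => intro p; simp [Cmd.code, Cmd.len, ha, hb]
  | ite b c₁ c₂ h1 h2 => intro p; simp [Cmd.code, Cmd.len, h1, h2]; omega
  | whl b c h => intro p; simp [Cmd.code, Cmd.len, h]; omega

def CodeAt (P : Program) (p : ℕ) (l : Program) : Prop :=
  ∀ i < l.length, P[p + i]? = l[i]?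

theorem CodeAt.left {P p a b} (h : CodeAt P p (a ++ b)) : CodeAt P p a := fun i hi => by
  rw [h i (by simp; omega), List.getElem?_append_left hi]

theorem CodeAt.right {P p a b} (h : CodeAt P p (a ++ b)) : CodeAt P (p + a.length) b :=
  fun i hi => by
    rw [add_assoc, h (a.length + i) (by simp; omega),
      List.getElem?_append_right (by omega), Nat.add_sub_cancel_left]

theorem codeAt_append (a b c : Program) : CodeAt (a ++ (b ++ c)) a.length b := fun i hi => by
  rw [List.getElem?_append_right (by omega), Nat.add_sub_cancel_left, List.getElem?_append_left hi]

/-! ### Correctness of the compiled code -/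

/-- The effect of instructions without jumps. -/
def execs (w : ℕ) (l : Program) (ρ : State) : State := l.foldl (fun ρ i => i.exec w ρ) ρ

theorem execs_append (w a b ρ) : execs w (a ++ b) ρ = execs w b (execs w a ρ) :=
  List.foldl_append

def Straight (l : Program) : Prop := ∀ i ∈ l, ∀ w ρ, (i.exec w ρ).pc = ρ.pc + 1

theorem Straight.append {a b} (ha : Straight a) (hb : Straight b) : Straight (a ++ b) :=
  fun i hi => by
    rcases List.mem_append.1 hi with h | h
    · exact ha i h
    · exact hb i h

theorem straight_addrCode (k d) : Straight (addrCode k d) := by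
  unfold addrCode
  split
  · intro i hi; simp at hi
  · intro i hi w ρ
    simp only [List.mem_cons, List.not_mem_nil, or_false] at hi
    rcases hi with h | h | h | h | h | h | h <;> subst h <;> rfl

theorem Expr.straight (e : Expr) : ∀ d, Straight (e.code d) := by
  induction e with
  | var x => intro d i hi w ρ; simp [Expr.code] at hi; subst hi; rfl
  | lit c => intro d i hi w ρ; simp [Expr.code] at hi; subst hi; rfl
  | bin o a b ha hb =>
    intro d
    refine ((ha d).append (hb _)).append ?_
    intro i hi w ρ; simp at hi; subst hi; rfl
  | ld k i j hi hj =>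
    intro d
    refine (((hi d).append (hj _)).append (straight_addrCode k d)).append ?_
    intro i hi w ρ; simp at hi; subst hi; rfl

theorem Cond.straight (b : Cond) : Straight b.code := by
  cases b with
  | lt a b =>
    refine ((a.straight 0).append (b.straight 1)).append ?_
    intro i hi w ρ; simp at hi; subst hi; rfl
  | le a b =>
    refine ((b.straight 0).append (a.straight 1)).append ?_
    intro i hi w ρ; simp at hi; rcases hi with h | h | h <;> subst h <;> rfl
  | eq a b =>
    refine ((a.straight 0).append (b.straight 1)).append ?_
    intro i hi w ρ; simp at hi; subst hi; rfl

theorem step_eq {w P ρ ins} (h : P[ρ.pc]? = some ins) : step w P ρ = ins.exec w ρ := by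
  simp [step, h]

theorem execs_steps (w : ℕ) (P : Program) (l : Program) : ∀ ρ, Straight l → CodeAt P ρ.pc l →
    (step w P)^[l.length] ρ = execs w l ρ ∧ (execs w l ρ).pc = ρ.pc + l.length := by
  induction l with
  | nil => intro ρ _ _; exact ⟨rfl, rfl⟩
  | cons a l ih =>
    intro ρ hs hc
    have ha : P[ρ.pc]? = some a := by simpa using hc 0 (by simp)
    have hp := hs a (by simp) w ρ
    obtain ⟨h1, h2⟩ := ih (a.exec w ρ) (fun i hi => hs i (by simp [hi])) (fun i hi => by
      rw [hp]
      have := hc (i + 1) (by simpa using hi)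
      rw [add_assoc, add_comm 1 i, this]; simp)
    refine ⟨?_, ?_⟩
    · rw [List.length_cons, Function.iterate_succ_apply, step_eq ha, h1]; rfl
    · change (execs w l (a.exec w ρ)).pc = _
      rw [h2, hp, List.length_cons]; omega

/-- The cells below `E.W` are the raw memory. Above them the arrays are interleaved: array number,
column and row are the digits of a mixed radix expansion, whence injectivity. -/
def Env.addr (E : Env) (k i j : ℕ) : ℕ := E.W + ((i * E.W + j) * 32 + k)

theorem Env.addr_inj {E : Env} {k i j k' i' j' : ℕ} (hk : k < 32) (hk' : k' < 32) (hj : j < E.W)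
    (hj' : j' < E.W) (h : E.addr k i j = E.addr k' i' j') : k = k' ∧ i = i' ∧ j = j' := by
  unfold Env.addr at h
  have h1 : k = k' := by omega
  have h2 : i * E.W + j = i' * E.W + j' := by omega
  have h3 : i = i' := by
    have e1 : (i * E.W + j) / E.W = i := by
      rw [mul_comm, Nat.mul_add_div (by omega), Nat.div_eq_of_lt hj]; rfl
    have e2 : (i' * E.W + j') / E.W = i' := by
      rw [mul_comm, Nat.mul_add_div (by omega), Nat.div_eq_of_lt hj']; rfl
    rw [← e1, h2, e2]
  subst h3
  exact ⟨h1, rfl, by omega⟩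

/-- The environment fits a machine with `w`-bit words. -/
structure Env.Fits (E : Env) (w : ℕ) : Prop where
  le : E.B ≤ 2 ^ w
  lit : 64 ≤ 2 ^ w
  addr : E.W + E.W * E.W * 32 ≤ 2 ^ w

theorem Env.Fits.addr_lt {E : Env} {w k i j : ℕ} (h : E.Fits w) (hk : k < 32) (hi : i < E.W)
    (hj : j < E.W) : E.addr k i j < 2 ^ w ∧ i * E.W < 2 ^ w ∧ i * E.W + j < 2 ^ w ∧
      (i * E.W + j) * 32 < 2 ^ w ∧ (i * E.W + j) * 32 + k < 2 ^ w := by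
  have := h.addr
  have : (i + 1) * E.W ≤ E.W * E.W := Nat.mul_le_mul_right _ hi
  rw [add_mul] at this
  unfold Env.addr
  refine ⟨?_, ?_, ?_, ?_, ?_⟩ <;> omega

/-- The registers and the memory of the machine represent the store. -/
structure Sim (E : Env) (w : ℕ) (σ : Store) (ρ : State) : Prop where
  vars : ∀ x, ρ.reg (2 * x + 1) = σ.var x
  base : E.live → ρ.reg 0 = E.W
  raw : ∀ i < E.W, ρ.mem i = σ.arr 0 i 0
  cells : ∀ k i j, 0 < k → k < 32 → i < E.W → j < E.W → ρ.mem (E.addr k i j) = σ.arr k i j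
  bv : ∀ x, σ.var x < 2 ^ w
  ba : ∀ k i j, σ.arr k i j < 2 ^ w

/-- Only temporaries from `d` on differ. -/
structure Keep (d : ℕ) (ρ ρ' : State) : Prop where
  odd : ∀ x, ρ'.reg (2 * x + 1) = ρ.reg (2 * x + 1)
  zero : ρ'.reg 0 = ρ.reg 0
  low : ∀ x < d, ρ'.reg (2 * x + 2) = ρ.reg (2 * x + 2)
  mem : ρ'.mem = ρ.mem

theorem Keep.refl (d ρ) : Keep d ρ ρ := ⟨fun _ => rfl, rfl, fun _ _ => rfl, rfl⟩
theorem Keep.trans {d ρ ρ' ρ''} (h : Keep d ρ ρ') (h' : Keep d ρ' ρ'') : Keep d ρ ρ'' :=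
  ⟨fun x => (h'.odd x).trans (h.odd x), h'.zero.trans h.zero,
    fun x hx => (h'.low x hx).trans (h.low x hx), h'.mem.trans h.mem⟩
theorem Keep.weaken {d d' ρ ρ'} (h : Keep d' ρ ρ') (hd : d ≤ d') : Keep d ρ ρ' :=
  ⟨h.odd, h.zero, fun x hx => h.low x (by omega), h.mem⟩
theorem Keep.sim {d ρ ρ' E w σ} (h : Keep d ρ ρ') (hs : Sim E w σ ρ) : Sim E w σ ρ' :=
  ⟨fun x => (h.odd x).trans (hs.vars x), fun hl => h.zero.trans (hs.base hl),
    fun i hi => by rw [h.mem]; exact hs.raw i hi,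
    fun k i j h1 h2 h3 h4 => by rw [h.mem]; exact hs.cells k i j h1 h2 h3 h4, hs.bv, hs.ba⟩

theorem Keep.update {d : ℕ} {ρ : State} {p r m} (h : Keep d ρ ⟨p, r, m⟩) (p' v x : ℕ)
    (hx : d ≤ x) : Keep d ρ ⟨p', Function.update r (2 * x + 2) v, m⟩ := by
  refine ⟨fun y => ?_, ?_, fun y hy => ?_, h.mem⟩
  · have : 2 * y + 1 ≠ 2 * x + 2 := by omega
    exact (Function.update_of_ne this _ _).trans (h.odd y)
  · have : 0 ≠ 2 * x + 2 := by omega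
    exact (Function.update_of_ne this v r).trans h.zero
  · have : 2 * y + 2 ≠ 2 * x + 2 := by omega
    exact (Function.update_of_ne this _ _).trans (h.low y hy)

theorem keep_update (d : ℕ) (ρ : State) (p v x : ℕ) (hx : d ≤ x) :
    Keep d ρ ⟨p, Function.update ρ.reg (2 * x + 2) v, ρ.mem⟩ :=
  Keep.update (p := ρ.pc) (Keep.refl d ρ) p v x hx

theorem BinOp.eval_eq_val {w B : ℕ} (hB : B ≤ 2 ^ w) (o : BinOp) {a b : ℕ} (ha : a < 2 ^ w)
    (h : o.Safe B a b) : o.eval w a b = o.val a b ∧ o.val a b < 2 ^ w := by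
  have key : o.val a b < 2 ^ w := by
    cases o <;> simp only [BinOp.Safe] at h <;> simp only [BinOp.val]
    · omega
    · omega
    · omega
    · exact lt_of_le_of_lt (Nat.div_le_self _ _) ha
    · exact lt_of_le_of_lt (Nat.mod_le _ _) ha
  refine ⟨?_, key⟩
  cases o <;> simp only [BinOp.Safe] at h <;> simp only [BinOp.val, BinOp.eval] at key ⊢
  · exact Nat.mod_eq_of_lt key
  · have : a + (2 ^ w - b) = (a - b) + 2 ^ w ∨ b > 2 ^ w := by omega
    rcases this with h' | h'
    · rw [h', Nat.add_mod_right, Nat.mod_eq_of_lt key]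
    · omega
  · exact Nat.mod_eq_of_lt key
  · exact Nat.mod_eq_of_lt key
  · exact Nat.mod_eq_of_lt key

theorem addrCode_spec {E : Env} {w : ℕ} (hE : E.Fits w) {σ ρ} (hs : Sim E w σ ρ) {k d i j : ℕ}
    (hl : if k = 0 then j = 0 else E.live)
    (hk : k < 32) (hi : i < E.W) (hj : j < E.W) (e1 : ρ.reg (2 * d + 2) = i)
    (e2 : ρ.reg (2 * d + 4) = j) :
    (execs w (addrCode k d) ρ).reg (2 * d + 2) = (if k = 0 then i else E.addr k i j) ∧
      Keep d ρ (execs w (addrCode k d) ρ) := by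
  unfold addrCode
  split
  · exact ⟨e1, Keep.refl _ _⟩
  · rename_i hk0
    rw [if_neg hk0] at hl
    have hb := hs.base hl
    obtain ⟨a1, a2, a3, a4, a5⟩ := hE.addr_lt hk hi hj
    have := hE.lit
    have ne1 : (0 : ℕ) ≠ 2 * d + 2 := by omega
    have ne2 : 2 * d + 4 ≠ 2 * d + 2 := by omega
    have ne4 : 2 * d + 2 ≠ 2 * d + 4 := by omega
    have ne3 : (0 : ℕ) ≠ 2 * d + 4 := by omega
    have m1 : 32 % 2 ^ w = 32 := Nat.mod_eq_of_lt (by omega)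
    have m2 : k % 2 ^ w = k := Nat.mod_eq_of_lt (by omega)
    refine ⟨?_, ?_⟩
    · simp only [execs, List.foldl, Instr.exec, Function.update_self, ne_eq, ne1, ne2, ne3, ne4,
        not_false_eq_true, Function.update_of_ne, BinOp.eval, e1, e2, hb, m1, m2,
        Nat.mod_eq_of_lt a2, Nat.mod_eq_of_lt a3, Nat.mod_eq_of_lt a4, Nat.mod_eq_of_lt a5]
      rw [add_comm]
      exact Nat.mod_eq_of_lt a1
    · simp only [execs, List.foldl, Instr.exec]
      have h0 : Keep d ρ ⟨ρ.pc, ρ.reg, ρ.mem⟩ := Keep.refl d ρ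
      exact ((((((h0.update 0 _ d le_rfl).update 0 _ d le_rfl).update 0 _ (d + 1) (by omega)).update
        0 _ d le_rfl).update 0 _ (d + 1) (by omega)).update 0 _ d le_rfl).update _ _ d le_rfl

/-- The second operand is evaluated at depth `d + 1`, and `Keep` guarantees that the first operand,
held in temporary `d`, survives this. -/
theorem Expr.code_spec {E : Env} {w : ℕ} (hE : E.Fits w) {σ} (e : Expr) : ∀ d ρ, Sim E w σ ρ →
    e.Ok E σ → (execs w (e.code d) ρ).reg (2 * d + 2) = e.eval σ ∧
      Keep d ρ (execs w (e.code d) ρ) ∧ e.eval σ < 2 ^ w := by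
  induction e with
  | var x =>
    intro d ρ hs _
    refine ⟨?_, keep_update d ρ _ _ d le_rfl, hs.bv x⟩
    simpa [Expr.code, execs, Instr.exec] using hs.vars x
  | lit c =>
    intro d ρ hs h
    have h' : c < 64 := h
    have := hE.lit
    have hc : c < 2 ^ w := by omega
    refine ⟨?_, keep_update d ρ _ _ d le_rfl, hc⟩
    simp [Expr.code, execs, Instr.exec, Expr.eval, Nat.mod_eq_of_lt hc]
  | bin o a b ha hb =>
    intro d ρ hs h
    obtain ⟨h1, h2, h3⟩ := h
    obtain ⟨a1, a2, a3⟩ := ha d ρ hs h1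
    obtain ⟨b1, b2, b3⟩ := hb (d + 1) _ (a2.sim hs) h2
    obtain ⟨o1, o2⟩ := o.eval_eq_val hE.le a3 h3
    simp only [Expr.code, execs_append]
    refine ⟨?_, (a2.trans (b2.weaken (by omega))).trans ?_, o2⟩
    · have c1 := b2.low d (by omega)
      simp only [execs, List.foldl, Instr.exec, Function.update_self] at *
      rw [c1, a1, show 2 * d + 4 = 2 * (d + 1) + 2 by ring, b1, o1]
      rfl
    · exact keep_update d _ _ _ d le_rfl
  | ld k i j hi hj =>
    intro d ρ hs h
    obtain ⟨h1, h2, h3, h4, h5, h6⟩ := h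
    obtain ⟨a1, a2, a3⟩ := hi d ρ hs h1
    obtain ⟨b1, b2, b3⟩ := hj (d + 1) _ (a2.sim hs) h2
    have hs' := b2.sim (a2.sim hs)
    obtain ⟨c1, c2⟩ := addrCode_spec (d := d) hE hs' h3 h4 h5 h6
      ((b2.low d (by omega)).trans a1) b1
    simp only [Expr.code, execs_append]
    refine ⟨?_, ((a2.trans (b2.weaken (by omega))).trans c2).trans ?_, hs.ba _ _ _⟩
    · simp only [execs, List.foldl, Instr.exec, Function.update_self] at *
      rw [c1]
      have hs'' := c2.sim hs'
      split
      · rename_i hk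
        rw [if_pos hk] at h3
        rw [hs''.raw _ h5, hk, Expr.eval, h3]
      · exact hs''.cells k _ _ (by omega) h4 h5 h6
    · exact keep_update d _ _ _ d le_rfl

theorem Cond.code_spec {E : Env} {w : ℕ} (hE : E.Fits w) {σ ρ} (b : Cond) (hs : Sim E w σ ρ)
    (h : b.Ok E σ) : ((execs w b.code ρ).reg 2 = 0 ↔ ¬ b.Holds σ) ∧
      Sim E w σ (execs w b.code ρ) := by
  have h64 := hE.lit
  have m1 : 1 % 2 ^ w = 1 := Nat.mod_eq_of_lt (by omega)
  have two : ∀ (a b : Expr), a.Ok E σ → b.Ok E σ →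
      (execs w (a.code 0 ++ b.code 1) ρ).reg 2 = a.eval σ ∧
      (execs w (a.code 0 ++ b.code 1) ρ).reg 4 = b.eval σ ∧
      Keep 0 ρ (execs w (a.code 0 ++ b.code 1) ρ) := by
    intro a b ha hb
    obtain ⟨a1, a2, a3⟩ := a.code_spec hE 0 ρ hs ha
    obtain ⟨b1, b2, b3⟩ := b.code_spec hE 1 _ (a2.sim hs) hb
    rw [execs_append]
    exact ⟨(b2.low 0 (by omega)).trans a1, b1, a2.trans (b2.weaken (by omega))⟩
  cases b with
  | lt a b =>
    obtain ⟨a1, a2, a3⟩ := two a b h.1 h.2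
    simp only [Cond.code, execs_append _ (_ ++ _)]
    generalize execs w (a.code 0 ++ b.code 1) ρ = ρ' at *
    refine ⟨?_, (a3.trans (keep_update 0 _ _ _ 0 le_rfl)).sim hs⟩
    simp only [execs, List.foldl, Instr.exec, Function.update_self, BinOp.eval, a1, a2,
      Cond.holds_lt]
    split <;> simp_all
  | le a b =>
    obtain ⟨a1, a2, a3⟩ := two b a h.2 h.1
    simp only [Cond.code, execs_append _ (_ ++ _)]
    generalize execs w (b.code 0 ++ a.code 1) ρ = ρ' at *
    refine ⟨?_, Keep.sim (((a3.update (p := ρ'.pc) 0 _ 0 le_rfl).update 0 _ 1 (by omega)).update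
      _ _ 0 le_rfl) hs⟩
    simp only [execs, List.foldl, Instr.exec, Function.update_self, BinOp.eval, a1, a2,
      Cond.holds_le, Function.update_of_ne (show (2 : ℕ) ≠ 4 by decide)]
    by_cases hc : b.eval σ < a.eval σ
    · simp [hc, m1]
    · simp [hc, m1]
  | eq a b =>
    obtain ⟨a1, a2, a3⟩ := two a b h.1 h.2
    simp only [Cond.code, execs_append _ (_ ++ _)]
    generalize execs w (a.code 0 ++ b.code 1) ρ = ρ' at *
    refine ⟨?_, (a3.trans (keep_update 0 _ _ _ 0 le_rfl)).sim hs⟩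
    simp only [execs, List.foldl, Instr.exec, Function.update_self, BinOp.eval, a1, a2,
      Cond.holds_eq]
    split <;> simp_all

theorem Sim.set {E : Env} {w : ℕ} {σ ρ} (hs : Sim E w σ ρ) (x v p : ℕ) (hv : v < 2 ^ w) :
    Sim E w (σ.set x v) ⟨p, Function.update ρ.reg (2 * x + 1) v, ρ.mem⟩ := by
  refine ⟨fun y => ?_, fun hl => ?_, hs.raw, hs.cells, fun y => ?_, hs.ba⟩
  · rw [Store.set_var]
    split
    · rename_i h; subst h; exact Function.update_self _ _ _
    · exact (Function.update_of_ne (by omega) _ _).trans (hs.vars y)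
  · have : 0 ≠ 2 * x + 1 := by omega
    exact (Function.update_of_ne this v ρ.reg).trans (hs.base hl)
  · rw [Store.set_var]
    split
    · exact hv
    · exact hs.bv y

theorem Sim.put {E : Env} {w : ℕ} {σ ρ} (hs : Sim E w σ ρ) (k i j v p : ℕ) (hv : v < 2 ^ w)
    (hl : if k = 0 then j = 0 else E.live)
    (hk : k < 32) (hi : i < E.W) (hj : j < E.W) :
    Sim E w (σ.put k i j v)
      ⟨p, ρ.reg, Function.update ρ.mem (if k = 0 then i else E.addr k i j) v⟩ := by
  refine ⟨hs.vars, hs.base, fun i' hi' => ?_, fun k' i' j' h1 h2 h3 h4 => ?_, hs.bv,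
    fun k' i' j' => ?_⟩
  · by_cases hk0 : k = 0
    · subst hk0
      simp only [if_true] at hl
      subst hl
      simp only [Store.put_arr, if_true, and_true, Function.update_apply]
      split
      · rfl
      · exact hs.raw i' hi'
    · rw [if_neg hk0, Store.put_arr, if_neg (by omega)]
      refine (Function.update_of_ne ?_ _ _).trans (hs.raw i' hi')
      unfold Env.addr; omega
  · by_cases hk0 : k = 0
    · rw [if_pos hk0, Store.put_arr, if_neg (by omega)]
      refine (Function.update_of_ne ?_ _ _).trans (hs.cells k' i' j' h1 h2 h3 h4)
      unfold Env.addr; omega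
    · rw [if_neg hk0, Store.put_arr]
      simp only [Function.update_apply]
      by_cases he : E.addr k' i' j' = E.addr k i j
      · obtain ⟨e1, e2, e3⟩ := Env.addr_inj h2 hk h4 hj he
        simp [e1, e2, e3]
      · rw [if_neg he, hs.cells k' i' j' h1 h2 h3 h4]
        split
        · rename_i hkk
          subst hkk
          dsimp only
          rw [if_neg]
          rintro ⟨rfl, rfl⟩
          exact he rfl
        · rfl
  · rw [Store.put_arr]
    split
    · dsimp only
      split
      · exact hv
      · exact hs.ba _ _ _
    · exact hs.ba _ _ _

/-- Each counted loop iteration pays for at most one passage through the code, and one more passage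
covers what is executed without iterating. Hence the bound `c.len * (t + 1)`. -/
theorem Run.compile {E : Env} {w : ℕ} (hE : E.Fits w) {c σ t τ} (h : Run E c σ t τ)
    (P : Program) : ∀ p ρ, Sim E w σ ρ → ρ.pc = p → CodeAt P p (c.code p) →
    ∃ T ρ', (step w P)^[T] ρ = ρ' ∧ T ≤ c.len * (t + 1) ∧ Sim E w τ ρ' ∧ ρ'.pc = p + c.len := by
  induction h with
  | skip σ => intro p ρ hs hp _; exact ⟨0, ρ, rfl, by simp, hs, by simp [hp, Cmd.len]⟩
  | set σ x e he =>
    intro p ρ hs hp hc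
    subst hp
    obtain ⟨a1, a2, a3⟩ := e.code_spec hE 0 ρ hs he
    have hst : Straight (Cmd.code (.set x e) ρ.pc) :=
      (e.straight 0).append (fun i hi w ρ => by simp at hi; subst hi; rfl)
    obtain ⟨b1, b2⟩ := execs_steps w P _ ρ hst hc
    rw [Cmd.length_code] at b1 b2
    refine ⟨_, _, b1, by simp, ?_, b2⟩
    simp only [Cmd.code, execs_append]
    generalize execs w (e.code 0) ρ = ρ' at *
    have := (a2.sim hs).set x (e.eval σ) (ρ'.pc + 1) a3
    simpa only [execs, List.foldl, Instr.exec, a1] using this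
  | put σ k i j e hij he =>
    intro p ρ hs hp hc
    subst hp
    obtain ⟨h1, h2, h3, h4, h5, h6⟩ := hij
    obtain ⟨a1, a2, a3⟩ := i.code_spec hE 0 ρ hs h1
    obtain ⟨b1, b2, b3⟩ := j.code_spec hE 1 _ (a2.sim hs) h2
    have hs' := b2.sim (a2.sim hs)
    obtain ⟨c1, c2⟩ := addrCode_spec (d := 0) hE hs' h3 h4 h5 h6
      ((b2.low 0 (by omega)).trans a1) b1
    obtain ⟨d1, d2, d3⟩ := e.code_spec hE 1 _ (c2.sim hs') he
    have hst : Straight (Cmd.code (.put k i j e) ρ.pc) :=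
      ((((i.straight 0).append (j.straight 1)).append (straight_addrCode k 0)).append
        (e.straight 1)).append (fun i hi w ρ => by simp at hi; subst hi; rfl)
    obtain ⟨r1, r2⟩ := execs_steps w P _ ρ hst hc
    rw [Cmd.length_code] at r1 r2
    refine ⟨_, _, r1, by simp, ?_, r2⟩
    simp only [Cmd.code, execs_append]
    have c3 := (d2.low 0 (by omega)).trans c1
    generalize execs w (e.code 1) _ = ρ' at *
    have := (d2.sim (c2.sim hs')).put k _ _ _ (ρ'.pc + 1) d3 h3 h4 h5 h6
    simpa only [execs, List.foldl, Instr.exec, d1, c3] using this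
  | @seq a b σ t₁ σ₁ t₂ σ₂ _ _ ih1 ih2 =>
    intro p ρ hs hp hc
    obtain ⟨T1, ρ1, r1, l1, s1, p1⟩ := ih1 p ρ hs hp hc.left
    have hc2 := hc.right
    rw [Cmd.length_code] at hc2
    obtain ⟨T2, ρ2, r2, l2, s2, p2⟩ := ih2 _ ρ1 s1 p1 hc2
    refine ⟨T2 + T1, ρ2, by rw [Function.iterate_add_apply, r1, r2], ?_, s2, by
      rw [p2, Cmd.len]; ring⟩
    simp only [Cmd.len]
    nlinarith
  | @iteT b c₁ c₂ σ t τ hok hb _ ih =>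
    intro p ρ hs hp hc
    simp only [Cmd.code] at hc
    obtain ⟨b1, b2⟩ := b.code_spec hE hs hok
    subst hp
    obtain ⟨r1, r2⟩ := execs_steps w P _ ρ b.straight hc.left
    have hj : P[(execs w b.code ρ).pc]? =
        some (.jz 2 (ρ.pc + b.code.length + 1 + c₁.len + 1)) := by
      rw [r2]; simpa using hc.right.left 0 (by simp)
    have e1 := step_eq (w := w) hj
    have hne : (execs w b.code ρ).reg 2 ≠ 0 := fun h => b1.1 h hb
    simp only [Instr.exec, if_neg hne] at e1
    have hc1 := hc.right.right.left
    obtain ⟨T, ρ', q1, q2, q3, q4⟩ := ih (ρ.pc + b.code.length + 1)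
      ⟨(execs w b.code ρ).pc + 1, (execs w b.code ρ).reg, (execs w b.code ρ).mem⟩
      ⟨b2.vars, b2.base, b2.raw, b2.cells, b2.bv, b2.ba⟩ (by simp [r2]) hc1
    have hj2 := hc.right.right.right.left 0 (by simp)
    rw [Cmd.length_code] at hj2
    have hj3 : P[ρ'.pc]? = some (.jmp (ρ.pc + b.code.length + 1 + c₁.len + 1 + c₂.len)) := by
      rw [q4]; simpa using hj2
    refine ⟨1 + (T + (1 + b.code.length)),
      ⟨ρ.pc + b.code.length + 1 + c₁.len + 1 + c₂.len, ρ'.reg, ρ'.mem⟩, ?_, ?_, ?_, ?_⟩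
    · rw [Function.iterate_add_apply, Function.iterate_add_apply, Function.iterate_add_apply, r1,
        Function.iterate_one, e1, q1, step_eq hj3]
      rfl
    · simp only [Cmd.len]; nlinarith
    · exact ⟨q3.vars, q3.base, q3.raw, q3.cells, q3.bv, q3.ba⟩
    · simp only [Cmd.len]; ring
  | @iteF b c₁ c₂ σ t τ hok hb _ ih =>
    intro p ρ hs hp hc
    simp only [Cmd.code] at hc
    obtain ⟨b1, b2⟩ := b.code_spec hE hs hok
    subst hp
    obtain ⟨r1, r2⟩ := execs_steps w P _ ρ b.straight hc.left
    have hj : P[(execs w b.code ρ).pc]? =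
        some (.jz 2 (ρ.pc + b.code.length + 1 + c₁.len + 1)) := by
      rw [r2]; simpa using hc.right.left 0 (by simp)
    have e1 := step_eq (w := w) hj
    simp only [Instr.exec, if_pos (b1.2 hb)] at e1
    have hc1 := hc.right.right.right.right
    rw [Cmd.length_code] at hc1
    obtain ⟨T, ρ', q1, q2, q3, q4⟩ := ih (ρ.pc + b.code.length + 1 + c₁.len + 1)
      ⟨ρ.pc + b.code.length + 1 + c₁.len + 1, (execs w b.code ρ).reg, (execs w b.code ρ).mem⟩
      ⟨b2.vars, b2.base, b2.raw, b2.cells, b2.bv, b2.ba⟩ rfl hc1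
    refine ⟨T + (1 + b.code.length), ρ', ?_, ?_, q3, ?_⟩
    · rw [Function.iterate_add_apply, Function.iterate_add_apply, r1,
        Function.iterate_one, e1, q1]
    · simp only [Cmd.len]; nlinarith
    · rw [q4]; simp only [Cmd.len]; ring
  | @whlT b c σ t₁ σ₁ t₂ σ₂ hok hb _ _ ih1 ih2 =>
    intro p ρ hs hp hc
    have hc0 := hc
    simp only [Cmd.code] at hc
    obtain ⟨b1, b2⟩ := b.code_spec hE hs hok
    subst hp
    obtain ⟨r1, r2⟩ := execs_steps w P _ ρ b.straight hc.left
    have hj : P[(execs w b.code ρ).pc]? =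
        some (.jz 2 (ρ.pc + b.code.length + 1 + c.len + 1)) := by
      rw [r2]; simpa using hc.right.left 0 (by simp)
    have e1 := step_eq (w := w) hj
    have hne : (execs w b.code ρ).reg 2 ≠ 0 := fun h => b1.1 h hb
    simp only [Instr.exec, if_neg hne] at e1
    have hc1 := hc.right.right.left
    obtain ⟨T, ρ', q1, q2, q3, q4⟩ := ih1 (ρ.pc + b.code.length + 1)
      ⟨(execs w b.code ρ).pc + 1, (execs w b.code ρ).reg, (execs w b.code ρ).mem⟩
      ⟨b2.vars, b2.base, b2.raw, b2.cells, b2.bv, b2.ba⟩ (by simp [r2]) hc1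
    have hj2 := hc.right.right.right 0 (by simp)
    rw [Cmd.length_code] at hj2
    have hj3 : P[ρ'.pc]? = some (.jmp ρ.pc) := by
      rw [q4]; simpa using hj2
    obtain ⟨T2, ρ2, u1, u2, u3, u4⟩ := ih2 ρ.pc ⟨ρ.pc, ρ'.reg, ρ'.mem⟩
      ⟨q3.vars, q3.base, q3.raw, q3.cells, q3.bv, q3.ba⟩ rfl hc0
    refine ⟨T2 + (1 + (T + (1 + b.code.length))), ρ2, ?_, ?_, u3, u4⟩
    · rw [Function.iterate_add_apply, Function.iterate_add_apply, Function.iterate_add_apply,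
        Function.iterate_add_apply, r1, Function.iterate_one, e1, q1, step_eq hj3]
      exact u1
    · simp only [Cmd.len] at u2 ⊢; nlinarith
  | @whlF b c σ hok hb =>
    intro p ρ hs hp hc
    simp only [Cmd.code] at hc
    obtain ⟨b1, b2⟩ := b.code_spec hE hs hok
    subst hp
    obtain ⟨r1, r2⟩ := execs_steps w P _ ρ b.straight hc.left
    have hj : P[(execs w b.code ρ).pc]? =
        some (.jz 2 (ρ.pc + b.code.length + 1 + c.len + 1)) := by
      rw [r2]; simpa using hc.right.left 0 (by simp)
    have e1 := step_eq (w := w) hj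
    simp only [Instr.exec, if_pos (b1.2 hb)] at e1
    refine ⟨1 + b.code.length, ⟨ρ.pc + b.code.length + 1 + c.len + 1, (execs w b.code ρ).reg,
        (execs w b.code ρ).mem⟩, ?_, ?_, ?_, ?_⟩
    · rw [Function.iterate_add_apply, r1, Function.iterate_one, e1]
    · simp only [Cmd.len]; nlinarith
    · exact ⟨b2.vars, b2.base, b2.raw, b2.cells, b2.bv, b2.ba⟩
    · simp only [Cmd.len]; ring

end WordRAM

/-! ### Weighted selection -/

open Finset

section Selection
variable {κ : ℕ → ℚ} {ω : ℕ → ℕ}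

/-- The elements with key above that of `x` have weight at most `c`, those with key at least that
of `x` have weight more than `c`. -/
def IsThreshold (κ : ℕ → ℚ) (ω : ℕ → ℕ) (m : ℕ) (a : ℕ → ℕ) (c x : ℕ) : Prop :=
  (∑ k ∈ range m, if κ x < κ (a k) then ω (a k) else 0) ≤ c ∧
    c < ∑ k ∈ range m, if κ x ≤ κ (a k) then ω (a k) else 0

/-- Among the elements for which the keys at least as large weigh more than `c`, take one of largest
key. The elements above it are those with at least the next larger key, and these weigh at most `c`
by maximality. -/
theorem exists_isThreshold {m : ℕ} {a : ℕ → ℕ} {c : ℕ} (h : c < ∑ k ∈ range m, ω (a k)) :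
    ∃ k < m, IsThreshold κ ω m a c (a k) := by
  have hm : (range m).Nonempty := by
    rw [nonempty_range_iff]; rintro rfl; simp at h
  obtain ⟨k0, hk0, hmin⟩ := exists_min_image (range m) (fun k => κ (a k)) hm
  set s := (range m).filter (fun j => c < ∑ k ∈ range m, if κ (a j) ≤ κ (a k) then ω (a k) else 0)
    with hs
  have h0 : k0 ∈ s := by
    rw [hs, mem_filter]
    refine ⟨hk0, ?_⟩
    rwa [sum_congr rfl (fun k hk => if_pos (hmin k hk))]
  obtain ⟨j, hj, hmax⟩ := exists_max_image s (fun k => κ (a k)) ⟨k0, h0⟩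
  rw [hs, mem_filter] at hj
  refine ⟨j, mem_range.1 hj.1, ?_, hj.2⟩
  by_cases hg : ((range m).filter (fun k => κ (a j) < κ (a k))).Nonempty
  · obtain ⟨y, hy, hy'⟩ := exists_min_image _ (fun k => κ (a k)) hg
    rw [mem_filter] at hy
    have hys : y ∉ s := fun h => absurd (hmax y h) (not_le.2 hy.2)
    rw [hs, mem_filter, not_and, not_lt] at hys
    refine le_trans (le_of_eq ?_) (hys hy.1)
    refine sum_congr rfl fun k hk => ?_
    refine if_congr ⟨fun h => hy' k (mem_filter.2 ⟨hk, h⟩), fun h => hy.2.trans_le h⟩ rfl rfl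
  · rw [not_nonempty_iff_eq_empty, filter_eq_empty_iff] at hg
    rw [sum_congr rfl (fun k hk => if_neg (hg hk))]
    simp

/-- The first `m'` entries of `a'` are those of the first `m` entries of `a` that satisfy `p`. -/
structure IsFilter (p : ℕ → Prop) [DecidablePred p] (m : ℕ) (a : ℕ → ℕ) (m' : ℕ) (a' : ℕ → ℕ) :
    Prop where
  -- Agreement of the sums of every `φ` says that the two lists are equal as multisets, whatever
  -- their order.
  sum : ∀ φ : ℕ → ℕ, ∑ k ∈ range m', φ (a' k) = ∑ k ∈ range m, if p (a k) then φ (a k) else 0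
  mem : ∀ k' < m', p (a' k') ∧ ∃ k < m, a' k' = a k

theorem IsFilter.card {p : ℕ → Prop} [DecidablePred p] {m a m' a'}
    (h : IsFilter p m a m' a') : m' = ∑ k ∈ range m, if p (a k) then 1 else 0 := by
  simpa using h.sum (fun _ => 1)

/-- If the threshold lies above the pivot, elements at or below the pivot contribute to neither of
its two sums, so they may be discarded. -/
theorem IsFilter.isThreshold_gt {x m a m' a' c y} (h : IsFilter (fun i => κ x < κ i) m a m' a')
    (hy : IsThreshold κ ω m' a' c y) (hxy : κ x < κ y) : IsThreshold κ ω m a c y := by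
  obtain ⟨h1, h2⟩ := hy
  rw [h.sum (fun i => if κ y < κ i then ω i else 0)] at h1
  rw [h.sum (fun i => if κ y ≤ κ i then ω i else 0)] at h2
  refine ⟨le_trans (le_of_eq ?_) h1, h2.trans_le (le_of_eq ?_)⟩
  · refine sum_congr rfl fun k _ => ?_
    by_cases hk : κ y < κ (a k)
    · simp [hk, hxy.trans hk]
    · simp [hk]
  · refine sum_congr rfl fun k _ => ?_
    by_cases hk : κ y ≤ κ (a k)
    · simp [hk, hxy.trans_le hk]
    · simp [hk]

theorem sum_ite_lt_add_eq (m : ℕ) (a : ℕ → ℕ) (x : ℕ) :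
    (∑ k ∈ range m, if κ x < κ (a k) then ω (a k) else 0) +
      (∑ k ∈ range m, if κ x = κ (a k) then ω (a k) else 0) =
      ∑ k ∈ range m, if κ x ≤ κ (a k) then ω (a k) else 0 := by
  rw [← sum_add_distrib]
  refine sum_congr rfl fun k _ => ?_
  rcases lt_trichotomy (κ x) (κ (a k)) with h | h | h
  · simp [h, h.le, h.ne]
  · simp [h]
  · simp [h.not_gt, h.not_ge, h.ne']

theorem sum_ite_le_add_gt (m : ℕ) (a : ℕ → ℕ) (x : ℕ) :
    (∑ k ∈ range m, if κ x ≤ κ (a k) then ω (a k) else 0) +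
      (∑ k ∈ range m, if κ (a k) < κ x then ω (a k) else 0) = ∑ k ∈ range m, ω (a k) := by
  rw [← sum_add_distrib]
  refine sum_congr rfl fun k _ => ?_
  rcases le_or_gt (κ x) (κ (a k)) with h | h
  · simp [h, h.not_gt]
  · simp [h, h.not_ge]

/-- If the threshold lies below the pivot, everything from the pivot upwards counts fully in both of
its sums; it is discarded and its weight is deducted from the capacity. -/
theorem IsFilter.isThreshold_lt {x m a m' a' c y} (h : IsFilter (fun i => κ i < κ x) m a m' a')
    (hc : (∑ k ∈ range m, if κ x ≤ κ (a k) then ω (a k) else 0) ≤ c)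
    (hy : IsThreshold κ ω m' a' (c - ∑ k ∈ range m, if κ x ≤ κ (a k) then ω (a k) else 0) y)
    (hxy : κ y < κ x) : IsThreshold κ ω m a c y := by
  obtain ⟨h1, h2⟩ := hy
  rw [h.sum (fun i => if κ y < κ i then ω i else 0)] at h1
  rw [h.sum (fun i => if κ y ≤ κ i then ω i else 0)] at h2
  have e1 : (∑ k ∈ range m, if κ y < κ (a k) then ω (a k) else 0) =
      (∑ k ∈ range m, if κ (a k) < κ x then (if κ y < κ (a k) then ω (a k) else 0) else 0) +
      ∑ k ∈ range m, if κ x ≤ κ (a k) then ω (a k) else 0 := by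
    rw [← sum_add_distrib]
    refine sum_congr rfl fun k _ => ?_
    rcases le_or_gt (κ x) (κ (a k)) with h | h
    · simp [h, h.not_gt, hxy.trans_le h]
    · simp [h, h.not_ge]
  have e2 : (∑ k ∈ range m, if κ y ≤ κ (a k) then ω (a k) else 0) =
      (∑ k ∈ range m, if κ (a k) < κ x then (if κ y ≤ κ (a k) then ω (a k) else 0) else 0) +
      ∑ k ∈ range m, if κ x ≤ κ (a k) then ω (a k) else 0 := by
    rw [← sum_add_distrib]
    refine sum_congr rfl fun k _ => ?_
    rcases le_or_gt (κ x) (κ (a k)) with h | h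
    · simp [h, h.not_gt, (hxy.trans_le h).le]
    · simp [h, h.not_ge]
  exact ⟨by rw [e1]; omega, by rw [e2]; omega⟩

theorem sum_range_five_mul (m : ℕ) (φ : ℕ → ℕ) :
    ∑ k ∈ range (5 * m), φ k = ∑ g ∈ range m, ∑ r ∈ range 5, φ (5 * g + r) := by
  induction m with
  | zero => rfl
  | succ m ih => rw [mul_add, mul_one, sum_range_add, ih, sum_range_succ _ m]

/-- The median of the medians of groups of five splits off a constant fraction. -/
theorem median_of_medians {m x : ℕ} {a b : ℕ → ℕ}
    (hb : ∀ g < m / 5, IsThreshold κ (fun _ => 1) 5 (fun r => a (5 * g + r)) 2 (b g))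
    (hx : IsThreshold κ (fun _ => 1) (m / 5) b (m / 5 / 2) x) :
    3 * (m / 5 - m / 5 / 2) + (∑ k ∈ range m, if κ x < κ (a k) then 1 else 0) ≤ m ∧
    3 * (m / 5 / 2) + 3 + (∑ k ∈ range m, if κ (a k) < κ x then 1 else 0) ≤ m := by
  obtain ⟨h1, h2⟩ := hx
  dsimp only at h1 h2
  have hle : ∀ φ : ℕ → ℕ, ∑ k ∈ range (5 * (m / 5)), φ k ≤ ∑ k ∈ range m, φ k := fun φ =>
    sum_le_sum_of_subset (range_subset_range.2 (Nat.mul_div_le m 5))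
  -- At most `m / 5 / 2` medians exceed `x`. Each of the other groups has at least three elements
  -- that do not exceed its median, hence not `x`.
  have small : 3 * (∑ g ∈ range (m / 5), if κ x < κ (b g) then 0 else 1) ≤
      ∑ k ∈ range m, if κ x < κ (a k) then 0 else 1 := by
    refine le_trans ?_ (hle _)
    rw [sum_range_five_mul, mul_sum]
    refine sum_le_sum fun g hg => ?_
    split
    · simp
    · rename_i h
      have := (hb g (mem_range.1 hg)).1
      dsimp only at this
      have e : (∑ r ∈ range 5, if κ (b g) < κ (a (5 * g + r)) then 1 else 0) +
          (∑ r ∈ range 5, if κ (b g) < κ (a (5 * g + r)) then 0 else 1) = 5 := by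
        rw [← sum_add_distrib, sum_congr rfl (g := fun _ => 1) (fun r _ => by split <;> rfl)]
        simp
      have : (∑ r ∈ range 5, if κ (b g) < κ (a (5 * g + r)) then 0 else 1) ≤
          ∑ r ∈ range 5, if κ x < κ (a (5 * g + r)) then 0 else 1 := by
        refine sum_le_sum fun r _ => ?_
        by_cases hr : κ (b g) < κ (a (5 * g + r))
        · simp [hr]
        · have : ¬ κ x < κ (a (5 * g + r)) := fun h' => hr ((not_lt.1 h).trans_lt h')
          simp [hr, this]
      omega
  -- More than `m / 5 / 2` medians are at least `x`, which accounts for the additional `3`; each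
  -- such group has at least three elements that are not below its median.
  have large : 3 * (∑ g ∈ range (m / 5), if κ x ≤ κ (b g) then 1 else 0) ≤
      ∑ k ∈ range m, if κ x ≤ κ (a k) then 1 else 0 := by
    refine le_trans ?_ (hle _)
    rw [sum_range_five_mul, mul_sum]
    refine sum_le_sum fun g hg => ?_
    split
    · rename_i h
      have := (hb g (mem_range.1 hg)).2
      dsimp only at this
      have : (∑ r ∈ range 5, if κ (b g) ≤ κ (a (5 * g + r)) then 1 else 0) ≤
          ∑ r ∈ range 5, if κ x ≤ κ (a (5 * g + r)) then 1 else 0 := by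
        refine sum_le_sum fun r _ => ?_
        by_cases hr : κ (b g) ≤ κ (a (5 * g + r))
        · simp [hr, h.trans hr]
        · simp [hr]
      omega
    · simp
  have e1 : (∑ g ∈ range (m / 5), if κ x < κ (b g) then 1 else 0) +
      (∑ g ∈ range (m / 5), if κ x < κ (b g) then 0 else 1) = m / 5 := by
    rw [← sum_add_distrib, sum_congr rfl (g := fun _ => 1) (fun r _ => by split <;> rfl)]
    simp
  have e2 : (∑ k ∈ range m, if κ x < κ (a k) then 1 else 0) +
      (∑ k ∈ range m, if κ x < κ (a k) then 0 else 1) = m := by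
    rw [← sum_add_distrib, sum_congr rfl (g := fun _ => 1) (fun r _ => by split <;> rfl)]
    simp
  have e3 := sum_ite_le_add_gt (κ := κ) (ω := fun _ => 1) m a x
  simp only [sum_const, card_range, smul_eq_mul, mul_one] at e3
  omega

theorem IsFilter.zero (p : ℕ → Prop) [DecidablePred p] (a b : ℕ → ℕ) : IsFilter p 0 a 0 b :=
  ⟨fun _ => rfl, fun _ h => absurd h (Nat.not_lt_zero _)⟩

theorem IsFilter.pos {p : ℕ → Prop} [DecidablePred p] {k a c b b'} (h : IsFilter p k a c b)
    (hp : p (a k)) (h1 : ∀ x < c, b' x = b x) (h2 : b' c = a k) :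
    IsFilter p (k + 1) a (c + 1) b' := by
  refine ⟨fun φ => ?_, fun x hx => ?_⟩
  · rw [sum_range_succ, sum_range_succ, ← h.sum, h2, if_pos hp,
      sum_congr rfl fun x hx => by rw [h1 x (mem_range.1 hx)]]
  · rcases Nat.lt_succ_iff_lt_or_eq.1 hx with hx | rfl
    · obtain ⟨h3, y, hy, h4⟩ := h.mem x hx
      rw [h1 x hx]
      exact ⟨h3, y, by omega, h4⟩
    · rw [h2]; exact ⟨hp, k, by omega, rfl⟩

theorem IsFilter.neg {p : ℕ → Prop} [DecidablePred p] {k a c b} (h : IsFilter p k a c b)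
    (hp : ¬ p (a k)) : IsFilter p (k + 1) a c b := by
  refine ⟨fun φ => ?_, fun x hx => ?_⟩
  · rw [sum_range_succ, ← h.sum, if_neg hp, add_zero]
  · obtain ⟨h3, y, hy, h4⟩ := h.mem x hx
    exact ⟨h3, y, by omega, h4⟩

end Selection


/-! ### Weighted selection on the machine -/

namespace WordRAM

-- Arrays: `aS`, `aV`, `aMU` hold sizes, values and remaining multiplicities, `aX` the result of the
-- greedy algorithm. Row `j` of `aCL` lists the items of size `j`, row `0` all items, and `aCN`
-- holds the lengths of these lists. `aA`, `aM`, `aC` hold elements, length and capacity for each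
-- recursion depth of the selection.
notation "aS" => (1 : ℕ)
notation "aV" => (2 : ℕ)
notation "aMU" => (4 : ℕ)
notation "aX" => (5 : ℕ)
notation "aCL" => (6 : ℕ)
notation "aCN" => (7 : ℕ)
notation "aA" => (8 : ℕ)
notation "aM" => (9 : ℕ)
notation "aC" => (10 : ℕ)

notation "vd" => (11 : ℕ)
notation "vf" => (12 : ℕ)
notation "vm" => (13 : ℕ)
notation "vlam" => (14 : ℕ)
notation "vln" => (15 : ℕ)
notation "vld" => (16 : ℕ)
notation "vcap" => (17 : ℕ)
notation "vk" => (18 : ℕ)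
notation "vid" => (19 : ℕ)
notation "vwt" => (20 : ℕ)
notation "vwg" => (21 : ℕ)
notation "vwe" => (22 : ℕ)
notation "vc" => (23 : ℕ)
notation "vg" => (24 : ℕ)
notation "vmm" => (25 : ℕ)
notation "va" => (26 : ℕ)
notation "vb" => (27 : ℕ)
notation "vx" => (28 : ℕ)
notation "vy" => (29 : ℕ)
notation "vgt" => (30 : ℕ)
notation "vge" => (31 : ℕ)

open WordRAM.Expr WordRAM.Cmd

/-- The items of an instance: number, sizes, values. -/
structure Items where
  n : ℕ
  sz : ℕ → ℕ
  v : ℕ → ℕ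

/-- The rational keys occur only in specifications. The program compares them by cross
multiplication, which is why `Items.Fits` bounds the products of values and sizes. -/
def Items.key (I : Items) (i : ℕ) : ℚ := I.v i / I.sz i

structure Items.Fits (I : Items) (E : Env) : Prop where
  live : E.live
  n_lt : I.n + 64 < E.W
  WB : E.W ≤ E.B
  pos : ∀ i < I.n, 0 < I.sz i
  prod : ∀ i < I.n, ∀ j < I.n, I.v i * I.sz j < E.B

structure Items.In (I : Items) (σ : Store) : Prop where
  S : ∀ i < I.n, σ.arr aS i 0 = I.sz i
  V : ∀ i < I.n, σ.arr aV i 0 = I.v i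

theorem Items.In.of_eq {I : Items} {σ τ : Store} (h : I.In σ) (h1 : τ.arr aS = σ.arr aS)
    (h2 : τ.arr aV = σ.arr aV) : I.In τ :=
  ⟨fun i hi => by rw [h1, h.S i hi], fun i hi => by rw [h2, h.V i hi]⟩

theorem Items.key_lt {I : Items} {i j : ℕ} (hi : 0 < I.sz i) (hj : 0 < I.sz j) :
    I.v i * I.sz j < I.v j * I.sz i ↔ I.key i < I.key j := by
  unfold Items.key
  rw [div_lt_div_iff₀ (by exact_mod_cast hi) (by exact_mod_cast hj)]
  norm_cast

theorem Items.key_le {I : Items} {i j : ℕ} (hi : 0 < I.sz i) (hj : 0 < I.sz j) :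
    I.v i * I.sz j ≤ I.v j * I.sz i ↔ I.key i ≤ I.key j := by
  rw [← not_lt, ← not_lt, Items.key_lt hj hi]

theorem Items.key_eq {I : Items} {i j : ℕ} (hi : 0 < I.sz i) (hj : 0 < I.sz j) :
    I.v i * I.sz j = I.v j * I.sz i ↔ I.key i = I.key j := by
  rw [le_antisymm_iff, le_antisymm_iff, Items.key_le hi hj, Items.key_le hj hi]

/-- A trichotomy in the form of rewrite rules, which lets `simp` decide every comparison in the loop
body at once. -/
theorem lt_eq_le_cases (x y : ℚ) :
    ((x < y) = True ∧ (x = y) = False ∧ (y ≤ x) = False) ∨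
    ((x < y) = False ∧ (x = y) = True ∧ (y ≤ x) = True) ∨
    ((x < y) = False ∧ (x = y) = False ∧ (y ≤ x) = True) := by
  rcases lt_trichotomy x y with h | h | h
  · simp [h, h.ne]
  · simp [h]
  · simp [h.not_gt, h.ne', h.le]

/-- Weigh the elements of row `d` against the pivot. -/
def partCount : Cmd :=
  vk ::= 0 ;; vwg ::= 0 ;; vwe ::= 0 ;;
  whl (§vk ≺ §vm)
    (vid ::= ld aA §vd §vk ;;
     ite (§vd ≗ 0) (vwt ::= ld aS §vid 0 * ld aMU §vid 0) (vwt ::= 1) ;;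
     ite (§vln * ld aS §vid 0 ≺ ld aV §vid 0 * §vld) (vwg ::= §vwg + §vwt)
       (ite (§vln * ld aS §vid 0 ≗ ld aV §vid 0 * §vld) (vwe ::= §vwe + §vwt) skip) ;;
     vk ::= §vk + 1)

/-- The weight of an item at recursion depth `d` of the selection. -/
def rowWeight (I : Items) (mu : ℕ → ℕ) (d i : ℕ) : ℕ := if d = 0 then I.sz i * mu i else 1

theorem partCount_spec {E : Env} {I : Items} (hF : I.Fits E) {σ : Store} (hI : I.In σ)
    {a mu : ℕ → ℕ} {m d x : ℕ} (hmu : ∀ i < I.n, σ.arr aMU i 0 = mu i)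
    (hd : σ.var vd = d) (hdW : d < E.W) (hm : σ.var vm = m) (hmW : m < E.W)
    (ha : ∀ k < m, σ.arr aA d k = a k) (han : ∀ k < m, a k < I.n) (hx : x < I.n)
    (hln : σ.var vln = I.v x) (hld : σ.var vld = I.sz x)
    (hw : ∑ k ∈ range m, rowWeight I mu d (a k) < E.B) :
    wp E partCount σ (fun t τ => t ≤ m ∧
      τ.var vwg = (∑ k ∈ range m, if I.key x < I.key (a k) then rowWeight I mu d (a k) else 0) ∧
      τ.var vwe =
        (∑ k ∈ range m, if I.key x = I.key (a k) then rowWeight I mu d (a k) else 0)) := by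
  have hWB := hF.WB
  have hnW := hF.n_lt
  simp only [partCount, wp_seq, wp_set]
  refine ⟨by simp, by simp, by simp, ?_⟩
  refine wp_for m (fun k τ =>
      τ.var vwg = (∑ k ∈ range k, if I.key x < I.key (a k) then rowWeight I mu d (a k) else 0) ∧
      τ.var vwe =
        (∑ k ∈ range k, if I.key x = I.key (a k) then rowWeight I mu d (a k) else 0))
    (fun _ => 0) (by simp) (by simp) ?_ ?_ ?_
  · intro k τ hA _
    exact ⟨by simp, by simpa using (hA.v vm rfl).trans hm⟩
  · rintro k τ hk hA hvk ⟨h1, h2⟩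
    have e1 : τ.var vd = d := (hA.v vd rfl).trans (by simpa using hd)
    have e2 : τ.var vln = I.v x := (hA.v vln rfl).trans (by simpa using hln)
    have e3 : τ.var vld = I.sz x := (hA.v vld rfl).trans (by simpa using hld)
    have e4 : τ.arr aA d k = a k := by rw [hA.a aA rfl]; exact ha k hk
    have hak := han k hk
    have e5 : τ.arr aS (a k) 0 = I.sz (a k) := by rw [hA.a aS rfl]; exact hI.S _ hak
    have e6 : τ.arr aV (a k) 0 = I.v (a k) := by rw [hA.a aV rfl]; exact hI.V _ hak
    have e7 : τ.arr aMU (a k) 0 = mu (a k) := by rw [hA.a aMU rfl]; exact hmu _ hak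
    have b1 := hF.prod x hx (a k) hak
    have b2 := hF.prod (a k) hak x hx
    have b3 : rowWeight I mu d (a k) ≤ ∑ k ∈ range m, rowWeight I mu d (a k) :=
      single_le_sum (f := fun k => rowWeight I mu d (a k)) (fun _ _ => Nat.zero_le _)
        (mem_range.2 hk)
    have b4 : ∑ k ∈ range (k + 1), rowWeight I mu d (a k) ≤
      ∑ k ∈ range m, rowWeight I mu d (a k) :=
      sum_le_sum_of_subset (range_subset_range.2 hk)
    have b5 : (∑ k ∈ range k, if I.key x < I.key (a k) then rowWeight I mu d (a k) else 0) ≤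
        ∑ k ∈ range k, rowWeight I mu d (a k) :=
      sum_le_sum fun _ _ => by split <;> simp
    have b6 : (∑ k ∈ range k, if I.key x = I.key (a k) then rowWeight I mu d (a k) else 0) ≤
        ∑ k ∈ range k, rowWeight I mu d (a k) :=
      sum_le_sum fun _ _ => by split <;> simp
    have k1 := Items.key_lt (hF.pos x hx) (hF.pos _ hak)
    have k2 := Items.key_eq (hF.pos x hx) (hF.pos _ hak)
    have k3 := Items.key_le (hF.pos _ hak) (hF.pos x hx)
    rw [sum_range_succ] at b4
    have hwt : rowWeight I mu d (a k) = if d = 0 then I.sz (a k) * mu (a k) else 1 := rfl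
    rcases lt_eq_le_cases (I.key x) (I.key (a k)) with ⟨c1, c2, c3⟩ | ⟨c1, c2, c3⟩ | ⟨c1, c2, c3⟩ <;>
      rcases eq_or_ne d 0 with rfl | hd0 <;>
      (first | simp only [if_neg hd0] at hwt | simp only [if_true] at hwt) <;>
      simp [e1, e2, e3, e4, e5, e6, e7, hvk, h1, h2, hF.live, sum_range_succ, k1, k2, k3, c1,
        c2, c3] <;> (try simp only [hd0, false_imp_iff, true_and]) <;> omega
  · intro t τ hA _ ⟨h1, h2⟩ ht
    exact ⟨by simpa using ht, h1, h2⟩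

/-- Keep only the elements of row `d` that satisfy a condition. -/
def compact (keep : Cond) : Cmd :=
  vk ::= 0 ;; vc ::= 0 ;;
  whl (§vk ≺ §vm)
    (vid ::= ld aA §vd §vk ;;
     ite keep (put aA §vd §vc §vid ;; vc ::= §vc + 1) skip ;;
     vk ::= §vk + 1)

theorem compact_spec {E : Env} {I : Items} (hF : I.Fits E) {σ : Store} {keep : Cond}
    {p : ℕ → Prop} [DecidablePred p] {a : ℕ → ℕ} {m d : ℕ}
    (hd : σ.var vd = d) (hdW : d < E.W) (hm : σ.var vm = m) (hmW : m < E.W)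
    (ha : ∀ k < m, σ.arr aA d k = a k) (han : ∀ k < m, a k < I.n)
    (hkeep : ∀ τ : Store, τ.var vln = σ.var vln → τ.var vld = σ.var vld →
      τ.arr aS = σ.arr aS → τ.arr aV = σ.arr aV → τ.var vid < I.n →
      keep.Ok E τ ∧ (keep.Holds τ ↔ p (τ.var vid))) :
    wp E (compact keep) σ (fun t τ => t ≤ m ∧ τ.var vc ≤ m ∧
      IsFilter p m a (τ.var vc) (τ.arr aA d) ∧ ∀ d', d' ≠ d → τ.arr aA d' = σ.arr aA d') := by
  have hWB := hF.WB
  simp only [compact, wp_seq, wp_set]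
  refine ⟨by simp, by simp, ?_⟩
  -- The row is compacted in place: the write position `vc` never passes the read position `k`, so
  -- the entries still to be read are intact.
  refine wp_for m (fun k τ => τ.var vc ≤ k ∧ IsFilter p k a (τ.var vc) (τ.arr aA d) ∧
      (∀ x, k ≤ x → x < m → τ.arr aA d x = a x) ∧ ∀ d', d' ≠ d → τ.arr aA d' = σ.arr aA d')
    (fun _ => 0) (by simp) ?_ ?_ ?_ ?_
  · refine ⟨by simp, by simpa using IsFilter.zero p a _, fun x _ hx => by simpa using ha x hx,
      fun d' _ => by simp⟩
  · intro k τ hA _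
    exact ⟨by simp, by simpa using (hA.v vm rfl).trans hm⟩
  · rintro k τ hk hA hvk ⟨h1, h2, h3, h4⟩
    have e1 : τ.var vd = d := (hA.v vd rfl).trans (by simpa using hd)
    have e4 : τ.arr aA d k = a k := h3 k le_rfl hk
    have hak := han k hk
    obtain ⟨g1, g2⟩ := hkeep (τ.set vid (a k))
      (by simpa using hA.v vln rfl) (by simpa using hA.v vld rfl) (by simpa using hA.a aS rfl)
      (by simpa using hA.a aV rfl) (by simpa using hak)
    simp only [Store.set_var, if_true] at g2
    simp only [wp_seq, wp_set, wp_ite, wp_skip, wp_put, eval_ld, eval_var, e1, hvk, e4]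
    refine ⟨by simp [e1, hvk, hF.live]; omega, g1, fun hp => ?_, fun hp => ?_⟩
    · rw [g2] at hp
      simp [e1, hvk, hF.live]
      refine ⟨by omega, by omega, by omega, by omega, h2.pos hp ?_ ?_, fun x hx hxm => ?_,
        fun d' hd' => ?_⟩
      · intro x hx
        have : x ≠ τ.var 23 := by simpa using Nat.ne_of_lt hx
        simp [this]
      · simp
      · have : x ≠ τ.var 23 := by omega
        simp only [this, if_false]
        exact h3 x (by omega) hxm
      · rw [← h4 d' hd']; funext x; simp [hd']
    · rw [g2] at hp
      simp [hvk]
      refine ⟨by omega, by omega, h2.neg hp, fun x hx hxm => ?_, h4⟩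
      exact h3 x (by omega) hxm
  · rintro t τ hA _ ⟨h1, h2, h3, h4⟩ ht
    exact ⟨by simpa using ht, h1, h2, h4⟩

/-- Count the elements of group `g` of row `d` above and not below `x`. -/
def medCount : Cmd :=
  vgt ::= 0 ;; vge ::= 0 ;; vb ::= 0 ;;
  whl (§vb ≺ 5)
    (vy ::= ld aA §vd (5 * §vg + §vb) ;;
     ite (ld aV §vx 0 * ld aS §vy 0 ≺ ld aV §vy 0 * ld aS §vx 0) (vgt ::= §vgt + 1) skip ;;
     ite (ld aV §vx 0 * ld aS §vy 0 ≼ ld aV §vy 0 * ld aS §vx 0) (vge ::= §vge + 1) skip ;;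
     vb ::= §vb + 1)

theorem medCount_spec {E : Env} {I : Items} (hF : I.Fits E) {σ : Store} (hI : I.In σ)
    {a : ℕ → ℕ} {d g x : ℕ}
    (hd : σ.var vd = d) (hdW : d < E.W) (hg : σ.var vg = g) (hgW : 5 * g + 5 < E.W)
    (ha : ∀ r < 5, σ.arr aA d (5 * g + r) = a r) (han : ∀ r < 5, a r < I.n) (hx : x < I.n)
    (hvx : σ.var vx = x) :
    wp E medCount σ (fun t τ => t ≤ 5 ∧
      τ.var vgt = (∑ r ∈ range 5, if I.key x < I.key (a r) then 1 else 0) ∧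
      τ.var vge = (∑ r ∈ range 5, if I.key x ≤ I.key (a r) then 1 else 0)) := by
  have hWB := hF.WB
  have hnW := hF.n_lt
  simp only [medCount, wp_seq, wp_set]
  refine ⟨by simp, by simp, by simp, ?_⟩
  refine wp_for 5 (fun k τ =>
      τ.var vgt = (∑ r ∈ range k, if I.key x < I.key (a r) then 1 else 0) ∧
      τ.var vge = (∑ r ∈ range k, if I.key x ≤ I.key (a r) then 1 else 0))
    (fun _ => 0) (by simp) (by simp) ?_ ?_ ?_
  · intro k τ hA _
    exact ⟨by simp, by simp⟩
  · rintro k τ hk hA hvk ⟨h1, h2⟩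
    have e1 : τ.var vd = d := (hA.v vd rfl).trans (by simpa using hd)
    have e2 : τ.var vg = g := (hA.v vg rfl).trans (by simpa using hg)
    have e3 : τ.var vx = x := (hA.v vx rfl).trans (by simpa using hvx)
    have e4 : τ.arr aA d (5 * g + k) = a k := by rw [hA.a aA rfl]; exact ha k hk
    have hak := han k hk
    have e5 : τ.arr aS (a k) 0 = I.sz (a k) := by rw [hA.a aS rfl]; exact hI.S _ hak
    have e6 : τ.arr aV (a k) 0 = I.v (a k) := by rw [hA.a aV rfl]; exact hI.V _ hak
    have e7 : τ.arr aS x 0 = I.sz x := by rw [hA.a aS rfl]; exact hI.S _ hx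
    have e8 : τ.arr aV x 0 = I.v x := by rw [hA.a aV rfl]; exact hI.V _ hx
    have b1 := hF.prod x hx (a k) hak
    have b2 := hF.prod (a k) hak x hx
    have k1 := Items.key_lt (hF.pos x hx) (hF.pos _ hak)
    have k2 := Items.key_le (hF.pos x hx) (hF.pos _ hak)
    have b3 : (∑ r ∈ range k, if I.key x < I.key (a r) then 1 else 0) ≤ k :=
      (sum_le_card_nsmul (range k) (fun r => if I.key x < I.key (a r) then 1 else 0) 1
        (fun r _ => by split <;> simp)).trans (by simp)
    have b4 : (∑ r ∈ range k, if I.key x ≤ I.key (a r) then 1 else 0) ≤ k :=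
      (sum_le_card_nsmul (range k) (fun r => if I.key x ≤ I.key (a r) then 1 else 0) 1
        (fun r _ => by split <;> simp)).trans (by simp)
    rcases lt_or_ge (I.key x) (I.key (a k)) with c1 | c1
    · simp [e1, e2, e3, e4, e5, e6, e7, e8, hvk, h1, h2, hF.live, sum_range_succ, k1, k2, c1,
        c1.le, -sum_boole]
      omega
    · have c1' := c1.not_gt
      by_cases c2 : I.key x ≤ I.key (a k)
      · simp [e1, e2, e3, e4, e5, e6, e7, e8, hvk, h1, h2, hF.live, sum_range_succ, k1, k2,
          c1', c2, -not_lt, -sum_boole]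
        omega
      · simp [e1, e2, e3, e4, e5, e6, e7, e8, hvk, h1, h2, hF.live, sum_range_succ, k1, k2,
          c1', c2, -not_lt, -not_le, -sum_boole]
        omega
  · intro t τ hA _ ⟨h1, h2⟩ ht
    exact ⟨by simpa using ht, h1, h2⟩

/-- Put the median of group `g` of row `d` into row `d + 1`. -/
def medGroup : Cmd :=
  va ::= 0 ;;
  whl (§va ≺ 5)
    (vx ::= ld aA §vd (5 * §vg + §va) ;;
     medCount ;;
     ite (§vgt ≼ 2) (ite (2 ≺ §vge) (put aA (§vd + 1) §vg §vx) skip) skip ;;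
     va ::= §va + 1)

theorem medGroup_spec {E : Env} {I : Items} (hF : I.Fits E) {σ : Store} (hI : I.In σ)
    {a : ℕ → ℕ} {d g : ℕ}
    (hd : σ.var vd = d) (hdW : d + 1 < E.W) (hg : σ.var vg = g) (hgW : 5 * g + 5 < E.W)
    (ha : ∀ r < 5, σ.arr aA d (5 * g + r) = a r) (han : ∀ r < 5, a r < I.n) :
    wp E medGroup σ (fun t τ => t ≤ 30 ∧
      (∃ r < 5, τ.arr aA (d + 1) g = a r) ∧
      IsThreshold I.key (fun _ => 1) 5 a 2 (τ.arr aA (d + 1) g) ∧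
      ∀ i j, i ≠ d + 1 ∨ j ≠ g → τ.arr aA i j = σ.arr aA i j) := by
  have hWB := hF.WB
  have hnW := hF.n_lt
  simp only [medGroup, wp_seq, wp_set]
  refine ⟨by simp, ?_⟩
  -- Each of the five elements is tested for being the median, and later hits may overwrite earlier
  -- ones. That some test succeeds is used only after the loop, so the invariant is conditional on a
  -- hit.
  refine wp_for 5 (fun k τ =>
      ((∃ q < k, IsThreshold I.key (fun _ => 1) 5 a 2 (a q)) →
        (∃ r < 5, τ.arr aA (d + 1) g = a r) ∧
        IsThreshold I.key (fun _ => 1) 5 a 2 (τ.arr aA (d + 1) g)) ∧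
      ∀ i j, i ≠ d + 1 ∨ j ≠ g → τ.arr aA i j = σ.arr aA i j)
    (fun _ => 5) (by simp) ⟨fun ⟨q, hq, _⟩ => absurd hq (Nat.not_lt_zero _), by simp⟩ ?_ ?_ ?_
  · intro k τ hA _
    exact ⟨by simp, by simp⟩
  · rintro k τ hk hA hvk ⟨h1, h2⟩
    have e1 : τ.var vd = d := (hA.v vd rfl).trans (by simpa using hd)
    have e2 : τ.var vg = g := (hA.v vg rfl).trans (by simpa using hg)
    have e3 : ∀ r < 5, τ.arr aA d (5 * g + r) = a r := fun r hr => by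
      rw [h2 _ _ (Or.inl (by omega)), ha r hr]
    have e4 := e3 k hk
    simp only [wp_seq, wp_set, eval_ld, eval_var, eval_add, eval_mul, eval_lit, e1, e2, hvk, e4]
    refine ⟨by simp [e1, e2, hvk, hF.live]; omega, ?_⟩
    have hI' : I.In (τ.set vx (a k)) :=
      hI.of_eq (by simpa using hA.a aS rfl) (by simpa using hA.a aV rfl)
    refine (medCount_spec hF hI' (d := d) (g := g) (x := a k) (by simpa using e1) (by omega)
      (by simpa using e2) hgW (fun r hr => by simpa using e3 r hr) han (han k hk)
      (by simp)).mono ?_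
    rintro t υ hB ⟨ht, g1, g2⟩
    have e1' : υ.var vd = d := (hB.v vd rfl).trans (by simpa using e1)
    have e2' : υ.var vg = g := (hB.v vg rfl).trans (by simpa using e2)
    have e3' : υ.var vx = a k := (hB.v vx rfl).trans (by simp)
    have e4' : υ.var va = k := (hB.v va rfl).trans (by simpa using hvk)
    have e5' : υ.arr aA = τ.arr aA := (hB.a aA rfl).trans (by simp)
    have hthr : IsThreshold I.key (fun _ => 1) 5 a 2 (a k) ↔ υ.var vgt ≤ 2 ∧ 2 < υ.var vge := by
      rw [g1, g2]; rfl
    have keepInv : ¬ IsThreshold I.key (fun _ => 1) 5 a 2 (a k) →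
        ((∃ q < k + 1, IsThreshold I.key (fun _ => 1) 5 a 2 (a q)) →
        (∃ r < 5, υ.arr aA (d + 1) g = a r) ∧
        IsThreshold I.key (fun _ => 1) 5 a 2 (υ.arr aA (d + 1) g)) ∧
      ∀ i j, i ≠ d + 1 ∨ j ≠ g → υ.arr aA i j = σ.arr aA i j := by
      intro hn
      rw [e5']
      refine ⟨fun ⟨q, hq, hq'⟩ => h1 ⟨q, ?_, hq'⟩, h2⟩
      rcases Nat.lt_succ_iff_lt_or_eq.1 hq with h | rfl
      · exact h
      · exact absurd hq' hn
    simp only [wp_ite, wp_skip, wp_put, Cond.holds_le, Cond.holds_lt, eval_var,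
      eval_lit, eval_add, e1', e2', e3', e4']
    refine ⟨by simp, fun c1 => ⟨by simp, fun c2 => ?_, fun c2 => ?_⟩, fun c1 => ?_⟩
    · have hk' := hthr.2 ⟨c1, c2⟩
      simp only [Store.put_var, e4']
      refine ⟨by simp [e1', e2', hF.live]; omega, by simp, by simp [e4']; omega, by simp,
        ⟨fun _ => ?_, ?_⟩, by omega⟩
      · simp only [Store.set_arr, Store.put_arr, if_true, and_self]
        exact ⟨⟨k, hk, rfl⟩, hk'⟩
      · intro i j hij
        have : ¬ (i = d + 1 ∧ j = g) := by omega
        simp only [Store.set_arr, Store.put_arr, if_true, this, if_false, e5']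
        exact h2 i j hij
    · exact ⟨by simp [e4']; omega, by simp, by simpa using keepInv (fun h => c2 (hthr.1 h).2),
        by omega⟩
    · exact ⟨by simp [e4']; omega, by simp, by simpa using keepInv (fun h => c1 (hthr.1 h).1),
        by omega⟩
  · rintro t τ hA _ ⟨h1, h2⟩ ht
    obtain ⟨q, hq, hq'⟩ := exists_isThreshold (κ := I.key) (ω := fun _ => 1) (m := 5) (a := a)
      (c := 2) (by simp)
    obtain ⟨h3, h4⟩ := h1 ⟨q, hq, hq'⟩
    exact ⟨by simpa using ht, h3, h4, h2⟩

/-- Put the medians of the groups of five of row `d` into row `d + 1`. -/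
def medians : Cmd :=
  vg ::= 0 ;; vmm ::= §vm / 5 ;;
  whl (§vg ≺ §vmm) (medGroup ;; vg ::= §vg + 1)

theorem medians_spec {E : Env} {I : Items} (hF : I.Fits E) {σ : Store} (hI : I.In σ)
    {a : ℕ → ℕ} {m d : ℕ}
    (hd : σ.var vd = d) (hdW : d + 1 < E.W) (hm : σ.var vm = m) (hmW : m < E.W)
    (ha : ∀ k < m, σ.arr aA d k = a k) (han : ∀ k < m, a k < I.n) :
    wp E medians σ (fun t τ => t ≤ 31 * (m / 5) ∧ τ.var vmm = m / 5 ∧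
      (∀ g < m / 5, (∃ k < m, τ.arr aA (d + 1) g = a k) ∧
        IsThreshold I.key (fun _ => 1) 5 (fun r => a (5 * g + r)) 2 (τ.arr aA (d + 1) g)) ∧
      ∀ d', d' ≠ d + 1 → τ.arr aA d' = σ.arr aA d') := by
  have hWB := hF.WB
  have hnW := hF.n_lt
  simp only [medians, wp_seq, wp_set]
  refine ⟨by simp, by simp, ?_⟩
  refine wp_for (m / 5) (fun k τ =>
      (∀ g < k, (∃ k < m, τ.arr aA (d + 1) g = a k) ∧
        IsThreshold I.key (fun _ => 1) 5 (fun r => a (5 * g + r)) 2 (τ.arr aA (d + 1) g)) ∧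
      ∀ d', d' ≠ d + 1 → τ.arr aA d' = σ.arr aA d')
    (fun _ => 30) (by simp) (by simp) ?_ ?_ ?_
  · intro k τ hA _
    have : τ.var vmm = m / 5 := (hA.v vmm rfl).trans (by simpa using by rw [← hm])
    exact ⟨by simp, this⟩
  · rintro k τ hk hA hvk ⟨h1, h2⟩
    have hk5 : 5 * k + 5 ≤ m := by omega
    have e1 : τ.var vd = d := (hA.v vd rfl).trans (by simpa using hd)
    have hI' : I.In τ := hI.of_eq (by simpa using hA.a aS rfl) (by simpa using hA.a aV rfl)
    rw [wp_seq]
    refine (medGroup_spec hF hI' (a := fun r => a (5 * k + r)) (g := k) e1 hdW hvk (by omega)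
      (fun r hr => by rw [h2 d (by omega)]; exact ha _ (by omega))
      (fun r hr => han _ (by omega))).mono ?_
    rintro t υ hB ⟨ht, ⟨r, hr, g1⟩, g2, g3⟩
    have e2 : υ.var vg = k := (hB.v vg rfl).trans hvk
    rw [wp_set]
    refine ⟨by simp [e2]; omega, by simp [e2], ⟨fun g hg => ?_, fun d' hd' => ?_⟩, by omega⟩
    · simp only [Store.set_arr]
      rcases Nat.lt_succ_iff_lt_or_eq.1 hg with hg | rfl
      · rw [g3 _ _ (Or.inr (by omega))]
        exact h1 g hg
      · exact ⟨⟨_, by omega, g1⟩, g2⟩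
    · simp only [Store.set_arr]
      rw [← h2 d' hd']
      funext j
      exact g3 _ _ (Or.inl hd')
  · rintro t τ hA _ ⟨h1, h2⟩ ht
    have : τ.var vmm = m / 5 := (hA.v vmm rfl).trans (by simpa using by rw [← hm])
    refine ⟨?_, this, h1, h2⟩
    simp at ht
    omega

end WordRAM


namespace WordRAM
open WordRAM.Expr WordRAM.Cmd

theorem Reach.of_wp {E : Env} {b : Cond} {c : Cmd} {σ : Store} {Q : ℕ → Store → Prop}
    (h1 : b.Ok E σ) (h2 : b.Holds σ) (h : wp E c σ Q) :
    ∃ t τ, Reach E b c σ (t + 1) τ ∧ Agree c σ τ ∧ Q t τ := by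
  obtain ⟨t, τ, r, q⟩ := h
  exact ⟨t, τ, .step h1 h2 r (.refl τ), r.agree, q⟩

def keyAbove : Cond := §vln * ld aS §vid 0 ≺ ld aV §vid 0 * §vld
def keyBelow : Cond := ld aV §vid 0 * §vld ≺ §vln * ld aS §vid 0

/-- Partition row `d` by the pivot, and restrict it to the part that contains the threshold. -/
def partition : Cmd :=
  vm ::= ld aM §vd 0 ;; vcap ::= ld aC §vd 0 ;;
  vln ::= ld aV §vlam 0 ;; vld ::= ld aS §vlam 0 ;;
  partCount ;;
  ite (§vcap ≺ §vwg) (compact keyAbove ;; put aM §vd 0 §vc ;; vf ::= 0)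
    (ite (§vcap ≺ §vwg + §vwe) (vf ::= 2)
      (compact keyBelow ;; put aM §vd 0 §vc ;; put aC §vd 0 (§vcap - (§vwg + §vwe)) ;; vf ::= 0))

/-- Row `d` holds the elements `a 0, …, a (m - 1)` and the capacity `c`. -/
structure Row (E : Env) (I : Items) (mu : ℕ → ℕ) (σ : Store) (d m c : ℕ) (a : ℕ → ℕ) : Prop where
  len : σ.arr aM d 0 = m
  cap : σ.arr aC d 0 = c
  elem : ∀ k < m, σ.arr aA d k = a k
  lt : ∀ k < m, a k < I.n
  le : m < E.W
  cap_lt : c < ∑ k ∈ range m, rowWeight I mu d (a k)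
  weight : ∑ k ∈ range m, rowWeight I mu d (a k) < E.B

structure Items.Mult (I : Items) (mu : ℕ → ℕ) (σ : Store) : Prop where
  M : ∀ i < I.n, σ.arr aMU i 0 = mu i

/-- The weights above and at the pivot tell on which side of it the threshold lies. Restricting the
row to that side loses no information: every threshold of the restricted row is one of the original
row. The two possible new lengths are stated because the choice of the pivot bounds both. -/
theorem partition_spec {E : Env} {I : Items} (hF : I.Fits E) {σ : Store} (hI : I.In σ)
    {mu : ℕ → ℕ} (hmu : I.Mult mu σ) {a : ℕ → ℕ} {m d c x : ℕ} (hd : σ.var vd = d)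
    (hdW : d < E.W) (hx : x < I.n) (hlam : σ.var vlam = x) (hr : Row E I mu σ d m c a) :
    wp E partition σ (fun t τ => t ≤ 2 * m ∧
      (∀ d', d' ≠ d → τ.arr aA d' = σ.arr aA d' ∧ τ.arr aM d' = σ.arr aM d' ∧
        τ.arr aC d' = σ.arr aC d') ∧
      ((τ.var vf = 2 ∧ IsThreshold I.key (rowWeight I mu d) m a c x) ∨
       (τ.var vf = 0 ∧ ∃ m' c' a', Row E I mu τ d m' c' a' ∧
        (∀ k < m', ∃ k' < m, a' k = a k') ∧
        (∀ k < m', IsThreshold I.key (rowWeight I mu d) m' a' c' (a' k) →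
          IsThreshold I.key (rowWeight I mu d) m a c (a' k)) ∧
        (m' = (∑ k ∈ range m, if I.key x < I.key (a k) then 1 else 0) ∨
         m' = ∑ k ∈ range m, if I.key (a k) < I.key x then 1 else 0)))) := by
  have hWB := hF.WB
  have hnW := hF.n_lt
  obtain ⟨r1, r2, r3, r4, r5, r6, r7⟩ := hr
  have hSx := hI.S x hx
  have hVx := hI.V x hx
  have hall : (∑ k ∈ range m, if I.key x ≤ I.key (a k) then rowWeight I mu d (a k) else 0) ≤
      ∑ k ∈ range m, rowWeight I mu d (a k) := sum_le_sum fun _ _ => by split <;> simp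
  have hadd := sum_ite_lt_add_eq (κ := I.key) (ω := rowWeight I mu d) m a x
  have hadd' := sum_ite_le_add_gt (κ := I.key) (ω := rowWeight I mu d) m a x
  simp only [partition, wp_seq, wp_set]
  refine ⟨by simp [hd, hF.live]; omega, by simp [hd, hF.live]; omega,
    by simp [hlam, hF.live]; omega, by simp [hlam, hF.live]; omega, ?_⟩
  refine (partCount_spec hF (hI.of_eq (by simp) (by simp)) (a := a) (mu := mu) (m := m) (d := d)
    (x := x) (by simpa using hmu.M) (by simpa using hd) hdW (by simp [hd, r1]) r5
    (by simpa using r3) r4 hx (by simp [hlam, hVx]) (by simp [hlam, hSx]) r7).mono ?_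
  rintro t τ hA ⟨ht, hg, he⟩
  have e1 : τ.var vcap = c := (hA.v vcap rfl).trans (by simp [hd, r2])
  have e2 : τ.var vd = d := (hA.v vd rfl).trans (by simpa using hd)
  have e3 : τ.var vm = m := (hA.v vm rfl).trans (by simp [hd, r1])
  have e4 : τ.var vln = I.v x := (hA.v vln rfl).trans (by simp [hlam, hVx])
  have e5 : τ.var vld = I.sz x := (hA.v vld rfl).trans (by simp [hlam, hSx])
  have a1 : τ.arr aA = σ.arr aA := (hA.a aA rfl).trans (by simp)
  have a2 : τ.arr aM = σ.arr aM := (hA.a aM rfl).trans (by simp)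
  have a3 : τ.arr aC = σ.arr aC := (hA.a aC rfl).trans (by simp)
  have a4 : τ.arr aS = σ.arr aS := (hA.a aS rfl).trans (by simp)
  have a5 : τ.arr aV = σ.arr aV := (hA.a aV rfl).trans (by simp)
  have hpos := hF.pos x hx
  simp only [wp_ite, Cond.holds_lt, eval_var, eval_add, e1, hg, he, hadd]
  refine ⟨by simp, fun hc => ?_, fun hc => ⟨by simp [hg, he]; omega, fun hc' => ?_, fun hc' => ?_⟩⟩
  · simp only [wp_seq]
    refine (compact_spec hF (p := fun i => I.key x < I.key i) (a := a) e2 hdW e3 r5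
      (by simpa [a1] using r3) r4 ?_).mono ?_
    · intro υ u1 u2 u3 u4 u5
      have u6 := hF.prod x hx _ u5
      have u7 := hF.prod _ u5 x hx
      have u8 : υ.arr aS (υ.var vid) 0 = I.sz (υ.var vid) := by rw [u3, a4]; exact hI.S _ u5
      have u9 : υ.arr aV (υ.var vid) 0 = I.v (υ.var vid) := by rw [u4, a5]; exact hI.V _ u5
      refine ⟨?_, ?_⟩
      · simp [keyAbove, hF.live, u8, u9, u1, u2, e4, e5]
        omega
      · simp [keyAbove, u8, u9, u1, u2, e4, e5, Items.key_lt hpos (hF.pos _ u5)]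
    · rintro t' υ hB ⟨ht', b1, b2, b3⟩
      have f1 : υ.var vd = d := (hB.v vd rfl).trans e2
      have f2 : υ.arr aM = σ.arr aM := (hB.a aM rfl).trans a2
      have f3 : υ.arr aC = σ.arr aC := (hB.a aC rfl).trans a3
      simp only [wp_put, wp_set]
      refine ⟨by simp [f1, hF.live]; omega, by simp, by simp, by omega, fun d' hd' => ?_,
        Or.inr ⟨by simp, υ.var vc, c, υ.arr aA d, ?_, ?_, ?_, Or.inl ?_⟩⟩
      · refine ⟨?_, ?_, ?_⟩
        · simp; rw [b3 d' hd', a1]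
        · simp [f1, hd', f2]
        · simp [f3]
      · refine ⟨by simp [f1], by simp [f3, r2], by simp, fun k hk => ?_, by omega, ?_, ?_⟩
        · obtain ⟨_, k', hk', h⟩ := b2.mem k hk
          rw [h]; exact r4 k' hk'
        · rw [b2.sum]; exact hc
        · rw [b2.sum]; omega
      · intro k hk
        exact (b2.mem k hk).2
      · intro k hk hthr
        exact b2.isThreshold_gt hthr (b2.mem k hk).1
      · exact b2.card
  · simp only [wp_set]
    refine ⟨by simp, by omega, fun d' _ => ?_, Or.inl ⟨by simp, by omega, hc'⟩⟩
    simp [a1, a2, a3]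
  · simp only [wp_seq]
    refine (compact_spec hF (p := fun i => I.key i < I.key x) (a := a) e2 hdW e3 r5
      (by simpa [a1] using r3) r4 ?_).mono ?_
    · intro υ u1 u2 u3 u4 u5
      have u6 := hF.prod x hx _ u5
      have u7 := hF.prod _ u5 x hx
      have u8 : υ.arr aS (υ.var vid) 0 = I.sz (υ.var vid) := by rw [u3, a4]; exact hI.S _ u5
      have u9 : υ.arr aV (υ.var vid) 0 = I.v (υ.var vid) := by rw [u4, a5]; exact hI.V _ u5
      refine ⟨?_, ?_⟩
      · simp [keyBelow, hF.live, u8, u9, u1, u2, e4, e5]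
        omega
      · simp [keyBelow, u8, u9, u1, u2, e4, e5, Items.key_lt (hF.pos _ u5) hpos]
    · rintro t' υ hB ⟨ht', b1, b2, b3⟩
      have f1 : υ.var vd = d := (hB.v vd rfl).trans e2
      have f2 : υ.arr aM = σ.arr aM := (hB.a aM rfl).trans a2
      have f3 : υ.arr aC = σ.arr aC := (hB.a aC rfl).trans a3
      have f4 : υ.var vcap = c := (hB.v vcap rfl).trans e1
      have f5 := (hB.v vwg rfl).trans hg
      have f6 := (hB.v vwe rfl).trans he
      simp only [wp_put, wp_set]
      refine ⟨by simp [f1, hF.live]; omega, by simp, by simp [f1, hF.live]; omega,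
        by simp [f4, f5, f6]; omega, by simp, by omega, fun d' hd' => ?_,
        Or.inr ⟨by simp, υ.var vc,
          c - ∑ k ∈ range m, if I.key x ≤ I.key (a k) then rowWeight I mu d (a k) else 0,
          υ.arr aA d, ?_, ?_, ?_, Or.inr ?_⟩⟩
      · refine ⟨?_, ?_, ?_⟩
        · simp; rw [b3 d' hd', a1]
        · simp [f1, hd', f2]
        · simp [f1, hd', f3]
      · refine ⟨by simp [f1], by simp [f1, f4, f5, f6, hadd], by simp, fun k hk => ?_, by omega,
          ?_, ?_⟩
        · obtain ⟨_, k', hk', h⟩ := b2.mem k hk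
          rw [h]; exact r4 k' hk'
        · rw [b2.sum]; omega
        · rw [b2.sum]; omega
      · intro k hk
        exact (b2.mem k hk).2
      · intro k hk hthr
        exact b2.isThreshold_lt (by omega) hthr (b2.mem k hk).1
      · exact b2.card

/-- One step of the selection. In mode `0` a pivot for row `d` is wanted, in mode `1` the pivot is
known, in mode `2` the threshold of row `d` is known. -/
def selectBody : Cmd :=
  ite (§vf ≗ 0)
    (vm ::= ld aM §vd 0 ;;
     ite (§vm ≺ 60) (vlam ::= ld aA §vd 0 ;; vf ::= 1)
       (medians ;; vd ::= §vd + 1 ;; put aM §vd 0 §vmm ;; put aC §vd 0 (§vmm / 2)))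
    (ite (§vf ≗ 1) partition
      (ite (§vd ≗ 0) (vf ::= 3) (vd ::= §vd - 1 ;; vf ::= 1)))

/-- Weighted selection in row `0` by medians of medians. -/
def select : Cmd :=
  vd ::= 0 ;; vf ::= 0 ;; whl (§vf ≺ 3) selectBody

/-- The recursion of median of medians is simulated by one loop, with the row number `d` as stack
pointer. The induction therefore also asserts that the rows below `d`, which belong to pending
calls, are preserved. Each descent raises `d` by one but shrinks the row to a fifth, so `d + m`
stays within the row width. -/
theorem select_reach {E : Env} {I : Items} (hF : I.Fits E) {mu : ℕ → ℕ} (m : ℕ) :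
    ∀ (σ : Store) (d c : ℕ) (a : ℕ → ℕ), I.In σ → I.Mult mu σ → σ.var vd = d → σ.var vf = 0 →
      Row E I mu σ d m c a → d + m + 2 < E.W →
      ∃ t τ, Reach E (§vf ≺ 3) selectBody σ t τ ∧ t ≤ 200 * m ∧ τ.var vf = 2 ∧ τ.var vd = d ∧
        (∃ k < m, τ.var vlam = a k) ∧
        IsThreshold I.key (rowWeight I mu d) m a c (τ.var vlam) ∧
        ∀ d' < d, τ.arr aA d' = σ.arr aA d' ∧ τ.arr aM d' = σ.arr aM d' ∧
          τ.arr aC d' = σ.arr aC d' := by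
  have hWB := hF.WB
  have hnW := hF.n_lt
  induction m using Nat.strong_induction_on with
  | _ m ih =>
    intro σ d c a hI hmu hd hf hr hdm
    have hInOf : ∀ τ, Agree selectBody σ τ → I.In τ ∧ I.Mult mu τ := fun τ hA =>
      ⟨hI.of_eq (hA.a aS rfl) (hA.a aV rfl), ⟨fun i hi => by rw [hA.a aMU rfl, hmu.M i hi]⟩⟩
    have hm0 : 0 < m := by
      rcases Nat.eq_zero_or_pos m with rfl | h
      · have := hr.cap_lt; simp at this
      · exact h
    -- The common continuation once a pivot is known: a partition leaves at most `M` elements, and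
    -- the induction hypothesis handles these.
    have pivot : ∀ (σ' : Store) (M : ℕ) (k0 : ℕ), Agree selectBody σ σ' → σ'.var vd = d →
        σ'.var vf = 1 → Row E I mu σ' d m c a → k0 < m → σ'.var vlam = a k0 → M < m →
        (∑ k ∈ range m, if I.key (a k0) < I.key (a k) then 1 else 0) ≤ M →
        (∑ k ∈ range m, if I.key (a k) < I.key (a k0) then 1 else 0) ≤ M →
        ∃ t τ, Reach E (§vf ≺ 3) selectBody σ' t τ ∧ t ≤ 2 * m + 1 + 200 * M ∧ τ.var vf = 2 ∧
          τ.var vd = d ∧ (∃ k < m, τ.var vlam = a k) ∧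
          IsThreshold I.key (rowWeight I mu d) m a c (τ.var vlam) ∧
          ∀ d' < d, τ.arr aA d' = σ'.arr aA d' ∧ τ.arr aM d' = σ'.arr aM d' ∧
            τ.arr aC d' = σ'.arr aC d' := by
      intro σ' M k0 hA' hd' hf' hr' hk0 hlam hM hgt hlt
      obtain ⟨hI', hmu'⟩ := hInOf σ' hA'
      have hp := (partition_spec hF hI' hmu' hd' (by omega) (hr'.lt k0 hk0) hlam hr').mono
        (fun t τ h1 h2 => And.intro (h1.v vlam rfl) (And.intro (h1.v vd rfl) h2))
      have hbody : ∀ Q, wp E partition σ' Q → wp E selectBody σ' Q := by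
        intro Q h
        unfold selectBody
        rw [wp_ite]
        refine ⟨by simp, fun h => by simp [hf'] at h, fun _ => ?_⟩
        rw [wp_ite]
        exact ⟨by simp, fun _ => h, fun h => by simp [hf'] at h⟩
      obtain ⟨t, τ, R, hA, g1, g2, ht, grow, g3⟩ := Reach.of_wp (b := §vf ≺ 3)
        (by simp) (by simp [hf']) (hbody _ hp)
      have hvd : τ.var vd = d := g2.trans hd'
      have hvl : τ.var vlam = a k0 := g1.trans hlam
      rcases g3 with ⟨h1, h2⟩ | ⟨h1, m', c', a', h2, h3, h4, h5⟩
      · refine ⟨t + 1, τ, R, by omega, h1, hvd, ⟨k0, hk0, hvl⟩, by rwa [hvl], fun d' hd' => ?_⟩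
        exact grow d' (by omega)
      · obtain ⟨hIτ, hmuτ⟩ := hInOf τ (hA'.trans hA)
        obtain ⟨t', υ, R', q1, q2, q3, ⟨k, hk, q4⟩, q5, q6⟩ :=
          ih m' (by omega) τ d c' a' hIτ hmuτ hvd h1 h2 (by omega)
        obtain ⟨k', hk', h3'⟩ := h3 k hk
        refine ⟨_, υ, R.trans R', by omega, q2, q3, ⟨k', hk', q4.trans h3'⟩, ?_, fun d' hd' => ?_⟩
        · rw [q4] at q5 ⊢
          exact h4 k hk q5
        · obtain ⟨u1, u2, u3⟩ := q6 d' hd'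
          obtain ⟨w1, w2, w3⟩ := grow d' (by omega)
          exact ⟨u1.trans w1, u2.trans w2, u3.trans w3⟩
    -- In a short row any pivot will do. It discards at least itself, which frees a budget of `200`,
    -- more than the cost of one partition.
    by_cases hm60 : m < 60
    · have hbody : wp E selectBody σ (fun t τ => t = 0 ∧ τ.var vd = d ∧ τ.var vf = 1 ∧
          τ.arr = σ.arr ∧ τ.var vlam = a 0) := by
        simp [selectBody, hf, hd, hF.live, hr.len, hm60, hr.elem 0 hm0]
        omega
      obtain ⟨t, τ, R, hA, g1, g2, g3, g4, g5⟩ := Reach.of_wp (b := §vf ≺ 3)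
        (by simp) (by simp [hf]) hbody
      have hrτ : Row E I mu τ d m c a := ⟨by rw [g4, hr.len], by rw [g4, hr.cap],
        by rw [g4]; exact hr.elem, hr.lt, hr.le, hr.cap_lt, hr.weight⟩
      have key : ∀ q : ℕ → Prop, ∀ [DecidablePred q], ¬ q 0 →
          (∑ k ∈ range m, if q k then 1 else 0) ≤ m - 1 := by
        intro q _ hq
        obtain ⟨m', rfl⟩ : ∃ m', m = m' + 1 := ⟨m - 1, by omega⟩
        rw [sum_range_succ', if_neg hq]
        refine (Nat.add_zero _).le.trans ((sum_le_card_nsmul _ _ 1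
          (fun k _ => by split <;> simp)).trans (by simp))
      obtain ⟨t', υ, R', q1, q2, q3, q4, q5, q6⟩ := pivot τ (m - 1) 0 hA g2 g3 hrτ hm0 g5
        (by omega) (key _ (lt_irrefl _)) (key _ (lt_irrefl _))
      refine ⟨_, υ, R.trans R', by omega, q2, q3, q4, q5, fun d' hd' => ?_⟩
      rw [← g4]; exact q6 d' hd'
    · have hbody : wp E selectBody σ (fun t τ => t ≤ 31 * (m / 5) ∧ τ.var vd = d + 1 ∧
          τ.var vf = 0 ∧
          (∀ g < m / 5, (∃ k < m, τ.arr aA (d + 1) g = a k) ∧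
            IsThreshold I.key (fun _ => 1) 5 (fun r => a (5 * g + r)) 2 (τ.arr aA (d + 1) g)) ∧
          (∀ d', d' ≠ d + 1 → τ.arr aA d' = σ.arr aA d' ∧ τ.arr aM d' = σ.arr aM d' ∧
            τ.arr aC d' = σ.arr aC d') ∧ τ.arr aM (d + 1) 0 = m / 5 ∧
          τ.arr aC (d + 1) 0 = m / 5 / 2) := by
        simp only [selectBody, wp_ite, wp_seq, wp_set]
        refine ⟨by simp, fun _ => ⟨by simp [hd, hF.live]; omega, by simp, fun h => ?_, fun _ => ?_⟩,
          fun h => by simp [hf] at h⟩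
        · simp [hd, hr.len] at h; omega
        · refine (medians_spec hF (hI.of_eq (by simp) (by simp)) (a := a) (d := d) (m := m)
            (by simpa using hd) (by omega) (by simp [hd, hr.len]) hr.le (by simpa using hr.elem)
            hr.lt).mono ?_
          rintro t τ hA ⟨h1, h2, h3, h4⟩
          have e1 : τ.var vd = d := (hA.v vd rfl).trans (by simpa using hd)
          have e2 : τ.var vf = 0 := (hA.v vf rfl).trans (by simpa using hf)
          have e3 : τ.arr aM = σ.arr aM := (hA.a aM rfl).trans (by simp)
          have e4 : τ.arr aC = σ.arr aC := (hA.a aC rfl).trans (by simp)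
          simp only [wp_put]
          refine ⟨by simp [e1]; omega, by simp [e1, hF.live]; omega, by simp,
            by simp [e1, hF.live]; omega, by simp, by omega, by simp [e1], by simp [e2],
            by simpa using h3, fun d' hd' => ⟨?_, ?_, ?_⟩, by simp [e1, h2], by simp [e1, h2]⟩
          · simpa using h4 d' hd'
          · simp [e1, hd', e3]
          · simp [e1, hd', e4]
      obtain ⟨t, τ, R, hA, g1, g2, g3, g4, g5, g6, g7⟩ := Reach.of_wp (b := §vf ≺ 3)
        (by simp) (by simp [hf]) hbody
      obtain ⟨hIτ, hmuτ⟩ := hInOf τ hA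
      -- Rows of medians carry unit weights, so the capacity `m / 5 / 2` asks for their median.
      have hs : ∑ k ∈ range (m / 5), rowWeight I mu (d + 1) (τ.arr aA (d + 1) k) = m / 5 := by
        simp [rowWeight]
      have hrc : Row E I mu τ (d + 1) (m / 5) (m / 5 / 2) (τ.arr aA (d + 1)) := by
        refine ⟨g6, g7, fun _ _ => rfl, fun k hk => ?_, by omega, by rw [hs]; omega,
          by rw [hs]; omega⟩
        obtain ⟨⟨k', hk', h⟩, _⟩ := g4 k hk
        rw [h]; exact hr.lt k' hk'
      obtain ⟨t1, τ1, R1, p1, p2, p3, ⟨k1, hk1, p4⟩, p5, p6⟩ :=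
        ih (m / 5) (by omega) τ (d + 1) _ _ hIτ hmuτ g2 g3 hrc (by omega)
      have hbody2 : wp E selectBody τ1 (fun t τ => t = 0 ∧ τ.var vd = d ∧ τ.var vf = 1 ∧
          τ.arr = τ1.arr ∧ τ.var vlam = τ1.var vlam) := by
        simp [selectBody, p2, p3]
      obtain ⟨t2, τ2, R2, hA2, s1, s2, s3, s4, s5⟩ := Reach.of_wp (b := §vf ≺ 3)
        (by simp) (by simp [p2]) hbody2
      have rowd : τ2.arr aA d = σ.arr aA d ∧ τ2.arr aM d = σ.arr aM d ∧
          τ2.arr aC d = σ.arr aC d := by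
        obtain ⟨u1, u2, u3⟩ := p6 d (by omega)
        obtain ⟨w1, w2, w3⟩ := g5 d (by omega)
        rw [s4]
        exact ⟨u1.trans w1, u2.trans w2, u3.trans w3⟩
      have hr2 : Row E I mu τ2 d m c a := ⟨by rw [rowd.2.1, hr.len], by rw [rowd.2.2, hr.cap],
        by rw [rowd.1]; exact hr.elem, hr.lt, hr.le, hr.cap_lt, hr.weight⟩
      obtain ⟨⟨k0, hk0, hk0'⟩, _⟩ := g4 k1 hk1
      have hl2 : τ2.var vlam = a k0 := s5.trans (p4.trans hk0')
      have hmom := median_of_medians (κ := I.key) (m := m) (x := a k0) (a := a)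
        (b := τ.arr aA (d + 1)) (fun g hg => (g4 g hg).2) (by
          have hw1 : rowWeight I mu (d + 1) = fun _ => 1 := by funext i; simp [rowWeight]
          rw [← hl2, s5, ← hw1]; exact p5)
      -- The two recursive calls have sizes of about `m / 5` and `7 * m / 10`. Their sum is a
      -- constant fraction below `m`, so the linear cost of this level fits into `200 * m`; the
      -- rounding errors are absorbed by `60 ≤ m`.
      obtain ⟨t3, τ3, R3, q1, q2, q3, q4, q5, q6⟩ :=
        pivot τ2 (m - 3 * (m / 5 - m / 5 / 2)) k0 ((hA.trans R1.agree).trans hA2) s2 s3 hr2 hk0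
          hl2 (by omega) (by omega) (by omega)
      refine ⟨_, τ3, ((R.trans R1).trans R2).trans R3, by omega, q2, q3, q4, q5, fun d' hd' => ?_⟩
      obtain ⟨u1, u2, u3⟩ := p6 d' (by omega)
      obtain ⟨w1, w2, w3⟩ := g5 d' (by omega)
      obtain ⟨z1, z2, z3⟩ := q6 d' hd'
      rw [s4] at z1 z2 z3
      exact ⟨z1.trans (u1.trans w1), z2.trans (u2.trans w2), z3.trans (u3.trans w3)⟩

theorem select_spec {E : Env} {I : Items} (hF : I.Fits E) {mu : ℕ → ℕ} {m : ℕ} {σ : Store}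
    {c : ℕ} {a : ℕ → ℕ} (hI : I.In σ) (hmu : I.Mult mu σ) (hr : Row E I mu σ 0 m c a)
    (hm : m + 2 < E.W) :
    wp E select σ (fun t τ => t ≤ 200 * m + 1 ∧ (∃ k < m, τ.var vlam = a k) ∧
      IsThreshold I.key (fun i => I.sz i * mu i) m a c (τ.var vlam)) := by
  simp only [select, wp_seq, wp_set]
  refine ⟨by simp, by simp, ?_⟩
  obtain ⟨t, τ, R, h1, h2, h3, h4, h5, h6⟩ := select_reach hF (mu := mu) m
    ((σ.set vd 0).set vf 0) 0 c a (hI.of_eq (by simp) (by simp))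
    ⟨by simpa using hmu.M⟩ (by simp) (by simp)
    ⟨by simpa using hr.len, by simpa using hr.cap, by simpa using hr.elem, hr.lt, hr.le,
      hr.cap_lt, hr.weight⟩ (by omega)
  have hbody : wp E selectBody τ (fun t υ => t = 0 ∧ υ.var vf = 3 ∧
      υ.var vlam = τ.var vlam) := by
    simp [selectBody, h2, h3]
  obtain ⟨t', υ, R', hA, g1, g2, g3⟩ := Reach.of_wp (b := §vf ≺ 3) (by simp) (by simp [h2]) hbody
  refine ⟨_, υ, (R.trans R').run (by simp) (by simp [g2]), by omega, ?_, ?_⟩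
  · rw [g3]; exact h4
  · have e : rowWeight I mu 0 = fun i => I.sz i * mu i := by funext i; simp [rowWeight]
    rw [g3, ← e]; exact h5

end WordRAM


/-! ### The greedy algorithm -/

namespace WordRAM
open WordRAM.Expr WordRAM.Cmd

notation "vrow" => (32 : ℕ)
notation "vgc" => (33 : ℕ)
notation "vlen" => (34 : ℕ)
notation "vtot" => (35 : ℕ)
notation "vrem" => (36 : ℕ)
notation "vz" => (37 : ℕ)

/-- `X` is a greedy solution for the items `a 0, …, a (m - 1)`. -/
structure IsGreedy (I : Items) (mu : ℕ → ℕ) (m : ℕ) (a : ℕ → ℕ) (cap : ℕ) (X : ℕ → ℕ) :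
    Prop where
  thr : ∃ p q, 0 < q ∧ ∀ k < m, (p * I.sz (a k) < I.v (a k) * q → X (a k) = mu (a k)) ∧
    (I.v (a k) * q < p * I.sz (a k) → X (a k) = 0)
  le : ∀ k < m, X (a k) ≤ mu (a k)
  sum_le : ∑ k ∈ range m, I.sz (a k) * X (a k) ≤ cap
  -- If not everything is taken, the unused capacity is smaller than the size of some item. No order
  -- among the items at the threshold is prescribed.
  full : (∀ k < m, X (a k) = mu (a k)) ∨
    ∃ k < m, cap < ∑ k ∈ range m, I.sz (a k) * X (a k) + I.sz (a k)

/-- Load the ids of row `row` and compute their total weight. -/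
def greedyInit : Cmd :=
  vk ::= 0 ;; vtot ::= 0 ;; vlen ::= ld aCN §vrow 0 ;;
  whl (§vk ≺ §vlen)
    (vid ::= ld aCL §vrow §vk ;; put aA 0 §vk §vid ;;
     vtot ::= §vtot + ld aS §vid 0 * ld aMU §vid 0 ;; vk ::= §vk + 1)

/-- Take all copies of the items above the threshold. -/
def greedyFull : Cmd :=
  vrem ::= §vgc ;; vk ::= 0 ;;
  whl (§vk ≺ §vlen)
    (vid ::= ld aCL §vrow §vk ;;
     ite keyAbove (put aX §vid 0 (ld aMU §vid 0) ;;
       vrem ::= §vrem - ld aS §vid 0 * ld aMU §vid 0) (put aX §vid 0 0) ;;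
     vk ::= §vk + 1)

/-- Take as many copies as possible of the items at the threshold. -/
def greedyFill : Cmd :=
  vk ::= 0 ;;
  whl (§vk ≺ §vlen)
    (vid ::= ld aCL §vrow §vk ;;
     ite (§vln * ld aS §vid 0 ≗ ld aV §vid 0 * §vld)
      (vz ::= §vrem / ld aS §vid 0 ;;
       ite (ld aMU §vid 0 ≼ §vz) (vz ::= ld aMU §vid 0) skip ;;
       put aX §vid 0 §vz ;; vrem ::= §vrem - ld aS §vid 0 * §vz) skip ;;
     vk ::= §vk + 1)

/-- The greedy algorithm for the items listed in row `row`, with capacity `gc`. -/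
def greedy : Cmd :=
  greedyInit ;;
  ite (§vtot ≼ §vgc) (vln ::= 0 ;; vld ::= 1)
    (put aM 0 0 §vlen ;; put aC 0 0 §vgc ;; select ;;
     vln ::= ld aV §vlam 0 ;; vld ::= ld aS §vlam 0) ;;
  greedyFull ;; greedyFill

/-- Row `r` of the class lists consists of `a 0, …, a (m - 1)`. -/
structure ListRow (E : Env) (I : Items) (σ : Store) (r m : ℕ) (a : ℕ → ℕ) : Prop where
  row_lt : r < E.W
  len : σ.arr aCN r 0 = m
  le : m + 2 < E.W
  elem : ∀ k < m, σ.arr aCL r k = a k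
  lt : ∀ k < m, a k < I.n
  inj : ∀ k < m, ∀ k' < m, a k = a k' → k = k'

theorem ListRow.of_eq {E : Env} {I : Items} {σ τ : Store} {r m : ℕ} {a : ℕ → ℕ}
    (h : ListRow E I σ r m a) (h1 : τ.arr aCN = σ.arr aCN) (h2 : τ.arr aCL = σ.arr aCL) :
    ListRow E I τ r m a :=
  ⟨h.row_lt, by rw [h1, h.len], h.le, fun k hk => by rw [h2, h.elem k hk], h.lt, h.inj⟩

theorem Items.Mult.of_eq {I : Items} {mu : ℕ → ℕ} {σ τ : Store} (h : I.Mult mu σ)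
    (h1 : τ.arr aMU = σ.arr aMU) : I.Mult mu τ := ⟨fun i hi => by rw [h1, h.M i hi]⟩

theorem greedyInit_spec {E : Env} {I : Items} (hF : I.Fits E) {σ : Store} (hI : I.In σ)
    {mu : ℕ → ℕ} (hmu : I.Mult mu σ) {r m : ℕ} {a : ℕ → ℕ} (hr : ListRow E I σ r m a)
    (hrow : σ.var vrow = r) (hB : ∑ k ∈ range m, I.sz (a k) * mu (a k) < E.B) :
    wp E greedyInit σ (fun t τ => t ≤ m ∧ τ.var vlen = m ∧
      τ.var vtot = ∑ k ∈ range m, I.sz (a k) * mu (a k) ∧ ∀ k < m, τ.arr aA 0 k = a k) := by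
  have hWB := hF.WB
  have hnW := hF.n_lt
  have h0 := hr.row_lt
  have hle := hr.le
  simp only [greedyInit, wp_seq, wp_set]
  refine ⟨by simp, by simp, by simp [hrow, hF.live]; omega, ?_⟩
  refine wp_for m (fun k τ => τ.var vtot = ∑ x ∈ range k, I.sz (a x) * mu (a x) ∧
      ∀ x < k, τ.arr aA 0 x = a x) (fun _ => 0) (by simp) (by simp) ?_ ?_ ?_
  · intro k τ hA _
    exact ⟨by simp, (hA.v vlen rfl).trans (by simp [hrow, hr.len])⟩
  · rintro k τ hk hA hvk ⟨h1, h2⟩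
    have e1 : τ.var vrow = r := (hA.v vrow rfl).trans (by simpa using hrow)
    have hak := hr.lt k hk
    have e2 : τ.arr aCL r k = a k := by rw [hA.a aCL rfl]; exact hr.elem k hk
    have e5 : τ.arr aS (a k) 0 = I.sz (a k) := by rw [hA.a aS rfl]; exact hI.S _ hak
    have e7 : τ.arr aMU (a k) 0 = mu (a k) := by rw [hA.a aMU rfl]; exact hmu.M _ hak
    have b : ∑ x ∈ range (k + 1), I.sz (a x) * mu (a x) ≤
        ∑ x ∈ range m, I.sz (a x) * mu (a x) := sum_le_sum_of_subset (range_subset_range.2 hk)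
    rw [sum_range_succ] at b
    simp [e1, e2, e5, e7, hvk, h1, hF.live, sum_range_succ]
    refine ⟨by omega, by omega, by omega, by omega, fun x hx => ?_⟩
    split
    · rename_i h; rw [h]
    · exact h2 x (by omega)
  · rintro t τ hA _ ⟨h1, h2⟩ ht
    exact ⟨by simpa using ht, (hA.v vlen rfl).trans (by simp [hrow, hr.len]), h1, h2⟩

theorem greedyFull_spec {E : Env} {I : Items} (hF : I.Fits E) {σ : Store} (hI : I.In σ)
    {mu : ℕ → ℕ} (hmu : I.Mult mu σ) {r m : ℕ} {a : ℕ → ℕ} (hr : ListRow E I σ r m a)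
    (hrow : σ.var vrow = r) (hlen : σ.var vlen = m) {p q cap : ℕ}
    (hB : ∑ k ∈ range m, I.sz (a k) * mu (a k) < E.B)
    (hp : σ.var vln = p) (hq : σ.var vld = q) (hc : σ.var vgc = cap)
    (hpB : ∀ k < m, p * I.sz (a k) < E.B ∧ I.v (a k) * q < E.B)
    (hcap : (∑ k ∈ range m,
      if p * I.sz (a k) < I.v (a k) * q then I.sz (a k) * mu (a k) else 0) ≤ cap) :
    wp E greedyFull σ (fun t τ => t ≤ m ∧
      τ.var vrem + ∑ k ∈ range m, I.sz (a k) * τ.arr aX (a k) 0 = cap ∧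
      (∀ k < m, τ.arr aX (a k) 0 =
        if p * I.sz (a k) < I.v (a k) * q then mu (a k) else 0) ∧
      ∀ i, (∀ k < m, a k ≠ i) → τ.arr aX i = σ.arr aX i) := by
  have hWB := hF.WB
  have hnW := hF.n_lt
  have h0 := hr.row_lt
  have hle := hr.le
  simp only [greedyFull, wp_seq, wp_set]
  refine ⟨by simp, by simp, ?_⟩
  refine wp_for m (fun k τ => (τ.var vrem + ∑ x ∈ range k,
        (if p * I.sz (a x) < I.v (a x) * q then I.sz (a x) * mu (a x) else 0) = cap) ∧
      (∀ x < k, τ.arr aX (a x) 0 =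
        if p * I.sz (a x) < I.v (a x) * q then mu (a x) else 0) ∧
      ∀ i, (∀ x < m, a x ≠ i) → τ.arr aX i = σ.arr aX i) (fun _ => 0) (by simp) (by simp [hc])
      ?_ ?_ ?_
  · intro k τ hA _
    exact ⟨by simp, (hA.v vlen rfl).trans (by simp [hlen])⟩
  · rintro k τ hk hA hvk ⟨h1, h2, h3⟩
    have e1 : τ.var vrow = r := (hA.v vrow rfl).trans (by simpa using hrow)
    have e3 : τ.var vln = p := (hA.v vln rfl).trans (by simpa using hp)
    have e4 : τ.var vld = q := (hA.v vld rfl).trans (by simpa using hq)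
    have hak := hr.lt k hk
    have e2 : τ.arr aCL r k = a k := by rw [hA.a aCL rfl]; exact hr.elem k hk
    have e5 : τ.arr aS (a k) 0 = I.sz (a k) := by rw [hA.a aS rfl]; exact hI.S _ hak
    have e6 : τ.arr aV (a k) 0 = I.v (a k) := by rw [hA.a aV rfl]; exact hI.V _ hak
    have e7 : τ.arr aMU (a k) 0 = mu (a k) := by rw [hA.a aMU rfl]; exact hmu.M _ hak
    have b1 : I.sz (a k) * mu (a k) ≤ ∑ k ∈ range m, I.sz (a k) * mu (a k) :=
      single_le_sum (f := fun k => I.sz (a k) * mu (a k)) (fun _ _ => Nat.zero_le _)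
        (mem_range.2 hk)
    obtain ⟨b2, b3⟩ := hpB k hk
    have b : ∑ x ∈ range (k + 1),
        (if p * I.sz (a x) < I.v (a x) * q then I.sz (a x) * mu (a x) else 0) ≤
        ∑ x ∈ range m, if p * I.sz (a x) < I.v (a x) * q then I.sz (a x) * mu (a x) else 0 :=
      sum_le_sum_of_subset (range_subset_range.2 hk)
    rw [sum_range_succ] at b
    have hne : ∀ x < k, a x ≠ a k := fun x hx h => by
      have := hr.inj x (by omega) k hk h; omega
    by_cases hab : p * I.sz (a k) < I.v (a k) * q
    · rw [if_pos hab] at b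
      simp [keyAbove, e1, e2, e3, e4, e5, e6, e7, hvk, hF.live, sum_range_succ, hab, hab.not_ge]
      refine ⟨by omega, by omega, by omega, by omega, by omega, by omega, fun x hx => ?_,
        fun i hi => ?_⟩
      · split
        · rename_i h; rw [h, if_pos hab]
        · rename_i h
          refine h2 x (Nat.lt_of_le_of_ne (by omega) fun h' => h (by rw [h']))
      · rw [← h3 i hi]; funext j; simp [Ne.symm (hi k hk)]
    · simp [keyAbove, e1, e2, e3, e4, e5, e6, hvk, hF.live, sum_range_succ, hab, not_lt.1 hab]
      refine ⟨by omega, by omega, by omega, by omega, by omega, fun x hx => ?_, fun i hi => ?_⟩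
      · split
        · rename_i h; rw [h, if_neg hab]
        · rename_i h
          refine h2 x (Nat.lt_of_le_of_ne (by omega) fun h' => h (by rw [h']))
      · rw [← h3 i hi]; funext j; simp [Ne.symm (hi k hk)]
  · rintro t τ hA _ ⟨h1, h2, h3⟩ ht
    refine ⟨by simpa using ht, ?_, h2, h3⟩
    rw [← h1]
    congr 1
    refine sum_congr rfl fun x hx => ?_
    rw [h2 x (mem_range.1 hx)]
    split <;> simp

theorem greedyFill_spec {E : Env} {I : Items} (hF : I.Fits E) {σ : Store} (hI : I.In σ)
    {mu : ℕ → ℕ} (hmu : I.Mult mu σ) {r m : ℕ} {a : ℕ → ℕ} (hr : ListRow E I σ r m a)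
    (hrow : σ.var vrow = r) (hlen : σ.var vlen = m) {p q cap : ℕ}
    (hp : σ.var vln = p) (hq : σ.var vld = q) (hcB : cap < E.B)
    (hpB : ∀ k < m, p * I.sz (a k) < E.B ∧ I.v (a k) * q < E.B)
    (hrem : σ.var vrem + ∑ k ∈ range m, I.sz (a k) * σ.arr aX (a k) 0 = cap)
    (hX : ∀ k < m, σ.arr aX (a k) 0 =
        if p * I.sz (a k) < I.v (a k) * q then mu (a k) else 0) :
    wp E greedyFill σ (fun t τ => t ≤ m ∧
      τ.var vrem + ∑ k ∈ range m, I.sz (a k) * τ.arr aX (a k) 0 = cap ∧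
      (∀ k < m, (p * I.sz (a k) < I.v (a k) * q → τ.arr aX (a k) 0 = mu (a k)) ∧
        (I.v (a k) * q < p * I.sz (a k) → τ.arr aX (a k) 0 = 0) ∧
        τ.arr aX (a k) 0 ≤ mu (a k)) ∧
      ((∀ k < m, p * I.sz (a k) = I.v (a k) * q → τ.arr aX (a k) 0 = mu (a k)) ∨
        ∃ k < m, τ.var vrem < I.sz (a k)) ∧
      ∀ i, (∀ k < m, a k ≠ i) → τ.arr aX i = σ.arr aX i) := by
  have hWB := hF.WB
  have hnW := hF.n_lt
  have h0 := hr.row_lt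
  have hle := hr.le
  simp only [greedyFill, wp_seq, wp_set]
  refine ⟨by simp, ?_⟩
  refine wp_for m (fun k τ =>
      τ.var vrem + ∑ k ∈ range m, I.sz (a k) * τ.arr aX (a k) 0 = cap ∧
      (∀ x < m, (p * I.sz (a x) < I.v (a x) * q → τ.arr aX (a x) 0 = mu (a x)) ∧
        (I.v (a x) * q < p * I.sz (a x) → τ.arr aX (a x) 0 = 0) ∧
        τ.arr aX (a x) 0 ≤ mu (a x) ∧
        (k ≤ x → p * I.sz (a x) = I.v (a x) * q → τ.arr aX (a x) 0 = 0)) ∧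
      ((∀ x < k, p * I.sz (a x) = I.v (a x) * q → τ.arr aX (a x) 0 = mu (a x)) ∨
        ∃ x < m, τ.var vrem < I.sz (a x)) ∧
      ∀ i, (∀ k < m, a k ≠ i) → τ.arr aX i = σ.arr aX i) (fun _ => 0) (by simp) ?_ ?_ ?_ ?_
  · simp only [Store.set_arr, Store.set_var]
    refine ⟨by simpa using hrem, fun x hx => ?_, Or.inl fun x hx => absurd hx (Nat.not_lt_zero _),
      by simp⟩
    rw [hX x hx]
    refine ⟨fun h => if_pos h, fun h => if_neg h.not_gt, by split <;> simp, fun _ h => ?_⟩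
    rw [h]; simp
  · intro k τ hA _
    exact ⟨by simp, (hA.v vlen rfl).trans (by simp [hlen])⟩
  · rintro k τ hk hA hvk ⟨h1, h2, h3, h4⟩
    have e1 : τ.var vrow = r := (hA.v vrow rfl).trans (by simpa using hrow)
    have e3 : τ.var vln = p := (hA.v vln rfl).trans (by simpa using hp)
    have e4 : τ.var vld = q := (hA.v vld rfl).trans (by simpa using hq)
    have hak := hr.lt k hk
    have e2 : τ.arr aCL r k = a k := by rw [hA.a aCL rfl]; exact hr.elem k hk
    have e5 : τ.arr aS (a k) 0 = I.sz (a k) := by rw [hA.a aS rfl]; exact hI.S _ hak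
    have e6 : τ.arr aV (a k) 0 = I.v (a k) := by rw [hA.a aV rfl]; exact hI.V _ hak
    have e7 : τ.arr aMU (a k) 0 = mu (a k) := by rw [hA.a aMU rfl]; exact hmu.M _ hak
    obtain ⟨b2, b3⟩ := hpB k hk
    have hpos := hF.pos _ hak
    have hne : ∀ x < m, x ≠ k → a x ≠ a k := fun x hx hxk h => hxk (hr.inj x hx k hk h)
    by_cases hab : p * I.sz (a k) = I.v (a k) * q
    · have hXk := (h2 k hk).2.2.2 le_rfl hab
      set z := if mu (a k) ≤ τ.var vrem / I.sz (a k) then mu (a k)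
        else τ.var vrem / I.sz (a k) with hz
      have hz1 : z ≤ τ.var vrem / I.sz (a k) := by rw [hz]; split <;> omega
      have hz2 : z ≤ mu (a k) := by rw [hz]; split <;> omega
      have hz3 : I.sz (a k) * z ≤ τ.var vrem :=
        (Nat.mul_le_mul_left _ hz1).trans (Nat.mul_div_le _ _)
      -- Either the item is used up or the remaining capacity drops below its size; the second
      -- alternative persists, since the remaining capacity only shrinks.
      have hz4 : z = mu (a k) ∨ τ.var vrem - I.sz (a k) * z < I.sz (a k) := by
        by_cases h : mu (a k) ≤ τ.var vrem / I.sz (a k)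
        · left; rw [hz, if_pos h]
        · right
          rw [hz, if_neg h]
          have := Nat.div_add_mod (τ.var vrem) (I.sz (a k))
          have := Nat.mod_lt (τ.var vrem) hpos
          omega
      have hrest : wp E (put aX §vid 0 §vz ;; vrem ::= §vrem - ld aS §vid 0 * §vz ;;
          vk ::= §vk + 1) ((τ.set vid (a k)).set vz z) (fun t τ' => τ'.var vk = k + 1 ∧
            (τ'.var vrem + ∑ k ∈ range m, I.sz (a k) * τ'.arr aX (a k) 0 = cap ∧
            (∀ x < m, (p * I.sz (a x) < I.v (a x) * q → τ'.arr aX (a x) 0 = mu (a x)) ∧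
              (I.v (a x) * q < p * I.sz (a x) → τ'.arr aX (a x) 0 = 0) ∧
              τ'.arr aX (a x) 0 ≤ mu (a x) ∧
              (k + 1 ≤ x → p * I.sz (a x) = I.v (a x) * q → τ'.arr aX (a x) 0 = 0)) ∧
            ((∀ x < k + 1, p * I.sz (a x) = I.v (a x) * q → τ'.arr aX (a x) 0 = mu (a x)) ∨
              ∃ x < m, τ'.var vrem < I.sz (a x)) ∧
            ∀ i, (∀ k < m, a k ≠ i) → τ'.arr aX i = σ.arr aX i) ∧ t ≤ 0) := by
        have hsum : ∑ x ∈ range m, I.sz (a x) * (if a x = a k then z else τ.arr aX (a x) 0) =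
            I.sz (a k) * z + ∑ x ∈ range m, I.sz (a x) * τ.arr aX (a x) 0 := by
          rw [← add_sum_erase _ _ (mem_range.2 hk), ← add_sum_erase _ _ (mem_range.2 hk), hXk]
          simp only [if_true, mul_zero, zero_add]
          congr 1
          refine sum_congr rfl fun x hx => ?_
          rw [mem_erase, mem_range] at hx
          rw [if_neg (hne x hx.2 hx.1)]
        simp [e5, hvk, hF.live, -mul_ite, hsum]
        refine ⟨by omega, by omega, by omega, by omega, fun x hx => ?_, ?_, fun i hi => ?_⟩
        · by_cases hxk : x = k
          · subst hxk
            simp only [if_true]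
            exact ⟨fun h => absurd hab h.ne, fun h => absurd hab h.ne', hz2, fun h => by omega⟩
          · rw [if_neg (hne x hx hxk)]
            obtain ⟨u1, u2, u3, u4⟩ := h2 x hx
            exact ⟨u1, u2, u3, fun h => u4 (by omega)⟩
        · rcases hz4 with hz4 | hz4
          · rcases h3 with h3 | ⟨x, hx, h3⟩
            · left
              intro x hx heq
              by_cases hxk : x = k
              · subst hxk; simpa using hz4
              · rw [if_neg (hne x (by omega) hxk)]
                exact h3 x (by omega) heq
            · right; exact ⟨x, hx, by omega⟩
          · right; exact ⟨k, hk, by omega⟩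
        · rw [← h4 i hi]; funext j; simp [Ne.symm (hi k hk)]
      simp only [wp_seq, wp_set, wp_ite, wp_skip, eval_ld, eval_var, e1, hvk, e2] at hrest ⊢
      refine ⟨by simp [e1, hvk, hF.live]; omega,
        by simp [e3, e4, e5, e6, hF.live]; omega, fun _ => ⟨by simp [hF.live]; omega,
          by simp [hF.live]; omega, fun h => ⟨by simp [hF.live]; omega, ?_⟩, fun h => ?_⟩,
          fun h => by simp [e3, e4, e5, e6, hab] at h⟩
      · have h' : mu (a k) ≤ τ.var vrem / I.sz (a k) := by simpa [e5, e7] using h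
        have hz' : z = mu (a k) := by rw [hz, if_pos h']
        rw [hz'] at hrest
        simpa [e5, e7] using hrest
      · have h' : ¬ mu (a k) ≤ τ.var vrem / I.sz (a k) := by simpa [e5, e7] using h
        have hz' : z = τ.var vrem / I.sz (a k) := by rw [hz, if_neg h']
        simp [e5] at hrest ⊢
        rw [← hz']; exact hrest
    · simp [e1, e2, e3, e4, e5, e6, hvk, hF.live, hab]
      refine ⟨by omega, by omega, by omega, h1, fun x hx => ?_, ?_, h4⟩
      · obtain ⟨u1, u2, u3, u4⟩ := h2 x hx
        exact ⟨u1, u2, u3, fun h => u4 (by omega)⟩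
      · rcases h3 with h3 | h3
        · left
          intro x hx heq
          rcases Nat.lt_or_eq_of_le hx with hx | rfl
          · exact h3 x hx heq
          · exact absurd heq hab
        · exact Or.inr h3
  · rintro t τ hA _ ⟨h1, h2, h3, h4⟩ ht
    exact ⟨by simpa using ht, h1, fun k hk => ⟨(h2 k hk).1, (h2 k hk).2.1, (h2 k hk).2.2.1⟩, h3, h4⟩

theorem greedy_spec {E : Env} {I : Items} (hF : I.Fits E) {σ : Store} (hI : I.In σ)
    {mu : ℕ → ℕ} (hmu : I.Mult mu σ) {r m : ℕ} {a : ℕ → ℕ} (hr : ListRow E I σ r m a)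
    (hrow : σ.var vrow = r) {cap : ℕ} (hc : σ.var vgc = cap) (hcB : cap < E.B)
    (hB : ∑ k ∈ range m, I.sz (a k) * mu (a k) < E.B) :
    wp E greedy σ (fun t τ => t ≤ 203 * m + 1 ∧
      τ.var vrem + ∑ k ∈ range m, I.sz (a k) * τ.arr aX (a k) 0 = cap ∧
      IsGreedy I mu m a cap (fun i => τ.arr aX i 0) ∧
      ∀ i, (∀ k < m, a k ≠ i) → τ.arr aX i = σ.arr aX i) := by
  have hWB := hF.WB
  have hnW := hF.n_lt
  have h0 := hr.row_lt
  have hle := hr.le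
  -- The two final passes work for any threshold `p / q` such that the items above it fit and,
  -- unless `p = 0`, those at or above it do not. Here `t₀` is the cost incurred so far.
  have finish : ∀ (t₀ : ℕ) (τ : Store) (p q : ℕ), Agree greedy σ τ → τ.var vrow = r →
      τ.var vlen = m → τ.var vgc = cap → τ.arr aX = σ.arr aX → 0 < q →
      τ.var vln = p → τ.var vld = q →
      (∀ k < m, p * I.sz (a k) < E.B ∧ I.v (a k) * q < E.B) →
      (∑ k ∈ range m,
        if p * I.sz (a k) < I.v (a k) * q then I.sz (a k) * mu (a k) else 0) ≤ cap →
      (p = 0 ∨ cap < ∑ k ∈ range m,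
        if p * I.sz (a k) ≤ I.v (a k) * q then I.sz (a k) * mu (a k) else 0) →
      t₀ ≤ 201 * m + 1 →
      wp E (greedyFull ;; greedyFill) τ (fun t υ => t₀ + t ≤ 203 * m + 1 ∧
        υ.var vrem + ∑ k ∈ range m, I.sz (a k) * υ.arr aX (a k) 0 = cap ∧
        IsGreedy I mu m a cap (fun i => υ.arr aX i 0) ∧
        ∀ i, (∀ k < m, a k ≠ i) → υ.arr aX i = σ.arr aX i) := by
    intro t₀ τ p q hA h1 h2 h3 h4 h5 h6 h7 h8 h9 h10 h11
    have hIτ : I.In τ := hI.of_eq (hA.a aS rfl) (hA.a aV rfl)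
    have hmuτ : I.Mult mu τ := hmu.of_eq (hA.a aMU rfl)
    have hrτ : ListRow E I τ r m a := hr.of_eq (hA.a aCN rfl) (hA.a aCL rfl)
    rw [wp_seq]
    refine (greedyFull_spec hF hIτ hmuτ hrτ h1 h2 hB h6 h7 h3 h8 h9).mono ?_
    rintro t υ hA' ⟨g1, g2, g3, g4⟩
    refine (greedyFill_spec hF (hIτ.of_eq (hA'.a aS rfl) (hA'.a aV rfl))
      (hmuτ.of_eq (hA'.a aMU rfl)) (hrτ.of_eq (hA'.a aCN rfl) (hA'.a aCL rfl))
      ((hA'.v vrow rfl).trans h1) ((hA'.v vlen rfl).trans h2) ((hA'.v vln rfl).trans h6)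
      ((hA'.v vld rfl).trans h7) hcB h8 g2 g3).mono ?_
    rintro t' υ' - ⟨q1, q2, q3, q4, q5⟩
    refine ⟨by omega, q2, ⟨⟨p, q, h5, fun k hk => ⟨(q3 k hk).1, (q3 k hk).2.1⟩⟩,
      fun k hk => (q3 k hk).2.2, by omega, ?_⟩, fun i hi => by rw [q5 i hi, g4 i hi, h4]⟩
    rcases q4 with q4 | ⟨k, hk, q4⟩
    · left
      intro k hk
      -- For `p = 0` every item lies at or above the threshold, so everything has been taken.
      -- Otherwise the items at the threshold cannot all have been used up, because the items at or
      -- above it weigh more than the capacity.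
      rcases h10 with rfl | h10
      · rcases Nat.eq_zero_or_pos (I.v (a k) * q) with h | h
        · exact q4 k hk (by omega)
        · exact (q3 k hk).1 (by omega)
      · exfalso
        have : (∑ k ∈ range m,
            if p * I.sz (a k) ≤ I.v (a k) * q then I.sz (a k) * mu (a k) else 0) ≤
            ∑ k ∈ range m, I.sz (a k) * υ'.arr aX (a k) 0 := by
          refine sum_le_sum fun x hx => ?_
          rw [mem_range] at hx
          split
          · rename_i h
            rcases h.lt_or_eq with h | h
            · rw [(q3 x hx).1 h]
            · rw [q4 x hx h]
          · exact Nat.zero_le _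
        omega
    · right; exact ⟨k, hk, by omega⟩
  simp only [greedy]
  rw [wp_seq]
  refine (greedyInit_spec hF hI hmu hr hrow hB).mono ?_
  rintro t τ hA ⟨h1, h2, h3, h4⟩
  have e1 : τ.var vrow = r := (hA.v vrow rfl).trans hrow
  have e2 : τ.var vgc = cap := (hA.v vgc rfl).trans hc
  have e3 : τ.arr aX = σ.arr aX := hA.a aX rfl
  have hA₁ : Agree greedy σ τ := ⟨fun x hx => hA.v x (by
    simp only [greedy, Cmd.wv, Bool.or_eq_false_iff] at hx; exact hx.1), fun x hx => hA.a x (by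
    simp only [greedy, Cmd.wa, Bool.or_eq_false_iff] at hx; exact hx.1)⟩
  have hIτ : I.In τ := hI.of_eq (hA.a aS rfl) (hA.a aV rfl)
  rw [wp_seq, wp_ite]
  refine ⟨by simp, fun hcap => ?_, fun hcap => ?_⟩
  · simp only [Cond.holds_le, eval_var, h3, e2] at hcap
    simp only [wp_seq (a := Cmd.set _ _), wp_set]
    refine ⟨by simp, by simp, ?_⟩
    refine (finish (t + (0 + 0)) _ 0 1 ?_ (by simpa using e1) (by simpa using h2)
      (by simpa using e2) (by simpa using e3) one_pos (by simp) (by simp) ?_ ?_ (Or.inl rfl)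
      (by omega)).mono fun _ _ _ h => by simpa only [add_assoc, zero_add, add_zero] using h
    · refine ⟨fun x hx => ?_, fun x hx => by simpa using hA₁.a x hx⟩
      have : x ≠ vln ∧ x ≠ vld := by
        constructor <;> rintro rfl <;> simp [greedy, Cmd.wv] at hx
      simpa [this.1, this.2] using hA₁.v x hx
    · intro k hk
      have := hF.prod _ (hr.lt k hk) _ (hr.lt k hk)
      have h := Nat.le_mul_of_pos_right (I.v (a k)) (hF.pos _ (hr.lt k hk))
      omega
    · refine (sum_le_sum fun k _ => ?_).trans hcap
      split <;> simp
  · simp only [Cond.holds_le, eval_var, h3, e2, not_le] at hcap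
    simp only [wp_seq (a := Cmd.put _ _ _ _), wp_seq (a := select), wp_seq (a := Cmd.set _ _),
      wp_put, wp_set]
    refine ⟨by simp [hF.live]; omega, by simp, by simp [hF.live]; omega, by simp, ?_⟩
    have hrow' : Row E I mu ((τ.put aM 0 0 m).put aC 0 0 cap) 0 m cap a :=
      ⟨by simp, by simp, by simpa using h4, hr.lt, by omega, by simpa [rowWeight] using hcap,
        by simpa [rowWeight] using hB⟩
    simp only [eval_var, eval_lit, h2, Store.put_var, e2]
    refine (select_spec hF (mu := mu) (hIτ.of_eq (by simp) (by simp))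
      ⟨fun i hi => by simpa [hA.a aMU rfl] using hmu.M i hi⟩ hrow' hle).mono ?_
    rintro t' υ hB' ⟨g1, ⟨k0, hk0, g2⟩, g3⟩
    have hak := hr.lt k0 hk0
    have hIυ : I.In υ := hIτ.of_eq ((hB'.a aS rfl).trans (by simp))
      ((hB'.a aV rfl).trans (by simp))
    have f1 := hIυ.S _ hak
    have f2 := hIυ.V _ hak
    refine ⟨by simp [g2, hF.live]; omega, by simp [g2, hF.live]; omega, ?_⟩
    have hpk := hF.pos _ hak
    have hk1 : ∀ k < m, I.v (a k0) * I.sz (a k) < I.v (a k) * I.sz (a k0) ↔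
        I.key (a k0) < I.key (a k) := fun k hk => Items.key_lt hpk (hF.pos _ (hr.lt k hk))
    have hk2 : ∀ k < m, I.v (a k0) * I.sz (a k) ≤ I.v (a k) * I.sz (a k0) ↔
        I.key (a k0) ≤ I.key (a k) := fun k hk => Items.key_le hpk (hF.pos _ (hr.lt k hk))
    rw [g2] at g3
    have f3 : υ.arr aX = σ.arr aX := (hB'.a aX rfl).trans (by simpa using e3)
    refine (finish (t + (0 + (0 + (t' + (0 + 0))))) _ (I.v (a k0)) (I.sz (a k0)) ?_
      (by simpa using (hB'.v vrow rfl).trans (by simpa using e1))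
      (by simpa using (hB'.v vlen rfl).trans (by simpa using h2))
      (by simpa using (hB'.v vgc rfl).trans (by simpa using e2)) (by simpa using f3) hpk
      (by simp [g2, f2]) (by simp [g2, f1]) ?_ ?_ ?_
      (by omega)).mono fun _ _ _ h => by simpa only [add_assoc, zero_add, add_zero] using h
    · refine ⟨fun x hx => ?_, fun x hx => ?_⟩
      · have : x ≠ vln ∧ x ≠ vld := by
          constructor <;> rintro rfl <;> simp [greedy, Cmd.wv] at hx
        have hx' : select.wv x = false := by
          simp only [greedy, Cmd.wv, Bool.or_eq_false_iff] at hx; tauto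
        simpa [this.1, this.2, hB'.v x hx'] using hA₁.v x hx
      · have : x ≠ aM ∧ x ≠ aC := by
          constructor <;> rintro rfl <;> simp [greedy, Cmd.wa] at hx
        have hx' : select.wa x = false := by
          simp only [greedy, Cmd.wa, Bool.or_eq_false_iff] at hx; tauto
        simpa [this.1, this.2, hB'.a x hx'] using hA₁.a x hx
    · exact fun k hk => ⟨hF.prod _ hak _ (hr.lt k hk), hF.prod _ (hr.lt k hk) _ hak⟩
    · refine le_trans (le_of_eq (sum_congr rfl fun k hk => ?_)) g3.1
      simp only [hk1 k (mem_range.1 hk)]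
    · right
      refine lt_of_lt_of_eq g3.2 (sum_congr rfl fun k hk => ?_)
      simp only [hk2 k (mem_range.1 hk)]

end WordRAM



/-! ### Proximity of greedy and optimal solutions -/

/-- The copies counted by `d` are put into an arbitrary sequence; `c k` counts those among the first
`k`. This makes prefix sums of sizes available. -/
theorem exists_unit_chain (n A : ℕ) : ∀ d : ℕ → ℕ, ∑ i ∈ range n, d i = A →
    ∃ c : ℕ → ℕ → ℕ, (∀ i, c 0 i = 0) ∧ (∀ i < n, c A i = d i) ∧
      ∀ k < A, ∃ i < n, ∀ x, c (k + 1) x = c k x + if x = i then 1 else 0 := by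
  induction A with
  | zero =>
    intro d hd
    refine ⟨fun _ _ => 0, fun _ => rfl, fun i hi => ?_, fun k hk => absurd hk (Nat.not_lt_zero _)⟩
    rw [sum_eq_zero_iff] at hd
    exact (hd i (mem_range.2 hi)).symm
  | succ A ih =>
    intro d hd
    obtain ⟨i, hi, hdi⟩ : ∃ i < n, 0 < d i := by
      by_contra! h
      rw [sum_eq_zero fun i hi => Nat.le_zero.1 (h i (mem_range.1 hi))] at hd
      omega
    have hsub : ∀ x, d x = d x - (if x = i then 1 else 0) + if x = i then 1 else 0 := by
      intro x; split
      · rename_i h; subst h; omega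
      · omega
    have hd' : ∑ x ∈ range n, (d x - if x = i then 1 else 0) = A := by
      have : ∑ x ∈ range n, d x = ∑ x ∈ range n, ((d x - if x = i then 1 else 0) +
          if x = i then 1 else 0) := sum_congr rfl fun x _ => hsub x
      rw [sum_add_distrib, sum_ite_eq' (range n) i, if_pos (mem_range.2 hi)] at this
      omega
    obtain ⟨c, h0, hA, hs⟩ := ih _ hd'
    refine ⟨fun k x => if k ≤ A then c k x else c A x + if x = i then 1 else 0, fun x => ?_,
      fun x hx => ?_, fun k hk => ?_⟩
    · simpa using h0 x
    · simp only [Nat.not_succ_le_self, if_false]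
      rw [hA x hx, ← hsub]
    · rcases Nat.lt_or_ge k A with h | h
      · obtain ⟨i', hi', h'⟩ := hs k h
        refine ⟨i', hi', fun x => ?_⟩
        simp only [h.le, Nat.succ_le_of_lt h, if_true]
        exact h' x
      · obtain rfl : k = A := by omega
        exact ⟨i, hi, fun x => by simp⟩

/-- Two sequences with steps at most `s` that stay close have increments in common. -/
theorem exists_common_increment {s A R : ℕ} {PA PR : ℕ → ℕ} (h0' : PR 0 = 0)
    (hA : ∀ k < A, PA k ≤ PA (k + 1)) (hR : ∀ k < R, PR (k + 1) ≤ PR k + s)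
    (hle : PA A < PR R + s) (hsA : s ≤ A) (hR' : ∀ k < R, PR k ≤ PR (k + 1)) :
    ∃ i i' j j', i < i' ∧ i' ≤ A ∧ j ≤ j' ∧ j' ≤ R ∧ PA i' + PR j = PA i + PR j' := by
  have mono : ∀ {N : ℕ} {f : ℕ → ℕ}, (∀ k < N, f k ≤ f (k + 1)) →
      ∀ j ≤ N, ∀ i ≤ j, f i ≤ f j := by
    intro N f h j
    induction j with
    | zero => intro _ i hi; rw [Nat.le_zero.1 hi]
    | succ j ih =>
      intro hj i hi
      rcases Nat.lt_or_eq_of_le hi with hi | rfl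
      · exact (ih (by omega) i (by omega)).trans (h j (by omega))
      · exact le_rfl
  -- The partner of `i` is the last index at which `PR` does not exceed `PA i`. The next step of
  -- `PR`, or the hypothesis on the end points, bounds the gap below `s`.
  have hj : ∀ i, ∃ j, i ≤ A → j ≤ R ∧ PR j ≤ PA i ∧ PA i < PR j + s := by
    intro i
    by_cases hi : i ≤ A
    · refine ⟨Nat.findGreatest (fun j => PR j ≤ PA i) R, fun _ => ?_⟩
      have h1 := Nat.findGreatest_le (P := fun j => PR j ≤ PA i) R
      have h2 := Nat.findGreatest_spec (P := fun j => PR j ≤ PA i) (Nat.zero_le R) (by simp [h0'])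
      refine ⟨h1, h2, ?_⟩
      rcases Nat.lt_or_eq_of_le h1 with h | h
      · have h3 := Nat.findGreatest_is_greatest (P := fun j => PR j ≤ PA i)
          (Nat.lt_succ_self _) h
        have h4 := hR _ h
        simp only [Nat.succ_eq_add_one] at h3
        omega
      · rw [h]
        exact (mono hA A le_rfl i hi).trans_lt hle
    · exact ⟨0, fun h => absurd h hi⟩
  choose j hj using hj
  -- Pigeonhole: `s + 1` indices, but only `s` possible gaps.
  obtain ⟨x, hx, y, hy, hxy, h⟩ := exists_ne_map_eq_of_card_lt_of_maps_to
    (s := range (s + 1)) (t := range s) (f := fun i => PA i - PR (j i)) (by simp) (by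
      intro i hi
      have hi' : i < s + 1 := by simpa using hi
      obtain ⟨_, h1, h2⟩ := hj i (by omega)
      simp only [coe_range, Set.mem_Iio]
      omega)
  wlog hlt : x < y generalizing x y
  · exact this y hy x hx hxy.symm h.symm (by omega)
  rw [mem_range] at hx hy
  obtain ⟨a1, a2, a3⟩ := hj x (by omega)
  obtain ⟨b1, b2, b3⟩ := hj y (by omega)
  have hm := mono hA y (by omega) x (by omega)
  -- If the partners were in the wrong order, monotonicity and the equality of gaps would force both
  -- sequences to be constant between the indices; then an empty increment of `PR` serves.
  by_cases hjj : j x ≤ j y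
  · exact ⟨x, y, j x, j y, hlt, by omega, hjj, b1, by omega⟩
  · have hm' := mono hR' (j x) a1 (j y) (by omega)
    exact ⟨x, y, j x, j x, hlt, by omega, le_rfl, a1, by omega⟩

namespace WordRAM

/-- `z` is a feasible solution with multiplicities `u` and capacity `cap`. -/
structure Items.Feasible (I : Items) (u : ℕ → ℕ) (cap : ℕ) (z : ℕ → ℕ) : Prop where
  le : ∀ i < I.n, z i ≤ u i
  cap_le : ∑ i ∈ range I.n, I.sz i * z i ≤ cap

def Items.value (I : Items) (z : ℕ → ℕ) : ℕ := ∑ i ∈ range I.n, I.v i * z i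

theorem Items.value_le {I : Items} {u z : ℕ → ℕ} (h : ∀ i < I.n, z i ≤ u i) :
    I.value z ≤ I.value u :=
  sum_le_sum fun i hi => Nat.mul_le_mul_left _ (h i (mem_range.1 hi))

structure Items.Optimal (I : Items) (u : ℕ → ℕ) (cap : ℕ) (z : ℕ → ℕ) : Prop
    extends I.Feasible u cap z where
  max : ∀ z', I.Feasible u cap z' → I.value z' ≤ I.value z

theorem Items.exists_optimal (I : Items) (u : ℕ → ℕ) (cap : ℕ) : ∃ z, I.Optimal u cap z := by
  classical
  have h := Nat.findGreatest_spec (P := fun m => ∃ z, I.Feasible u cap z ∧ I.value z = m)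
    (Nat.zero_le (I.value u)) ⟨fun _ => 0, ⟨by simp, by simp⟩, by simp [Items.value]⟩
  obtain ⟨z, hz, hv⟩ := h
  refine ⟨z, hz, fun z' hz' => ?_⟩
  rw [hv]
  exact Nat.le_findGreatest (Items.value_le hz'.le) ⟨z', hz', rfl⟩

/-- The number of copies by which two solutions differ. -/
def Items.dist (I : Items) (z p : ℕ → ℕ) : ℕ := ∑ i ∈ range I.n, ((z i - p i) + (p i - z i))

/-- A copy that `z` has in addition to `p` belongs to an item not used up by `p`, so its value per
size is at most the threshold; a copy that `z` lacks is taken by `p`, so its value per size is at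
least the threshold. Exchanging sets of equal total size thus gives another optimal solution. It is
closer to `p` by the number of copies exchanged, which must be zero by the choice of `z`. -/
theorem IsGreedy.no_exchange {I : Items} {u p z : ℕ → ℕ} {cap : ℕ}
    (hp : IsGreedy I u I.n id cap p) (hz : I.Optimal u cap z)
    (hmin : ∀ z', I.Optimal u cap z' → I.dist z p ≤ I.dist z' p) {α β : ℕ → ℕ}
    (hα : ∀ i < I.n, α i ≤ z i - p i) (hβ : ∀ i < I.n, β i ≤ p i - z i)
    (hs : ∑ i ∈ range I.n, I.sz i * α i = ∑ i ∈ range I.n, I.sz i * β i) :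
    ∀ i < I.n, α i = 0 ∧ β i = 0 := by
  obtain ⟨P, Q, hQ, hthr⟩ := hp.thr
  have sum_swap : ∀ f : ℕ → ℕ, ∑ i ∈ range I.n, f i * (z i - α i + β i) +
      ∑ i ∈ range I.n, f i * α i = ∑ i ∈ range I.n, f i * z i + ∑ i ∈ range I.n, f i * β i := by
    intro f
    rw [← sum_add_distrib, ← sum_add_distrib]
    refine sum_congr rfl fun i hi => ?_
    rw [← mul_add, ← mul_add]
    congr 1
    have := hα i (mem_range.1 hi)
    omega
  have hval : ∑ i ∈ range I.n, I.v i * α i ≤ ∑ i ∈ range I.n, I.v i * β i := by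
    refine Nat.le_of_mul_le_mul_right ?_ hQ
    have h1 : (∑ i ∈ range I.n, I.v i * α i) * Q ≤ P * ∑ i ∈ range I.n, I.sz i * α i := by
      rw [sum_mul, mul_sum]
      refine sum_le_sum fun i hi => ?_
      rw [mem_range] at hi
      rcases Nat.eq_zero_or_pos (α i) with h | h
      · simp [h]
      · have h2 : I.v i * Q ≤ P * I.sz i := by
          by_contra! h3
          have := (hthr i hi).1 h3
          have := hz.le i hi
          have := hα i hi
          simp only [id] at *
          omega
        calc I.v i * α i * Q = I.v i * Q * α i := by ring
          _ ≤ P * I.sz i * α i := Nat.mul_le_mul_right _ h2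
          _ = _ := by ring
    have h2 : P * ∑ i ∈ range I.n, I.sz i * β i ≤ (∑ i ∈ range I.n, I.v i * β i) * Q := by
      rw [sum_mul, mul_sum]
      refine sum_le_sum fun i hi => ?_
      rw [mem_range] at hi
      rcases Nat.eq_zero_or_pos (β i) with h | h
      · simp [h]
      · have h2 : P * I.sz i ≤ I.v i * Q := by
          by_contra! h3
          have := (hthr i hi).2 h3
          have := hβ i hi
          simp only [id] at *
          omega
        calc P * (I.sz i * β i) = P * I.sz i * β i := by ring
          _ ≤ I.v i * Q * β i := Nat.mul_le_mul_right _ h2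
          _ = _ := by ring
    rw [hs] at h1
    exact h1.trans h2
  have hopt : I.Optimal u cap (fun i => z i - α i + β i) := by
    refine ⟨⟨fun i hi => ?_, ?_⟩, fun z' hz' => ?_⟩
    · have h1 := hp.le i hi
      have := hz.le i hi
      have := hβ i hi
      simp only [id] at h1
      omega
    · have := sum_swap I.sz
      have := hz.cap_le
      omega
    · have := sum_swap I.v
      have := hz.max z' hz'
      unfold Items.value at *
      beta_reduce
      omega
  have hd : I.dist (fun i => z i - α i + β i) p + ∑ i ∈ range I.n, (α i + β i) = I.dist z p := by
    unfold Items.dist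
    rw [← sum_add_distrib]
    refine sum_congr rfl fun i hi => ?_
    have := hα i (mem_range.1 hi)
    have := hβ i (mem_range.1 hi)
    beta_reduce
    omega
  have := hmin _ hopt
  have h0 : ∑ i ∈ range I.n, (α i + β i) = 0 := by omega
  rw [sum_eq_zero_iff] at h0
  intro i hi
  have := h0 i (mem_range.2 hi)
  omega

theorem sum_chain_step {n : ℕ} {f : ℕ → ℕ} {c c' : ℕ → ℕ} {i : ℕ} (hi : i < n)
    (h : ∀ x, c' x = c x + if x = i then 1 else 0) :
    ∑ x ∈ range n, f x * c' x = ∑ x ∈ range n, f x * c x + f i := by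
  simp [h, mul_add, sum_add_distrib, hi]

/-- A greedy solution is close to some optimal solution. -/
theorem IsGreedy.exists_optimal_close {I : Items} {u p : ℕ → ℕ} {cap s : ℕ}
    (hp : IsGreedy I u I.n id cap p) (hs : 0 < s) (hsz : ∀ i < I.n, I.sz i ≤ s) :
    ∃ z, I.Optimal u cap z ∧ ∑ i ∈ range I.n, (z i - p i) < s ∧
      ∑ i ∈ range I.n, (p i - z i) < s ∧ ((∀ i < I.n, p i = u i) → ∀ i < I.n, z i = p i) := by
  classical
  have hpf : I.Feasible u cap p := ⟨hp.le, hp.sum_le⟩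
  -- When everything fits, the unused capacity need not be below `s`, but `p` itself is optimal.
  by_cases hfull : ∀ i < I.n, p i = u i
  · exact ⟨p, ⟨hpf, fun z' hz' => Items.value_le fun i hi => (hz'.le i hi).trans (hfull i hi).ge⟩,
      by simpa using hs, by simpa using hs, fun _ _ _ => rfl⟩
  have hclose : ∃ k < I.n, cap < ∑ i ∈ range I.n, I.sz i * p i + I.sz k :=
    hp.full.resolve_left hfull
  obtain ⟨k0, hk0, hcap⟩ := hclose
  have hk0s := hsz k0 hk0
  -- Among the optimal solutions, one at minimal distance from `p`.
  obtain ⟨z, hz, hmin⟩ : ∃ z, I.Optimal u cap z ∧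
      ∀ z', I.Optimal u cap z' → I.dist z p ≤ I.dist z' p := by
    have hex : ∃ d z, I.Optimal u cap z ∧ I.dist z p = d :=
      let ⟨z, hz⟩ := I.exists_optimal u cap; ⟨_, z, hz, rfl⟩
    obtain ⟨z, hz, hd⟩ := Nat.find_spec hex
    exact ⟨z, hz, fun z' hz' => by rw [hd]; exact Nat.find_min' hex ⟨z', hz', rfl⟩⟩
  refine ⟨z, hz, ?_, ?_, fun h => absurd h hfull⟩ <;> by_contra! hge
  all_goals
    obtain ⟨c, c0, cA, cs⟩ := exists_unit_chain I.n _ (fun i => z i - p i) rfl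
    obtain ⟨b, b0, bR, bs⟩ := exists_unit_chain I.n _ (fun i => p i - z i) rfl
    set A := ∑ i ∈ range I.n, (z i - p i) with hAdef
    set R := ∑ i ∈ range I.n, (p i - z i) with hRdef
    have mono : ∀ {N : ℕ} {f : ℕ → ℕ → ℕ}, (∀ k < N, ∃ i < I.n, ∀ x, f (k + 1) x = f k x +
        if x = i then 1 else 0) → ∀ j ≤ N, ∀ i ≤ j, ∀ x, f i x ≤ f j x := by
      intro N f h j
      induction j with
      | zero => intro _ i hi x; rw [Nat.le_zero.1 hi]
      | succ j ih =>
        intro hj i hi x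
        rcases Nat.lt_or_eq_of_le hi with hi | rfl
        · obtain ⟨i', _, h'⟩ := h j (by omega)
          have := ih (by omega) i (by omega) x
          rw [h']; omega
        · exact le_rfl
    have hPA : ∀ {N : ℕ} {f : ℕ → ℕ → ℕ}, (∀ k < N, ∃ i < I.n, ∀ x, f (k + 1) x = f k x +
        if x = i then 1 else 0) → ∀ k < N,
        ∑ x ∈ range I.n, I.sz x * f k x ≤ ∑ x ∈ range I.n, I.sz x * f (k + 1) x ∧
        ∑ x ∈ range I.n, I.sz x * f (k + 1) x ≤ ∑ x ∈ range I.n, I.sz x * f k x + s := by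
      intro N f h k hk
      obtain ⟨i, hi, h'⟩ := h k hk
      rw [sum_chain_step hi h']
      have := hsz i hi
      omega
    -- Segments of the two sequences with the same total size would be a nontrivial exchange,
    -- against `IsGreedy.no_exchange`.
    have hstep : ∀ i i' j j', i ≤ i' → i' ≤ A → j ≤ j' → j' ≤ R → (i < i' ∨ j < j') →
        ∑ x ∈ range I.n, I.sz x * c i' x + ∑ x ∈ range I.n, I.sz x * b j x =
        ∑ x ∈ range I.n, I.sz x * c i x + ∑ x ∈ range I.n, I.sz x * b j' x → False := by
      intro i i' j j' h1 h2 h3 h4 h5 h6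
      have hc := mono cs i' h2 i h1
      have hb := mono bs j' h4 j h3
      have sub : ∀ f g : ℕ → ℕ, (∀ x, f x ≤ g x) → ∑ x ∈ range I.n, I.sz x * (g x - f x) +
          ∑ x ∈ range I.n, I.sz x * f x = ∑ x ∈ range I.n, I.sz x * g x := by
        intro f g h
        rw [← sum_add_distrib]
        refine sum_congr rfl fun x _ => ?_
        rw [← mul_add, Nat.sub_add_cancel (h x)]
      have e1 := sub _ _ hc
      have e2 := sub _ _ hb
      have h0 := hp.no_exchange hz hmin (α := fun x => c i' x - c i x)
        (β := fun x => b j' x - b j x) (fun x hx => by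
          have := mono cs A le_rfl i' h2 x
          rw [cA x hx] at this
          omega) (fun x hx => by
          have := mono bs R le_rfl j' h4 x
          rw [bR x hx] at this
          omega) (by omega)
      rcases h5 with h5 | h5
      · obtain ⟨q, hq, h'⟩ := cs i (by omega)
        have h7 := mono cs i' h2 (i + 1) h5 q
        rw [h', if_pos rfl] at h7
        have := (h0 q hq).1
        omega
      · obtain ⟨q, hq, h'⟩ := bs j (by omega)
        have h7 := mono bs j' h4 (j + 1) h5 q
        rw [h', if_pos rfl] at h7
        have := (h0 q hq).2
        omega
    have hbal : ∑ x ∈ range I.n, I.sz x * c A x + ∑ x ∈ range I.n, I.sz x * p x =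
        ∑ x ∈ range I.n, I.sz x * b R x + ∑ x ∈ range I.n, I.sz x * z x := by
      rw [← sum_add_distrib, ← sum_add_distrib]
      refine sum_congr rfl fun x hx => ?_
      rw [cA x (mem_range.1 hx), bR x (mem_range.1 hx), ← mul_add, ← mul_add]
      congr 1
      omega
    have hz1 := hz.cap_le
  -- Too many added copies: as `p` leaves less than `s` of the capacity unused, the added copies
  -- weigh less than the removed ones plus `s`.
  · obtain ⟨i, i', j, j', h1, h2, h3, h4, h5⟩ := exists_common_increment
      (PA := fun k => ∑ x ∈ range I.n, I.sz x * c k x)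
      (PR := fun k => ∑ x ∈ range I.n, I.sz x * b k x) (s := s) (A := A) (R := R)
      (by simp [b0]) (fun k hk => (hPA cs k hk).1) (fun k hk => (hPA bs k hk).2)
      (by omega) hge (fun k hk => (hPA bs k hk).1)
    exact hstep i i' j j' h1.le h2 h3 h4 (Or.inl h1) h5
  -- Too many removed copies: if they weighed at least `s` more than the added ones, one of them
  -- could be put back into `z` without exceeding the capacity, giving an optimal solution closer to
  -- `p`.
  · have hlt : ∑ x ∈ range I.n, I.sz x * b R x < ∑ x ∈ range I.n, I.sz x * c A x + s := by
      by_contra! hlt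
      obtain ⟨i, hi, hpi⟩ : ∃ i < I.n, 0 < p i - z i := by
        by_contra! h
        rw [sum_eq_zero fun i hi => Nat.le_zero.1 (h i (mem_range.1 hi))] at hRdef
        omega
      have hi' : ∀ x, z x + (if x = i then 1 else 0) = z x + if x = i then 1 else 0 := fun _ => rfl
      have hopt : I.Optimal u cap (fun x => z x + if x = i then 1 else 0) := by
        refine ⟨⟨fun x hx => ?_, ?_⟩, fun z' hz' => (hz.max z' hz').trans ?_⟩
        · have h1 := hz.le x hx
          have h2 := hp.le x hx
          simp only [id] at h2
          split
          · rename_i h; subst h; omega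
          · omega
        · rw [sum_chain_step hi hi']
          have := hsz i hi
          have := hpf.cap_le
          omega
        · unfold Items.value
          rw [sum_chain_step hi hi']
          omega
      have hd : I.dist (fun x => z x + if x = i then 1 else 0) p + 1 = I.dist z p := by
        unfold Items.dist
        rw [← add_sum_erase _ _ (mem_range.2 hi), ← add_sum_erase _ _ (mem_range.2 hi)]
        have : ∑ x ∈ (range I.n).erase i, ((z x + if x = i then 1 else 0) - p x +
            (p x - (z x + if x = i then 1 else 0))) =
            ∑ x ∈ (range I.n).erase i, (z x - p x + (p x - z x)) :=
          sum_congr rfl fun x hx => by rw [if_neg (mem_erase.1 hx).1, add_zero]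
        beta_reduce
        rw [this, if_pos rfl]
        omega
      have := hmin _ hopt
      omega
    obtain ⟨i, i', j, j', h1, h2, h3, h4, h5⟩ := exists_common_increment
      (PR := fun k => ∑ x ∈ range I.n, I.sz x * c k x)
      (PA := fun k => ∑ x ∈ range I.n, I.sz x * b k x) (s := s) (A := R) (R := A)
      (by simp [c0]) (fun k hk => (hPA bs k hk).1) (fun k hk => (hPA cs k hk).2)
      hlt hge (fun k hk => (hPA cs k hk).1)
    refine hstep j j' i i' h3 h4 h1.le h2 (Or.inr h1) ?_
    omega

end WordRAM


namespace WordRAM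

/-! ### Items of equal size -/

/-- The number of occurrences of `i` among `e 0, …, e (k - 1)`. -/
def copies (e : ℕ → ℕ) (k i : ℕ) : ℕ := ∑ x ∈ range k, if e x = i then 1 else 0

theorem copies_succ (e : ℕ → ℕ) (k i : ℕ) :
    copies e (k + 1) i = copies e k i + if e k = i then 1 else 0 := sum_range_succ _ _

theorem copies_mono (e : ℕ → ℕ) {k k' : ℕ} (h : k ≤ k') (i : ℕ) : copies e k i ≤ copies e k' i :=
  sum_le_sum_of_subset (range_subset_range.2 h)

theorem sum_mul_copies {m k : ℕ} {a e : ℕ → ℕ} (f : ℕ → ℕ)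
    (inj : ∀ x < m, ∀ x' < m, a x = a x' → x = x') (mem : ∀ x < k, ∃ x' < m, e x = a x') :
    ∑ q ∈ range m, f (a q) * copies e k (a q) = ∑ x ∈ range k, f (e x) := by
  simp only [copies, mul_sum]
  rw [sum_comm]
  refine sum_congr rfl fun x hx => ?_
  obtain ⟨x', hx', h⟩ := mem x (mem_range.1 hx)
  rw [sum_eq_single x']
  · simp [h]
  · intro b hb hne
    rw [if_neg fun h' => hne (inj _ (mem_range.1 hb) _ hx' (by rw [← h', h])), mul_zero]
  · intro h; exact absurd (mem_range.2 hx') h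

/-- For items of one size `j`, a capacity of `j * K` just counts copies, and a greedy solution that
stops early has less than `j` left. So the greedy algorithm selects the best `K` copies. -/
theorem IsGreedy.card_eq {I : Items} {mu : ℕ → ℕ} {m j K : ℕ} {a X : ℕ → ℕ} (hj : 0 < j)
    (h : IsGreedy I mu m a (j * K) X) (hsz : ∀ k < m, I.sz (a k) = j) :
    ∑ k ∈ range m, X (a k) = min K (∑ k ∈ range m, mu (a k)) := by
  have e : ∑ k ∈ range m, I.sz (a k) * X (a k) = j * ∑ k ∈ range m, X (a k) := by
    rw [mul_sum]
    exact sum_congr rfl fun k hk => by rw [hsz k (mem_range.1 hk)]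
  have h1 := h.sum_le
  rw [e] at h1
  have h2 := Nat.le_of_mul_le_mul_left h1 hj
  have h3 : ∑ k ∈ range m, X (a k) ≤ ∑ k ∈ range m, mu (a k) :=
    sum_le_sum fun k hk => h.le k (mem_range.1 hk)
  rcases h.full with h4 | ⟨k, hk, h4⟩
  · have h5 : ∑ k ∈ range m, X (a k) = ∑ k ∈ range m, mu (a k) :=
      sum_congr rfl fun k hk => h4 k (mem_range.1 hk)
    omega
  · rw [e, hsz k hk, ← Nat.mul_succ] at h4
    have := Nat.lt_of_mul_lt_mul_left h4
    omega

/-- Item by item, the signs of `q * v - p` and `w - z` agree or one of the two vanishes. The sum of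
the products is therefore nonnegative, and the terms with `p` cancel because both selections have
the same number of copies. -/
theorem threshold_max {m p q : ℕ} {v a u w z : ℕ → ℕ} (hq : 0 < q)
    (hthr : ∀ k < m, (p < v (a k) * q → w (a k) = u (a k)) ∧ (v (a k) * q < p → w (a k) = 0))
    (hz : ∀ k < m, z (a k) ≤ u (a k))
    (hs : ∑ k ∈ range m, z (a k) = ∑ k ∈ range m, w (a k)) :
    ∑ k ∈ range m, v (a k) * z (a k) ≤ ∑ k ∈ range m, v (a k) * w (a k) := by
  have key : ∑ k ∈ range m, (q * (v (a k) * z (a k)) + p * w (a k)) ≤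
      ∑ k ∈ range m, (q * (v (a k) * w (a k)) + p * z (a k)) := by
    refine sum_le_sum fun k hk => ?_
    rw [mem_range] at hk
    obtain ⟨h1, h2⟩ := hthr k hk
    have h3 := hz k hk
    rcases lt_trichotomy (w (a k)) (z (a k)) with h | h | h
    · have : v (a k) * q ≤ p := by
        by_contra! h'
        rw [h1 h'] at h
        omega
      obtain ⟨d, hd⟩ := Nat.exists_eq_add_of_lt h
      rw [hd]
      nlinarith [Nat.mul_le_mul_right (d + 1) this]
    · rw [h]
    · have : p ≤ v (a k) * q := by
        by_contra! h'
        rw [h2 h'] at h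
        omega
      obtain ⟨d, hd⟩ := Nat.exists_eq_add_of_lt h
      rw [hd]
      nlinarith [Nat.mul_le_mul_right (d + 1) this]
  rw [sum_add_distrib, sum_add_distrib, ← mul_sum, ← mul_sum, ← mul_sum, ← mul_sum, hs] at key
  exact Nat.le_of_mul_le_mul_left (by omega) hq

/-- The items `a 0, …, a (m - 1)` have size `j`; `y` takes the best `P - s` copies of them, and
`e 0, …, e (L - 1)` are the next best copies in order. -/
structure ClassData (I : Items) (u y : ℕ → ℕ) (s P j m : ℕ) (a : ℕ → ℕ) (L : ℕ) (e : ℕ → ℕ) :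
    Prop where
  inj : ∀ x < m, ∀ x' < m, a x = a x' → x = x'
  size : ∀ k < m, I.sz (a k) = j
  base : IsGreedy I u m a (j * (P - s)) y
  ex : ∃ X, IsGreedy I (fun i => u i - y i) m a (j * (2 * s)) X ∧
    ∀ k < m, X (a k) = copies e L (a k)
  mem : ∀ k < L, ∃ k' < m, e k = a k'
  anti : ∀ k k', k ≤ k' → k' < L → I.v (e k') ≤ I.v (e k)

namespace ClassData
variable {I : Items} {u y : ℕ → ℕ} {s P j m : ℕ} {a : ℕ → ℕ} {L : ℕ} {e : ℕ → ℕ}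

theorem sum_base (h : ClassData I u y s P j m a L e) (hj : 0 < j)
    (hP : P ≤ ∑ k ∈ range m, u (a k)) : ∑ k ∈ range m, y (a k) = P - s := by
  rw [h.base.card_eq hj h.size]; omega

theorem length_eq (h : ClassData I u y s P j m a L e) (hj : 0 < j)
    (hP : P ≤ ∑ k ∈ range m, u (a k)) : L = min (2 * s) (∑ k ∈ range m, u (a k) - (P - s)) := by
  obtain ⟨X, hX, hc⟩ := h.ex
  have h1 := hX.card_eq hj h.size
  have h2 := sum_mul_copies (fun _ => 1) h.inj h.mem
  simp only [one_mul, sum_const, card_range, smul_eq_mul, mul_one] at h2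
  rw [sum_congr rfl fun k hk => hc k (mem_range.1 hk), h2] at h1
  have h3 : ∑ k ∈ range m, (u (a k) - y (a k)) + ∑ k ∈ range m, y (a k) =
      ∑ k ∈ range m, u (a k) := by
    rw [← sum_add_distrib]
    exact sum_congr rfl fun k hk => Nat.sub_add_cancel (h.base.le k (mem_range.1 hk))
  rw [h.sum_base hj hP] at h3
  omega

theorem add_copies_le (h : ClassData I u y s P j m a L e) {k x : ℕ} (hk : k ≤ L) (hx : x < m) :
    y (a x) + copies e k (a x) ≤ u (a x) := by
  obtain ⟨X, hX, hc⟩ := h.ex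
  have h1 := hX.le x hx
  have h2 := h.base.le x hx
  have h3 := copies_mono e hk (a x)
  rw [hc x hx] at h1
  omega

/-- The base together with a prefix of the list is again a threshold selection, so `threshold_max`
applies. Only the threshold depends on the length of the prefix. -/
theorem value_le (h : ClassData I u y s P j m a L e) {k : ℕ} (hk : k ≤ L)
    {z : ℕ → ℕ} (hz : ∀ x < m, z (a x) ≤ u (a x))
    (hs : ∑ x ∈ range m, z (a x) = ∑ x ∈ range m, y (a x) + k) :
    ∑ x ∈ range m, I.v (a x) * z (a x) ≤
      ∑ x ∈ range m, I.v (a x) * y (a x) + ∑ x ∈ range k, I.v (e x) := by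
  obtain ⟨X, hX, hc⟩ := h.ex
  have hmem : ∀ x < k, ∃ x' < m, e x = a x' := fun x hx => h.mem x (by omega)
  have hcard : ∑ x ∈ range m, copies e k (a x) = k := by
    have := sum_mul_copies (fun _ => 1) h.inj hmem
    simpa using this
  rw [← sum_mul_copies I.v h.inj hmem, ← sum_add_distrib, sum_congr rfl fun x _ =>
    (mul_add (I.v (a x)) (y (a x)) (copies e k (a x))).symm]
  obtain ⟨p1, q1, hq1, t1⟩ := h.base.thr
  obtain ⟨p2, q2, hq2, t2⟩ := hX.thr
  -- the elements of the list lie between the two thresholds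
  have hel : ∀ x < L, ∃ x' < m, e x = a x' ∧ p2 * j ≤ I.v (a x') * q2 ∧
      I.v (a x') * q1 ≤ p1 * j := by
    intro x hx
    obtain ⟨x', hx', hex⟩ := h.mem x hx
    have hpos : 0 < copies e L (a x') := by
      have h1 := copies_mono e (Nat.succ_le_of_lt hx) (a x')
      rw [Nat.succ_eq_add_one, copies_succ, if_pos hex] at h1
      omega
    rw [← hc x' hx'] at hpos
    obtain ⟨b1, b2⟩ := t1 x' hx'
    obtain ⟨b3, b4⟩ := t2 x' hx'
    rw [h.size x' hx'] at b1 b2 b3 b4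
    have hle := hX.le x' hx'
    refine ⟨x', hx', hex, ?_, ?_⟩ <;> by_contra! hlt
    · have := b4 hlt; omega
    · have := b1 hlt; omega
  suffices hthr : ∃ p q, 0 < q ∧ ∀ x < m,
      (p < I.v (a x) * q → y (a x) + copies e k (a x) = u (a x)) ∧
      (I.v (a x) * q < p → y (a x) + copies e k (a x) = 0) by
    obtain ⟨p, q, hq, hthr⟩ := hthr
    exact threshold_max (w := fun i => y i + copies e k i) hq hthr hz
      (by rw [hs, sum_add_distrib, hcard])
  rcases Nat.eq_zero_or_pos L with hL | hL
  · obtain rfl : k = 0 := by omega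
    refine ⟨p1 * j, q1, hq1, fun x hx => ?_⟩
    have := t1 x hx
    rw [h.size x hx] at this
    simpa [copies] using this
  rcases Nat.lt_or_ge k L with hkL | hkL
  -- The threshold is the value of the first listed copy that is left out.
  · obtain ⟨x0, hx0, he, c1, c2⟩ := hel k hkL
    refine ⟨I.v (a x0), 1, one_pos, fun x hx => ⟨fun hlt => ?_, fun hlt => ?_⟩⟩ <;>
      rw [mul_one] at hlt <;> obtain ⟨b1, b2⟩ := t1 x hx <;> obtain ⟨b3, b4⟩ := t2 x hx <;>
      rw [h.size x hx] at b1 b2 b3 b4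
    · have hfull := b3 (c1.trans_lt (Nat.mul_lt_mul_of_pos_right hlt hq2))
      rw [hc x hx] at hfull
      have hall : copies e L (a x) = copies e k (a x) := by
        refine (sum_subset (range_subset_range.2 hkL.le) fun q hq hq' => ?_).symm
        rw [mem_range] at hq hq'
        refine if_neg fun hex => ?_
        have := h.anti k q (by omega) hq
        rw [hex, he] at this
        omega
      have := h.base.le x hx
      omega
    · have h0 := b2 ((Nat.mul_lt_mul_of_pos_right hlt hq1).trans_le c2)
      have : copies e k (a x) = 0 := by
        refine sum_eq_zero fun q hq => ?_
        rw [mem_range] at hq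
        refine if_neg fun hex => ?_
        have := h.anti q k hq.le hkL
        rw [hex, he] at this
        omega
      omega
  -- The whole list is taken, so the threshold is that of the second greedy solution. Comparison
  -- with the first listed copy shows that items below it are also below the threshold of the base.
  · obtain rfl : k = L := by omega
    obtain ⟨x0, hx0, he, c1, c2⟩ := hel 0 hL
    refine ⟨p2 * j, q2, hq2, fun x hx => ⟨fun hlt => ?_, fun hlt => ?_⟩⟩ <;>
      obtain ⟨b1, b2⟩ := t1 x hx <;> obtain ⟨b3, b4⟩ := t2 x hx <;>
      rw [h.size x hx] at b1 b2 b3 b4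
    · have := b3 hlt
      rw [hc x hx] at this
      have := h.base.le x hx
      omega
    · have h0 := b4 hlt
      rw [hc x hx] at h0
      have hlt' : I.v (a x) < I.v (a x0) := by
        by_contra! hge
        have := Nat.mul_le_mul_right q2 hge
        omega
      have := b2 ((Nat.mul_lt_mul_of_pos_right hlt' hq1).trans_le c2)
      omega

end ClassData

end WordRAM


namespace WordRAM

/-! ### The dynamic program over the item sizes -/

/-- The value of the first copies of the list `e`, with a penalty for leaving the list. -/
def gain (v e : ℕ → ℕ) (pen Q r L : ℕ) : ℕ → ℕ
  -- There are at most `2 * Q` steps and none loses more than `pen`, so with this initial value the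
  -- truncated subtraction below is exact.
  | 0 => 2 * Q * pen
  | z + 1 =>
    if z + r < Q then gain v e pen Q r L z + pen
    else if z + r - Q < L then gain v e pen Q r L z + v (e (z + r - Q))
    else gain v e pen Q r L z - pen

section gain
variable {v e : ℕ → ℕ} {pen Q r L : ℕ}

/-- The index `z` stands for `z - Q` copies more than the greedy solution, that is, for `z + r - Q`
copies beyond the base. Up to a constant, the gain is the value of these copies minus `pen` for
every copy by which the number falls below `0` or exceeds `L`. -/
theorem gain_add (hr : r ≤ Q) : ∀ z ≤ 2 * Q,
    gain v e pen Q r L z + pen * ((Q - r - z) + (z + r - Q - L)) =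
      2 * Q * pen + (Q - r) * pen + ∑ x ∈ range (min (z + r - Q) L), v (e x) := by
  intro z
  induction z with
  | zero =>
    intro _
    have h1 : r - Q = 0 := by omega
    simp [gain, h1, mul_comm]
  | succ z ih =>
    intro hz
    have ih := ih (by omega)
    rw [gain]
    split_ifs with h1 h2
    · have e1 : Q - r - z = (Q - r - (z + 1)) + 1 := by omega
      have e2 : z + r - Q = 0 := by omega
      have e3 : z + 1 + r - Q = 0 := by omega
      rw [e2, e1] at ih
      rw [e3]
      simp only [Nat.zero_sub, add_zero, mul_add, mul_one] at ih ⊢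
      omega
    · have e1 : z + 1 + r - Q = z + r - Q + 1 := by omega
      have e2 : min (z + r - Q + 1) L = z + r - Q + 1 := by omega
      have e3 : min (z + r - Q) L = z + r - Q := by omega
      have e4 : Q - r - z = 0 := by omega
      have e5 : Q - r - (z + 1) = 0 := by omega
      have e6 : z + r - Q - L = 0 := by omega
      have e7 : z + r - Q + 1 - L = 0 := by omega
      rw [e3, e4, e6] at ih
      rw [e1, e2, e5, e7, sum_range_succ]
      omega
    · have e1 : z + 1 + r - Q - L = z + r - Q - L + 1 := by omega
      have e2 : min (z + 1 + r - Q) L = min (z + r - Q) L := by omega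
      have e4 : Q - r - z = 0 := by omega
      have e5 : Q - r - (z + 1) = 0 := by omega
      rw [e4, zero_add] at ih
      rw [e1, e2, e5, zero_add, mul_add, mul_one]
      have h3 : pen * (z + r - Q - L) + pen ≤ 2 * Q * pen := by
        rw [← Nat.mul_succ, mul_comm]
        exact Nat.mul_le_mul_right _ (by omega)
      omega

theorem gain_le (hr : r ≤ Q) {z : ℕ} (hz : z ≤ 2 * Q) :
    gain v e pen Q r L z ≤ 3 * Q * pen + ∑ x ∈ range L, v (e x) := by
  have h := gain_add (v := v) (e := e) (pen := pen) (L := L) hr z hz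
  have h1 : (Q - r) * pen ≤ Q * pen := Nat.mul_le_mul_right _ (by omega)
  have h2 : ∑ x ∈ range (min (z + r - Q) L), v (e x) ≤ ∑ x ∈ range L, v (e x) :=
    sum_le_sum_of_subset (range_subset_range.2 (by omega))
  have h3 : 3 * Q * pen = 2 * Q * pen + Q * pen := by ring
  omega

theorem gain_pen_le (hr : r ≤ Q) {z : ℕ} (hz : z + 1 ≤ 2 * Q) (hQ : Q ≤ z + r) :
    pen ≤ gain v e pen Q r L z := by
  have h1 := gain_add (v := v) (e := e) (pen := pen) (L := L) hr z (by omega)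
  have h3 : pen * ((Q - r - z) + (z + r - Q - L)) + pen ≤ 2 * Q * pen := by
    rw [← Nat.mul_succ, mul_comm]
    exact Nat.mul_le_mul_right _ (by omega)
  omega

/-- The increments of the gain are `pen`, then the values along the list, which decrease and are at
most `pen`, then `-pen`. So they never increase. -/
theorem gain_step (hr : r ≤ Q) (hpen : ∀ x < L, v (e x) ≤ pen)
    (hanti : ∀ k k', k ≤ k' → k' < L → v (e k') ≤ v (e k)) {z z' : ℕ} (h : z ≤ z')
    (hz : z' + 1 ≤ 2 * Q) :
    gain v e pen Q r L z + gain v e pen Q r L (z' + 1) ≤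
      gain v e pen Q r L (z + 1) + gain v e pen Q r L z' := by
  rw [gain, gain]
  split_ifs with h1 h2 h3 h4 h5 h6 h7 h8
  all_goals first
    | omega
    | (have := hpen (z + r - Q) (by omega); omega)
    | (have := hpen (z' + r - Q) (by omega); omega)
    | (have := hanti (z + r - Q) (z' + r - Q) (by omega) (by omega); omega)
    | (have := gain_pen_le (v := v) (e := e) (pen := pen) (L := L) hr (z := z) (by omega)
        (by omega)
       have := gain_pen_le (v := v) (e := e) (pen := pen) (L := L) hr (z := z') (by omega)
        (by omega)
       omega)

theorem gain_concave (hr : r ≤ Q) (hpen : ∀ x < L, v (e x) ≤ pen)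
    (hanti : ∀ k k', k ≤ k' → k' < L → v (e k') ≤ v (e k)) {z z' : ℕ} (h : z ≤ z') (d : ℕ)
    (hz : z' + d ≤ 2 * Q) :
    gain v e pen Q r L z + gain v e pen Q r L (z' + d) ≤
      gain v e pen Q r L (z + d) + gain v e pen Q r L z' := by
  induction d with
  | zero => exact le_rfl
  | succ d ih =>
    have h1 := ih (by omega)
    have h2 := gain_step (v := v) hr hpen hanti (z := z + d) (z' := z' + d) (by omega) (by omega)
    simp only [← add_assoc] at h2 ⊢
    omega

end gain

/-- The classes of the items of size `1, …, s` with their data; `p` is a solution. -/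
structure ClassFamily (I : Items) (u y : ℕ → ℕ) (s : ℕ) (p : ℕ → ℕ) (m : ℕ → ℕ) (a : ℕ → ℕ → ℕ)
    (L : ℕ → ℕ) (e : ℕ → ℕ → ℕ) : Prop where
  size_pos : ∀ i < I.n, 0 < I.sz i
  size_le : ∀ i < I.n, I.sz i ≤ s
  filter : ∀ j < s, IsFilter (fun i => I.sz i = j + 1) I.n id (m (j + 1)) (a (j + 1))
  data : ∀ j < s, ClassData I u y s (∑ k ∈ range (m (j + 1)), p (a (j + 1) k)) (j + 1)
    (m (j + 1)) (a (j + 1)) (L (j + 1)) (e (j + 1))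

theorem ClassFamily.sum_classes {I : Items} {u y : ℕ → ℕ} {s : ℕ} {p : ℕ → ℕ} {m : ℕ → ℕ}
    {a : ℕ → ℕ → ℕ} {L : ℕ → ℕ} {e : ℕ → ℕ → ℕ} (h : ClassFamily I u y s p m a L e) (f : ℕ → ℕ) :
    ∑ j ∈ range s, ∑ k ∈ range (m (j + 1)), f (a (j + 1) k) = ∑ i ∈ range I.n, f i := by
  rw [sum_congr rfl fun j hj => (h.filter j (mem_range.1 hj)).sum f, sum_comm]
  refine sum_congr rfl fun i hi => ?_
  have h1 := h.size_pos i (mem_range.1 hi)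
  have h2 := h.size_le i (mem_range.1 hi)
  rw [sum_eq_single (I.sz i - 1)]
  · rw [if_pos]; · rfl
    simp only [id]; omega
  · intro j _ hne
    rw [if_neg]; simp only [id]; omega
  · intro h'; exact absurd (mem_range.2 (by omega)) h'

theorem ClassFamily.sum_classes_size {I : Items} {u y : ℕ → ℕ} {s : ℕ} {p : ℕ → ℕ} {m : ℕ → ℕ}
    {a : ℕ → ℕ → ℕ} {L : ℕ → ℕ} {e : ℕ → ℕ → ℕ} (h : ClassFamily I u y s p m a L e) (f : ℕ → ℕ) :
    ∑ j ∈ range s, (j + 1) * ∑ k ∈ range (m (j + 1)), f (a (j + 1) k) =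
      ∑ i ∈ range I.n, I.sz i * f i := by
  rw [← h.sum_classes fun i => I.sz i * f i]
  refine sum_congr rfl fun j hj => ?_
  rw [mul_sum]
  refine sum_congr rfl fun k hk => ?_
  rw [(h.data j (mem_range.1 hj)).size k (mem_range.1 hk)]

/-- The tables of the dynamic program: `F j x` is optimal, `H j x` is the choice. -/
structure DPTable (s pen : ℕ) (G : ℕ → ℕ → ℕ) (F H : ℕ → ℕ → ℕ) : Prop where
  zero : ∀ x ≤ 2 * (s * s), F 0 x = if s * s ≤ x then pen else 0
  choice_le : ∀ j < s, ∀ x ≤ 2 * (s * s),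
    x % (j + 1) + (j + 1) * H (j + 1) x ≤ 2 * (s * s)
  -- A step for size `j + 1` keeps the residue of the state. It uses `x / (j + 1) - b` copies more
  -- than the greedy solution; the shift in the argument of `G` makes this difference a natural
  -- number.
  eq : ∀ j < s, ∀ x ≤ 2 * (s * s), F (j + 1) x = F j (x % (j + 1) + (j + 1) * H (j + 1) x) +
    G (j + 1) (x / (j + 1) + (2 * (s * s) / (j + 1) + 1) - H (j + 1) x)
  le : ∀ j < s, ∀ x ≤ 2 * (s * s), ∀ b, x % (j + 1) + (j + 1) * b ≤ 2 * (s * s) →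
    F j (x % (j + 1) + (j + 1) * b) +
      G (j + 1) (x / (j + 1) + (2 * (s * s) / (j + 1) + 1) - b) ≤ F (j + 1) x

/-- The states are shifted by `s * s`, so the bonus at `x 0` rewards paths whose free capacity is
nonnegative in the end. -/
def pathVal (s pen : ℕ) (G : ℕ → ℕ → ℕ) (x : ℕ → ℕ) (j : ℕ) : ℕ :=
  (if s * s ≤ x 0 then pen else 0) +
    ∑ i ∈ range j, G (i + 1) (x (i + 1) / (i + 1) + (2 * (s * s) / (i + 1) + 1) - x i / (i + 1))

/-- The table dominates every path inside the window whose steps keep the respective residues. -/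
theorem DPTable.pathVal_le {s pen : ℕ} {G F H : ℕ → ℕ → ℕ} (h : DPTable s pen G F H) {x : ℕ → ℕ}
    (hx : ∀ j ≤ s, x j ≤ 2 * (s * s)) (hm : ∀ j < s, x (j + 1) % (j + 1) = x j % (j + 1)) :
    ∀ j ≤ s, pathVal s pen G x j ≤ F j (x j) := by
  intro j
  induction j with
  | zero => intro _; simp [pathVal, h.zero _ (hx 0 (Nat.zero_le _))]
  | succ j ih =>
    intro hj
    have h1 := ih (by omega)
    have h2 := h.le j hj (x (j + 1)) (hx _ hj) (x j / (j + 1)) (by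
      rw [hm j hj, Nat.mod_add_div]; exact hx j (by omega))
    rw [hm j hj, Nat.mod_add_div] at h2
    unfold pathVal at h1 ⊢
    rw [sum_range_succ]
    omega

/-- A path that follows the recorded choices attains the table entries; it is determined downwards
from its last state, hence the induction on the distance from `s`. -/
theorem DPTable.pathVal_eq {s pen : ℕ} {G F H : ℕ → ℕ → ℕ} (h : DPTable s pen G F H) {x : ℕ → ℕ}
    (hxs : x s ≤ 2 * (s * s))
    (hm : ∀ j < s, x j = x (j + 1) % (j + 1) + (j + 1) * H (j + 1) (x (j + 1))) :
    (∀ j ≤ s, x j ≤ 2 * (s * s)) ∧ ∀ j ≤ s, pathVal s pen G x j = F j (x j) := by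
  have hx : ∀ d ≤ s, x (s - d) ≤ 2 * (s * s) := by
    intro d
    induction d with
    | zero => intro _; exact hxs
    | succ d ih =>
      intro hd
      have h1 := ih (by omega)
      have h2 := hm (s - (d + 1)) (by omega)
      rw [show s - (d + 1) + 1 = s - d by omega] at h2
      rw [h2]
      have := h.choice_le (s - (d + 1)) (by omega) _ h1
      rwa [show s - (d + 1) + 1 = s - d by omega] at this
  have hx : ∀ j ≤ s, x j ≤ 2 * (s * s) := fun j hj => by
    have := hx (s - j) (by omega)
    rwa [show s - (s - j) = j by omega] at this
  refine ⟨hx, fun j => ?_⟩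
  induction j with
  | zero => intro _; simp [pathVal, h.zero _ (hx 0 (Nat.zero_le _))]
  | succ j ih =>
    intro hj
    have h1 := ih (by omega)
    have h2 := h.eq j hj (x (j + 1)) (hx _ hj)
    have h3 := hm j hj
    have h4 : x j / (j + 1) = H (j + 1) (x (j + 1)) := by
      rw [h3, Nat.add_mul_div_left _ _ (Nat.succ_pos j),
        Nat.div_eq_of_lt (Nat.mod_lt _ (Nat.succ_pos j)), zero_add]
    rw [← h3, ← h1] at h2
    rw [h2]
    unfold pathVal
    rw [sum_range_succ, h4]
    omega

end WordRAM


/-! ### Optimality of the dynamic program -/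

namespace WordRAM

/-- The number of items of `p` in the class of size `j`. -/
def classSum (m : ℕ → ℕ) (a : ℕ → ℕ → ℕ) (p : ℕ → ℕ) (j : ℕ) : ℕ := ∑ k ∈ range (m j), p (a j k)

namespace ClassFamily
variable {I : Items} {u y : ℕ → ℕ} {s : ℕ} {p : ℕ → ℕ} {m : ℕ → ℕ} {a : ℕ → ℕ → ℕ} {L : ℕ → ℕ}
  {e : ℕ → ℕ → ℕ} {G F H : ℕ → ℕ → ℕ}

theorem lt_n (h : ClassFamily I u y s p m a L e) {j : ℕ} (hj : j < s) {q : ℕ}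
    (hq : q < m (j + 1)) : a (j + 1) q < I.n := by
  obtain ⟨_, q', hk', h'⟩ := (h.filter j hj).mem q hq
  rw [h']; exact hk'

theorem classSum_le (h : ClassFamily I u y s p m a L e) {w : ℕ → ℕ}
    (hw : ∀ i < I.n, w i ≤ u i) {j : ℕ} (hj : j < s) :
    classSum m a w (j + 1) ≤ classSum m a u (j + 1) :=
  sum_le_sum fun _ hk => hw _ (h.lt_n hj (mem_range.1 hk))

theorem length_eq (h : ClassFamily I u y s p m a L e) (hp : ∀ i < I.n, p i ≤ u i) {j : ℕ}
    (hj : j < s) : L (j + 1) = min (2 * s) (classSum m a u (j + 1) - (classSum m a p (j + 1) - s)) :=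
  (h.data j hj).length_eq (Nat.succ_pos j) (h.classSum_le hp hj)

theorem classSum_base (h : ClassFamily I u y s p m a L e) (hp : ∀ i < I.n, p i ≤ u i) {j : ℕ}
    (hj : j < s) : classSum m a y (j + 1) = classSum m a p (j + 1) - s :=
  (h.data j hj).sum_base (Nat.succ_pos j) (h.classSum_le hp hj)

/-- Sums over the sizes above `j` of two close solutions are close. -/
theorem tail_le (h : ClassFamily I u y s p m a L e) (w z : ℕ → ℕ) {j : ℕ} (hj : j ≤ s) :
    ∑ i ∈ Ico j s, (i + 1) * classSum m a w (i + 1) ≤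
      ∑ i ∈ Ico j s, (i + 1) * classSum m a z (i + 1) +
        s * ∑ i ∈ range I.n, (w i - z i) := by
  have h1 : ∑ i ∈ Ico j s, classSum m a (fun i => w i - z i) (i + 1) ≤
      ∑ i ∈ range I.n, (w i - z i) := by
    rw [← h.sum_classes fun i => w i - z i, ← sum_range_add_sum_Ico _ hj]
    exact Nat.le_add_left _ _
  refine le_trans ?_ (Nat.add_le_add_left (Nat.mul_le_mul_left s h1) _)
  rw [mul_sum, ← sum_add_distrib]
  refine sum_le_sum fun i hi => ?_
  rw [mem_Ico] at hi
  have h2 : classSum m a w (i + 1) ≤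
      classSum m a z (i + 1) + classSum m a (fun i => w i - z i) (i + 1) := by
    unfold classSum
    rw [← sum_add_distrib]
    exact sum_le_sum fun k _ => by beta_reduce; omega
  calc (i + 1) * classSum m a w (i + 1)
      ≤ (i + 1) * classSum m a z (i + 1) +
        (i + 1) * classSum m a (fun i => w i - z i) (i + 1) := by
        rw [← mul_add]; exact Nat.mul_le_mul_left _ h2
    _ ≤ _ := Nat.add_le_add_left (Nat.mul_le_mul_right _ (by omega)) _

/-- The path of a solution close to the greedy solution. -/
theorem exists_path (h : ClassFamily I u y s p m a L e) {cap : ℕ} {z : ℕ → ℕ}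
    (hz : ∑ i ∈ range I.n, I.sz i * z i ≤ cap) (hs : 0 < s)
    (hadd : ∑ i ∈ range I.n, (z i - p i) < s) (hrem : ∑ i ∈ range I.n, (p i - z i) < s)
    {D : ℕ} (hD : D + ∑ i ∈ range I.n, I.sz i * p i = cap)
    (hfull : (∀ i < I.n, z i = p i) ∨ D < s) :
    ∃ x : ℕ → ℕ, x s = s * s + min D (s * s) ∧ s * s ≤ x 0 ∧ (∀ j ≤ s, x j ≤ 2 * (s * s)) ∧
      ∀ j < s, x (j + 1) + (j + 1) * classSum m a p (j + 1) =
        x j + (j + 1) * classSum m a z (j + 1) := by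
  set T : (ℕ → ℕ) → ℕ → ℕ := fun w j => ∑ i ∈ Ico j s, (i + 1) * classSum m a w (i + 1) with hT
  have hss : s * (s - 1) + s = s * s := by
    obtain ⟨q, rfl⟩ : ∃ q, s = q + 1 := ⟨s - 1, by omega⟩
    simp only [Nat.add_sub_cancel]; ring
  have e1 : ∀ j ≤ s, T z j ≤ T p j + s * (s - 1) := fun j hj =>
    (h.tail_le z p hj).trans (Nat.add_le_add_left (Nat.mul_le_mul_left s (by omega)) _)
  have e2 : ∀ j ≤ s, T p j ≤ T z j + s * (s - 1) := fun j hj =>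
    (h.tail_le p z hj).trans (Nat.add_le_add_left (Nat.mul_le_mul_left s (by omega)) _)
  have e3 : ∀ w, T w 0 = ∑ i ∈ range I.n, I.sz i * w i := fun w => by
    rw [← h.sum_classes_size w, hT]; simp [classSum]
  have e4 : ∀ w, T w s = 0 := fun w => by simp [hT]
  have e5 : (∀ i < I.n, z i = p i) → ∀ j ≤ s, T z j = T p j := by
    intro hzp j _
    refine sum_congr rfl fun i hi => ?_
    congr 1
    exact sum_congr rfl fun k hk => hzp _ (h.lt_n (mem_Ico.1 hi).2 (mem_range.1 hk))
  -- Shifted by `s * s`, the state is the free capacity when sizes above `j` are packed as in `z`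
  -- and the others as in `p`. Fewer than `s` copies of size at most `s` change in either direction,
  -- so it stays in the window. Truncating `D` is harmless, because `D` reaches `s` only if `z` and
  -- `p` coincide.
  refine ⟨fun j => s * s + min D (s * s) + T p j - T z j, by simp [e4], ?_, fun j hj => ?_,
    fun j hj => ?_⟩
  · rw [← e3] at hz hD
    have := e1 0 (Nat.zero_le _)
    have h2 := e2 0 (Nat.zero_le _)
    beta_reduce
    omega
  · have := e1 j hj
    have h2 := e2 j hj
    beta_reduce
    rcases hfull with hf | hf
    · rw [e5 hf j hj]; omega
    · omega
  · have hstep : ∀ w, T w j = (j + 1) * classSum m a w (j + 1) + T w (j + 1) := fun w => by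
      rw [hT]; exact sum_eq_sum_Ico_succ_bot hj _
    have := e1 j hj.le
    have h2 := e1 (j + 1) hj
    have h3 := hstep z
    have h4 := hstep p
    beta_reduce
    omega

/-- The dynamic program finds an optimal solution. -/
theorem optimal (h : ClassFamily I u y s p m a L e) {cap pen : ℕ} (hs : 0 < s)
    (hp : IsGreedy I u I.n id cap p) (hpen : pen = I.value u + 1) {D : ℕ}
    (hD : D + ∑ i ∈ range I.n, I.sz i * p i = cap)
    (hG : ∀ j < s, ∀ z ≤ 2 * (2 * (s * s) / (j + 1) + 1), G (j + 1) z =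
      gain I.v (e (j + 1)) pen (2 * (s * s) / (j + 1) + 1) (min (classSum m a p (j + 1)) s)
        (L (j + 1)) z)
    (hT : DPTable s pen G F H) {x : ℕ → ℕ} (hxs : x s = s * s + min D (s * s))
    (hx : ∀ j < s, x j = x (j + 1) % (j + 1) + (j + 1) * H (j + 1) (x (j + 1))) {K : ℕ → ℕ}
    (hK : ∀ j < s, K (j + 1) = x (j + 1) / (j + 1) + min (classSum m a p (j + 1)) s -
      H (j + 1) (x (j + 1))) :
    (∀ j < s, H (j + 1) (x (j + 1)) ≤ x (j + 1) / (j + 1) + min (classSum m a p (j + 1)) s ∧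
      K (j + 1) ≤ L (j + 1)) ∧
    I.Optimal u cap (fun i => y i + copies (e (I.sz i)) (K (I.sz i)) i) := by
  set P := classSum m a p with hP
  set r : ℕ → ℕ := fun j => min (P j) s with hr
  set Q : ℕ → ℕ := fun j => 2 * (s * s) / j + 1 with hQ
  have hrQ : ∀ j < s, r (j + 1) ≤ Q (j + 1) := by
    intro j hj
    have h1 : s ≤ 2 * (s * s) / (j + 1) := by
      rw [Nat.le_div_iff_mul_le (Nat.succ_pos j)]
      calc s * (j + 1) ≤ s * s := Nat.mul_le_mul_left _ hj
        _ ≤ _ := by omega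
    simp only [hr, hQ]
    omega
  -- the value of a path
  set zz : (ℕ → ℕ) → ℕ → ℕ := fun x j => x (j + 1) / (j + 1) + Q (j + 1) - x j / (j + 1) with hzz
  set val : (ℕ → ℕ) → ℕ → ℕ := fun x j =>
    ∑ k ∈ range (min (zz x j + r (j + 1) - Q (j + 1)) (L (j + 1))), I.v (e (j + 1) k) with hval
  set viol : (ℕ → ℕ) → ℕ → ℕ := fun x j =>
    (Q (j + 1) - r (j + 1) - zz x j) + (zz x j + r (j + 1) - Q (j + 1) - L (j + 1)) with hviol
  set base := ∑ j ∈ range s, (2 * Q (j + 1) * pen + (Q (j + 1) - r (j + 1)) * pen) with hbase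
  -- Bookkeeping for any path: its value equals a constant plus the value of the listed copies used,
  -- plus the bonus for the capacity, minus `pen` for every violation.
  have hpath : ∀ x : ℕ → ℕ, (∀ j ≤ s, x j ≤ 2 * (s * s)) →
      pathVal s pen G x s + pen * ∑ j ∈ range s, viol x j =
        (if s * s ≤ x 0 then pen else 0) + base + ∑ j ∈ range s, val x j := by
    intro x hx
    unfold pathVal
    rw [add_assoc, add_assoc, hbase, mul_sum, ← sum_add_distrib, ← sum_add_distrib]
    congr 1
    refine sum_congr rfl fun j hj => ?_
    rw [mem_range] at hj
    have hz2 : zz x j ≤ 2 * Q (j + 1) := by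
      have : x (j + 1) / (j + 1) ≤ 2 * (s * s) / (j + 1) := Nat.div_le_div_right (hx _ hj)
      simp only [hzz, hQ]
      generalize x (j + 1) / (j + 1) = q₁ at this ⊢
      generalize 2 * (s * s) / (j + 1) = q₂ at this ⊢
      generalize x j / (j + 1) = q₃
      omega
    have h1 := gain_add (v := I.v) (e := e (j + 1)) (pen := pen) (L := L (j + 1)) (hrQ j hj) _ hz2
    rw [← hG j hj _ hz2] at h1
    exact h1
  -- Listed copies are distinct copies within the multiplicities `u`, so together they are worth
  -- less than `pen`.
  have hvalu : ∀ K : ℕ → ℕ, (∀ j < s, K j ≤ L (j + 1)) →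
      ∑ j ∈ range s, ∑ k ∈ range (K j), I.v (e (j + 1) k) ≤ I.value u := by
    intro K hK
    rw [Items.value, ← h.sum_classes fun i => I.v i * u i]
    refine sum_le_sum fun j hj => ?_
    rw [mem_range] at hj
    rw [← sum_mul_copies I.v (h.data j hj).inj fun x hx =>
      (h.data j hj).mem x (hx.trans_le (hK j hj))]
    refine sum_le_sum fun k hk => Nat.mul_le_mul_left _ ?_
    have := (h.data j hj).add_copies_le (hK j hj) (mem_range.1 hk)
    omega
  -- an optimal solution close to the greedy one
  obtain ⟨z, hz, hz1, hz2, hz3⟩ := hp.exists_optimal_close hs h.size_le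
  have hfull : (∀ i < I.n, z i = p i) ∨ D < s := by
    rcases hp.full with hf | ⟨k, hk, hf⟩
    · exact Or.inl (hz3 hf)
    · right
      have := h.size_le k hk
      simp only [id] at *
      omega
  obtain ⟨x', hx's, hx'0, hx'2, hx'⟩ := h.exists_path hz.cap_le hs hz1 hz2 hD hfull
  -- The distance bounds hold for the total over all sizes, hence in each class.
  have hPZ : ∀ j < s, P (j + 1) ≤ classSum m a z (j + 1) + s ∧
      classSum m a z (j + 1) ≤ P (j + 1) + s := by
    have key : ∀ w w' : ℕ → ℕ, ∑ i ∈ range I.n, (w i - w' i) < s → ∀ j < s,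
        classSum m a w (j + 1) ≤ classSum m a w' (j + 1) + s := by
      intro w w' hww j hj
      have h1 : classSum m a (fun i => w i - w' i) (j + 1) ≤ ∑ i ∈ range I.n, (w i - w' i) := by
        rw [← h.sum_classes fun i => w i - w' i]
        exact single_le_sum (f := fun j => classSum m a (fun i => w i - w' i) (j + 1))
          (fun _ _ => Nat.zero_le _) (mem_range.2 hj)
      have h2 : classSum m a w (j + 1) ≤
          classSum m a w' (j + 1) + classSum m a (fun i => w i - w' i) (j + 1) := by
        unfold classSum
        rw [← sum_add_distrib]
        exact sum_le_sum fun k _ => by beta_reduce; omega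
      omega
    exact fun j hj => ⟨key p z hz2 j hj, key z p hz1 j hj⟩
  have hpu : ∀ i < I.n, p i ≤ u i := hp.le
  have hk' : ∀ j < s, zz x' j + P (j + 1) = Q (j + 1) + classSum m a z (j + 1) := by
    intro j hj
    have h1 := congrArg (· / (j + 1)) (hx' j hj)
    simp only [Nat.add_mul_div_left _ _ (Nat.succ_pos j)] at h1
    have h2 : x' j / (j + 1) ≤ 2 * (s * s) / (j + 1) := Nat.div_le_div_right (hx'2 j hj.le)
    have hPj : P (j + 1) = classSum m a p (j + 1) := rfl
    simp only [hzz, hQ]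
    generalize x' (j + 1) / (j + 1) = q₁ at h1 ⊢
    generalize x' j / (j + 1) = q₂ at h1 h2 ⊢
    generalize 2 * (s * s) / (j + 1) = q₃ at h2 ⊢
    omega
  -- In every class the close solution `z` lies between the base and the end of the list, so its
  -- path has no violation.
  have hviol' : ∀ j < s, viol x' j = 0 ∧ zz x' j + r (j + 1) - Q (j + 1) ≤ L (j + 1) ∧
      zz x' j + r (j + 1) - Q (j + 1) + (P (j + 1) - s) = classSum m a z (j + 1) := by
    intro j hj
    have h1 := hk' j hj
    obtain ⟨h2, h3⟩ := hPZ j hj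
    have h4 := h.length_eq hpu hj
    have h5 := h.classSum_le hz.le hj
    have h6 := hrQ j hj
    have hPj : P (j + 1) = classSum m a p (j + 1) := rfl
    simp only [hviol, hr] at h6 ⊢
    omega
  have hmod : ∀ j < s, x' (j + 1) % (j + 1) = x' j % (j + 1) := by
    intro j hj
    have h1 := congrArg (· % (j + 1)) (hx' j hj)
    simpa [Nat.add_mul_mod_self_left] using h1
  have hle1 := hT.pathVal_le hx'2 hmod s le_rfl
  obtain ⟨hx2, hpe⟩ := hT.pathVal_eq (x := x) (by rw [hxs]; omega) hx
  have hle2 := hpe s le_rfl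
  rw [hx's, ← hxs, ← hle2] at hle1
  have q1 := hpath x hx2
  have q2 := hpath x' hx'2
  rw [sum_eq_zero fun j hj => (hviol' j (mem_range.1 hj)).1, if_pos hx'0] at q2
  have hvx : ∑ j ∈ range s, val x j + 1 ≤ pen := by
    rw [hpen]
    exact Nat.succ_le_succ (hvalu _ fun j _ => min_le_right _ _)
  -- The path of choices is at least as good as that of `z`, which gets the full bonus. A missing
  -- bonus, or below a violation, would cost `pen`, which exceeds all value to be gained from listed
  -- copies.
  have hx0 : s * s ≤ x 0 := by
    by_contra hlt
    rw [if_neg hlt] at q1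
    omega
  rw [if_pos hx0] at q1
  have hviol0 : ∑ j ∈ range s, viol x j = 0 := by
    by_contra hne
    have : pen * 1 ≤ pen * ∑ j ∈ range s, viol x j := Nat.mul_le_mul_left _ (by omega)
    omega
  rw [hviol0] at q1
  have hbest : ∑ j ∈ range s, val x' j ≤ ∑ j ∈ range s, val x j := by omega
  have hdiv : ∀ j < s, x j / (j + 1) = H (j + 1) (x (j + 1)) := by
    intro j hj
    rw [hx j hj, Nat.add_mul_div_left _ _ (Nat.succ_pos j),
      Nat.div_eq_of_lt (Nat.mod_lt _ (Nat.succ_pos j)), zero_add]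
  have hKz : ∀ j < s, x j / (j + 1) ≤ x (j + 1) / (j + 1) + r (j + 1) ∧
      zz x j + r (j + 1) - Q (j + 1) = K (j + 1) ∧ K (j + 1) ≤ L (j + 1) := by
    intro j hj
    rw [sum_eq_zero_iff] at hviol0
    have h1 := hviol0 j (mem_range.2 hj)
    have h2 := hK j hj
    rw [← hdiv j hj] at h2
    have h3 : x j / (j + 1) ≤ 2 * (s * s) / (j + 1) := Nat.div_le_div_right (hx2 j hj.le)
    have h6 := hrQ j hj
    have h7 : zz x j = x (j + 1) / (j + 1) + Q (j + 1) - x j / (j + 1) := rfl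
    have h8 : Q (j + 1) = 2 * (s * s) / (j + 1) + 1 := rfl
    have h9 : min (P (j + 1)) s = r (j + 1) := rfl
    simp only [hviol] at h1
    generalize x (j + 1) / (j + 1) = q₁ at *
    generalize x j / (j + 1) = q₂ at *
    generalize 2 * (s * s) / (j + 1) = q₃ at *
    omega
  refine ⟨fun j hj => by rw [← hdiv j hj]; exact ⟨(hKz j hj).1, (hKz j hj).2.2⟩, ?_⟩
  set w : ℕ → ℕ := fun i => y i + copies (e (I.sz i)) (K (I.sz i)) i with hw
  have hwa : ∀ j < s, ∀ k < m (j + 1), w (a (j + 1) k) =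
      y (a (j + 1) k) + copies (e (j + 1)) (K (j + 1)) (a (j + 1) k) := by
    intro j hj k hk
    simp only [hw, (h.data j hj).size k hk]
  have hmem : ∀ j < s, ∀ q < K (j + 1), ∃ x' < m (j + 1), e (j + 1) q = a (j + 1) x' :=
    fun j hj q hq => (h.data j hj).mem q (hq.trans_le (hKz j hj).2.2)
  have hsumw : ∀ f : ℕ → ℕ, ∀ j < s, ∑ k ∈ range (m (j + 1)), f (a (j + 1) k) * w (a (j + 1) k) =
      ∑ k ∈ range (m (j + 1)), f (a (j + 1) k) * y (a (j + 1) k) +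
        ∑ k ∈ range (K (j + 1)), f (e (j + 1) k) := by
    intro f j hj
    rw [← sum_mul_copies f (h.data j hj).inj (hmem j hj), ← sum_add_distrib]
    exact sum_congr rfl fun k hk => by rw [hwa j hj k (mem_range.1 hk), mul_add]
  refine ⟨⟨fun i hi => ?_, ?_⟩, fun z' hz' => (hz.max z' hz').trans ?_⟩
  · have hi1 := h.size_pos i hi
    have hi2 := h.size_le i hi
    have hj : I.sz i - 1 < s := by omega
    have hcard := (h.filter _ hj).sum (fun i' => if i' = i then 1 else 0)
    rw [sum_eq_single_of_mem i (mem_range.2 hi) (fun b _ hne => by simp [hne])] at hcard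
    rw [Nat.sub_add_cancel hi1] at hcard
    simp only [id, if_true] at hcard
    obtain ⟨k, hk, hki⟩ : ∃ k < m (I.sz i), a (I.sz i) k = i := by
      by_contra! hno
      rw [sum_eq_zero fun k hk => if_neg (hno k (mem_range.1 hk))] at hcard
      omega
    have h1 := (h.data _ hj).add_copies_le (hKz _ hj).2.2 (x := k)
      (by rwa [Nat.sub_add_cancel hi1])
    rw [Nat.sub_add_cancel hi1, hki] at h1
    exact h1
  · rw [← h.sum_classes_size w]
    -- Each step of the path pays exactly for the change of weight in its class. Telescoping, the
    -- new solution weighs as much as `p` plus `x s - x 0`, which is at most the capacity.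
    have h1 : ∀ j < s, (j + 1) * ∑ k ∈ range (m (j + 1)), w (a (j + 1) k) + x j =
        (j + 1) * P (j + 1) + x (j + 1) := by
      intro j hj
      have h2 := hsumw (fun _ => 1) j hj
      simp only [one_mul, sum_const, card_range, smul_eq_mul, mul_one] at h2
      have h3 : ∑ k ∈ range (m (j + 1)), y (a (j + 1) k) = P (j + 1) - s :=
        h.classSum_base hpu hj
      have h4 := hK j hj
      have h5 := (hKz j hj).1
      rw [hdiv j hj] at h5
      have h6 : (∑ k ∈ range (m (j + 1)), w (a (j + 1) k)) + H (j + 1) (x (j + 1)) =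
          P (j + 1) + x (j + 1) / (j + 1) := by
        have h9 : min (P (j + 1)) s = r (j + 1) := rfl
        have h8 : r (j + 1) = min (P (j + 1)) s := rfl
        omega
      have h7 := congrArg ((j + 1) * ·) h6
      simp only [mul_add] at h7
      have h8 := hx j hj
      have h9 := Nat.mod_add_div (x (j + 1)) (j + 1)
      omega
    have h2 : ∀ q ≤ s, ∑ j ∈ range q, (j + 1) * ∑ k ∈ range (m (j + 1)), w (a (j + 1) k) + x 0 =
        ∑ j ∈ range q, (j + 1) * P (j + 1) + x q := by
      intro q
      induction q with
      | zero => intro _; simp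
      | succ q ih =>
        intro hq
        have := ih (by omega)
        have := h1 q hq
        rw [sum_range_succ, sum_range_succ]
        omega
    have h3 := h2 s le_rfl
    have h4 : ∑ j ∈ range s, (j + 1) * P (j + 1) = ∑ i ∈ range I.n, I.sz i * p i :=
      h.sum_classes_size p
    omega
  · unfold Items.value
    rw [← h.sum_classes fun i => I.v i * z i, ← h.sum_classes fun i => I.v i * w i,
      sum_congr rfl fun j hj => hsumw I.v j (mem_range.1 hj)]
    -- Within each class the base plus a prefix of the list is the best choice for its number of
    -- copies, so `z` is worth no more than its path says.
    have h1 : ∀ j < s, ∑ k ∈ range (m (j + 1)), I.v (a (j + 1) k) * z (a (j + 1) k) ≤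
        ∑ k ∈ range (m (j + 1)), I.v (a (j + 1) k) * y (a (j + 1) k) + val x' j := by
      intro j hj
      obtain ⟨g1, g2, g3⟩ := hviol' j hj
      have h2 := (h.data j hj).value_le g2 (z := z) (fun k hk => hz.le _ (h.lt_n hj hk)) (by
        have h3 : ∑ k ∈ range (m (j + 1)), y (a (j + 1) k) = P (j + 1) - s :=
          h.classSum_base hpu hj
        rw [h3]; exact g3.symm.trans (Nat.add_comm _ _))
      simp only [hval, min_eq_left g2]
      exact h2
    refine (sum_le_sum fun j hj => h1 j (mem_range.1 hj)).trans ?_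
    rw [sum_add_distrib, sum_add_distrib]
    refine Nat.add_le_add_left (hbest.trans (le_of_eq (sum_congr rfl fun j hj => ?_))) _
    obtain ⟨_, g2, g3⟩ := hKz j (mem_range.1 hj)
    simp only [hval, g2, min_eq_left g3]

end ClassFamily

end WordRAM


namespace WordRAM
open WordRAM.Expr WordRAM.Cmd

/-! ### Row maxima of a Monge matrix -/

-- Arrays: `aF` is the table of the dynamic program, `aG` the gains of the current class. Row `l` of
-- `aSC` lists the columns kept for level `l` of the row maxima algorithm, `aLC` holds the lengths
-- of these lists, `aK` the columns of the maxima found.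
notation "aF" => (17 : ℕ)
notation "aG" => (16 : ℕ)
notation "aSC" => (19 : ℕ)
notation "aLC" => (20 : ℕ)
notation "aK" => (21 : ℕ)
notation "vi" => (38 : ℕ)
notation "vj" => (39 : ℕ)
notation "vrho" => (40 : ℕ)
notation "vQ" => (41 : ℕ)
notation "vq" => (42 : ℕ)
notation "vl" => (43 : ℕ)
notation "vp" => (44 : ℕ)
notation "vql" => (45 : ℕ)
notation "vnc" => (46 : ℕ)
notation "vw" => (47 : ℕ)
notation "vlim" => (48 : ℕ)

/-- The larger columns gain on the smaller ones in later rows. -/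
def Monge (q : ℕ) (M : ℕ → ℕ → ℕ) : Prop :=
  ∀ x x' y y', x ≤ x' → x' < q → y ≤ y' → y' < q → M x y' + M x' y ≤ M x y + M x' y'

/-- The advantage of a larger column over a smaller one does not decrease with the row. -/
theorem Monge.later {q : ℕ} {M : ℕ → ℕ → ℕ} (h : Monge q M) {x x' y y' : ℕ} (hx : x ≤ x')
    (hx' : x' < q) (hy : y ≤ y') (hy' : y' < q) (hle : M x y ≤ M x y') : M x' y ≤ M x' y' := by
  have := h x x' y y' hx hx' hy hy'
  omega

theorem Monge.earlier {q : ℕ} {M : ℕ → ℕ → ℕ} (h : Monge q M) {x x' y y' : ℕ} (hx : x ≤ x')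
    (hx' : x' < q) (hy : y ≤ y') (hy' : y' < q) (hle : M x' y' ≤ M x' y) : M x y' ≤ M x y := by
  have := h x x' y y' hx hx' hy hy'
  omega

/-- The entry in row `a` and column `b` of the current matrix. -/
def entry (a b : Expr) : Expr := ld aF §vi (§vrho + §vj * b) + ld aG (a + §vQ - b) 0

structure Entries (E : Env) (q : ℕ) (M : ℕ → ℕ → ℕ) (σ : Store) : Prop where
  live : E.live
  WB : E.W ≤ E.B
  row : σ.var vi < E.W
  col : ∀ y < q, σ.var vrho + σ.var vj * y < E.W
  diag : ∀ x < q, ∀ y < q, y ≤ x + σ.var vQ ∧ x + σ.var vQ < E.W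
  sum : ∀ x < q, ∀ y < q, σ.arr aF (σ.var vi) (σ.var vrho + σ.var vj * y) +
    σ.arr aG (x + σ.var vQ - y) 0 = M x y ∧ M x y < E.B
  q_le : 2 * q + 4 < E.W
  monge : Monge q M

theorem Entries.of_eq {E : Env} {q : ℕ} {M : ℕ → ℕ → ℕ} {σ τ : Store} (h : Entries E q M σ)
    (h1 : τ.var vi = σ.var vi) (h2 : τ.var vj = σ.var vj) (h3 : τ.var vrho = σ.var vrho)
    (h4 : τ.var vQ = σ.var vQ) (h5 : τ.arr aF (σ.var vi) = σ.arr aF (σ.var vi))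
    (h6 : τ.arr aG = σ.arr aG) : Entries E q M τ := by
  refine ⟨h.live, h.WB, ?_, ?_, ?_, ?_, h.q_le, h.monge⟩
  · rw [h1]; exact h.row
  · rw [h2, h3]; exact h.col
  · rw [h4]; exact h.diag
  · rw [h1, h2, h3, h4, h5, h6]; exact h.sum

theorem Entries.entry_ok {E : Env} {q : ℕ} {M : ℕ → ℕ → ℕ} {σ : Store} (h : Entries E q M σ)
    {a b : Expr} {x y : ℕ} (ha : a.Ok E σ) (hb : b.Ok E σ) (hx : a.eval σ = x) (hy : b.eval σ = y)
    (hxq : x < q) (hyq : y < q) : (entry a b).Ok E σ ∧ (entry a b).eval σ = M x y := by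
  have h1 := h.col y hyq
  have h2 := h.diag x hxq y hyq
  obtain ⟨h3, h4⟩ := h.sum x hxq y hyq
  have h5 := h.row
  have h6 := h.WB
  refine ⟨?_, by simp [entry, hx, hy, h3]⟩
  simp [entry, ha, hb, hx, hy, h3, h.live]
  omega

/-- The `c`-th row of level `l`, counted from `1`. -/
def levelRow (l c : ℕ) : ℕ := c * 2 ^ l - 1

theorem levelRow_lt {q l c : ℕ} (hq : 0 < q) (hc : c ≤ q / 2 ^ l) : levelRow l c < q := by
  have h1 : c * 2 ^ l ≤ q := (Nat.mul_le_mul_right _ hc).trans (Nat.div_mul_le_self _ _)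
  unfold levelRow
  omega

theorem levelRow_mono {l c c' : ℕ} (h : c ≤ c') : levelRow l c ≤ levelRow l c' :=
  Nat.sub_le_sub_right (Nat.mul_le_mul_right _ h) _

/-- The columns listed in row `lc` contain maxima of the rows of level `l`. -/
structure Covers (q : ℕ) (M : ℕ → ℕ → ℕ) (τ : Store) (lc l : ℕ) : Prop where
  lt : ∀ x < τ.arr aLC lc 0, τ.arr aSC lc x < q
  mono : ∀ x x', x ≤ x' → x' < τ.arr aLC lc 0 → τ.arr aSC lc x ≤ τ.arr aSC lc x'
  cover : ∀ c, 0 < c → c ≤ q / 2 ^ l → ∀ y < q, ∃ x < τ.arr aLC lc 0,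
    M (levelRow l c) y ≤ M (levelRow l c) (τ.arr aSC lc x)

theorem Covers.of_eq {q : ℕ} {M : ℕ → ℕ → ℕ} {σ τ : Store} {lc l : ℕ} (h : Covers q M σ lc l)
    (h1 : τ.arr aLC lc 0 = σ.arr aLC lc 0) (h2 : τ.arr aSC lc = σ.arr aSC lc) :
    Covers q M τ lc l := by
  refine ⟨?_, ?_, ?_⟩ <;> rw [h1, h2]
  exacts [h.lt, h.mono, h.cover]

/-- The rows of level `l + 1` are every second row of level `l`. -/
theorem Covers.succ {q : ℕ} {M : ℕ → ℕ → ℕ} {τ : Store} {lc l : ℕ} (h : Covers q M τ lc l) :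
    Covers q M τ lc (l + 1) := by
  refine ⟨h.lt, h.mono, fun c hc hcq y hy => ?_⟩
  have e : levelRow (l + 1) c = levelRow l (2 * c) := by
    unfold levelRow; rw [pow_succ]; congr 1; ring
  rw [e]
  refine h.cover (2 * c) (by omega) ?_ y hy
  rw [Nat.le_div_iff_mul_le (by positivity)] at hcq ⊢
  rw [pow_succ] at hcq
  calc 2 * c * 2 ^ l = c * (2 ^ l * 2) := by ring
    _ ≤ q := hcq

/-- Reduce the list of columns of level `l` to one column per row. -/
def reduceLevel : Cmd :=
  vnc ::= ld aLC §vl 0 ;; vc ::= 0 ;; vk ::= 0 ;;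
  whl (§vk ≺ §vnc)
    (vb ::= ld aSC §vl §vk ;;
     ite (§vc ≗ 0) (put aSC (§vl + 1) 0 §vb ;; vc ::= 1 ;; vk ::= §vk + 1)
       (vx ::= ld aSC (§vl + 1) (§vc - 1) ;;
        ite (entry (§vc * §vp - 1) §vx ≺ entry (§vc * §vp - 1) §vb) (vc ::= §vc - 1)
          (ite (§vc ≺ §vql) (put aSC (§vl + 1) §vc §vb ;; vc ::= §vc + 1) skip ;;
           vk ::= §vk + 1))) ;;
  put aLC (§vl + 1) 0 §vc

theorem reduceLevel_spec {E : Env} {q : ℕ} {M : ℕ → ℕ → ℕ} {σ : Store} (hE : Entries E q M σ)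
    {l : ℕ} (hl : σ.var vl = l) (hlW : l + 1 < E.W) (hp : σ.var vp = 2 ^ l)
    (hql : σ.var vql = q / 2 ^ l) (hq : 0 < q / 2 ^ l) (hc : Covers q M σ l l)
    (hnc : σ.arr aLC l 0 ≤ q) :
    wp E reduceLevel σ (fun t τ => t ≤ 2 * σ.arr aLC l 0 ∧ Covers q M τ (l + 1) l ∧
      τ.arr aLC (l + 1) 0 ≤ q / 2 ^ l ∧
      ∀ l', l' ≠ l + 1 → τ.arr aLC l' = σ.arr aLC l' ∧ τ.arr aSC l' = σ.arr aSC l') := by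
  have hq0 : 0 < q := Nat.pos_of_ne_zero fun h => by rw [h] at hq; simp at hq
  have hWB := hE.WB
  have hqW := hE.q_le
  have hqq : q / 2 ^ l ≤ q := Nat.div_le_self _ _
  set nc := σ.arr aLC l 0 with hncd
  set n := q / 2 ^ l with hn
  simp only [reduceLevel, wp_seq, wp_set]
  refine ⟨by simp [hl, hE.live]; omega, by simp, by simp, ?_⟩
  -- The stack discipline of SMAWK. The column at stack position `x + 1` is beaten by its
  -- predecessor at the rows up to number `x + 1`, so it can only matter at later rows. Every column
  -- read so far is matched, at each row, by a stack column or by the column about to be read; the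
  -- latter is needed between a deletion and the following push.
  refine wp_whl (fun τ => τ.var vc ≤ n ∧ τ.var vk ≤ nc ∧
      (∀ x < τ.var vc, τ.arr aSC (l + 1) x < q) ∧
      (∀ x x', x ≤ x' → x' < τ.var vc → τ.arr aSC (l + 1) x ≤ τ.arr aSC (l + 1) x') ∧
      (∀ x < τ.var vc, ∀ k, τ.var vk ≤ k → k < nc → τ.arr aSC (l + 1) x ≤ σ.arr aSC l k) ∧
      (∀ x, x + 1 < τ.var vc → M (levelRow l (x + 1)) (τ.arr aSC (l + 1) (x + 1)) ≤
        M (levelRow l (x + 1)) (τ.arr aSC (l + 1) x)) ∧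
      (∀ c, 0 < c → c ≤ n → ∀ k < τ.var vk,
        (∃ x < τ.var vc, M (levelRow l c) (σ.arr aSC l k) ≤
          M (levelRow l c) (τ.arr aSC (l + 1) x)) ∨
        (τ.var vk < nc ∧ M (levelRow l c) (σ.arr aSC l k) ≤
          M (levelRow l c) (σ.arr aSC l (τ.var vk)))) ∧
      ∀ l', l' ≠ l + 1 → τ.arr aSC l' = σ.arr aSC l')
    -- A push advances `vk` and lengthens the stack, a deletion shortens the stack, a rejected
    -- column advances `vk`; each lowers the potential.
    (fun τ => 2 * (nc - τ.var vk) + τ.var vc) ?_ ?_ ?_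
  · simp
  · rintro τ hA ⟨i1, i2, i3, i4, i5, i6, i7, i8⟩
    have e1 : τ.var vl = l := (hA.v vl rfl).trans (by simpa using hl)
    have e2 : τ.var vp = 2 ^ l := (hA.v vp rfl).trans (by simpa using hp)
    have e3 : τ.var vql = n := (hA.v vql rfl).trans (by simpa using hql)
    have e4 : τ.var vnc = nc := (hA.v vnc rfl).trans (by simp [hl, hncd])
    refine ⟨by simp, fun hk => ?_⟩
    simp only [Cond.holds_lt, eval_var, e4] at hk
    have i8l := i8 l (by omega)
    set k := τ.var vk with hkd
    have hb := hc.lt k hk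
    simp only [wp_seq, wp_set, eval_ld, eval_var, e1, ← hkd]
    refine ⟨by simp [e1, hE.live, ← hkd]; omega, ?_⟩
    rw [i8l, wp_ite]
    refine ⟨by simp, fun hc0 => ?_, fun hc0 => ?_⟩
    · replace hc0 : τ.var vc = 0 := by simpa using hc0
      simp only [wp_seq, wp_set, wp_put]
      simp [e1, hE.live, hc0, ← hkd]
      refine ⟨by omega, by omega, ⟨hq, hk, hb, ?_, fun k' hk' hk'n => hc.mono k k' (by omega) hk'n,
        fun c hc1 hc2 k' hk' => ?_, fun l' hl' => ?_⟩, by omega⟩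
      · rintro x x' hx rfl
        rw [Nat.le_zero.1 hx]
      · rcases Nat.lt_or_eq_of_le hk' with hk' | rfl
        · rcases i7 c hc1 hc2 k' hk' with ⟨x, hx, _⟩ | h
          · omega
          · exact Or.inl h.2
        · exact Or.inl le_rfl
      · rw [← i8 l' hl']; funext j; simp [hl']
    · replace hc0 : 0 < τ.var vc := by
        rcases Nat.eq_zero_or_pos (τ.var vc) with h | h
        · exact absurd (by simpa using h) hc0
        · exact h
      set c := τ.var vc with hcd
      have htop := i3 (c - 1) (by omega)
      have hcp : c * 2 ^ l ≤ q := (Nat.mul_le_mul_right _ i1).trans (Nat.div_mul_le_self _ _)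
      have hcp1 : 1 ≤ c * 2 ^ l := Nat.mul_pos hc0 (by positivity)
      have hrow : levelRow l c < q := levelRow_lt hq0 i1
      simp only [wp_seq (b := Cmd.ite _ _ _), wp_set]
      refine ⟨by simp [e1, hE.live, ← hcd]; omega, ?_⟩
      simp only [eval_ld, eval_add, eval_sub, eval_var, eval_lit, Store.set_var, Store.set_arr,
        Nat.reduceEqDiff, if_false, e1, ← hcd]
      set υ := (τ.set vb (σ.arr aSC l k)).set vx (τ.arr aSC (l + 1) (c - 1)) with hυ
      have hEυ : Entries E q M υ := hE.of_eq
        (by simp [hυ]; exact hA.v vi rfl) (by simp [hυ]; exact hA.v vj rfl)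
        (by simp [hυ]; exact hA.v vrho rfl) (by simp [hυ]; exact hA.v vQ rfl)
        (by simp [hυ]; rw [hA.a aF rfl]; simp) (by simp [hυ]; exact hA.a aG rfl)
      have ea : (§vc * §vp - 1 : Expr).Ok E υ ∧ (§vc * §vp - 1 : Expr).eval υ = levelRow l c := by
        simp [hυ, e2, ← hcd, levelRow]
        omega
      obtain ⟨o1, v1⟩ := hEυ.entry_ok (b := §vx) (y := τ.arr aSC (l + 1) (c - 1)) ea.1
        (by simp) ea.2 (by simp [hυ]) hrow htop
      obtain ⟨o2, v2⟩ := hEυ.entry_ok (b := §vb) (y := σ.arr aSC l k) ea.1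
        (by simp) ea.2 (by simp [hυ]) hrow hb
      have hle : τ.arr aSC (l + 1) (c - 1) ≤ σ.arr aSC l k := i5 (c - 1) (by omega) k le_rfl hk
      have hR : ∀ c', c' ≤ n → levelRow l c' < q := fun c' h => levelRow_lt hq0 h
      have hM := hE.monge
      rw [wp_ite]
      refine ⟨⟨o1, o2⟩, fun hlt => ?_, fun hlt => ?_⟩
      -- The new column beats the top of the stack at row number `c`, hence from there on. At
      -- earlier rows the entry below the top is at least as good as the top. So the top can go.
      · rw [Cond.holds_lt, v1, v2] at hlt
        simp [hυ, ← hcd, ← hkd]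
        refine ⟨by omega, ⟨by omega, by omega, fun x hx => i3 x (by omega),
          fun x x' hx hx' => i4 x x' hx (by omega), fun x hx => i5 x (by omega),
          fun x hx => i6 x (by omega), fun c' hc1 hc2 k' hk' => ?_, i8⟩, by omega⟩
        rcases i7 c' hc1 hc2 k' hk' with ⟨x, hx, h⟩ | h
        · rcases Nat.lt_or_ge x (c - 1) with hx1 | hx1
          · exact Or.inl ⟨x, hx1, h⟩
          · obtain rfl : x = c - 1 := by omega
            rcases Nat.lt_or_ge c' c with hcc | hcc
            · left
              refine ⟨c - 2, by omega, h.trans ?_⟩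
              have h6 := i6 (c - 2) (by omega)
              rw [show c - 2 + 1 = c - 1 by omega] at h6
              exact hM.earlier (levelRow_mono (by omega)) (hR _ (by omega))
                (i4 _ _ (by omega) (by omega)) htop h6
            · right
              exact ⟨hk, h.trans (hM.later (levelRow_mono hcc) (hR _ hc2) hle hb hlt.le)⟩
        · exact Or.inr h
      · rw [Cond.holds_lt, v1, v2, not_lt] at hlt
        -- Otherwise the top is at least as good as the new column at row number `c` and all earlier
        -- ones.
        have hdom : ∀ c', 0 < c' → c' ≤ c → M (levelRow l c') (σ.arr aSC l k) ≤
            M (levelRow l c') (τ.arr aSC (l + 1) (c - 1)) := fun c' _ h =>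
          hM.earlier (levelRow_mono h) hrow hle hb hlt
        rw [wp_seq, wp_ite]
        refine ⟨by simp, fun hcn => ?_, fun hcn => ?_⟩
        · replace hcn : c < n := by simpa [hυ, ← hcd, e3] using hcn
          simp [hυ, e1, hE.live, ← hcd, ← hkd]
          refine ⟨by omega, by omega, by omega, ⟨by omega, by omega, fun x hx => ?_,
            fun x x' hx hx' => ?_, fun x hx k' hk1 hk2 => ?_, fun x hx => ?_,
            fun c' hc1 hc2 k' hk' => ?_, fun l' hl' => ?_⟩, by omega⟩
          · split
            · exact hb
            · exact i3 x (by omega)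
          · have h5 := i5 x
            by_cases h1 : x' = c
            · by_cases h2 : x = c
              · simp [h1, h2]
              · simp only [h1, h2, if_true, if_false]
                exact i5 x (by omega) k le_rfl hk
            · have h2 : x ≠ c := by omega
              simp only [h1, h2, if_false]
              exact i4 x x' hx (by omega)
          · split
            · exact hc.mono k k' (by omega) hk2
            · exact i5 x (by omega) k' (by omega) hk2
          · have hx1 : x ≠ c := by omega
            simp only [hx1, if_false]
            split
            · rename_i h
              have := hdom c hc0 le_rfl
              rw [h]
              obtain rfl : x = c - 1 := by omega
              exact this
            · exact i6 x (by omega)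
          · left
            rcases Nat.lt_or_eq_of_le hk' with hk' | rfl
            · rcases i7 c' hc1 hc2 k' hk' with ⟨x, hx, h⟩ | h
              · refine ⟨x, by omega, ?_⟩
                rw [if_neg (by omega)]; exact h
              · exact ⟨c, by omega, by rw [if_pos rfl]; exact h.2⟩
            · exact ⟨c, by omega, by rw [if_pos rfl]⟩
          · rw [← i8 l' hl']; funext j; simp [hl']
        -- The stack has as many columns as there are rows, so `hdom` covers every row and the new
        -- column can be rejected.
        · replace hcn : n ≤ c := by simpa [hυ, ← hcd, e3] using hcn
          simp [hυ, ← hcd, ← hkd]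
          refine ⟨by omega, ⟨i1, by omega, i3, i4, fun x hx k' hk1 => i5 x hx k' (by omega), i6,
            fun c' hc1 hc2 k' hk' => ?_, i8⟩, by omega⟩
          left
          have hd := hdom c' hc1 (by omega)
          rcases Nat.lt_or_eq_of_le hk' with hk' | rfl
          · rcases i7 c' hc1 hc2 k' hk' with h | h
            · exact h
            · exact ⟨c - 1, by omega, h.2.trans hd⟩
          · exact ⟨c - 1, by omega, hd⟩
  · rintro t τ hA ⟨i1, i2, i3, i4, i5, i6, i7, i8⟩ hk ht
    have e1 : τ.var vl = l := (hA.v vl rfl).trans (by simpa using hl)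
    have e4 : τ.var vnc = nc := (hA.v vnc rfl).trans (by simp [hl, hncd])
    have e5 : τ.arr aLC = σ.arr aLC := hA.a aLC rfl
    simp only [Cond.holds_lt, eval_var, e4] at hk
    simp [e1, hE.live]
    refine ⟨by omega, by simpa using ht.trans' (Nat.le_add_right _ _), ⟨by simpa using i3,
      by simpa using i4, fun c hc1 hc2 y hy => ?_⟩, i1, fun l' hl' => ⟨?_, i8 l' hl'⟩⟩
    · obtain ⟨k, hk1, hk2⟩ := hc.cover c hc1 hc2 y hy
      rcases i7 c hc1 hc2 k (by omega) with ⟨x, hx, h⟩ | h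
      · exact ⟨x, by simpa using hx, by simpa using hk2.trans h⟩
      · omega
    · simp [hl', e5]

end WordRAM


namespace WordRAM
open WordRAM.Expr WordRAM.Cmd

/-- Compute the row `vy` to be filled and the last column `vlim` to be considered for it. -/
def fillLimit : Cmd :=
  vy ::= (§va + 1) * §vp - 1 ;;
  vlim ::= §vq - 1 ;;
  ite (§va + 1 ≺ §vql)
    (vlim ::= ld aK ((§va + 2) * §vp - 1) 0 ;; ite (§vlim ≺ §vw) (vlim ::= §vw) skip) skip

/-- Is there another column to be considered? -/
def fillNext : Cmd :=
  vf ::= 0 ;;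
  ite (§vk ≺ §vnc) (vb ::= ld aSC (§vl + 1) §vk ;; ite (§vb ≼ §vlim) (vf ::= 1) skip) skip

/-- Consider the next column, or finish the row. -/
def fillStep : Cmd :=
  ite (§vf ≗ 1) (ite (entry §vy §vx ≺ entry §vy §vb) (vx ::= §vb) skip ;; vk ::= §vk + 1)
    (ite (entry §vy §vx ≺ entry §vy §vlim) (vx ::= §vlim) skip ;;
     put aK §vy 0 §vx ;; vx ::= §vlim ;; vw ::= §vlim ;; va ::= §va + 2)

/-- Fill in the maxima of the odd rows of a level, from those of the next level. -/
def fillLevel : Cmd :=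
  vnc ::= ld aLC (§vl + 1) 0 ;; vx ::= 0 ;; vw ::= 0 ;; vk ::= 0 ;; va ::= 0 ;;
  whl (§va ≺ §vql) (fillLimit ;; fillNext ;; fillStep)

theorem fillLimit_spec {E : Env} {q l i n w : ℕ} {σ : Store} (hE : E.live) (hWB : E.W ≤ E.B)
    (hq : 2 * q + 4 < E.W) (hp : σ.var vp = 2 ^ l) (hvq : σ.var vq = q) (hql : σ.var vql = n)
    (ha : σ.var va = i) (hw : σ.var vw = w) (hn : n * 2 ^ l ≤ q) (hi : i < n) :
    wp E fillLimit σ (fun t τ => t = 0 ∧ τ.var vy = levelRow l (i + 1) ∧ τ.var vlim =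
      if i + 1 < n then max w (σ.arr aK (levelRow l (i + 2)) 0) else q - 1) := by
  have h1 : (i + 1) * 2 ^ l ≤ q := (Nat.mul_le_mul_right _ hi).trans hn
  have h2 : 1 ≤ (i + 1) * 2 ^ l := Nat.mul_pos (Nat.succ_pos _) (by positivity)
  have h3 : 1 ≤ (i + 2) * 2 ^ l := Nat.mul_pos (Nat.succ_pos _) (by positivity)
  have h4 : n ≤ q := (Nat.le_mul_of_pos_right n (by positivity)).trans hn
  have e : (i + 2) * 2 ^ l - 1 = levelRow l (i + 2) := rfl
  simp [fillLimit, ha, hp, hvq, hql, hE, e, hw]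
  refine ⟨by omega, by omega, by omega, fun h5 => ?_, fun h5 => ⟨rfl, fun h => by omega⟩⟩
  have h6 : (i + 2) * 2 ^ l ≤ q := (Nat.mul_le_mul_right _ h5).trans hn
  refine ⟨by unfold levelRow; omega, fun h7 => ⟨rfl, ?_⟩, fun h7 => ⟨rfl, ?_⟩⟩
  · rw [if_pos h5, max_eq_left h7.le]
  · rw [if_pos h5, max_eq_right h7]

theorem fillNext_spec {E : Env} {l k nc : ℕ} {σ : Store} (hE : E.live) (hWB : E.W ≤ E.B)
    (hl : σ.var vl = l) (hlW : l + 1 < E.W) (hk : σ.var vk = k) (hnc : σ.var vnc = nc)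
    (hncW : nc < E.W) :
    wp E fillNext σ (fun t τ => t = 0 ∧
      ((τ.var vf = 1 ∧ k < nc ∧ τ.var vb = σ.arr aSC (l + 1) k ∧
        σ.arr aSC (l + 1) k ≤ σ.var vlim) ∨
       (τ.var vf = 0 ∧ (k < nc → σ.var vlim < σ.arr aSC (l + 1) k)))) := by
  simp [fillNext, hl, hk, hnc, hE]
  refine ⟨fun h => ⟨by omega, fun h1 => ⟨h, h1⟩, fun h1 _ => h1⟩, fun h h1 => by omega⟩

/-- `k` is a column with a maximum of row `x`. -/
def IsRowMax (q : ℕ) (M : ℕ → ℕ → ℕ) (x k : ℕ) : Prop := k < q ∧ ∀ y < q, M x y ≤ M x k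

theorem levelRow_inj {l c c' : ℕ} (hc : 0 < c) (hc' : 0 < c') (h : levelRow l c = levelRow l c') :
    c = c' := by
  unfold levelRow at h
  have h1 : 0 < 2 ^ l := by positivity
  have h2 := Nat.mul_pos hc h1
  have h3 := Nat.mul_pos hc' h1
  exact Nat.eq_of_mul_eq_mul_right h1 (by omega)

/-- Maxima can be chosen to move to the right with the row, so a row is searched only up to a
maximum of the next row, and from where the previous search ended. The list is scanned once for all
rows together. -/
theorem fillLevel_spec {E : Env} {q : ℕ} {M : ℕ → ℕ → ℕ} {σ : Store} (hE : Entries E q M σ)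
    {l : ℕ} (hl : σ.var vl = l) (hlW : l + 1 < E.W) (hp : σ.var vp = 2 ^ l) (hvq : σ.var vq = q)
    (hql : σ.var vql = q / 2 ^ l) (hq : 0 < q / 2 ^ l) (hc : Covers q M σ (l + 1) l)
    (hncW : σ.arr aLC (l + 1) 0 < E.W)
    (hK : ∀ c, 0 < c → c ≤ q / 2 ^ (l + 1) →
      IsRowMax q M (levelRow (l + 1) c) (σ.arr aK (levelRow (l + 1) c) 0)) :
    wp E fillLevel σ (fun t τ => t ≤ σ.arr aLC (l + 1) 0 + q / 2 ^ l ∧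
      ∀ c, 0 < c → c ≤ q / 2 ^ l →
        IsRowMax q M (levelRow l c) (τ.arr aK (levelRow l c) 0)) := by
  have hq0 : 0 < q := Nat.pos_of_ne_zero fun h => by rw [h] at hq; simp at hq
  have hWB := hE.WB
  have hqW := hE.q_le
  have hM := hE.monge
  have hqq : q / 2 ^ l ≤ q := Nat.div_le_self _ _
  have hn2 : q / 2 ^ (l + 1) = q / 2 ^ l / 2 := by rw [pow_succ, Nat.div_div_eq_div_mul]
  have hrow2 : ∀ c, levelRow (l + 1) c = levelRow l (2 * c) := fun c => by
    unfold levelRow; rw [pow_succ]; congr 1; ring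
  rw [hn2] at hK
  set nc := σ.arr aLC (l + 1) 0 with hncd
  set n := q / 2 ^ l with hn
  have hnq : n * 2 ^ l ≤ q := Nat.div_mul_le_self _ _
  have hR : ∀ c', c' ≤ n → levelRow l c' < q := fun c' h => levelRow_lt hq0 h
  simp only [fillLevel, wp_seq, wp_set]
  refine ⟨by simp [hl, hE.live]; omega, by simp, by simp, by simp, by simp, ?_⟩
  -- Ties may put a recorded maximum to the left of the column where the search starts; the maximum
  -- with `vw` keeps the limits monotone.
  set lim : Store → ℕ := fun τ => if τ.var va + 1 < n then
    max (τ.var vw) (τ.arr aK (levelRow l (τ.var va + 2)) 0) else q - 1 with hlimd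
  set inv : Store → Prop := fun τ => τ.var va % 2 = 0 ∧ τ.var va ≤ n + 1 ∧ τ.var vk ≤ nc ∧ τ.var vw < q ∧
      τ.var vx < q ∧
      (∀ c, 0 < c → c ≤ n → c % 2 = 0 ∨ c ≤ τ.var va →
        IsRowMax q M (levelRow l c) (τ.arr aK (levelRow l c) 0)) ∧
      (τ.var va < n → (∀ y ≤ τ.var vw,
          M (levelRow l (τ.var va + 1)) y ≤ M (levelRow l (τ.var va + 1)) (τ.var vw)) ∧
        ∀ x < τ.var vk, σ.arr aSC (l + 1) x ≤ lim τ ∧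
          M (levelRow l (τ.var va + 1)) (σ.arr aSC (l + 1) x) ≤
          M (levelRow l (τ.var va + 1)) (τ.var vx)) with hinv
  refine wp_whl inv
    (fun τ => (nc - τ.var vk) + (n - τ.var va)) ?_ ?_ ?_
  · refine ⟨by simp, by simp, by simp, by simpa using hq0, by simpa using hq0, ?_, ?_⟩
    · intro c h1 h2 h3
      simp only [Store.set_var, if_true, eval_lit] at h3
      obtain ⟨c', rfl⟩ : ∃ c', c = 2 * c' := ⟨c / 2, by omega⟩
      have := hK c' (by omega) (by omega)
      rw [hrow2] at this
      simpa using this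
    · simp
  · rintro τ hA ⟨i1, i2, i3, i4, i5, i6, i7⟩
    have e1 : τ.var vl = l := (hA.v vl rfl).trans (by simpa using hl)
    have e2 : τ.var vp = 2 ^ l := (hA.v vp rfl).trans (by simpa using hp)
    have e3 : τ.var vql = n := (hA.v vql rfl).trans (by simpa using hql)
    have e4 : τ.var vnc = nc := (hA.v vnc rfl).trans (by simp [hl, hncd])
    have e5 : τ.var vq = q := (hA.v vq rfl).trans (by simpa using hvq)
    have e6 : τ.arr aSC = σ.arr aSC := (hA.a aSC rfl).trans (by simp)
    refine ⟨by simp, fun hi => ?_⟩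
    simp only [Cond.holds_lt, eval_var, e3] at hi
    obtain ⟨j7, i8⟩ := i7 hi
    clear i7
    set i := τ.var va with hid
    set w := τ.var vw with hwd
    set k := τ.var vk with hkd
    set x := τ.var vx with hxd
    set r := levelRow l (i + 1) with hr
    have hrq : r < q := hR _ (by omega)
    -- At the current row the limit is at least as good as every column to its right; at the next
    -- row to be filled it is at least as good as every column to its left. The second fact lets the
    -- search for that row start at the limit.
    have hlimq : lim τ < q ∧ w ≤ lim τ ∧ (∀ y < q, lim τ ≤ y → M r y ≤ M r (lim τ)) ∧
        (∀ y ≤ lim τ, i + 2 < n → M (levelRow l (i + 3)) y ≤ M (levelRow l (i + 3)) (lim τ)) := by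
      simp only [hlimd]
      split
      · rename_i h
        obtain ⟨m1, m2⟩ := i6 (i + 2) (by omega) (by omega) (Or.inl (by omega))
        rw [← hid]
        set κ := τ.arr aK (levelRow l (i + 2)) 0 with hκ
        have hright : ∀ y < q, κ ≤ y → M r y ≤ M r κ := fun y hy hle =>
          hM.earlier (levelRow_mono (by omega)) (hR (i + 2) (by omega)) hle hy (m2 y hy)
        have hleft : ∀ y ≤ κ, i + 2 < n →
            M (levelRow l (i + 3)) y ≤ M (levelRow l (i + 3)) κ := fun y hy hlt =>
          hM.later (levelRow_mono (by omega)) (hR _ (by omega)) hy m1 (m2 y (by omega))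
        rcases le_total w κ with hwκ | hwκ
        · rw [max_eq_right hwκ]
          exact ⟨m1, hwκ, hright, hleft⟩
        · rw [max_eq_left hwκ]
          refine ⟨i4, le_rfl, fun y hy hle => (hright y hy (by omega)).trans (j7 κ hwκ),
            fun y hy hlt => ?_⟩
          exact hM.later (x := r) (levelRow_mono (by omega)) (hR _ (by omega)) hy i4 (j7 y hy)
      · refine ⟨by omega, by omega, fun y hy hle => ?_, fun y _ h => by omega⟩
        obtain rfl : y = q - 1 := by omega
        exact le_rfl
    obtain ⟨l1, l2, l3, l4⟩ := hlimq
    have hlimeq : lim τ = if i + 1 < n then max w (τ.arr aK (levelRow l (i + 2)) 0)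
      else q - 1 := rfl
    set b := lim τ with hbd
    rw [wp_seq]
    refine (fillLimit_spec hE.live hWB hqW e2 e5 e3 hid.symm hwd.symm hnq hi).mono ?_
    rintro _ τ₁ hA₁ ⟨rfl, y1, y2⟩
    rw [← hr] at y1
    rw [← hlimeq] at y2
    rw [wp_seq]
    refine (fillNext_spec hE.live hWB ((hA₁.v vl rfl).trans e1) hlW (hA₁.v vk rfl)
      ((hA₁.v vnc rfl).trans e4) hncW).mono ?_
    rintro _ τ₂ hA₂ ⟨rfl, hnext⟩
    rw [hA₁.a aSC rfl, e6, ← hkd, y2] at hnext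
    have f1 : τ₂.var vx = x := (hA₂.v vx rfl).trans (hA₁.v vx rfl)
    have f2 : τ₂.var vk = k := (hA₂.v vk rfl).trans (hA₁.v vk rfl)
    have f3 : τ₂.var va = i := (hA₂.v va rfl).trans (hA₁.v va rfl)
    have f4 : τ₂.var vw = w := (hA₂.v vw rfl).trans (hA₁.v vw rfl)
    have f5 : τ₂.var vy = r := (hA₂.v vy rfl).trans y1
    have f6 : τ₂.var vlim = b := (hA₂.v vlim rfl).trans y2
    have f7 : τ₂.arr aK = τ.arr aK := (hA₂.a aK rfl).trans (hA₁.a aK rfl)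
    have hE₂ : Entries E q M τ₂ := hE.of_eq
      ((hA₂.v vi rfl).trans ((hA₁.v vi rfl).trans ((hA.v vi rfl).trans (by simp))))
      ((hA₂.v vj rfl).trans ((hA₁.v vj rfl).trans ((hA.v vj rfl).trans (by simp))))
      ((hA₂.v vrho rfl).trans ((hA₁.v vrho rfl).trans ((hA.v vrho rfl).trans (by simp))))
      ((hA₂.v vQ rfl).trans ((hA₁.v vQ rfl).trans ((hA.v vQ rfl).trans (by simp))))
      (by rw [hA₂.a aF rfl, hA₁.a aF rfl, hA.a aF rfl]; simp)
      (by rw [hA₂.a aG rfl, hA₁.a aG rfl, hA.a aG rfl]; simp)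
    obtain ⟨o1, v1⟩ := hE₂.entry_ok (a := §vy) (b := §vx) (by simp) (by simp) f5 f1 hrq i5
    obtain ⟨o2, v2⟩ := hE₂.entry_ok (a := §vy) (b := §vlim) (by simp) (by simp) f5 f6 hrq l1
    rcases hnext with ⟨hf, hk, hb, hbl⟩ | ⟨hf, hend⟩
    · obtain ⟨o3, v3⟩ := hE₂.entry_ok (a := §vy) (b := §vb) (by simp) (by simp) f5 hb hrq
        (hc.lt k hk)
      have hres : ∀ x', x' < q → M r x ≤ M r x' → M r (σ.arr aSC (l + 1) k) ≤ M r x' →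
          ∀ τ' : Store, τ'.arr = τ₂.arr → τ'.var va = i → τ'.var vw = w → τ'.var vk = k + 1 →
          τ'.var vx = x' → inv τ' ∧ 0 + 1 + ((nc - τ'.var vk) + (n - τ'.var va)) ≤
            (nc - k) + (n - i) := by
        intro x' h1 h2 h3 τ' g1 g2 g3 g4 g5
        refine ⟨⟨by omega, by omega, by omega, by omega, by omega, ?_, fun _ => ⟨?_, ?_⟩⟩,
          by omega⟩
        · rw [g1, f7, g2]; exact i6
        · rw [g2, g3]; exact j7
        · have hl' : lim τ' = b := by rw [hlimeq]; simp only [hlimd, g1, f7, g2, g3]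
          rw [g4, g2, g5, hl']
          intro z hz
          rcases Nat.lt_succ_iff_lt_or_eq.1 hz with hz | rfl
          · exact ⟨(i8 z hz).1, (i8 z hz).2.trans h2⟩
          · exact ⟨hbl, h3⟩
      have hkB : k + 1 < E.B := by omega
      simp only [fillStep, wp_ite, wp_seq, wp_set, wp_skip]
      refine ⟨by simp, fun _ => ⟨⟨o1, o3⟩, fun hlt => ⟨by simp, by simpa [f2] using hkB, ?_⟩,
        fun hlt => ⟨by simpa [f2] using hkB, ?_⟩⟩, fun h => absurd (by simpa using hf) h⟩
      · rw [Cond.holds_lt, v1, v3] at hlt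
        exact hres _ (hc.lt k hk) hlt.le le_rfl _ (by simp) (by simpa using f3)
          (by simpa using f4) (by simp [f2]) (by simp [hb])
      · rw [Cond.holds_lt, v1, v3, not_lt] at hlt
        exact hres x i5 le_rfl hlt _ (by simp) (by simpa using f3)
          (by simpa using f4) (by simp [f2]) (by simpa using f1)
    · have hres : ∀ x', x' < q → M r x ≤ M r x' → M r b ≤ M r x' →
          ∀ τ' : Store, τ'.arr aK = (fun a c => if a = r ∧ c = 0 then x' else τ.arr aK a c) →
          τ'.var va = i + 2 → τ'.var vw = b → τ'.var vk = k →
          τ'.var vx = b → inv τ' ∧ 0 + 1 + ((nc - τ'.var vk) + (n - τ'.var va)) ≤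
            (nc - k) + (n - i) := by
        intro x' h1 h2 h3 τ' g1 g2 g3 g4 g5
        have hmax : IsRowMax q M r x' := by
          -- The listed columns suffice at this row. Those already scanned are accounted for by `x`;
          -- the others lie to the right of the limit, which is at least as good there.
          refine ⟨h1, fun y hy => ?_⟩
          obtain ⟨z, hz, hzy⟩ := hc.cover (i + 1) (Nat.succ_pos _) (by omega) y hy
          refine hzy.trans ?_
          rcases Nat.lt_or_ge z k with hzk | hzk
          · exact (i8 z hzk).2.trans h2
          · have := hend (by omega)
            have := hc.mono k z hzk hz
            exact (l3 _ (hc.lt z hz) (by omega)).trans h3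
        have hKnew : ∀ c, 0 < c → c ≤ n → c % 2 = 0 ∨ c ≤ i + 2 →
            IsRowMax q M (levelRow l c) (τ'.arr aK (levelRow l c) 0) := by
          intro c c1 c2 c3
          rw [g1]
          by_cases hci : c = i + 1
          · subst hci; simpa [hr] using hmax
          · have : levelRow l c ≠ r := fun h => hci (levelRow_inj c1 (Nat.succ_pos _) h)
            simp only [this, false_and, if_false]
            exact i6 c c1 c2 (by omega)
        refine ⟨⟨by omega, by omega, by omega, by omega, by omega, by rwa [g2],
          fun h => ⟨?_, ?_⟩⟩, by omega⟩
        · rw [g2, g3]; exact fun y hy => l4 y hy (by omega)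
        · rw [g4, g2, g5]
          intro z hz
          refine ⟨(i8 z hz).1.trans ?_, l4 _ (i8 z hz).1 (by omega)⟩
          simp only [hlimd, g2, g3]
          split <;> omega
      have hiB : i + 2 < E.B := by omega
      have hrW : r < E.W := by omega
      have hW0 : 0 < E.W := by omega
      simp only [fillStep, wp_ite, wp_seq, wp_set, wp_skip, wp_put]
      refine ⟨by simp, fun h => ?_, fun _ => ⟨⟨o1, o2⟩, fun hlt => ?_, fun hlt => ?_⟩⟩
      · simp [hf] at h
      · rw [Cond.holds_lt, v1, v2] at hlt
        refine ⟨by simp, by simp [hE.live, f5, hrW, hW0], by simp, by simp, by simp,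
          by simpa [f3] using hiB, ?_⟩
        exact hres b l1 hlt.le le_rfl _ (by simp [f5, f6, f7]) (by simp [f3]) (by simp [f6])
          (by simp [f2]) (by simp [f6])
      · rw [Cond.holds_lt, v1, v2, not_lt] at hlt
        refine ⟨by simp [hE.live, f5, hrW, hW0], by simp, by simp, by simp,
          by simpa [f3] using hiB, ?_⟩
        exact hres x i5 le_rfl hlt _ (by simp [f5, f1, f7]) (by simp [f3]) (by simp [f6])
          (by simp [f2]) (by simp [f6])
  · rintro t τ hA ⟨i1, i2, i3, i4, i5, i6, i7⟩ hi ht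
    have e3 : τ.var vql = n := (hA.v vql rfl).trans (by simpa using hql)
    simp only [Cond.holds_lt, eval_var, e3] at hi
    simp at ht
    refine ⟨by omega, fun c h1 h2 => ?_⟩
    rcases Nat.lt_or_ge (τ.var va) c with h | h
    · omega
    · exact i6 c h1 h2 (Or.inr h)

end WordRAM


namespace WordRAM
open WordRAM.Expr WordRAM.Cmd

/-- Find a maximum in every row of the current matrix. -/
def rowMaxima : Cmd :=
  vk ::= 0 ;; whl (§vk ≺ §vq) (put aSC 0 §vk §vk ;; vk ::= §vk + 1) ;;
  put aLC 0 0 §vq ;; vl ::= 0 ;; vp ::= 1 ;; vql ::= §vq ;;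
  whl (0 ≺ §vql) (reduceLevel ;; vl ::= §vl + 1 ;; vp ::= §vp * 2 ;; vql ::= §vq / §vp) ;;
  whl (0 ≺ §vl) (vl ::= §vl - 1 ;; vp ::= §vp / 2 ;; vql ::= §vq / §vp ;; fillLevel)

/-- The reduced columns of the levels below `l` are available. -/
def Reduced (q : ℕ) (M : ℕ → ℕ → ℕ) (τ : Store) (l : ℕ) : Prop :=
  ∀ l' < l, Covers q M τ (l' + 1) l' ∧ τ.arr aLC (l' + 1) 0 ≤ q / 2 ^ l' ∧ 0 < q / 2 ^ l'

theorem Entries.agree {E : Env} {q : ℕ} {M : ℕ → ℕ → ℕ} {c : Cmd} {σ τ : Store}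
    (h : Entries E q M σ) (hA : Agree c σ τ)
    (hc : c.wv vi = false ∧ c.wv vj = false ∧ c.wv vrho = false ∧ c.wv vQ = false ∧
      c.wa aF = false ∧ c.wa aG = false) : Entries E q M τ :=
  h.of_eq (hA.v _ hc.1) (hA.v _ hc.2.1) (hA.v _ hc.2.2.1) (hA.v _ hc.2.2.2.1)
    (by rw [hA.a _ hc.2.2.2.2.1]) (hA.a _ hc.2.2.2.2.2)

theorem rowMaxima_spec {E : Env} {q : ℕ} {M : ℕ → ℕ → ℕ} {σ : Store} (hE : Entries E q M σ)
    (hvq : σ.var vq = q) (hq : 0 < q) :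
    wp E rowMaxima σ (fun t τ => t ≤ 16 * q ∧
      ∀ x < q, IsRowMax q M x (τ.arr aK x 0)) := by
  have hWB := hE.WB
  have hqW := hE.q_le
  simp only [rowMaxima, wp_seq, wp_set]
  refine ⟨by simp, ?_⟩
  refine wp_for q (fun k τ => ∀ x < k, τ.arr aSC 0 x = x) (fun _ => 0) (by simp) (by simp) ?_ ?_ ?_
  · intro k τ hA _
    exact ⟨by simp, (hA.v vq rfl).trans (by simpa using hvq)⟩
  · intro k τ hk hA hvk h
    simp [hvk, hE.live]
    refine ⟨by omega, by omega, fun x hx => ?_⟩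
    split
    · rename_i h; exact h.symm
    · exact h x (by omega)
  intro t₁ τ₁ hA₁ _ hSC ht₁
  have hE₁ : Entries E q M τ₁ := (hE.of_eq (τ := σ.set vk (eval σ 0)) (by simp) (by simp) (by simp) (by simp)
    (by simp) (by simp)).agree hA₁ (by decide)
  have hvq₁ : τ₁.var vq = q := (hA₁.v vq rfl).trans (by simpa using hvq)
  simp only [wp_put]
  refine ⟨by simp [hE.live]; omega, by simp, by simp, by simp, by simp, ?_⟩
  set τ₂ := (((τ₁.put aLC 0 0 q).set vl 0).set vp 1).set vql q with hτ₂
  have hE₂ : Entries E q M τ₂ := hE₁.of_eq (by simp [hτ₂]) (by simp [hτ₂]) (by simp [hτ₂])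
    (by simp [hτ₂]) (by simp [hτ₂]) (by simp [hτ₂])
  simp only [Store.put_var, Store.set_var, eval_var, eval_lit, hvq₁, Nat.reduceEqDiff, if_false]
  rw [← hτ₂]
  refine wp_whl (fun τ => ∃ l, τ.var vl = l ∧ τ.var vp = 2 ^ l ∧ τ.var vql = q / 2 ^ l ∧
      2 ^ l ≤ 2 * q ∧ Covers q M τ l l ∧ τ.arr aLC l 0 ≤ q ∧ Reduced q M τ l)
    -- A reduction costs at most twice the number of columns and leaves at most one column per row,
    -- while the next level has half as many rows; so the potential decays geometrically.
    (fun τ => 3 * (τ.arr aLC (τ.var vl) 0 + 2 * τ.var vql)) ?_ ?_ ?_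
  · refine ⟨0, by simp [hτ₂], by simp [hτ₂], by simp [hτ₂], by simp; omega, ⟨?_, ?_, ?_⟩,
      by simp [hτ₂], fun l' h => absurd h (Nat.not_lt_zero _)⟩
    · intro x hx
      have hx : x < q := by simpa [hτ₂] using hx
      simpa [hτ₂, hSC x hx] using hx
    · intro x x' hxx hx
      have hx : x' < q := by simpa [hτ₂] using hx
      simpa [hτ₂, hSC x' hx, hSC x (by omega)] using hxx
    · intro c _ _ y hy
      exact ⟨y, by simpa [hτ₂] using hy, by simp [hτ₂, hSC y hy]⟩
  · rintro τ hA ⟨l, i1, i2, i3, i4, i5, i6, i7⟩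
    have hEτ := hE₂.agree hA (by decide)
    have hvqτ : τ.var vq = q := (hA.v vq rfl).trans (by simpa [hτ₂] using hvq₁)
    refine ⟨by simp, fun hql => ?_⟩
    have hql : 0 < q / 2 ^ l := by simpa [i3] using hql
    have hl2 : l < 2 ^ l := Nat.lt_two_pow_self
    have hle : 2 ^ l ≤ q := by
      by_contra! h
      rw [Nat.div_eq_of_lt h] at hql
      omega
    rw [wp_seq]
    refine (reduceLevel_spec hEτ i1 (by omega) i2 i3 hql i5 i6).mono ?_
    rintro t υ hA' ⟨h1, h2, h3, h4⟩
    have f1 : υ.var vl = l := (hA'.v vl rfl).trans i1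
    have f2 : υ.var vp = 2 ^ l := (hA'.v vp rfl).trans i2
    have f3 : υ.var vq = q := (hA'.v vq rfl).trans hvqτ
    have hnc : 0 < τ.arr aLC l 0 := by
      obtain ⟨x, hx, _⟩ := i5.cover 1 one_pos hql 0 hq
      omega
    have hdiv : q / 2 ^ (l + 1) = q / 2 ^ l / 2 := by rw [pow_succ, Nat.div_div_eq_div_mul]
    have hqq : q / 2 ^ l ≤ q := Nat.div_le_self _ _
    simp only [wp_seq, wp_set]
    refine ⟨by simp [f1]; omega, by simp [f2]; omega, by simp, ⟨l + 1, by simp [f1],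
      by simp [f2, pow_succ], by simp [f2, f3, pow_succ], by rw [pow_succ]; omega,
      h2.succ.of_eq (by simp) (by simp), by simp; omega, ?_⟩, ?_⟩
    · intro l' hl'
      rcases Nat.lt_succ_iff_lt_or_eq.1 hl' with hl' | rfl
      · obtain ⟨k1, k2, k3⟩ := i7 l' hl'
        obtain ⟨e1, e2⟩ := h4 (l' + 1) (by omega)
        exact ⟨k1.of_eq (by simp [e1]) (by simp [e2]), by simpa [e1] using k2, k3⟩
      · exact ⟨h2.of_eq (by simp) (by simp), by simpa using h3, hql⟩
    · simp [f1, f2, f3, i1, i3, ← pow_succ]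
      omega
  rintro t₂ τ₃ hA₃ ⟨l, i1, i2, i3, i4, i5, i6, i7⟩ hql ht₂
  have hql : q / 2 ^ l = 0 := by simpa [i3] using hql
  have hE₃ := hE₂.agree hA₃ (by decide)
  have hvq₃ : τ₃.var vq = q := (hA₃.v vq rfl).trans (by simpa [hτ₂] using hvq₁)
  have ht₂' : t₂ ≤ 3 * (q + 2 * q) := by
    have : (τ₂.arr aLC (τ₂.var vl) 0) = q := by simp [hτ₂]
    have h2 : τ₂.var vql = q := by simp [hτ₂]
    rw [this, h2] at ht₂
    omega
  refine wp_whl (fun τ => ∃ l, τ.var vl = l ∧ τ.var vp = 2 ^ l ∧ 2 ^ l ≤ 2 * q ∧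
      Reduced q M τ l ∧ ∀ c, 0 < c → c ≤ q / 2 ^ l →
        IsRowMax q M (levelRow l c) (τ.arr aK (levelRow l c) 0))
    -- Filling a level costs at most twice its number of rows plus one iteration, and the number of
    -- rows at least doubles from one level to the next lower one.
    (fun τ => 6 * (q - q / 2 ^ τ.var vl)) ?_ ?_ ?_
  · exact ⟨l, i1, i2, i4, i7, fun c h1 h2 => by omega⟩
  · rintro τ hA ⟨l, j1, j2, j3, j4, j5⟩
    refine ⟨by simp, fun hl => ?_⟩
    obtain ⟨l, rfl⟩ : ∃ l', l = l' + 1 := ⟨l - 1, by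
      have : 0 < l := by simpa [j1] using hl
      omega⟩
    obtain ⟨k1, k2, k3⟩ := j4 l (Nat.lt_succ_self _)
    have hvqτ : τ.var vq = q := (hA.v vq rfl).trans hvq₃
    have hl2 : l + 1 < 2 ^ (l + 1) := Nat.lt_two_pow_self
    have hqq : q / 2 ^ l ≤ q := Nat.div_le_self _ _
    simp only [wp_seq, wp_set]
    refine ⟨by simp [j1], by simp, by simp, ?_⟩
    refine (fillLevel_spec (((hE₃.agree hA (by decide)).of_eq
      (τ := ((τ.set vl (eval τ (§vl - 1))).set vp (eval (τ.set vl (eval τ (§vl - 1))) (§vp / 2))).set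
        vql (eval ((τ.set vl (eval τ (§vl - 1))).set vp (eval (τ.set vl (eval τ (§vl - 1))) (§vp / 2)))
          (§vq / §vp))) (by simp) (by simp) (by simp)
      (by simp) (by simp) (by simp))) (l := l) (by simp [j1]) (by omega) (by simp [j2, pow_succ])
      (by simpa using hvqτ) (by simp [hvqτ, j2, pow_succ]) k3 (k1.of_eq (by simp) (by simp))
      (by simp; omega) (by simpa using j5)).mono ?_
    rintro t υ hA' ⟨h1, h2⟩
    have f1 : υ.var vl = l := (hA'.v vl rfl).trans (by simp [j1])
    have hdiv : q / 2 ^ (l + 1) = q / 2 ^ l / 2 := by rw [pow_succ, Nat.div_div_eq_div_mul]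
    refine ⟨⟨l, f1, (hA'.v vp rfl).trans (by simp [j2, pow_succ]), by rw [pow_succ] at j3; omega,
      fun l' hl' => ?_, h2⟩, ?_⟩
    · obtain ⟨g1, g2, g3⟩ := j4 l' (by omega)
      refine ⟨g1.of_eq (by rw [hA'.a aLC rfl]; simp) (by rw [hA'.a aSC rfl]; simp), ?_, g3⟩
      rw [hA'.a aLC rfl]
      simpa using g2
    · rw [f1, j1, hdiv]
      simp only [Store.set_arr] at h1
      omega
  · rintro t τ hA ⟨l, j1, j2, j3, j4, j5⟩ hl ht
    obtain rfl : l = 0 := by simpa [j1] using hl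
    refine ⟨?_, fun x hx => ?_⟩
    · simp only [sum_const_zero, add_zero] at ht₁
      rw [i1, hql] at ht
      omega
    · have := j5 (x + 1) (Nat.succ_pos _) (by simpa using hx)
      simpa [levelRow] using this

end WordRAM


namespace WordRAM
open WordRAM.Expr WordRAM.Cmd

/-! ### The items of one size -/

-- Indexed by the item size, `aCP` holds the number of copies in the greedy solution, `aE` the
-- sorted list of next best copies, and `aR` the number of greedy copies beyond the base. `aY` holds
-- the base and in the end the solution, indexed by items.
notation "aCP" => (11 : ℕ)
notation "aY" => (12 : ℕ)
notation "aE" => (13 : ℕ)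
notation "aR" => (15 : ℕ)
notation "vL" => (49 : ℕ)
notation "vs" => (50 : ℕ)
notation "vr" => (51 : ℕ)
notation "vpen" => (52 : ℕ)

/-- Move the solution `X` for row `row` to `Y` and reduce the multiplicities accordingly. -/
def takeBase : Cmd :=
  vlen ::= ld aCN §vrow 0 ;; vk ::= 0 ;;
  whl (§vk ≺ §vlen)
    (vid ::= ld aCL §vrow §vk ;; put aY §vid 0 (ld aX §vid 0) ;;
     put aMU §vid 0 (ld aMU §vid 0 - ld aX §vid 0) ;; vk ::= §vk + 1)

/-- List the items of row `row` with positive `X` and count their copies. -/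
def collect : Cmd :=
  vlen ::= ld aCN §vrow 0 ;; vL ::= 0 ;; vc ::= 0 ;; vk ::= 0 ;;
  whl (§vk ≺ §vlen)
    (vid ::= ld aCL §vrow §vk ;; vz ::= ld aX §vid 0 ;;
     ite (0 ≺ §vz) (put aA 0 §vc §vid ;; vc ::= §vc + 1 ;; vL ::= §vL + §vz) skip ;;
     vk ::= §vk + 1)

/-- Find the remaining copy of largest value. -/
def bestCopy : Cmd :=
  va ::= 0 ;; vx ::= 0 ;; vy ::= 0 ;;
  whl (§va ≺ §vc)
    (vid ::= ld aA 0 §va ;;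
     ite (0 ≺ ld aX §vid 0)
      (ite (§vy ≺ ld aV §vid 0 + 1) (vx ::= §vid ;; vy ::= ld aV §vid 0 + 1) skip) skip ;;
     va ::= §va + 1)

/-- List all copies in order of decreasing value. -/
def sortCopies : Cmd :=
  vk ::= 0 ;;
  whl (§vk ≺ §vL)
    (bestCopy ;; put aE §vrow §vk §vx ;; put aX §vx 0 (ld aX §vx 0 - 1) ;; vk ::= §vk + 1)

theorem takeBase_spec {E : Env} {I : Items} (hF : I.Fits E) {σ : Store} {r m : ℕ} {a : ℕ → ℕ}
    (hr : ListRow E I σ r m a) (hrow : σ.var vrow = r)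
    (hX : ∀ k < m, σ.arr aX (a k) 0 ≤ σ.arr aMU (a k) 0) :
    wp E takeBase σ (fun t τ => t ≤ m ∧ (∀ k < m, τ.arr aY (a k) 0 = σ.arr aX (a k) 0 ∧
        τ.arr aMU (a k) 0 = σ.arr aMU (a k) 0 - σ.arr aX (a k) 0) ∧
      ∀ i, (∀ k < m, a k ≠ i) → τ.arr aY i = σ.arr aY i ∧ τ.arr aMU i = σ.arr aMU i) := by
  have hWB := hF.WB
  have hnW := hF.n_lt
  have h0 := hr.row_lt
  have hle := hr.le
  simp only [takeBase, wp_seq, wp_set]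
  refine ⟨by simp [hF.live, hrow]; omega, by simp, ?_⟩
  refine wp_for m (fun k τ => (∀ x < k, τ.arr aY (a x) 0 = σ.arr aX (a x) 0 ∧
        τ.arr aMU (a x) 0 = σ.arr aMU (a x) 0 - σ.arr aX (a x) 0) ∧
      (∀ i, (∀ x < k, a x ≠ i) → τ.arr aY i = σ.arr aY i ∧ τ.arr aMU i = σ.arr aMU i))
    (fun _ => 0) (by simp) (by simp) ?_ ?_ ?_
  · intro k τ hA _
    exact ⟨by simp, (hA.v vlen rfl).trans (by simp [hrow, hr.len])⟩
  · rintro k τ hk hA hvk ⟨h1, h2⟩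
    have e1 : τ.var vrow = r := (hA.v vrow rfl).trans (by simpa using hrow)
    have hak := hr.lt k hk
    have e2 : τ.arr aCL r k = a k := by rw [hA.a aCL rfl]; exact hr.elem k hk
    have e3 : τ.arr aX = σ.arr aX := (hA.a aX rfl).trans (by simp)
    have hne : ∀ x < k, a x ≠ a k := fun x hx h => by
      have := hr.inj x (by omega) k hk h; omega
    have e4 : τ.arr aMU (a k) 0 = σ.arr aMU (a k) 0 := by rw [(h2 (a k) hne).2]
    have := hX k hk
    simp [e1, e2, e3, hvk, hF.live]
    refine ⟨by omega, by omega, by omega, by omega, fun x hx => ?_, fun i hi => ?_⟩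
    · by_cases hxk : x = k
      · subst hxk; simp [e4]
      · have := hne x (by omega)
        simpa [this] using h1 x (by omega)
    · have hik : i ≠ a k := Ne.symm (hi k le_rfl)
      obtain ⟨g1, g2⟩ := h2 i fun x hx => hi x (by omega)
      simp [hik, g1, g2]
  · rintro t τ hA _ ⟨h1, h2⟩ ht
    exact ⟨by simpa using ht, h1, h2⟩

theorem collect_spec {E : Env} {I : Items} (hF : I.Fits E) {σ : Store} {r m : ℕ} {a : ℕ → ℕ}
    (hr : ListRow E I σ r m a) (hrow : σ.var vrow = r)
    (hX : ∑ k ∈ range m, σ.arr aX (a k) 0 < E.B) :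
    wp E collect σ (fun t τ => t ≤ m ∧ τ.var vL = ∑ k ∈ range m, σ.arr aX (a k) 0 ∧
      τ.var vc ≤ τ.var vL ∧ τ.var vc ≤ m ∧
      IsFilter (fun i => 0 < σ.arr aX i 0) m a (τ.var vc) (τ.arr aA 0)) := by
  have hWB := hF.WB
  have hnW := hF.n_lt
  have h0 := hr.row_lt
  have hle := hr.le
  simp only [collect, wp_seq, wp_set]
  refine ⟨by simp [hF.live, hrow]; omega, by simp, by simp, by simp, ?_⟩
  refine wp_for m (fun k τ => τ.var vL = ∑ k ∈ range k, σ.arr aX (a k) 0 ∧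
      τ.var vc ≤ τ.var vL ∧ τ.var vc ≤ k ∧
      IsFilter (fun i => 0 < σ.arr aX i 0) k a (τ.var vc) (τ.arr aA 0))
    (fun _ => 0) (by simp) ?_ ?_ ?_ ?_
  · exact ⟨by simp, by simp, by simp, by simpa using IsFilter.zero _ a _⟩
  · intro k τ hA _
    exact ⟨by simp, (hA.v vlen rfl).trans (by simp [hrow, hr.len])⟩
  · rintro k τ hk hA hvk ⟨h1, h2, h3, h4⟩
    have e1 : τ.var vrow = r := (hA.v vrow rfl).trans (by simpa using hrow)
    have hak := hr.lt k hk
    have e2 : τ.arr aCL r k = a k := by rw [hA.a aCL rfl]; exact hr.elem k hk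
    have e3 : τ.arr aX = σ.arr aX := (hA.a aX rfl).trans (by simp)
    have b : ∑ x ∈ range (k + 1), σ.arr aX (a x) 0 ≤ ∑ x ∈ range m, σ.arr aX (a x) 0 :=
      sum_le_sum_of_subset (range_subset_range.2 hk)
    rw [sum_range_succ] at b
    rcases Nat.eq_zero_or_pos (σ.arr aX (a k) 0) with hz | hz
    · simp [e1, e2, e3, hvk, hF.live, hz, sum_range_succ, h1]
      exact ⟨by omega, by omega, by omega, by omega, by omega, h4.neg (by omega)⟩
    · simp [e1, e2, e3, hvk, hF.live, hz, hz.ne', sum_range_succ, h1]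
      refine ⟨by omega, by omega, by omega, by omega, by omega, by omega, by omega, by omega,
        h4.pos hz (fun x hx => ?_) (by simp)⟩
      have : x ≠ τ.var vc := hx.ne
      simp [this]
  · rintro t τ hA _ ⟨h1, h2, h3, h4⟩ ht
    exact ⟨by simpa using ht, h1, h2, h3, h4⟩

theorem bestCopy_spec {E : Env} {I : Items} (hF : I.Fits E) {σ : Store} (hI : I.In σ) {c : ℕ}
    {A : ℕ → ℕ} (hc : σ.var vc = c) (hcW : c < E.W) (hA : ∀ k < c, σ.arr aA 0 k = A k)
    (hAn : ∀ k < c, A k < I.n) (hv : ∀ i < I.n, I.v i + 1 < E.B)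
    (hex : ∃ k < c, 0 < σ.arr aX (A k) 0) :
    wp E bestCopy σ (fun t τ => t ≤ c ∧ (∃ k < c, τ.var vx = A k) ∧
      0 < σ.arr aX (τ.var vx) 0 ∧
      ∀ k < c, 0 < σ.arr aX (A k) 0 → I.v (A k) ≤ I.v (τ.var vx)) := by
  have hWB := hF.WB
  have hnW := hF.n_lt
  simp only [bestCopy, wp_seq, wp_set]
  refine ⟨by simp, by simp, by simp, ?_⟩
  -- `vy` is one more than the best value so far, so `0` means that nothing has been found, even if
  -- there are items of value `0`.
  refine wp_for c (fun k τ => (τ.var vy = 0 ∧ ∀ q < k, σ.arr aX (A q) 0 = 0) ∨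
      (τ.var vy = I.v (τ.var vx) + 1 ∧ (∃ k < c, τ.var vx = A k) ∧ 0 < σ.arr aX (τ.var vx) 0 ∧
        ∀ q < k, 0 < σ.arr aX (A q) 0 → I.v (A q) ≤ I.v (τ.var vx)))
    (fun _ => 0) (by simp) (by simp) ?_ ?_ ?_
  · intro k τ hA _
    exact ⟨by simp, (hA.v vc rfl).trans (by simp [hc])⟩
  · intro k τ hk hB hvk h
    have hak := hAn k hk
    have e1 : τ.arr aA 0 k = A k := by rw [hB.a aA rfl]; exact hA k hk
    have e3 : τ.arr aX = σ.arr aX := (hB.a aX rfl).trans (by simp)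
    have e4 : τ.arr aV (A k) 0 = I.v (A k) := by rw [hB.a aV rfl]; exact hI.V _ hak
    have hvk' := hv _ hak
    have hsucc : ∀ q, q < k + 1 → q < k ∨ q = k := fun q h => by omega
    rcases Nat.eq_zero_or_pos (σ.arr aX (A k) 0) with hz | hz
    · have hQ : (τ.var vy = 0 ∧ ∀ q < k + 1, σ.arr aX (A q) 0 = 0) ∨
          (τ.var vy = I.v (τ.var vx) + 1 ∧ (∃ k < c, τ.var vx = A k) ∧
            0 < σ.arr aX (τ.var vx) 0 ∧
            ∀ q < k + 1, 0 < σ.arr aX (A q) 0 → I.v (A q) ≤ I.v (τ.var vx)) := by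
        rcases h with ⟨h1, h2⟩ | ⟨h1, h2, h3, h4⟩
        · left
          refine ⟨h1, fun q hq => ?_⟩
          rcases hsucc q hq with hq | rfl
          exacts [h2 q hq, hz]
        · right
          refine ⟨h1, h2, h3, fun q hq hq0 => ?_⟩
          rcases hsucc q hq with hq | rfl
          exacts [h4 q hq hq0, by omega]
      simp only [wp_seq, wp_set, wp_ite, wp_skip]
      refine ⟨by simp [hF.live, hvk]; omega, by simp [hF.live, hvk, e1]; omega,
        fun h => by simp [hvk, e1, e3, hz] at h, fun _ => ⟨by simp [hvk]; omega, by simp [hvk],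
        by simpa using hQ, by simp⟩⟩
    · simp only [wp_seq, wp_set, wp_ite, wp_skip]
      refine ⟨by simp [hF.live, hvk]; omega, by simp [hF.live, hvk, e1]; omega,
        fun _ => ⟨by simp [hF.live, hvk, e1, e4]; omega, fun hlt => ?_, fun hlt => ?_⟩,
        fun h => by simp [hvk, e1, e3, hz] at h⟩
      · have hlt : τ.var vy < I.v (A k) + 1 := by simpa [hvk, e1, e4] using hlt
        refine ⟨by simp, by simp [hF.live, hvk, e1, e4]; omega, by simp [hvk]; omega,
          by simp [hvk], Or.inr ⟨by simp [hvk, e1, e4], ⟨k, hk, by simp [hvk, e1]⟩,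
          by simpa [hvk, e1] using hz, fun q hq hq0 => ?_⟩, by simp⟩
        simp [hvk, e1]
        rcases hsucc q hq with hq | rfl
        · rcases h with ⟨h1, h2⟩ | ⟨h1, h2, h3, h4⟩
          · have := h2 q hq; omega
          · have := h4 q hq hq0; omega
        · exact le_rfl
      · have hlt : I.v (A k) + 1 ≤ τ.var vy := by simpa [hvk, e1, e4] using hlt
        refine ⟨by simp [hvk]; omega, by simp [hvk], Or.inr ?_, by simp⟩
        rcases h with ⟨h1, h2⟩ | ⟨h1, h2, h3, h4⟩
        · omega
        · refine ⟨by simpa using h1, by simpa using h2, by simpa using h3, fun q hq hq0 => ?_⟩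
          simp
          rcases hsucc q hq with hq | rfl
          · exact h4 q hq hq0
          · omega
  · intro t τ hA _ h ht
    refine ⟨by simpa using ht, ?_⟩
    rcases h with ⟨_, h⟩ | ⟨_, h⟩
    · obtain ⟨k, hk, h1⟩ := hex
      have := h k hk
      omega
    · exact h

end WordRAM


/-- Test the multiset identity with the indicator of the element. -/
theorem IsFilter.exists_eq {p : ℕ → Prop} [DecidablePred p] {m m' : ℕ} {a a' : ℕ → ℕ}
    (h : IsFilter p m a m' a') {k : ℕ} (hk : k < m) (hp : p (a k)) : ∃ k' < m', a' k' = a k := by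
  by_contra! hne
  have h1 := h.sum fun i => if i = a k then 1 else 0
  rw [sum_eq_zero fun x hx => if_neg (hne x (mem_range.1 hx)), eq_comm, sum_eq_zero_iff] at h1
  simpa [hp] using h1 k (mem_range.2 hk)

namespace WordRAM
open WordRAM.Expr WordRAM.Cmd

theorem copies_congr {e e' : ℕ → ℕ} {k : ℕ} (h : ∀ x < k, e x = e' x) (i : ℕ) :
    copies e k i = copies e' k i :=
  sum_congr rfl fun x hx => by rw [h x (mem_range.1 hx)]

/-- The copies counted by `X₀` have been moved to the list `e` of length `k` except for those
counted by `X`. -/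
structure Sorted (I : Items) (X₀ X : ℕ → ℕ) (m : ℕ) (a : ℕ → ℕ) (k : ℕ) (e : ℕ → ℕ) : Prop where
  count : ∀ q < m, X (a q) + copies e k (a q) = X₀ (a q)
  mem : ∀ x < k, ∃ q < m, e x = a q
  le : ∀ x < k, ∀ q < m, 0 < X (a q) → I.v (a q) ≤ I.v (e x)
  anti : ∀ x x', x ≤ x' → x' < k → I.v (e x') ≤ I.v (e x)

namespace Sorted
variable {I : Items} {X₀ X : ℕ → ℕ} {m : ℕ} {a : ℕ → ℕ} {k : ℕ} {e : ℕ → ℕ}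

theorem sum_eq (h : Sorted I X₀ X m a k e) (inj : ∀ x < m, ∀ x' < m, a x = a x' → x = x') :
    ∑ q ∈ range m, X (a q) + k = ∑ q ∈ range m, X₀ (a q) := by
  have h2 := sum_mul_copies (fun _ => 1) inj h.mem
  simp only [one_mul, sum_const, card_range, smul_eq_mul, mul_one] at h2
  rw [← sum_congr rfl fun q hq => h.count q (mem_range.1 hq), sum_add_distrib, h2]

/-- Every remaining copy is worth at most every listed one, so appending a best remaining copy keeps
the list in order. -/
theorem step (h : Sorted I X₀ X m a k e) {i : ℕ} (hi : ∃ q < m, i = a q) (h0 : 0 < X i)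
    (hmax : ∀ q < m, 0 < X (a q) → I.v (a q) ≤ I.v i) {X' e' : ℕ → ℕ}
    (hX : ∀ x, X' x = if x = i then X i - 1 else X x)
    (he : ∀ x, e' x = if x = k then i else e x) : Sorted I X₀ X' m a (k + 1) e' := by
  have he' : ∀ x < k, e' x = e x := fun x hx => by rw [he, if_neg hx.ne]
  have hk : e' k = i := by rw [he, if_pos rfl]
  have hX' : ∀ x, 0 < X' x → 0 < X x := by
    intro x hx
    rw [hX] at hx
    split_ifs at hx with h1
    · rw [h1]; exact h0
    · exact hx
  refine ⟨fun q hq => ?_, fun x hx => ?_, fun x hx q hq hpos => ?_, fun x x' hx hx' => ?_⟩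
  · rw [copies_succ, copies_congr he', hX, hk]
    have := h.count q hq
    split_ifs with h1 h2 h2
    · rw [h1] at this ⊢; omega
    · exact absurd h1.symm h2
    · exact absurd h2.symm h1
    · omega
  · rcases Nat.lt_succ_iff_lt_or_eq.1 hx with h1 | rfl
    · rw [he' x h1]; exact h.mem x h1
    · rw [hk]; exact hi
  · rcases Nat.lt_succ_iff_lt_or_eq.1 hx with h1 | rfl
    · rw [he' x h1]; exact h.le x h1 q hq (hX' _ hpos)
    · rw [hk]; exact hmax q hq (hX' _ hpos)
  · rcases Nat.lt_succ_iff_lt_or_eq.1 hx' with h1 | rfl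
    · rw [he' x' h1, he' x (by omega)]; exact h.anti x x' hx h1
    · rw [hk]
      rcases Nat.lt_or_eq_of_le hx with h1 | rfl
      · obtain ⟨q, hq, rfl⟩ := hi
        rw [he' x h1]; exact h.le x h1 q hq h0
      · rw [hk]

end Sorted

/-- Selection sort, quadratic in the length of the list. The lists have at most `2 * s` entries, so
this stays within `O(s ^ 2)` per size. -/
theorem sortCopies_spec {E : Env} {I : Items} (hF : I.Fits E) {σ : Store} (hI : I.In σ)
    {r m L c : ℕ} {a A : ℕ → ℕ} (hrow : σ.var vrow = r) (hrW : r < E.W)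
    (hL : σ.var vL = L) (hLW : L + 2 < E.W) (hc : σ.var vc = c) (hcL : c ≤ L)
    (inj : ∀ x < m, ∀ x' < m, a x = a x' → x = x') (han : ∀ q < m, a q < I.n)
    (hA : IsFilter (fun i => 0 < σ.arr aX i 0) m a c A) (hA' : σ.arr aA 0 = A)
    (hsum : ∑ q ∈ range m, σ.arr aX (a q) 0 = L) (hv : ∀ i < I.n, I.v i + 1 < E.B) :
    wp E sortCopies σ (fun t τ => t ≤ L + L * L ∧
      Sorted I (fun i => σ.arr aX i 0) (fun i => τ.arr aX i 0) m a L (τ.arr aE r) ∧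
      ∀ i ≠ r, τ.arr aE i = σ.arr aE i) := by
  have hWB := hF.WB
  have hnW := hF.n_lt
  simp only [sortCopies, wp_seq, wp_set]
  refine ⟨by simp, ?_⟩
  refine wp_for L (fun k τ =>
      Sorted I (fun i => σ.arr aX i 0) (fun i => τ.arr aX i 0) m a k (τ.arr aE r) ∧
      ∀ i ≠ r, τ.arr aE i = σ.arr aE i) (fun _ => L) (by simp) ?_ ?_ ?_ ?_
  · exact ⟨⟨fun q hq => by simp [copies], by simp, by simp, by simp⟩, by simp⟩
  · intro k τ hB _
    exact ⟨by simp, (hB.v vL rfl).trans (by simp [hL])⟩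
  · rintro k τ hk hB hvk ⟨h1, h2⟩
    have hAm : ∀ x < c, ∃ q < m, A x = a q := fun x hx => (hA.mem x hx).2
    have h3 := h1.sum_eq inj
    rw [hsum] at h3
    have hall : ∀ q < m, 0 < τ.arr aX (a q) 0 → ∃ x < c, A x = a q := by
      intro q hq hp
      have := h1.count q hq
      exact hA.exists_eq hq (by omega)
    rw [wp_seq]
    refine (bestCopy_spec hF (hI.of_eq (hB.a aS rfl) (hB.a aV rfl)) (c := c) (A := A)
      ((hB.v vc rfl).trans (by simp [hc])) (by omega)
      (fun k _ => by rw [hB.a aA rfl]; simp [hA']) ?_ hv ?_).mono ?_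
    · intro x hx
      obtain ⟨q, hq, h⟩ := hAm x hx
      rw [h]; exact han q hq
    · by_contra! hne
      have : ∑ q ∈ range m, τ.arr aX (a q) 0 = 0 := by
        refine sum_eq_zero fun q hq => ?_
        by_contra h0
        obtain ⟨x, hx, h⟩ := hall q (mem_range.1 hq) (Nat.pos_of_ne_zero h0)
        have := hne x hx
        rw [h] at this
        omega
      omega
    · rintro t υ hC ⟨ht, ⟨x, hx, hvx⟩, hpos, hbest⟩
      obtain ⟨q, hq, hxq⟩ := hAm x hx
      have hlt := han q hq
      rw [← hxq, ← hvx] at hlt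
      have e1 : υ.var vrow = r := by
        rw [hC.v vrow rfl, hB.v vrow rfl]; simpa using hrow
      have e2 : υ.var vk = k := (hC.v vk rfl).trans hvk
      have e3 : υ.arr aX = τ.arr aX := hC.a aX rfl
      have e4 : υ.arr aE = τ.arr aE := hC.a aE rfl
      have hS := h1.step (i := υ.var vx) ⟨q, hq, by rw [hvx, hxq]⟩ hpos (fun q hq hp => by
        obtain ⟨x, hx, h⟩ := hall q hq hp
        rw [← h] at hp ⊢
        exact hbest x hx hp)
        (X' := fun x => if x = υ.var vx then τ.arr aX (υ.var vx) 0 - 1 else τ.arr aX x 0)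
        (e' := fun x => if x = k then υ.var vx else τ.arr aE r x) (fun _ => rfl) (fun _ => rfl)
      simp [e1, e2, e3, e4, hF.live]
      refine ⟨⟨by omega, by omega⟩, ⟨by omega, by omega⟩, ⟨⟨by omega, by omega⟩, by omega⟩, by omega,
        ⟨?_, ?_⟩, by omega⟩
      · exact hS
      · intro i hi
        simp [hi, h2 i hi]
  · rintro t τ hB _ ⟨h1, h2⟩ ht
    exact ⟨by simpa using ht, h1, h2⟩

theorem Sorted.eq_copies {I : Items} {X₀ X : ℕ → ℕ} {m L : ℕ} {a e : ℕ → ℕ}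
    (h : Sorted I X₀ X m a L e) (inj : ∀ x < m, ∀ x' < m, a x = a x' → x = x')
    (hL : ∑ q ∈ range m, X₀ (a q) = L) : ∀ q < m, X₀ (a q) = copies e L (a q) := by
  intro q hq
  have h1 := h.sum_eq inj
  have h2 : ∑ q ∈ range m, X (a q) = 0 := by omega
  have h3 := sum_eq_zero_iff.1 h2 q (mem_range.2 hq)
  have := h.count q hq
  omega

end WordRAM


namespace WordRAM
open WordRAM.Expr WordRAM.Cmd

theorem IsGreedy.congr {I : Items} {mu mu' : ℕ → ℕ} {m : ℕ} {a : ℕ → ℕ} {cap : ℕ} {X X' : ℕ → ℕ}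
    (h : IsGreedy I mu m a cap X) (hmu : ∀ k < m, mu' (a k) = mu (a k))
    (hX : ∀ k < m, X' (a k) = X (a k)) : IsGreedy I mu' m a cap X' := by
  have hs : ∑ k ∈ range m, I.sz (a k) * X' (a k) = ∑ k ∈ range m, I.sz (a k) * X (a k) :=
    sum_congr rfl fun k hk => by rw [hX k (mem_range.1 hk)]
  obtain ⟨p, q, hq, hthr⟩ := h.thr
  refine ⟨⟨p, q, hq, fun k hk => ?_⟩, fun k hk => ?_, by rw [hs]; exact h.sum_le, ?_⟩
  · rw [hX k hk, hmu k hk]; exact hthr k hk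
  · rw [hX k hk, hmu k hk]; exact h.le k hk
  · rw [hs]
    refine h.full.imp (fun h k hk => ?_) id
    rw [hX k hk, hmu k hk]; exact h k hk

/-- Fix the base copies of the items listed in row `row` and list the next best copies. -/
def classItems : Cmd :=
  vz ::= ld aCP §vrow 0 ;;
  ite (§vz ≼ §vs) (vr ::= §vz ;; vgc ::= 0) (vr ::= §vs ;; vgc ::= §vrow * (§vz - §vs)) ;;
  put aR §vrow 0 §vr ;; greedy ;; takeBase ;; vgc ::= §vrow * (2 * §vs) ;;
  greedy ;; collect ;; sortCopies

/-- All items of the class have size `j`, so the greedy algorithm with capacity `j * (P - s)`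
selects the base, and run again on what is left, with capacity `j * (2 * s)`, the next best copies,
in time linear in the length of the class list. Only these copies are sorted. -/
theorem classItems_spec {E : Env} {I : Items} (hF : I.Fits E) {σ : Store} (hI : I.In σ)
    {mu : ℕ → ℕ} (hmu : I.Mult mu σ) {j m s P : ℕ} {a : ℕ → ℕ} (hr : ListRow E I σ j m a)
    (hrow : σ.var vrow = j) (hs : σ.var vs = s) (hP : σ.arr aCP j 0 = P) (hj : 0 < j)
    (hsz : ∀ k < m, I.sz (a k) = j) (hsW : 2 * s + 2 < E.W) (hjs : j * (2 * s) < E.B)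
    (hjP : j * (P - s) < E.B) (hB : ∑ k ∈ range m, I.sz (a k) * mu (a k) < E.B)
    (hv : ∀ i < I.n, I.v i + 1 < E.B) :
    wp E classItems σ (fun t τ => t ≤ 408 * m + 2 + 2 * s + 2 * s * (2 * s) ∧
      ClassData I mu (fun i => τ.arr aY i 0) s P j m a (τ.var vL) (τ.arr aE j) ∧
      τ.var vr = min P s ∧ τ.var vL ≤ 2 * s ∧ τ.arr aR j 0 = min P s ∧
      (∀ i, (∀ k < m, a k ≠ i) → τ.arr aY i = σ.arr aY i ∧ τ.arr aMU i = σ.arr aMU i) ∧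
      ∀ i ≠ j, τ.arr aE i = σ.arr aE i ∧ τ.arr aR i = σ.arr aR i) := by
  have hWB := hF.WB
  have hnW := hF.n_lt
  have h0 := hr.row_lt
  have hle := hr.le
  -- What follows is common to the cases `P ≤ s` and `s < P`, which the program distinguishes
  -- because it may not subtract below zero.
  have main : ∀ σ₁ : Store, Agree classItems σ σ₁ → σ₁.arr aMU = σ.arr aMU →
      σ₁.arr aY = σ.arr aY → σ₁.arr aE = σ.arr aE → σ₁.var vr = min P s →
      σ₁.var vgc = j * (P - s) → (∀ i ≠ j, σ₁.arr aR i = σ.arr aR i) →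
      σ₁.arr aR j 0 = min P s →
      wp E (greedy ;; takeBase ;; vgc ::= §vrow * (2 * §vs) ;; greedy ;; collect ;; sortCopies) σ₁
        (fun t τ => t ≤ 408 * m + 2 + 2 * s + 2 * s * (2 * s) ∧
        ClassData I mu (fun i => τ.arr aY i 0) s P j m a (τ.var vL) (τ.arr aE j) ∧
        τ.var vr = min P s ∧ τ.var vL ≤ 2 * s ∧ τ.arr aR j 0 = min P s ∧
        (∀ i, (∀ k < m, a k ≠ i) → τ.arr aY i = σ.arr aY i ∧ τ.arr aMU i = σ.arr aMU i) ∧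
        ∀ i ≠ j, τ.arr aE i = σ.arr aE i ∧ τ.arr aR i = σ.arr aR i) := by
    intro σ₁ hA hMU hY hE hvr hgc hR hRj
    have g1 : ListRow E I σ₁ j m a := hr.of_eq (hA.a aCN rfl) (hA.a aCL rfl)
    have g2 : I.In σ₁ := hI.of_eq (hA.a aS rfl) (hA.a aV rfl)
    have g3 : σ₁.var vrow = j := (hA.v vrow rfl).trans hrow
    have g4 : σ₁.var vs = s := (hA.v vs rfl).trans hs
    rw [wp_seq]
    refine (greedy_spec hF g2 (hmu.of_eq hMU) g1 g3 hgc hjP hB).mono ?_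
    rintro t₁ τ₁ hA₁ ⟨ht₁, -, hG₁, -⟩
    have e1 : ∀ k < m, τ₁.arr aMU (a k) 0 = mu (a k) := fun k hk => by
      rw [hA₁.a aMU rfl, hMU, hmu.M _ (hr.lt k hk)]
    have g5 : ListRow E I τ₁ j m a := g1.of_eq (hA₁.a aCN rfl) (hA₁.a aCL rfl)
    rw [wp_seq]
    refine (takeBase_spec hF g5 ((hA₁.v vrow rfl).trans g3) fun k hk => ?_).mono ?_
    · rw [e1 k hk]; exact hG₁.le k hk
    rintro t₂ τ₂ hA₂ ⟨ht₂, hb, hfr⟩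
    rw [wp_seq, wp_set]
    have e2 : τ₂.var vrow = j := (hA₂.v vrow rfl).trans ((hA₁.v vrow rfl).trans g3)
    have e3 : τ₂.var vs = s := (hA₂.v vs rfl).trans ((hA₁.v vs rfl).trans g4)
    refine ⟨by simp [e2, e3]; omega, ?_⟩
    have hmu2 : ∀ k < m, τ₂.arr aMU (a k) 0 = mu (a k) - τ₂.arr aY (a k) 0 := fun k hk => by
      rw [(hb k hk).1, (hb k hk).2, e1 k hk]
    rw [wp_seq]
    refine (greedy_spec hF (σ := τ₂.set vgc _) (mu := fun i => τ₂.arr aMU i 0) (r := j) (m := m) (a := a)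
      (cap := j * (2 * s)) ?_ ⟨fun _ _ => rfl⟩ ?_ ?_ ?_ hjs ?_).mono ?_
    · exact g2.of_eq ((hA₂.a aS rfl).trans (hA₁.a aS rfl)) ((hA₂.a aV rfl).trans (hA₁.a aV rfl))
    · exact g5.of_eq (hA₂.a aCN rfl) (hA₂.a aCL rfl)
    · simp [e2]
    · simp [e2, e3]
    · refine lt_of_le_of_lt (sum_le_sum fun k hk => Nat.mul_le_mul_left _ ?_) hB
      rw [hmu2 k (mem_range.1 hk)]; omega
    rintro t₃ τ₃ hA₃ ⟨ht₃, -, hG₃, -⟩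
    have hcard := hG₃.card_eq hj hsz
    have e4 : τ₃.var vrow = j := (hA₃.v vrow rfl).trans (by simp [e2])
    have g6 : ListRow E I τ₃ j m a := (g5.of_eq (hA₂.a aCN rfl) (hA₂.a aCL rfl)).of_eq
      (hA₃.a aCN rfl) (hA₃.a aCL rfl)
    rw [wp_seq]
    refine (collect_spec hF g6 e4 ?_).mono ?_
    · rw [hcard]; omega
    rintro t₄ τ₄ hA₄ ⟨ht₄, hL, hc, hcm, hfil⟩
    have e5 : τ₄.arr aX = τ₃.arr aX := hA₄.a aX rfl
    have hL2 : τ₄.var vL ≤ 2 * s := by rw [hL, hcard]; omega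
    rw [← e5] at hL hfil
    refine (sortCopies_spec hF (a := a) (m := m)
      (((g2.of_eq ((hA₂.a aS rfl).trans (hA₁.a aS rfl))
        ((hA₂.a aV rfl).trans (hA₁.a aV rfl))).of_eq (hA₃.a aS rfl) (hA₃.a aV rfl)).of_eq
        (hA₄.a aS rfl) (hA₄.a aV rfl))
      ((hA₄.v vrow rfl).trans e4) h0 rfl (by omega) rfl hc hr.inj hr.lt hfil rfl hL.symm hv).mono ?_
    rintro t₅ τ₅ hA₅ ⟨ht₅, hS, hfrE⟩
    have eY : τ₅.arr aY = τ₂.arr aY := by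
      rw [hA₅.a aY rfl, hA₄.a aY rfl, hA₃.a aY rfl]; simp
    have eMU : τ₅.arr aMU = τ₂.arr aMU := by
      rw [hA₅.a aMU rfl, hA₄.a aMU rfl, hA₃.a aMU rfl]; simp
    have eR : τ₅.arr aR = σ₁.arr aR := by
      rw [hA₅.a aR rfl, hA₄.a aR rfl, hA₃.a aR rfl, ← hA₁.a aR rfl, ← hA₂.a aR rfl]; simp
    have eE : τ₄.arr aE = σ.arr aE := by
      rw [hA₄.a aE rfl, hA₃.a aE rfl, ← hE, ← hA₁.a aE rfl, ← hA₂.a aE rfl]; simp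
    have er : τ₅.var vr = min P s := by
      rw [hA₅.v vr rfl, hA₄.v vr rfl, hA₃.v vr rfl, ← hvr, ← hA₁.v vr rfl, ← hA₂.v vr rfl]; simp
    have eL : τ₅.var vL = τ₄.var vL := hA₅.v vL rfl
    rw [eL]
    refine ⟨?_, ⟨hr.inj, hsz, ?_, ⟨fun i => τ₄.arr aX i 0, ?_, hS.eq_copies hr.inj hL.symm⟩,
      hS.mem, hS.anti⟩, er, hL2, by rw [eR, hRj], fun i hi => ?_, fun i hi => ?_⟩
    · have : τ₄.var vL * τ₄.var vL ≤ 2 * s * (2 * s) := Nat.mul_le_mul hL2 hL2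
      omega
    · refine hG₁.congr (fun _ _ => rfl) fun k hk => ?_
      simp only [eY]; exact (hb k hk).1
    · refine hG₃.congr (fun k hk => ?_) fun k hk => ?_
      · simp only [eY]; exact (hmu2 k hk).symm
      · simp only [e5]
    · rw [eY, eMU, (hfr i hi).1, (hfr i hi).2, hA₁.a aY rfl, hA₁.a aMU rfl, hY, hMU]
      exact ⟨rfl, rfl⟩
    · rw [hfrE i hi, eE, eR, hR i hi]
      exact ⟨rfl, rfl⟩
  rw [classItems, wp_seq, wp_set, wp_seq, wp_ite]
  refine ⟨by simp [hF.live, hrow]; omega, by simp, fun h => ?_, fun h => ?_⟩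
  · have h : P ≤ s := by simpa [hrow, hP, hs] using h
    have e : P - s = 0 := by omega
    rw [wp_seq, wp_set, wp_set]
    refine ⟨by simp, by simp, ?_⟩
    rw [wp_seq, wp_put]
    refine ⟨by simp [hF.live, hrow]; omega, by simp, (main _ ⟨fun x hx => ?_, fun x hx => ?_⟩
      (by simp) (by simp) (by simp) ?_ ?_ ?_ ?_).mono fun t τ _ h => ?_⟩
    · have h1 : x ≠ vz := by rintro rfl; exact absurd hx (by decide)
      have h2 : x ≠ vr := by rintro rfl; exact absurd hx (by decide)
      have h3 : x ≠ vgc := by rintro rfl; exact absurd hx (by decide)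
      simp [h1, h2, h3]
    · have h1 : x ≠ aR := by rintro rfl; exact absurd hx (by decide)
      simp [h1]
    · simp [hrow, hP, h]
    · simp [e]
    · intro i hi; simp [hi, hrow]
    · simp [hrow, hP, h]
    · simpa using h
  · have h : s < P := by simpa [hrow, hP, hs] using h
    rw [wp_seq, wp_set, wp_set]
    refine ⟨by simp, by simp [hrow, hP, hs]; omega, ?_⟩
    rw [wp_seq, wp_put]
    refine ⟨by simp [hF.live, hrow]; omega, by simp, (main _ ⟨fun x hx => ?_, fun x hx => ?_⟩
      (by simp) (by simp) (by simp) ?_ ?_ ?_ ?_).mono fun t τ _ h => ?_⟩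
    · have h1 : x ≠ vz := by rintro rfl; exact absurd hx (by decide)
      have h2 : x ≠ vr := by rintro rfl; exact absurd hx (by decide)
      have h3 : x ≠ vgc := by rintro rfl; exact absurd hx (by decide)
      simp [h1, h2, h3]
    · have h1 : x ≠ aR := by rintro rfl; exact absurd hx (by decide)
      simp [h1]
    · simp [hs, h.le]
    · simp [hrow, hP, hs]
    · intro i hi; simp [hi, hrow]
    · simp [hrow, hs, h.le]
    · simpa using h

end WordRAM


namespace WordRAM
open WordRAM.Expr WordRAM.Cmd

/-! ### One step of the dynamic program -/

notation "aCH" => (18 : ℕ)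

/-- Tabulate the gains of the current class. -/
def gainTable : Cmd :=
  vQ ::= 2 * (§vs * §vs) / §vj + 1 ;; put aG 0 0 (2 * §vQ * §vpen) ;; vk ::= 0 ;;
  whl (§vk ≺ 2 * §vQ)
    (ite (§vk + §vr ≺ §vQ) (vw ::= ld aG §vk 0 + §vpen)
      (ite (§vk + §vr - §vQ ≺ §vL)
        (vw ::= ld aG §vk 0 + ld aV (ld aE §vj (§vk + §vr - §vQ)) 0)
        (vw ::= ld aG §vk 0 - §vpen)) ;;
     put aG (§vk + 1) 0 §vw ;; vk ::= §vk + 1)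

theorem gainTable_spec {E : Env} {I : Items} (hF : I.Fits E) {σ : Store} (hI : I.In σ)
    {s j Q r L pen : ℕ} {e : ℕ → ℕ} (hs : σ.var vs = s) (hj : σ.var vj = j) (hr : σ.var vr = r)
    (hL : σ.var vL = L) (hpen : σ.var vpen = pen) (he : ∀ x < L, σ.arr aE j x = e x)
    (hen : ∀ x < L, e x < I.n) (hQ : 2 * (s * s) / j + 1 = Q) (hrQ : r ≤ Q) (hjW : j < E.W)
    (hLW : L < E.W) (hQW : 2 * (s * s) + 2 * Q + r + 4 < E.W)
    (hB : 3 * Q * pen + ∑ x ∈ range L, I.v (e x) < E.B) :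
    wp E gainTable σ (fun t τ => t ≤ 2 * Q ∧ τ.var vQ = Q ∧
      ∀ z ≤ 2 * Q, τ.arr aG z 0 = gain I.v e pen Q r L z) := by
  have hWB := hF.WB
  have hnW := hF.n_lt
  have hle := fun z (hz : z ≤ 2 * Q) => gain_le (v := I.v) (e := e) (pen := pen) (L := L) hrQ hz
  have h3 : 3 * Q * pen = 2 * Q * pen + Q * pen := by ring
  have h4 : s * s ≤ 2 * (s * s) := by omega
  simp only [gainTable, wp_seq, wp_set, wp_put]
  refine ⟨by simp [hs, hj, hQ]; omega, by simp [hF.live]; omega,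
    by simp [hs, hj, hQ, hpen]; omega, by simp, ?_⟩
  refine wp_for (2 * Q) (fun k τ => ∀ z ≤ k, τ.arr aG z 0 = gain I.v e pen Q r L z)
    (fun _ => 0) (by simp) (by simp [gain, hs, hj, hQ, hpen]) ?_ ?_ ?_
  · intro k τ hA _
    have e1 : τ.var vQ = Q := (hA.v vQ rfl).trans (by simp [hs, hj, hQ])
    exact ⟨by simp [e1]; omega, by simp [e1]⟩
  · intro k τ hk hA hvk h
    have e1 : τ.var vQ = Q := (hA.v vQ rfl).trans (by simp [hs, hj, hQ])
    have e2 : τ.var vj = j := (hA.v vj rfl).trans (by simp [hj])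
    have e3 : τ.var vr = r := (hA.v vr rfl).trans (by simp [hr])
    have e4 : τ.var vL = L := (hA.v vL rfl).trans (by simp [hL])
    have e5 : τ.var vpen = pen := (hA.v vpen rfl).trans (by simp [hpen])
    have e6 := h k le_rfl
    have e7 : τ.arr aE = σ.arr aE := (hA.a aE rfl).trans (by simp)
    have hle' := hle (k + 1) (by omega)
    have hg : gain I.v e pen Q r L (k + 1) = if k + r < Q then gain I.v e pen Q r L k + pen
        else if k + r - Q < L then gain I.v e pen Q r L k + I.v (e (k + r - Q))
        else gain I.v e pen Q r L k - pen := by rw [gain]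
    have fin : ∀ x, x = gain I.v e pen Q r L (k + 1) → ∀ z ≤ k + 1,
        (if z = k + 1 then x else τ.arr aG z 0) = gain I.v e pen Q r L z := by
      intro x hx z hz
      split_ifs with h1
      · rw [hx, h1]
      · exact h z (by omega)
    simp only [wp_seq, wp_set, wp_ite, wp_put]
    refine ⟨by simp [hvk, e3]; omega, fun h1 => ?_, fun h1 => ⟨?_, fun h2 => ?_, fun h2 => ?_⟩⟩
    · have h1 : k + r < Q := by simpa [hvk, e1, e3] using h1
      rw [if_pos h1] at hg
      refine ⟨by simp [hF.live, hvk, e5, e6]; omega, by simp [hF.live, hvk]; omega, by simp,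
        by simp [hvk]; omega, by simp [hvk], ?_, by simp⟩
      simp [hvk, e5, e6]
      exact fin _ hg.symm
    · have h1 : Q ≤ k + r := by simpa [hvk, e1, e3] using h1
      simp [hvk, e1, e3]; omega
    · have h1 : Q ≤ k + r := by simpa [hvk, e1, e3] using h1
      have h2 : k + r - Q < L := by simpa [hvk, e1, e3, e4] using h2
      have h5 := hen _ h2
      have e8 : τ.arr aE j (k + r - Q) = e (k + r - Q) := by rw [e7, he _ h2]
      have e9 : τ.arr aV (e (k + r - Q)) 0 = I.v (e (k + r - Q)) := by
        rw [hA.a aV rfl]; simpa using hI.V _ h5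
      rw [if_neg (by omega), if_pos h2] at hg
      refine ⟨by simp [hF.live, hvk, e1, e2, e3, e6, e8, e9]; omega,
        by simp [hF.live, hvk]; omega, by simp, by simp [hvk]; omega, by simp [hvk], ?_, by simp⟩
      simp [hvk, e1, e2, e3, e6, e8, e9]
      exact fin _ hg.symm
    · have h1 : Q ≤ k + r := by simpa [hvk, e1, e3] using h1
      have h2 : ¬ k + r - Q < L := by simpa [hvk, e1, e3, e4] using h2
      have h5 := gain_pen_le (v := I.v) (e := e) (pen := pen) (L := L) hrQ (z := k)
        (by omega) h1
      rw [if_neg (by omega), if_neg h2] at hg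
      refine ⟨by simp [hF.live, hvk, e5, e6]; omega,
        by simp [hF.live, hvk]; omega, by simp, by simp [hvk]; omega, by simp [hvk], ?_, by simp⟩
      simp [hvk, e5, e6]
      exact fin _ hg.symm
  · rintro t τ hA _ h ht
    exact ⟨by simpa using ht, (hA.v vQ rfl).trans (by simp [hs, hj, hQ]), h⟩

/-- Record the row maxima for the current residue. -/
def recordMaxima : Cmd :=
  vk ::= 0 ;;
  whl (§vk ≺ §vq)
    (vz ::= ld aK §vk 0 ;; put aCH §vj (§vrho + §vj * §vk) §vz ;;
     put aF §vj (§vrho + §vj * §vk) (entry §vk §vz) ;; vk ::= §vk + 1)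

/-- Only cells of row `j` with residue `rho` are written. The matrix is read from row `vi`, which
differs from `j`, so it does not change meanwhile. -/
theorem recordMaxima_spec {E : Env} {q : ℕ} {M : ℕ → ℕ → ℕ} {σ : Store} (hE : Entries E q M σ)
    {j rho : ℕ} {K : ℕ → ℕ} (hq : σ.var vq = q) (hj : σ.var vj = j) (hi : σ.var vi ≠ j)
    (hrho : σ.var vrho = rho) (hrj : rho < j) (hjW : j < E.W) (hK : ∀ x < q, σ.arr aK x 0 = K x)
    (hKq : ∀ x < q, K x < q) :
    wp E recordMaxima σ (fun t τ => t ≤ q ∧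
      (∀ x < q, τ.arr aCH j (rho + j * x) = K x ∧ τ.arr aF j (rho + j * x) = M x (K x)) ∧
      ∀ i z, i ≠ j ∨ z % j ≠ rho → τ.arr aF i z = σ.arr aF i z ∧
        τ.arr aCH i z = σ.arr aCH i z) := by
  have hWB := hE.WB
  have hqW := hE.q_le
  simp only [recordMaxima, wp_seq, wp_set]
  refine ⟨by simp, ?_⟩
  refine wp_for q (fun k τ =>
      (∀ x < k, τ.arr aCH j (rho + j * x) = K x ∧ τ.arr aF j (rho + j * x) = M x (K x)) ∧
      ∀ i z, i ≠ j ∨ z % j ≠ rho → τ.arr aF i z = σ.arr aF i z ∧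
        τ.arr aCH i z = σ.arr aCH i z) (fun _ => 0) (by simp) (by simp) ?_ ?_ ?_
  · intro k τ hA _
    exact ⟨by simp, (hA.v vq rfl).trans (by simp [hq])⟩
  · rintro k τ hk hA hvk ⟨h1, h2⟩
    have e1 : τ.var vj = j := (hA.v vj rfl).trans (by simp [hj])
    have e2 : τ.var vrho = rho := (hA.v vrho rfl).trans (by simp [hrho])
    have e3 : τ.var vi = σ.var vi := (hA.v vi rfl).trans (by simp)
    have e4 : τ.arr aK k 0 = K k := by rw [hA.a aK rfl]; simpa using hK k hk
    have hKk := hKq k hk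
    have hcol := hE.col k hk
    rw [hj, hrho] at hcol
    have hτ : Entries E q M τ := hE.of_eq e3 (e1.trans hj.symm) (e2.trans hrho.symm)
      ((hA.v vQ rfl).trans (by simp)) (by ext z; exact (h2 _ z (.inl hi)).1)
      ((hA.a aG rfl).trans (by simp))
    have hmod : (rho + j * k) % j = rho := by
      rw [Nat.add_mul_mod_self_left, Nat.mod_eq_of_lt hrj]
    have hk' : j * k < E.W := by omega
    simp only [wp_seq, wp_set, wp_put]
    have hent := (hτ.of_eq (τ := (τ.set vz (K k)).put aCH j (rho + j * k) (K k)) (by simp)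
      (by simp) (by simp) (by simp) (by simp) (by simp)).entry_ok (a := §vk) (b := §vz)
      (x := k) (y := K k) (by simp) (by simp) (by simpa using hvk) (by simp) hk hKk
    refine ⟨by simp [hE.live, hvk]; omega, by simp [hE.live, hvk, e1, e2]; omega, by simp,
      by simp [hE.live, hvk, e1, e2]; omega, ?_, by simp [hvk]; omega, by simp [hvk], ?_, by simp⟩
    · simpa [hvk, e1, e2, e4] using hent.1
    · have hent2 := hent.2
      simp [hvk, e1, e2, e4] at hent2 ⊢
      rw [hent2]
      refine ⟨fun x hx => ?_, fun i z hz => ?_⟩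
      · rcases Nat.lt_or_eq_of_le hx with hx | rfl
        · have hj0 : j ≠ 0 := by omega
          simpa [hx.ne, hj0] using h1 x hx
        · simp
      · have : ¬ (i = j ∧ z = rho + j * k) := by
          rintro ⟨rfl, rfl⟩
          rcases hz with hz | hz
          exacts [hz rfl, hz hmod]
        simpa [this] using h2 i z (by simpa using hz)
  · rintro t τ hA _ ⟨h1, h2⟩ ht
    exact ⟨by simpa using ht, h1, h2⟩

end WordRAM


namespace WordRAM
open WordRAM.Expr WordRAM.Cmd

/-- `b` is the best predecessor of `x` for the step `j`, and `f` is the resulting value. -/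
structure IsBest (N j Q : ℕ) (F G : ℕ → ℕ) (x b f : ℕ) : Prop where
  le : x % j + j * b ≤ N
  eq : f = F (x % j + j * b) + G (x / j + Q - b)
  max : ∀ b', x % j + j * b' ≤ N → F (x % j + j * b') + G (x / j + Q - b') ≤ f

/-- Compute row `vj` of the dynamic program from the previous row. -/
def dpRow : Cmd :=
  vrho ::= 0 ;;
  whl (§vrho ≺ §vj)
    (vq ::= (2 * (§vs * §vs) - §vrho) / §vj + 1 ;; rowMaxima ;; recordMaxima ;;
     vrho ::= §vrho + 1)

/-- States with different residues modulo `j` do not interact. Each residue gives a square Monge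
matrix of order at most `Q`, where `j * Q` is about `2 * s ^ 2`, so the whole row costs `O(s ^ 2)`.
-/
theorem dpRow_spec {E : Env} {σ : Store} (hlive : E.live) (hWB : E.W ≤ E.B) {s j Q pen r L : ℕ}
    {v e : ℕ → ℕ} (hs : σ.var vs = s) (hj : σ.var vj = j) (hi : σ.var vi + 1 = j) (hjs : j ≤ s)
    (hQ : 2 * (s * s) / j + 1 = Q) (hvQ : σ.var vQ = Q) (hQW : 2 * (s * s) + 2 * Q + 4 < E.W)
    (hG : ∀ z ≤ 2 * Q, σ.arr aG z 0 = gain v e pen Q r L z) (hr : r ≤ Q)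
    (hpen : ∀ x < L, v (e x) ≤ pen)
    (hanti : ∀ k k', k ≤ k' → k' < L → v (e k') ≤ v (e k))
    (hB : ∀ x ≤ 2 * (s * s), ∀ z ≤ 2 * Q, σ.arr aF (j - 1) x + σ.arr aG z 0 < E.B) :
    wp E dpRow σ (fun t τ => t ≤ j * (17 * Q + 1) ∧
      (∀ x ≤ 2 * (s * s), IsBest (2 * (s * s)) j Q (σ.arr aF (j - 1)) (fun z => σ.arr aG z 0) x
        (τ.arr aCH j x) (τ.arr aF j x)) ∧
      ∀ i ≠ j, τ.arr aF i = σ.arr aF i ∧ τ.arr aCH i = σ.arr aCH i) := by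
  obtain ⟨i, rfl⟩ : ∃ i, i + 1 = j := ⟨_, hi⟩
  have hi : σ.var vi = i := by omega
  simp only [Nat.add_sub_cancel] at hB ⊢
  generalize hN : 2 * (s * s) = N at *
  have hjN : i + 1 ≤ N := by
    have : s ≤ s * s := Nat.le_mul_of_pos_left _ (by omega)
    omega
  simp only [dpRow, wp_seq, wp_set]
  refine ⟨by simp, ?_⟩
  refine wp_for (i + 1) (fun k τ =>
      (∀ x ≤ N, x % (i + 1) < k → IsBest N (i + 1) Q (σ.arr aF i) (fun z => σ.arr aG z 0) x
        (τ.arr aCH (i + 1) x) (τ.arr aF (i + 1) x)) ∧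
      ∀ x ≠ i + 1, τ.arr aF x = σ.arr aF x ∧ τ.arr aCH x = σ.arr aCH x)
    (fun _ => 17 * Q) (by simp) (by simp) ?_ ?_ ?_
  · intro k τ hA _
    exact ⟨by simp, (hA.v vj rfl).trans (by simp [hj])⟩
  · rintro k τ hk hA hvk ⟨h1, h2⟩
    have e1 : τ.var vj = i + 1 := (hA.v vj rfl).trans (by simp [hj])
    have e2 : τ.var vs = s := (hA.v vs rfl).trans (by simp [hs])
    have e3 : τ.var vi = i := (hA.v vi rfl).trans (by simp [hi])
    have e4 : τ.var vQ = Q := (hA.v vQ rfl).trans (by simp [hvQ])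
    have e5 : τ.arr aG = σ.arr aG := (hA.a aG rfl).trans (by simp)
    have e6 : τ.arr aF i = σ.arr aF i := (h2 i (by omega)).1
    -- The number of states with residue `k`, which are both the rows and the columns of the matrix.
    obtain ⟨q, hq⟩ : ∃ q, (N - k) / (i + 1) + 1 = q := ⟨_, rfl⟩
    have hqiff : ∀ y, y < q ↔ k + (i + 1) * y ≤ N := fun y => by
      rw [← hq, Nat.lt_succ_iff, Nat.le_div_iff_mul_le (by omega), mul_comm]
      omega
    have hqQ : q ≤ Q := by
      rw [← hq, ← hQ]
      exact Nat.add_le_add_right (Nat.div_le_div_right (by omega)) 1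
    have hss : s * s ≤ N := by omega
    have hE : Entries E q (fun x y => σ.arr aF i (k + (i + 1) * y) + σ.arr aG (x + Q - y) 0)
        (τ.set vq q) := by
      refine ⟨hlive, hWB, by simp [e3]; omega, fun y hy => ?_, fun x hx y hy => ?_,
        fun x hx y hy => ?_, by omega, fun x x' y y' hx hx' hy hy' => ?_⟩
      · have := (hqiff y).1 hy
        simp [e1, hvk]; omega
      · simp [e4]; omega
      · simp only [Store.set_var, Store.set_arr]
        simp only [e1, e3, e4, e5, hvk]
        exact ⟨by simp [e6], hB _ ((hqiff y).1 hy) _ (by omega)⟩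
      -- The table entries cancel in the Monge inequality, and what is left is concavity of the gain
      -- at arguments shifted by `x' - x`.
      · have := gain_concave (v := v) (e := e) (pen := pen) (L := L) hr hpen hanti
          (z := x + Q - y') (z' := x + Q - y) (by omega) (x' - x) (by omega)
        rw [show x + Q - y' + (x' - x) = x' + Q - y' by omega,
          show x + Q - y + (x' - x) = x' + Q - y by omega] at this
        rw [hG _ (by omega), hG _ (by omega), hG _ (by omega), hG _ (by omega)]
        omega
    rw [wp_seq, wp_set, wp_seq]
    refine ⟨by simp [e1, e2, hN, hvk, hq]; omega, ?_⟩
    have hev : Expr.eval τ ((2 * (§vs * §vs) - §vrho) / §vj + 1) = q := by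
      simp [e1, e2, hN, hvk, hq]
    rw [hev]
    refine (rowMaxima_spec hE (by simp) (by rw [← hq]; exact Nat.succ_pos _)).mono ?_
    rintro t₁ τ₁ hA₁ ⟨ht₁, hmax⟩
    rw [wp_seq]
    refine (recordMaxima_spec (hE.agree hA₁ (by decide)) (j := i + 1) (rho := k) (q := q)
      (K := fun x => τ₁.arr aK x 0) ((hA₁.v vq rfl).trans (by simp))
      ((hA₁.v vj rfl).trans (by simp [e1])) ?_ ((hA₁.v vrho rfl).trans (by simp [hvk])) hk
      (by omega) (fun _ _ => rfl) fun x hx => (hmax x hx).1).mono ?_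
    · rw [hA₁.v vi rfl]; simp [e3]
    rintro t₂ τ₂ hA₂ ⟨ht₂, hrec, hfr⟩
    rw [wp_set]
    have e7 : τ₂.var vrho = k := by rw [hA₂.v vrho rfl, hA₁.v vrho rfl]; simpa using hvk
    have e8 : τ₁.arr aF = τ.arr aF := (hA₁.a aF rfl).trans (by simp)
    have e9 : τ₁.arr aCH = τ.arr aCH := (hA₁.a aCH rfl).trans (by simp)
    refine ⟨by simp [e7]; omega, by simp [e7], ⟨fun x hx hxk => ?_, fun x hx => ?_⟩, by omega⟩
    · simp only [Store.set_arr]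
      by_cases hxe : x % (i + 1) = k
      · have hx' : x = k + (i + 1) * (x / (i + 1)) := by
          rw [← hxe, Nat.mod_add_div]
        have hlt : x / (i + 1) < q := (hqiff _).2 (by rw [← hx']; exact hx)
        obtain ⟨g1, g2⟩ := hrec _ hlt
        obtain ⟨g3, g4⟩ := hmax _ hlt
        rw [← hx'] at g1 g2
        rw [g1, g2]
        refine ⟨?_, by rw [hxe], fun b' hb' => ?_⟩
        · rw [hxe]; exact (hqiff _).1 g3
        · rw [hxe] at hb' ⊢
          exact g4 b' ((hqiff _).2 hb')
      · rw [(hfr _ _ (.inr hxe)).1, (hfr _ _ (.inr hxe)).2, e8, e9]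
        exact h1 x hx (by omega)
    · simp only [Store.set_arr]
      rw [← (h2 x hx).1, ← (h2 x hx).2, ← e8, ← e9]
      exact ⟨funext fun z => (hfr x z (.inl hx)).1, funext fun z => (hfr x z (.inl hx)).2⟩
  · rintro t τ hA _ ⟨h1, h2⟩ ht
    refine ⟨?_, fun x hx => h1 x hx (Nat.mod_lt _ (by omega)), h2⟩
    simp only [sum_const, card_range, smul_eq_mul] at ht
    rw [mul_add, mul_one]
    omega

end WordRAM


namespace WordRAM
open WordRAM.Expr WordRAM.Cmd

/-! ### The loop over the item sizes -/

theorem ClassData.congr {I : Items} {u u' y y' : ℕ → ℕ} {s P j m : ℕ} {a : ℕ → ℕ} {L : ℕ}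
    {e : ℕ → ℕ} (h : ClassData I u y s P j m a L e) (hu : ∀ k < m, u' (a k) = u (a k))
    (hy : ∀ k < m, y' (a k) = y (a k)) : ClassData I u' y' s P j m a L e := by
  obtain ⟨X, hX, hc⟩ := h.ex
  exact ⟨h.inj, h.size, h.base.congr hu hy,
    ⟨X, hX.congr (fun k hk => by rw [hu k hk, hy k hk]) fun _ _ => rfl, hc⟩, h.mem, h.anti⟩

/-- An item of multiplicity `0` may be worth more than the penalty, so the bound on listed values
needs that such items are not listed. -/
theorem ClassData.mult_pos {I : Items} {u y : ℕ → ℕ} {s P j m : ℕ} {a : ℕ → ℕ} {L : ℕ}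
    {e : ℕ → ℕ} (h : ClassData I u y s P j m a L e) {x : ℕ} (hx : x < L) : 0 < u (e x) := by
  obtain ⟨X, hX, hc⟩ := h.ex
  obtain ⟨k, hk, he⟩ := h.mem x hx
  have h1 := hX.le k hk
  have h2 : 1 ≤ copies e L (a k) := by
    have := copies_mono e (Nat.succ_le_of_lt hx) (a k)
    rw [copies_succ, if_pos he] at this
    omega
  rw [hc k hk] at h1
  rw [he]
  omega

theorem IsBest.congr {N j Q : ℕ} {F G G' : ℕ → ℕ} {x b f : ℕ} (h : IsBest N j Q F G x b f)
    (hG : ∀ z ≤ x / j + Q, G' z = G z) : IsBest N j Q F G' x b f := by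
  refine ⟨h.le, ?_, fun b' hb' => ?_⟩
  · rw [hG _ (Nat.sub_le _ _)]; exact h.eq
  · rw [hG _ (Nat.sub_le _ _)]; exact h.max b' hb'

def classStep : Cmd :=
  vj ::= §vi + 1 ;; vrow ::= §vj ;; classItems ;; gainTable ;; dpRow

def classLoop : Cmd := vi ::= 0 ;; whl (§vi ≺ §vs) (classStep ;; vi ::= §vi + 1)

/-- A bound for the gains. -/
def gainBound (s pen : ℕ) : ℕ := 3 * (2 * (s * s) + 1) * pen + 2 * s * pen

/-- The row width and the value bound suffice for the instance. -/
structure ClassEnv (E : Env) (I : Items) (u : ℕ → ℕ) (s pen : ℕ) (P m : ℕ → ℕ) (a : ℕ → ℕ → ℕ) :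
    Prop where
  fits : I.Fits E
  filter : ∀ j < s, IsFilter (fun i => I.sz i = j + 1) I.n id (m (j + 1)) (a (j + 1))
  v_le : ∀ i < I.n, 0 < u i → I.v i ≤ pen
  v_lt : ∀ i < I.n, I.v i + 1 < E.B
  P_lt : ∀ j < s, (j + 1) * P (j + 1) < E.B
  sum_lt : ∑ i ∈ range I.n, I.sz i * u i < E.B
  gain_lt : pen + (s + 1) * gainBound s pen < E.B
  s_lt : 6 * (s * s) + s + 10 < E.W

/-- The input of the class loop. -/
structure ClassState (E : Env) (I : Items) (s pen : ℕ) (P m : ℕ → ℕ) (a : ℕ → ℕ → ℕ) (σ : Store) :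
    Prop where
  items : I.In σ
  row : ∀ j < s, ListRow E I σ (j + 1) (m (j + 1)) (a (j + 1))
  s_eq : σ.var vs = s
  pen_eq : σ.var vpen = pen
  P_eq : ∀ j < s, σ.arr aCP (j + 1) 0 = P (j + 1)

theorem ClassState.agree {E : Env} {I : Items} {s pen : ℕ} {P m : ℕ → ℕ} {a : ℕ → ℕ → ℕ}
    {c : Cmd} {σ τ : Store} (h : ClassState E I s pen P m a σ) (hA : Agree c σ τ)
    (hc : c.wv vs = false ∧ c.wv vpen = false ∧ c.wa aS = false ∧ c.wa aV = false ∧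
      c.wa aCN = false ∧ c.wa aCL = false ∧ c.wa aCP = false) :
    ClassState E I s pen P m a τ := by
  obtain ⟨h1, h2, h3, h4, h5, h6, h7⟩ := hc
  exact ⟨h.items.of_eq (hA.a _ h3) (hA.a _ h4),
    fun j hj => (h.row j hj).of_eq (hA.a _ h5) (hA.a _ h6), (hA.v _ h1).trans h.s_eq,
    (hA.v _ h2).trans h.pen_eq, fun j hj => by rw [hA.a _ h7, h.P_eq j hj]⟩

/-- The data of class `j + 1` is complete. -/
def ClassDone (I : Items) (u : ℕ → ℕ) (s pen : ℕ) (P m : ℕ → ℕ) (a : ℕ → ℕ → ℕ) (τ : Store)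
    (j L : ℕ) : Prop :=
  ClassData I u (fun i => τ.arr aY i 0) s (P (j + 1)) (j + 1) (m (j + 1)) (a (j + 1)) L
    (τ.arr aE (j + 1)) ∧ L ≤ 2 * s ∧ τ.arr aR (j + 1) 0 = min (P (j + 1)) s ∧
  ∀ x ≤ 2 * (s * s), IsBest (2 * (s * s)) (j + 1) (2 * (s * s) / (j + 1) + 1) (τ.arr aF j)
    (gain I.v (τ.arr aE (j + 1)) pen (2 * (s * s) / (j + 1) + 1) (min (P (j + 1)) s) L) x
    (τ.arr aCH (j + 1) x) (τ.arr aF (j + 1) x)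

/-- The table grows by at most `gainBound` per size; carrying this bound along keeps all entries
within a word. -/
theorem classStep_spec {E : Env} {I : Items} {u : ℕ → ℕ} {s pen : ℕ} {P m : ℕ → ℕ}
    {a : ℕ → ℕ → ℕ} (hC : ClassEnv E I u s pen P m a) {σ : Store}
    (hS : ClassState E I s pen P m a σ) {i : ℕ} (hvi : σ.var vi = i) (hi : i < s)
    (hMU : ∀ k < m (i + 1), σ.arr aMU (a (i + 1) k) 0 = u (a (i + 1) k))
    (hFB : ∀ x ≤ 2 * (s * s), σ.arr aF i x ≤ pen + i * gainBound s pen) :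
    wp E classStep σ (fun t τ => t ≤ 408 * m (i + 1) + 66 * (s * s) ∧
      (∃ L, ClassDone I u s pen P m a τ i L) ∧
      (∀ x ≤ 2 * (s * s), τ.arr aF (i + 1) x ≤ pen + (i + 1) * gainBound s pen) ∧
      (∀ x, (∀ k < m (i + 1), a (i + 1) k ≠ x) →
        τ.arr aY x = σ.arr aY x ∧ τ.arr aMU x = σ.arr aMU x) ∧
      ∀ x ≠ i + 1, τ.arr aE x = σ.arr aE x ∧ τ.arr aR x = σ.arr aR x ∧
        τ.arr aF x = σ.arr aF x ∧ τ.arr aCH x = σ.arr aCH x) := by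
  have hF := hC.fits
  have hWB := hF.WB
  have hsW := hC.s_lt
  have hss : s ≤ s * s := Nat.le_mul_of_pos_left _ (by omega)
  have hrow := hS.row i hi
  have hjs : (i + 1) * (2 * s) ≤ 2 * (s * s) := by nlinarith
  simp only [classStep, wp_seq, wp_set]
  refine ⟨by simp [hvi]; omega, by simp, ?_⟩
  refine (classItems_spec hF (σ := (σ.set vj _).set vrow _) (hS.items.of_eq rfl rfl)
    (mu := fun x => σ.arr aMU x 0) ⟨fun _ _ => rfl⟩ (hrow.of_eq rfl rfl) (s := s)
    (P := P (i + 1)) (by simp [hvi]) (by simp [hS.s_eq]) (by simpa using hS.P_eq i hi)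
    (by omega) (fun k hk => ((hC.filter i hi).mem k hk).1) (by omega) (by omega) ?_ ?_
    hC.v_lt).mono ?_
  · exact lt_of_le_of_lt (Nat.mul_le_mul_left _ (Nat.sub_le _ _)) (hC.P_lt i hi)
  · rw [sum_congr rfl fun k hk => by rw [hMU k (mem_range.1 hk)],
      (hC.filter i hi).sum fun x => I.sz x * u x]
    refine lt_of_le_of_lt (sum_le_sum fun x _ => ?_) hC.sum_lt
    split_ifs
    exacts [le_rfl, Nat.zero_le _]
  rintro t₁ τ₁ hA₁ ⟨ht₁, hD, hvr, hL2, hR, hfr, hfrE⟩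
  generalize hL : τ₁.var vL = L at *
  have hD : ClassData I u (fun x => τ₁.arr aY x 0) s (P (i + 1)) (i + 1) (m (i + 1)) (a (i + 1)) L
    (τ₁.arr aE (i + 1)) := hD.congr (fun k hk => (hMU k hk).symm) fun _ _ => rfl
  have hen : ∀ x < L, τ₁.arr aE (i + 1) x < I.n := fun x hx => by
    obtain ⟨k, hk, he⟩ := hD.mem x hx
    rw [he]; exact hrow.lt k hk
  have hvpen : ∀ x < L, I.v (τ₁.arr aE (i + 1) x) ≤ pen := fun x hx =>
    hC.v_le _ (hen x hx) (hD.mult_pos hx)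
  obtain ⟨Q, hQ⟩ : ∃ Q, 2 * (s * s) / (i + 1) + 1 = Q := ⟨_, rfl⟩
  have hQ2 : Q ≤ 2 * (s * s) + 1 := by
    rw [← hQ]; exact Nat.add_le_add_right (Nat.div_le_self _ _) 1
  have hjQ : (i + 1) * Q ≤ 2 * (s * s) + (i + 1) := by
    rw [← hQ, mul_add, mul_one]
    exact Nat.add_le_add_right (Nat.mul_div_le _ _) _
  have hsQ : s ≤ Q := by
    rw [← hQ]
    refine le_trans ?_ (Nat.le_succ _)
    rw [Nat.le_div_iff_mul_le (by omega)]
    nlinarith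
  have hr : min (P (i + 1)) s ≤ Q := by omega
  have hsumv : ∑ x ∈ range L, I.v (τ₁.arr aE (i + 1) x) ≤ 2 * s * pen :=
    (sum_le_card_nsmul _ _ pen fun x hx => hvpen x (mem_range.1 hx)).trans (by
      simpa using Nat.mul_le_mul_right pen hL2)
  have hgb : 3 * Q * pen + ∑ x ∈ range L, I.v (τ₁.arr aE (i + 1) x) ≤ gainBound s pen :=
    Nat.add_le_add (Nat.mul_le_mul_right _ (Nat.mul_le_mul_left _ hQ2)) hsumv
  have hg := hC.gain_lt
  have hgs : (s + 1) * gainBound s pen = s * gainBound s pen + gainBound s pen := Nat.succ_mul _ _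
  have e1 : τ₁.var vj = i + 1 := (hA₁.v vj rfl).trans (by simp [hvi])
  have e2 : τ₁.var vs = s := (hA₁.v vs rfl).trans (by simp [hS.s_eq])
  have e3 : τ₁.var vi = i := (hA₁.v vi rfl).trans (by simp [hvi])
  have e4 : τ₁.arr aF = σ.arr aF := hA₁.a aF rfl
  have e5 : τ₁.arr aCH = σ.arr aCH := hA₁.a aCH rfl
  refine (gainTable_spec hF (pen := pen) (hS.items.of_eq (hA₁.a aS rfl) (hA₁.a aV rfl)) e2 e1 hvr hL
    ((hA₁.v vpen rfl).trans (by simp [hS.pen_eq])) (fun _ _ => rfl) hen hQ hr (by omega) (by omega)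
    (by omega) (by omega)).mono ?_
  rintro t₂ τ₂ hA₂ ⟨ht₂, hvQ, hG⟩
  have hgle : ∀ z ≤ 2 * Q, τ₂.arr aG z 0 ≤ gainBound s pen := fun z hz => by
    rw [hG z hz]; exact (gain_le hr hz).trans hgb
  have e6 : τ₂.arr aF = σ.arr aF := (hA₂.a aF rfl).trans e4
  have e7 : τ₂.arr aCH = σ.arr aCH := (hA₂.a aCH rfl).trans e5
  have hi' : i * gainBound s pen ≤ s * gainBound s pen := Nat.mul_le_mul_right _ hi.le
  refine (dpRow_spec hF.live hWB ((hA₂.v vs rfl).trans e2) ((hA₂.v vj rfl).trans e1)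
    (by rw [hA₂.v vi rfl, e3]) hi hQ hvQ (by omega) hG hr hvpen hD.anti
    fun x hx z hz => ?_).mono ?_
  · have h1 := hFB x hx
    have h2 := hgle z hz
    rw [e6]
    simp only [Nat.add_sub_cancel]
    omega
  rintro t₃ τ₃ hA₃ ⟨ht₃, hbest, hfr₃⟩
  simp only [Nat.add_sub_cancel, e6, e7] at hbest hfr₃
  have e8 : τ₃.arr aE = τ₁.arr aE := (hA₃.a aE rfl).trans (hA₂.a aE rfl)
  have e9 : τ₃.arr aY = τ₁.arr aY := (hA₃.a aY rfl).trans (hA₂.a aY rfl)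
  have e10 : τ₃.arr aR = τ₁.arr aR := (hA₃.a aR rfl).trans (hA₂.a aR rfl)
  have e11 : τ₃.arr aMU = τ₁.arr aMU := (hA₃.a aMU rfl).trans (hA₂.a aMU rfl)
  have hdiv : ∀ x ≤ 2 * (s * s), x / (i + 1) + Q ≤ 2 * Q := fun x hx => by
    have := Nat.div_le_div_right (c := i + 1) hx
    omega
  refine ⟨?_, ⟨L, ?_, hL2, ?_, fun x hx => ?_⟩, fun x hx => ?_, fun x hx => ?_, fun x hx => ?_⟩
  · have h1 : (i + 1) * (17 * Q + 1) = 17 * ((i + 1) * Q) + (i + 1) := by ring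
    have h2 : 2 * s * (2 * s) = 4 * (s * s) := by ring
    omega
  · rw [e8, e9]; exact hD
  · rw [e10]; exact hR
  · rw [(hfr₃ i (by omega)).1, e8, hQ]
    exact (hbest x hx).congr fun z hz => (hG z (hz.trans (hdiv x hx))).symm
  · rw [(hbest x hx).eq]
    have h3 : (i + 1) * gainBound s pen = i * gainBound s pen + gainBound s pen :=
      Nat.succ_mul _ _
    have h1 := hFB _ (hbest x hx).le
    have h2 := hgle (x / (i + 1) + Q - τ₃.arr aCH (i + 1) x)
      ((Nat.sub_le _ _).trans (hdiv x hx))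
    omega
  · rw [e9, e11]; exact hfr x hx
  · rw [e8, e10, (hfr₃ x hx).1, (hfr₃ x hx).2]
    exact ⟨(hfrE x hx).1, (hfrE x hx).2, rfl, rfl⟩

theorem ClassDone.frame {I : Items} {u : ℕ → ℕ} {s pen : ℕ} {P m : ℕ → ℕ} {a : ℕ → ℕ → ℕ}
    {σ τ : Store} {j L : ℕ} (h : ClassDone I u s pen P m a σ j L)
    (hY : ∀ k < m (j + 1), τ.arr aY (a (j + 1) k) = σ.arr aY (a (j + 1) k))
    (hE : τ.arr aE (j + 1) = σ.arr aE (j + 1)) (hR : τ.arr aR (j + 1) = σ.arr aR (j + 1))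
    (hF : τ.arr aF j = σ.arr aF j) (hF' : τ.arr aF (j + 1) = σ.arr aF (j + 1))
    (hH : τ.arr aCH (j + 1) = σ.arr aCH (j + 1)) : ClassDone I u s pen P m a τ j L := by
  obtain ⟨h1, h2, h3, h4⟩ := h
  refine ⟨?_, h2, by rw [hR, h3], ?_⟩
  · rw [hE]
    exact h1.congr (fun _ _ => rfl) fun k hk => by rw [hY k hk]
  · rw [hE, hF, hF', hH]; exact h4

theorem classLoop_spec {E : Env} {I : Items} {u : ℕ → ℕ} {s pen : ℕ} {P m : ℕ → ℕ}
    {a : ℕ → ℕ → ℕ} (hC : ClassEnv E I u s pen P m a) {σ : Store}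
    (hS : ClassState E I s pen P m a σ) (hMU : I.Mult u σ)
    (hF0 : ∀ x ≤ 2 * (s * s), σ.arr aF 0 x = if s * s ≤ x then pen else 0) :
    wp E classLoop σ (fun t τ =>
      t ≤ s + ∑ j ∈ range s, (408 * m (j + 1) + 66 * (s * s)) ∧ τ.arr aF 0 = σ.arr aF 0 ∧
      ∀ j < s, ∃ L, ClassDone I u s pen P m a τ j L) := by
  have hWB := hC.fits.WB
  have hsW := hC.s_lt
  have hmem : ∀ j < s, ∀ k < m (j + 1), I.sz (a (j + 1) k) = j + 1 :=
    fun j hj k hk => ((hC.filter j hj).mem k hk).1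
  have hne : ∀ i < s, ∀ j < s, j ≠ i → ∀ k < m (j + 1), ∀ k' < m (i + 1),
      a (i + 1) k' ≠ a (j + 1) k := by
    intro i hi j hj hji k hk k' hk' h
    have h1 := hmem i hi k' hk'
    rw [h, hmem j hj k hk] at h1
    omega
  simp only [classLoop, wp_seq, wp_set]
  refine ⟨by simp, ?_⟩
  -- The classes are disjoint, so treating one size leaves the data of the finished sizes and the
  -- multiplicities of the later ones untouched.
  refine wp_for s (fun i τ => (∀ j < i, ∃ L, ClassDone I u s pen P m a τ j L) ∧
      (∀ x ≤ 2 * (s * s), τ.arr aF i x ≤ pen + i * gainBound s pen) ∧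
      (∀ j, i ≤ j → j < s → ∀ k < m (j + 1), τ.arr aMU (a (j + 1) k) 0 = u (a (j + 1) k)) ∧
      τ.arr aF 0 = σ.arr aF 0)
    (fun j => 408 * m (j + 1) + 66 * (s * s)) (by simp) ?_ ?_ ?_ ?_
  · refine ⟨by simp, fun x hx => ?_, fun j _ hj k hk => hMU.M _ ((hS.row j hj).lt k hk), by simp⟩
    simp only [Store.set_arr, hF0 x hx]
    split_ifs <;> omega
  · intro k τ hA _
    exact ⟨by simp, (hA.v vs rfl).trans (by simp [hS.s_eq])⟩
  · rintro i τ hi hA hvi ⟨h1, h2, h3, h4⟩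
    have hSτ : ClassState E I s pen P m a τ :=
      (hS.agree (c := vi ::= 0) (τ := σ.set vi _) ⟨fun x hx => by
        have : x ≠ vi := by rintro rfl; exact absurd hx (by decide)
        simp [this], fun _ _ => rfl⟩ (by decide)).agree hA (by decide)
    rw [wp_seq]
    refine (classStep_spec hC hSτ hvi hi (h3 i le_rfl hi) h2).mono ?_
    rintro t υ hA' ⟨ht, hD, hB, hfr, hfr'⟩
    have e1 : υ.var vi = i := (hA'.v vi rfl).trans hvi
    have e2 : ∀ j < s, j ≠ i → ∀ k < m (j + 1), υ.arr aY (a (j + 1) k) = τ.arr aY (a (j + 1) k) ∧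
        υ.arr aMU (a (j + 1) k) = τ.arr aMU (a (j + 1) k) :=
      fun j hj hji k hk => hfr _ fun k' hk' => hne i hi j hj hji k hk k' hk'
    rw [wp_set]
    refine ⟨by simp [e1]; omega, by simp [e1], ⟨fun j hj => ?_, hB, fun j hij hj k hk => ?_, ?_⟩,
      by omega⟩
    · rcases Nat.lt_succ_iff_lt_or_eq.1 hj with hj | rfl
      · obtain ⟨L, hL⟩ := h1 j hj
        obtain ⟨g1, g2, g3, g4⟩ := hfr' (j + 1) (by omega)
        exact ⟨L, hL.frame (fun k hk => (e2 j (by omega) (by omega) k hk).1) g1 g2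
          (hfr' j (by omega)).2.2.1 g3 g4⟩
      · exact hD
    · simp only [Store.set_arr]
      rw [(e2 j hj (by omega) k hk).2]
      exact h3 j (by omega) hj k hk
    · simp only [Store.set_arr]
      rw [(hfr' 0 (by omega)).2.2.1, h4]
  · rintro t τ hA _ ⟨h1, -, -, h4⟩ ht
    exact ⟨by simpa using ht, h4, h1⟩

end WordRAM


namespace WordRAM
open WordRAM.Expr WordRAM.Cmd

/-! ### Reconstruction of the solution -/

notation "vD" => (53 : ℕ)

/-- The recorded choices determine a path from its end. The correctness statement of the dynamic
program speaks of the whole path, while the machine only ever holds one state of it. -/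
theorem exists_backward_path (φ : ℕ → ℕ → ℕ) (x₀ s : ℕ) :
    ∃ x : ℕ → ℕ, x s = x₀ ∧ ∀ j < s, x j = φ j (x (j + 1)) := by
  induction s generalizing x₀ with
  | zero => exact ⟨fun _ => x₀, rfl, fun _ h => absurd h (Nat.not_lt_zero _)⟩
  | succ s ih =>
    obtain ⟨x, h1, h2⟩ := ih (φ s x₀)
    refine ⟨fun j => if j = s + 1 then x₀ else x j, by simp, fun j hj => ?_⟩
    rcases Nat.lt_succ_iff_lt_or_eq.1 hj with hj | rfl
    · simp only [if_neg (show j ≠ s + 1 by omega), if_neg (show j + 1 ≠ s + 1 by omega)]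
      exact h2 j hj
    · simp [h1]

theorem ClassEnv.family {E : Env} {I : Items} {u p y : ℕ → ℕ} {s pen : ℕ} {m : ℕ → ℕ}
    {a e : ℕ → ℕ → ℕ} {L : ℕ → ℕ} (hC : ClassEnv E I u s pen (classSum m a p) m a)
    (hsz : ∀ i < I.n, I.sz i ≤ s)
    (h : ∀ j < s, ClassData I u y s (classSum m a p (j + 1)) (j + 1) (m (j + 1)) (a (j + 1))
      (L (j + 1)) (e (j + 1))) : ClassFamily I u y s p m a L e :=
  ⟨hC.fits.pos, hsz, hC.filter, h⟩

theorem dpTable_of_classDone {I : Items} {u : ℕ → ℕ} {s pen : ℕ} {P m L : ℕ → ℕ}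
    {a : ℕ → ℕ → ℕ} {τ : Store} (hF : ∀ x ≤ 2 * (s * s), τ.arr aF 0 x = if s * s ≤ x then pen else 0)
    (h : ∀ j < s, ClassDone I u s pen P m a τ j (L (j + 1))) :
    DPTable s pen (fun j => gain I.v (τ.arr aE j) pen (2 * (s * s) / j + 1) (min (P j) s) (L j))
      (τ.arr aF) (τ.arr aCH) :=
  ⟨hF, fun j hj x hx => ((h j hj).2.2.2 x hx).le, fun j hj x hx => ((h j hj).2.2.2 x hx).eq,
    fun j hj x hx b hb => ((h j hj).2.2.2 x hx).max b hb⟩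

/-- Add the first `vw` copies of the list of class `vj` to the solution. -/
def addCopies : Cmd :=
  vk ::= 0 ;;
  whl (§vk ≺ §vw)
    (vid ::= ld aE §vj §vk ;; put aY §vid 0 (ld aY §vid 0 + 1) ;; vk ::= §vk + 1)

theorem addCopies_spec {E : Env} {I : Items} (hF : I.Fits E) {σ : Store} {j w : ℕ} {e : ℕ → ℕ}
    (hj : σ.var vj = j) (hw : σ.var vw = w) (hjW : j < E.W) (hwW : w + 2 < E.W)
    (he : ∀ x < w, σ.arr aE j x = e x) (hen : ∀ x < w, e x < I.n)
    (hB : ∀ i < I.n, σ.arr aY i 0 + copies e w i < E.B) :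
    wp E addCopies σ (fun t τ => t ≤ w ∧
      ∀ i, τ.arr aY i 0 = σ.arr aY i 0 + copies e w i) := by
  have hWB := hF.WB
  have hnW := hF.n_lt
  simp only [addCopies, wp_seq, wp_set]
  refine ⟨by simp, ?_⟩
  refine wp_for w (fun k τ => ∀ i, τ.arr aY i 0 = σ.arr aY i 0 + copies e k i)
    (fun _ => 0) (by simp) (by simp [copies]) ?_ ?_ ?_
  · intro k τ hA _
    exact ⟨by simp, (hA.v vw rfl).trans (by simp [hw])⟩
  · intro k τ hk hA hvk h
    have e1 : τ.var vj = j := (hA.v vj rfl).trans (by simp [hj])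
    have e2 : τ.arr aE j k = e k := by rw [hA.a aE rfl]; simpa using he k hk
    have e3 := h (e k)
    have h1 := hen k hk
    have h2 := hB (e k) h1
    have h3 := copies_mono e (Nat.succ_le_of_lt hk) (e k)
    rw [copies_succ, if_pos rfl] at h3
    simp [e1, e2, e3, hvk, hF.live]
    refine ⟨by omega, by omega, by omega, by omega, fun i => ?_⟩
    rw [copies_succ]
    by_cases hi : i = e k
    · subst hi; simp; omega
    · simp [hi, h i, Ne.symm hi]
  · rintro t τ hA _ h ht
    exact ⟨by simpa using ht, h⟩

theorem Items.Optimal.congr {I : Items} {u z z' : ℕ → ℕ} {cap : ℕ} (h : I.Optimal u cap z)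
    (hz : ∀ i < I.n, z' i = z i) : I.Optimal u cap z' := by
  have hv : I.value z' = I.value z := sum_congr rfl fun i hi => by rw [hz i (mem_range.1 hi)]
  refine ⟨⟨fun i hi => by rw [hz i hi]; exact h.le i hi, ?_⟩, fun w hw => by
    rw [hv]; exact h.max w hw⟩
  rw [sum_congr rfl fun i hi => by rw [hz i (mem_range.1 hi)]]
  exact h.cap_le

/-- Follow the choices of the dynamic program. -/
def traceback : Cmd :=
  ite (§vD ≼ §vs * §vs) (vx ::= §vs * §vs + §vD) (vx ::= §vs * §vs + §vs * §vs) ;; vj ::= §vs ;;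
  whl (0 ≺ §vj)
    (vb ::= ld aCH §vj §vx ;; vw ::= §vx / §vj + ld aR §vj 0 - §vb ;; addCopies ;;
     vx ::= §vx % §vj + §vj * §vb ;; vj ::= §vj - 1)

theorem traceback_spec {E : Env} {I : Items} {u p : ℕ → ℕ} {s cap pen D : ℕ} {m L : ℕ → ℕ}
    {a : ℕ → ℕ → ℕ} (hC : ClassEnv E I u s pen (classSum m a p) m a) (hs : 0 < s)
    (hsz : ∀ i < I.n, I.sz i ≤ s) (hp : IsGreedy I u I.n id cap p) (hpen : pen = I.value u + 1)
    (hD : D + ∑ i ∈ range I.n, I.sz i * p i = cap) {σ : Store} (hvs : σ.var vs = s)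
    (hvD : σ.var vD = D) (huB : ∀ i < I.n, u i < E.B)
    (hF0 : ∀ x ≤ 2 * (s * s), σ.arr aF 0 x = if s * s ≤ x then pen else 0)
    (hL : ∀ j < s, ClassDone I u s pen (classSum m a p) m a σ j (L (j + 1))) :
    wp E traceback σ (fun t τ => t ≤ s + s * (2 * s) ∧
      I.Optimal u cap (fun i => τ.arr aY i 0)) := by
  have hF := hC.fits
  have hWB := hF.WB
  have hnW := hF.n_lt
  have hsW := hC.s_lt
  have hT := dpTable_of_classDone hF0 hL
  have hfam : ClassFamily I u (fun i => σ.arr aY i 0) s p m a L (σ.arr aE) :=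
    hC.family hsz fun j hj => (hL j hj).1
  obtain ⟨x, hxs, hx⟩ := exists_backward_path
    (fun j z => z % (j + 1) + (j + 1) * σ.arr aCH (j + 1) z) (s * s + min D (s * s)) s
  obtain ⟨K, hK⟩ : ∃ K : ℕ → ℕ, ∀ j < s, K (j + 1) = x (j + 1) / (j + 1) +
      min (classSum m a p (j + 1)) s - σ.arr aCH (j + 1) (x (j + 1)) :=
    ⟨fun j => x j / j + min (classSum m a p j) s - σ.arr aCH j (x j), fun _ _ => rfl⟩
  obtain ⟨hKL, hopt⟩ := hfam.optimal hs hp hpen hD (fun _ _ _ _ => rfl) hT hxs hx hK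
  have hxN : ∀ d ≤ s, x (s - d) ≤ 2 * (s * s) := by
    intro d
    induction d with
    | zero => intro _; rw [Nat.sub_zero, hxs]; omega
    | succ d ih =>
      intro hd
      have h1 := hT.choice_le (s - (d + 1)) (by omega) _ (ih (by omega))
      have h2 := hx (s - (d + 1)) (by omega)
      rw [show s - (d + 1) + 1 = s - d by omega] at h1 h2
      rw [h2]
      exact h1
  replace hxN : ∀ j ≤ s, x j ≤ 2 * (s * s) := fun j hj => by
    have := hxN (s - j) (by omega)
    rwa [show s - (s - j) = j by omega] at this
  have hss : s ≤ s * s := Nat.le_mul_of_pos_left _ hs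
  have hKs : ∀ j < s, K (j + 1) ≤ 2 * s := fun j hj => (hKL j hj).2.trans (hL j hj).2.1
  have hmem : ∀ j < s, ∀ k < L (j + 1), σ.arr aE (j + 1) k < I.n ∧
      I.sz (σ.arr aE (j + 1) k) = j + 1 := by
    intro j hj k hk
    obtain ⟨q, hq, h⟩ := (hL j hj).1.mem k hk
    rw [h]
    exact ⟨hfam.lt_n hj hq, (hL j hj).1.size q hq⟩
  simp only [traceback, wp_seq, wp_ite, wp_set]
  have main : ∀ σ₁ : Store, Agree traceback σ σ₁ → σ₁.arr aY = σ.arr aY → σ₁.var vx = x s →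
      σ₁.var vj = s → wp E (whl (0 ≺ §vj)
    (vb ::= ld aCH §vj §vx ;; vw ::= §vx / §vj + ld aR §vj 0 - §vb ;; addCopies ;;
     vx ::= §vx % §vj + §vj * §vb ;; vj ::= §vj - 1)) σ₁ (fun t τ => t ≤ s + s * (2 * s) ∧
      I.Optimal u cap (fun i => τ.arr aY i 0)) := by
    intro σ₁ hA₁ hY hvx hvj
    -- Sizes above `vj` have received their listed copies in addition to the base, the others still
    -- hold the base.
    refine wp_whl (fun τ => τ.var vj ≤ s ∧ τ.var vx = x (τ.var vj) ∧ ∀ i < I.n, τ.arr aY i 0 =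
        σ.arr aY i 0 + if τ.var vj < I.sz i then copies (σ.arr aE (I.sz i)) (K (I.sz i)) i else 0)
      (fun τ => τ.var vj * (2 * s + 1)) ?_ ?_ ?_
    · refine ⟨hvj.le, by rw [hvx, hvj], fun i hi => ?_⟩
      have := hsz i hi
      rw [hY, hvj, if_neg (by omega)]; rfl
    · rintro τ hA ⟨h1, h2, h3⟩
      refine ⟨by simp, fun h0 => ?_⟩
      obtain ⟨j, hj⟩ : ∃ j, τ.var vj = j + 1 := ⟨τ.var vj - 1, by simp at h0; omega⟩
      rw [hj] at h1 h2 h3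
      have hjs : j < s := by omega
      have e1 : τ.arr aCH = σ.arr aCH := (hA.a aCH rfl).trans (hA₁.a aCH rfl)
      have e2 : τ.arr aR (j + 1) 0 = min (classSum m a p (j + 1)) s := by
        rw [(hA.a aR rfl).trans (hA₁.a aR rfl)]; exact (hL j hjs).2.2.1
      have e3 : τ.arr aE = σ.arr aE := (hA.a aE rfl).trans (hA₁.a aE rfl)
      have h4 := hxN (j + 1) h1
      obtain ⟨h5, h6⟩ := hKL j hjs
      have h7 := hKs j hjs
      have h8 := hK j hjs
      have h9 := hxN j hjs.le
      have h10 := hx j hjs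
      have h11 : x (j + 1) / (j + 1) ≤ x (j + 1) := Nat.div_le_self _ _
      simp only [wp_seq, wp_set]
      refine ⟨by simp [hF.live, hj, h2]; omega, by simp [hF.live, hj, h2, e1, e2]; omega, ?_⟩
      refine (addCopies_spec hF (j := j + 1) (w := K (j + 1)) (e := σ.arr aE (j + 1))
        (by simp [hj]) (by simp [hj, h2, e1, e2, h8]) (by omega) (by omega)
        (fun k _ => by simp [e3]) (fun k hk => (hmem j hjs k (by omega)).1) fun i hi => ?_).mono ?_
      · simp only [Store.set_arr, h3 i hi]
        have g1 := hopt.le i hi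
        have g2 := huB i hi
        by_cases hij : I.sz i = j + 1
        · rw [if_neg (by omega)]
          rw [hij] at g1
          omega
        · have : copies (σ.arr aE (j + 1)) (K (j + 1)) i = 0 :=
            sum_eq_zero fun k hk => if_neg fun h => hij (by
              rw [← h]; exact (hmem j hjs k ((mem_range.1 hk).trans_le h6)).2)
          rw [this]
          split_ifs <;> omega
      rintro t υ hA' ⟨ht, hυ⟩
      have e4 : υ.var vj = j + 1 := (hA'.v vj rfl).trans (by simp [hj])
      have e5 : υ.var vx = x (j + 1) := (hA'.v vx rfl).trans (by simp [h2])
      have e6 : υ.var vb = σ.arr aCH (j + 1) (x (j + 1)) :=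
        (hA'.v vb rfl).trans (by simp [hj, h2, e1])
      have h12 : x (j + 1) % (j + 1) ≤ x (j + 1) := Nat.mod_le _ _
      refine ⟨by simp [e4, e5, e6]; omega, by simp [e4], ⟨by simp [e4]; omega,
        by simp [e4, e5, e6, h10], fun i hi => ?_⟩, ?_⟩
      · simp [e4, hυ, h3 i hi]
        by_cases hij : I.sz i = j + 1
        · rw [if_neg (by omega), if_pos (by omega), hij]; omega
        · have : copies (σ.arr aE (j + 1)) (K (j + 1)) i = 0 :=
            sum_eq_zero fun k hk => if_neg fun h => hij (by
              rw [← h]; exact (hmem j hjs k ((mem_range.1 hk).trans_le h6)).2)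
          rw [this]
          split_ifs <;> omega
      · simp [e4, hj]
        have : (j + 1) * (2 * s + 1) = j * (2 * s + 1) + (2 * s + 1) := Nat.succ_mul _ _
        omega
    · rintro t τ hA ⟨h1, h2, h3⟩ h0 ht
      have h0 : τ.var vj = 0 := by simpa using h0
      refine ⟨?_, hopt.congr fun i hi => ?_⟩
      · have : s * (2 * s + 1) = s * (2 * s) + s := Nat.mul_succ _ _
        rw [hvj] at ht
        omega
      · have := hF.pos i hi
        rw [h3 i hi, h0, if_pos this]
  refine ⟨by simp [hvs]; omega, fun h => ?_, fun h => ?_⟩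
  · have h : D ≤ s * s := by simpa [hvs, hvD] using h
    refine ⟨by simp [hvs, hvD]; omega, by simp, (main ((σ.set vx _).set vj _)
      ⟨fun y hy => ?_, fun _ _ => rfl⟩ rfl ?_ ?_).mono fun t τ _ h => by simpa using h⟩
    · have g1 : y ≠ vx := by rintro rfl; exact absurd hy (by decide)
      have g2 : y ≠ vj := by rintro rfl; exact absurd hy (by decide)
      simp [g1, g2]
    · simp [hvs, hvD, hxs, h]
    · simp [hvs]
  · have h : s * s < D := by simpa [hvs, hvD] using h
    refine ⟨by simp [hvs]; omega, by simp, (main ((σ.set vx _).set vj _)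
      ⟨fun y hy => ?_, fun _ _ => rfl⟩ rfl ?_ ?_).mono fun t τ _ h => by simpa using h⟩
    · have g1 : y ≠ vx := by rintro rfl; exact absurd hy (by decide)
      have g2 : y ≠ vj := by rintro rfl; exact absurd hy (by decide)
      simp [g1, g2]
    · simp [hvs, hxs, h.le]
    · simp [hvs]

end WordRAM


/-- The original list is the identity, so it contains each element at most once; counting with an
indicator transfers this to the filtered list. -/
theorem IsFilter.inj {p : ℕ → Prop} [DecidablePred p] {m m' : ℕ} {a' : ℕ → ℕ}
    (h : IsFilter p m id m' a') : ∀ k < m', ∀ k' < m', a' k = a' k' → k = k' := by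
  intro k hk k' hk' he
  by_contra hne
  have h1 := h.sum fun i => if i = a' k then 1 else 0
  have h2 : ∑ x ∈ range m, (if p (id x) then if id x = a' k then 1 else 0 else 0) ≤ 1 := by
    refine (sum_le_sum (g := fun x => if x = a' k then 1 else 0) fun x _ => ?_).trans ?_
    · simp only [id]; split_ifs <;> simp
    · rw [sum_ite_eq']; split_ifs <;> simp
  have h3 : ∑ x ∈ ({k, k'} : Finset ℕ), (if a' x = a' k then 1 else 0) ≤
      ∑ x ∈ range m', if a' x = a' k then 1 else 0 :=
    sum_le_sum_of_subset fun x hx => by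
      simp only [mem_insert, mem_singleton] at hx
      rcases hx with rfl | rfl
      exacts [mem_range.2 hk, mem_range.2 hk']
  rw [sum_pair hne, if_pos rfl, if_pos he.symm] at h3
  omega

namespace WordRAM
open WordRAM.Expr WordRAM.Cmd

/-! ### Setup -/

notation "vn" => (54 : ℕ)
notation "vt" => (55 : ℕ)

/-- Copy the items from the input. -/
def copyInput : Cmd :=
  vk ::= 0 ;; vs ::= 0 ;; vpen ::= 1 ;;
  whl (§vk ≺ §vn)
    (put aS §vk 0 (ld 0 (3 * §vk + 2) 0) ;; put aV §vk 0 (ld 0 (3 * §vk + 3) 0) ;;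
     put aMU §vk 0 (ld 0 (3 * §vk + 4) 0) ;; put aCL 0 §vk §vk ;;
     vz ::= ld aS §vk 0 ;; ite (§vs ≺ §vz) (vs ::= §vz) skip ;;
     vpen ::= §vpen + ld aV §vk 0 * ld aMU §vk 0 ;; vk ::= §vk + 1) ;;
  put aCN 0 0 §vn

theorem copyInput_spec {E : Env} {I : Items} (hF : I.Fits E) {u : ℕ → ℕ} {σ : Store}
    (hn : σ.var vn = I.n) (hS : ∀ i < I.n, σ.arr 0 (3 * i + 2) 0 = I.sz i)
    (hV : ∀ i < I.n, σ.arr 0 (3 * i + 3) 0 = I.v i) (hU : ∀ i < I.n, σ.arr 0 (3 * i + 4) 0 = u i)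
    (hW : 3 * I.n + 4 < E.W) (hB : I.value u + 1 < E.B) :
    wp E copyInput σ (fun t τ => t ≤ I.n ∧ I.In τ ∧ I.Mult u τ ∧ ListRow E I τ 0 I.n id ∧
      τ.var vs = (range I.n).sup I.sz ∧ τ.var vpen = I.value u + 1) := by
  have hWB := hF.WB
  have hnW := hF.n_lt
  simp only [copyInput, wp_seq, wp_set, wp_put]
  refine ⟨by simp, by simp, by simp, ?_⟩
  refine wp_for I.n (fun k τ => (∀ i < k, τ.arr aS i 0 = I.sz i ∧ τ.arr aV i 0 = I.v i ∧
      τ.arr aMU i 0 = u i ∧ τ.arr aCL 0 i = i) ∧ τ.var vs = (range k).sup I.sz ∧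
      τ.var vpen = ∑ i ∈ range k, I.v i * u i + 1) (fun _ => 0) (by simp) (by simp) ?_ ?_ ?_
  · intro k τ hA _
    exact ⟨by simp, (hA.v vn rfl).trans (by simp [hn])⟩
  · rintro k τ hk hA hvk ⟨h1, h2, h3⟩
    have e0 : τ.arr 0 = σ.arr 0 := (hA.a 0 rfl).trans (by simp)
    have e1 := hS k hk
    have e2 := hV k hk
    have e3 := hU k hk
    rw [← e0] at e1 e2 e3
    have b : ∑ x ∈ range (k + 1), I.v x * u x ≤ I.value u :=
      sum_le_sum_of_subset (range_subset_range.2 hk)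
    rw [sum_range_succ] at b
    simp only [wp_seq, wp_set, wp_put, wp_ite, wp_skip]
    refine ⟨by simp [hF.live, hvk]; omega, by simp [hvk]; omega, by simp [hF.live, hvk]; omega,
      by simp [hvk]; omega, by simp [hF.live, hvk]; omega, by simp [hvk]; omega,
      by simp [hF.live, hvk]; omega, by simp, by simp [hF.live, hvk]; omega, by simp,
      fun h => ?_, fun h => ?_⟩
    · have h : τ.var vs < I.sz k := by simpa [hvk, e1] using h
      refine ⟨by simp, by simp [hF.live, hvk, e2, e3, h3]; omega, by simp [hvk]; omega,
        by simp [hvk], ⟨fun i hi => ?_, ?_, ?_⟩, by simp⟩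
      · simp [hvk, e1, e2, e3]
        by_cases hik : i = k
        · simp [hik]
        · simpa [hik] using h1 i (by omega)
      · rw [range_add_one, sup_insert, ← h2]
        simp [hvk, e1, h.le]
      · simp [hvk, e2, e3, h3, sum_range_succ]; omega
    · have h : I.sz k ≤ τ.var vs := by simpa [hvk, e1] using h
      refine ⟨by simp [hF.live, hvk, e2, e3, h3]; omega, by simp [hvk]; omega,
        by simp [hvk], ⟨fun i hi => ?_, ?_, ?_⟩, by simp⟩
      · simp [hvk, e1, e2, e3]
        by_cases hik : i = k
        · simp [hik]
        · simpa [hik] using h1 i (by omega)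
      · rw [range_add_one, sup_insert, ← h2]
        simp [h]
      · simp [hvk, e2, e3, h3, sum_range_succ]; omega
  · rintro t τ hA _ ⟨h1, h2, h3⟩ ht
    have e1 : τ.var vn = I.n := (hA.v vn rfl).trans (by simp [hn])
    refine ⟨by simp [hF.live]; omega, by simp, by simpa using ht,
      ⟨fun i hi => by simpa using (h1 i hi).1, fun i hi => by simpa using (h1 i hi).2.1⟩,
      ⟨fun i hi => by simpa using (h1 i hi).2.2.1⟩, ⟨by omega, by simp [e1], by omega,
      fun i hi => by simpa using (h1 i hi).2.2.2, fun i hi => hi, fun _ _ _ _ h => h⟩, h2, h3⟩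

/-- Clear the counters of the size classes. -/
def clearClasses : Cmd :=
  vk ::= 0 ;;
  whl (§vk ≺ §vs) (put aCN (§vk + 1) 0 0 ;; put aCP (§vk + 1) 0 0 ;; vk ::= §vk + 1)

theorem clearClasses_spec {E : Env} (hlive : E.live) (hWB : E.W ≤ E.B) {σ : Store} {s : ℕ}
    (hs : σ.var vs = s) (hsW : s + 64 < E.W) :
    wp E clearClasses σ (fun t τ => t ≤ s ∧
      (∀ j < s, τ.arr aCN (j + 1) 0 = 0 ∧ τ.arr aCP (j + 1) 0 = 0) ∧
      τ.arr aCN 0 = σ.arr aCN 0) := by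
  simp only [clearClasses, wp_seq, wp_set]
  refine ⟨by simp, ?_⟩
  refine wp_for s (fun k τ => (∀ j < k, τ.arr aCN (j + 1) 0 = 0 ∧ τ.arr aCP (j + 1) 0 = 0) ∧
      τ.arr aCN 0 = σ.arr aCN 0) (fun _ => 0) (by simp) (by simp) ?_ ?_ ?_
  · intro k τ hA _
    exact ⟨by simp, (hA.v vs rfl).trans (by simp [hs])⟩
  · rintro k τ hk hA hvk ⟨h1, h2⟩
    simp [hvk, hlive]
    exact ⟨by omega, by omega, fun j hj => ⟨fun h => (h1 j (by omega)).1,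
      fun h => (h1 j (by omega)).2⟩, h2⟩
  · rintro t τ hA _ ⟨h1, h2⟩ ht
    exact ⟨by simpa using ht, h1, h2⟩

/-- Sort the items into size classes. -/
def fillClasses : Cmd :=
  vk ::= 0 ;;
  whl (§vk ≺ §vn)
    (vz ::= ld aS §vk 0 ;; vw ::= ld aCN §vz 0 ;; put aCL §vz §vw §vk ;;
     put aCN §vz 0 (§vw + 1) ;; vk ::= §vk + 1)

/-- A bucket sort by size. The lists for all sizes together have length `n`, and row `0`, which
lists all items, is not touched because sizes are positive. -/
theorem fillClasses_spec {E : Env} {I : Items} (hF : I.Fits E) {σ : Store} (hI : I.In σ) {s : ℕ}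
    (hn : σ.var vn = I.n) (hsz : ∀ i < I.n, I.sz i ≤ s) (hsW : s + 64 < E.W)
    (h0 : ∀ j < s, σ.arr aCN (j + 1) 0 = 0) :
    wp E fillClasses σ (fun t τ => t ≤ I.n ∧
      (∀ j < s, IsFilter (fun i => I.sz i = j + 1) I.n id (τ.arr aCN (j + 1) 0)
        (τ.arr aCL (j + 1))) ∧ τ.arr aCN 0 = σ.arr aCN 0 ∧ τ.arr aCL 0 = σ.arr aCL 0) := by
  have hWB := hF.WB
  have hnW := hF.n_lt
  simp only [fillClasses, wp_seq, wp_set]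
  refine ⟨by simp, ?_⟩
  refine wp_for I.n (fun k τ =>
      (∀ j < s, IsFilter (fun i => I.sz i = j + 1) k id (τ.arr aCN (j + 1) 0)
        (τ.arr aCL (j + 1)) ∧ τ.arr aCN (j + 1) 0 ≤ k) ∧ τ.arr aCN 0 = σ.arr aCN 0 ∧
      τ.arr aCL 0 = σ.arr aCL 0) (fun _ => 0) (by simp) ?_ ?_ ?_ ?_
  · refine ⟨fun j hj => ?_, rfl, rfl⟩
    have := h0 j hj
    simp [this, IsFilter.zero]
  · intro k τ hA _
    exact ⟨by simp, (hA.v vn rfl).trans (by simp [hn])⟩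
  · rintro k τ hk hA hvk ⟨h1, h2, h3⟩
    obtain ⟨j, hj⟩ : ∃ j, I.sz k = j + 1 := ⟨I.sz k - 1, by have := hF.pos k hk; omega⟩
    have e1 : τ.arr aS k 0 = j + 1 := by rw [hA.a aS rfl, ← hj]; simpa using hI.S k hk
    have hjs : j < s := by have := hsz k hk; omega
    obtain ⟨g1, g2⟩ := h1 j hjs
    simp [hvk, hF.live, e1]
    refine ⟨by omega, by omega, by omega, by omega, by omega, by omega, fun i hi => ?_, h2, h3⟩
    by_cases hij : i = j
    · subst hij
      simp
      exact ⟨g1.pos hj (fun x hx => by simp [hx.ne]) (by simp), by omega⟩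
    · simp [hij]
      obtain ⟨g3, g4⟩ := h1 i hi
      exact ⟨g3.neg (by simp only [id]; omega), by omega⟩
  · rintro t τ hA _ ⟨h1, h2, h3⟩ ht
    exact ⟨by simpa using ht, fun j hj => (h1 j hj).1, h2, h3⟩

/-- The initial row of the dynamic program. -/
def initRow : Cmd :=
  vk ::= 0 ;;
  whl (§vk ≺ 2 * (§vs * §vs) + 1)
    (ite (§vs * §vs ≼ §vk) (put aF 0 §vk §vpen) (put aF 0 §vk 0) ;; vk ::= §vk + 1)

theorem initRow_spec {E : Env} (hlive : E.live) (hWB : E.W ≤ E.B) {σ : Store} {s pen : ℕ}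
    (hs : σ.var vs = s) (hpen : σ.var vpen = pen) (hsW : 2 * (s * s) + 64 < E.W) :
    wp E initRow σ (fun t τ => t ≤ 2 * (s * s) + 1 ∧
      ∀ x ≤ 2 * (s * s), τ.arr aF 0 x = if s * s ≤ x then pen else 0) := by
  have h4 : s * s ≤ 2 * (s * s) := by omega
  simp only [initRow, wp_seq, wp_set]
  refine ⟨by simp, ?_⟩
  refine wp_for (2 * (s * s) + 1) (fun k τ => ∀ x < k, τ.arr aF 0 x = if s * s ≤ x then pen else 0)
    (fun _ => 0) (by simp) (by simp) ?_ ?_ ?_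
  · intro k τ hA _
    have e1 : τ.var vs = s := (hA.v vs rfl).trans (by simp [hs])
    exact ⟨by simp [e1]; omega, by simp [e1]⟩
  · intro k τ hk hA hvk h
    have e1 : τ.var vs = s := (hA.v vs rfl).trans (by simp [hs])
    have e2 : τ.var vpen = pen := (hA.v vpen rfl).trans (by simp [hpen])
    simp only [wp_seq, wp_set, wp_ite, wp_put]
    refine ⟨by simp [e1]; omega, fun hk' => ?_, fun hk' => ?_⟩
    · have hk' : s * s ≤ k := by simpa [e1, hvk] using hk'
      refine ⟨by simp [hlive, hvk]; omega, by simp, by simp [hvk]; omega, by simp [hvk],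
        fun x hx => ?_, by simp⟩
      simp [hvk, e2]
      by_cases hxk : x = k
      · subst hxk; simp [hk']
      · simpa [hxk] using h x (by omega)
    · have hk' : k < s * s := by simpa [e1, hvk] using hk'
      refine ⟨by simp [hlive, hvk]; omega, by simp, by simp [hvk]; omega, by simp [hvk],
        fun x hx => ?_, by simp⟩
      simp [hvk]
      by_cases hxk : x = k
      · subst hxk; simp [hk'.not_ge]
      · simpa [hxk] using h x (by omega)
  · rintro t τ hA _ h ht
    exact ⟨by simpa using ht, fun x hx => h x (by omega)⟩

/-- Count the items of the greedy solution in each class. -/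
def countClasses : Cmd :=
  vk ::= 0 ;;
  whl (§vk ≺ §vn)
    (vz ::= ld aS §vk 0 ;; put aCP §vz 0 (ld aCP §vz 0 + ld aX §vk 0) ;; vk ::= §vk + 1)

theorem countClasses_spec {E : Env} {I : Items} (hF : I.Fits E) {σ : Store} (hI : I.In σ) {s : ℕ}
    (hn : σ.var vn = I.n) (hsz : ∀ i < I.n, I.sz i ≤ s) (hsW : s + 64 < E.W)
    (hB : ∑ i ∈ range I.n, σ.arr aX i 0 < E.B) (h0 : ∀ j < s, σ.arr aCP (j + 1) 0 = 0) :
    wp E countClasses σ (fun t τ => t ≤ I.n ∧ ∀ j < s, τ.arr aCP (j + 1) 0 =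
      ∑ i ∈ range I.n, if I.sz i = j + 1 then σ.arr aX i 0 else 0) := by
  have hWB := hF.WB
  have hnW := hF.n_lt
  simp only [countClasses, wp_seq, wp_set]
  refine ⟨by simp, ?_⟩
  refine wp_for I.n (fun k τ => ∀ j < s, τ.arr aCP (j + 1) 0 =
      ∑ i ∈ range k, if I.sz i = j + 1 then σ.arr aX i 0 else 0)
    (fun _ => 0) (by simp) (by simpa using h0) ?_ ?_ ?_
  · intro k τ hA _
    exact ⟨by simp, (hA.v vn rfl).trans (by simp [hn])⟩
  · intro k τ hk hA hvk h
    obtain ⟨j, hj⟩ : ∃ j, I.sz k = j + 1 := ⟨I.sz k - 1, by have := hF.pos k hk; omega⟩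
    have e1 : τ.arr aS k 0 = j + 1 := by rw [hA.a aS rfl, ← hj]; simpa using hI.S k hk
    have e2 : τ.arr aX = σ.arr aX := (hA.a aX rfl).trans (by simp)
    have hjs : j < s := by have := hsz k hk; omega
    have g1 := h j hjs
    have g2 : ∑ i ∈ range k, (if I.sz i = j + 1 then σ.arr aX i 0 else 0) + σ.arr aX k 0 ≤
        ∑ i ∈ range I.n, σ.arr aX i 0 := by
      refine le_trans ?_ (sum_le_sum_of_subset (range_subset_range.2 hk))
      rw [sum_range_succ]
      exact Nat.add_le_add_right (sum_le_sum fun i _ => by split_ifs <;> omega) _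
    simp [-sum_boole, hvk, hF.live, e1, e2, g1]
    refine ⟨by omega, by omega, by omega, by omega, fun i hi => ?_⟩
    rw [sum_range_succ, hj]
    by_cases hij : i = j
    · subst hij; simp
    · have : ¬ j = i := fun h => hij h.symm
      simp [hij, this, h i hi]
  · rintro t τ hA _ h ht
    exact ⟨by simpa using ht, h⟩

/-- Write the solution and its value. -/
def output : Cmd :=
  vk ::= 0 ;; vz ::= 0 ;;
  whl (§vk ≺ §vn)
    (vz ::= §vz + ld aV §vk 0 * ld aY §vk 0 ;; put 0 (§vk + 1) 0 (ld aY §vk 0) ;;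
     vk ::= §vk + 1) ;;
  put 0 0 0 §vz

theorem output_spec {E : Env} {I : Items} (hF : I.Fits E) {σ : Store} (hI : I.In σ)
    (hn : σ.var vn = I.n) (hB : I.value (fun i => σ.arr aY i 0) < E.B) :
    wp E output σ (fun t τ => t ≤ I.n ∧ τ.arr 0 0 0 = I.value (fun i => σ.arr aY i 0) ∧
      ∀ i < I.n, τ.arr 0 (i + 1) 0 = σ.arr aY i 0) := by
  have hWB := hF.WB
  have hnW := hF.n_lt
  simp only [output, wp_seq, wp_set, wp_put]
  refine ⟨by simp, by simp, ?_⟩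
  refine wp_for I.n (fun k τ => τ.var vz = ∑ i ∈ range k, I.v i * σ.arr aY i 0 ∧
      ∀ i < k, τ.arr 0 (i + 1) 0 = σ.arr aY i 0) (fun _ => 0) (by simp) (by simp) ?_ ?_ ?_
  · intro k τ hA _
    exact ⟨by simp, (hA.v vn rfl).trans (by simp [hn])⟩
  · rintro k τ hk hA hvk ⟨h1, h2⟩
    have e1 : τ.arr aV k 0 = I.v k := by rw [hA.a aV rfl]; simpa using hI.V k hk
    have e2 : τ.arr aY = σ.arr aY := (hA.a aY rfl).trans (by simp)
    have b : ∑ x ∈ range (k + 1), I.v x * σ.arr aY x 0 ≤ I.value (fun i => σ.arr aY i 0) :=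
      sum_le_sum_of_subset (range_subset_range.2 hk)
    rw [sum_range_succ] at b
    simp [hvk, hF.live, e1, e2, h1, sum_range_succ]
    refine ⟨by omega, by omega, by omega, by omega, fun i hi => ?_⟩
    by_cases hik : i = k
    · simp [hik]
    · simpa [hik] using h2 i (by omega)
  · rintro t τ hA _ ⟨h1, h2⟩ ht
    refine ⟨by simp; omega, by simp, by simpa using ht, by simp [h1, Items.value], fun i hi => ?_⟩
    simpa using h2 i hi

end WordRAM


/-! ### The complete algorithm -/

namespace WordRAM
open WordRAM.Expr WordRAM.Cmd

/-- The knapsack algorithm. -/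
def solve : Cmd :=
  copyInput ;; clearClasses ;; fillClasses ;; initRow ;; vrow ::= 0 ;; vgc ::= §vt ;; greedy ;;
  vD ::= §vrem ;; countClasses ;; classLoop ;; traceback ;; output

structure SolveEnv (E : Env) (I : Items) (u : ℕ → ℕ) (cap s : ℕ) : Prop where
  fits : I.Fits E
  n_pos : 0 < I.n
  s_eq : (range I.n).sup I.sz = s
  n_lt : 3 * I.n + 4 < E.W
  s_lt : 6 * (s * s) + s + 64 < E.W
  v_lt : ∀ i < I.n, I.v i + 1 < E.B
  sum_lt : ∑ i ∈ range I.n, I.sz i * u i < E.B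
  cap_lt : cap < E.B
  gain_lt : I.value u + 1 + (s + 1) * gainBound s (I.value u + 1) < E.B

theorem solve_spec {E : Env} {I : Items} {u : ℕ → ℕ} {cap s : ℕ} (h : SolveEnv E I u cap s)
    {σ : Store} (hn : σ.var vn = I.n) (ht : σ.var vt = cap)
    (hS : ∀ i < I.n, σ.arr 0 (3 * i + 2) 0 = I.sz i)
    (hV : ∀ i < I.n, σ.arr 0 (3 * i + 3) 0 = I.v i)
    (hU : ∀ i < I.n, σ.arr 0 (3 * i + 4) 0 = u i) :
    wp E solve σ (fun t τ => t ≤ 615 * (I.n + s ^ 3) ∧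
      I.Optimal u cap (fun i => τ.arr 0 (i + 1) 0) ∧
      τ.arr 0 0 0 = I.value (fun i => τ.arr 0 (i + 1) 0)) := by
  have hF := h.fits
  have hWB := hF.WB
  have hnW := hF.n_lt
  have hnW' := h.n_lt
  have hsW := h.s_lt
  have hg := h.gain_lt
  have hsz : ∀ i < I.n, I.sz i ≤ s := fun i hi => by
    rw [← h.s_eq]; exact le_sup (f := I.sz) (mem_range.2 hi)
  have hs : 0 < s := (hF.pos 0 h.n_pos).trans_le (hsz 0 h.n_pos)
  obtain ⟨pen, hpen⟩ : ∃ pen, pen = I.value u + 1 := ⟨_, rfl⟩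
  have hu : ∀ i < I.n, u i ≤ I.sz i * u i := fun i hi => Nat.le_mul_of_pos_left _ (hF.pos i hi)
  have huB : ∀ i < I.n, u i < E.B := fun i hi =>
    ((hu i hi).trans (single_le_sum (f := fun i => I.sz i * u i) (fun _ _ => Nat.zero_le _)
      (mem_range.2 hi))).trans_lt h.sum_lt
  rw [solve, wp_seq]
  refine (copyInput_spec hF hn hS hV hU hnW' (by omega)).mono ?_
  rintro t₁ τ₁ A₁ ⟨ht₁, hI₁, hmu₁, hrow₁, hs₁, hpen₁⟩
  rw [h.s_eq] at hs₁
  rw [← hpen] at hpen₁ hg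
  have hn₁ : τ₁.var vn = I.n := (A₁.v vn rfl).trans hn
  rw [wp_seq]
  refine (clearClasses_spec hF.live hWB hs₁ (by omega)).mono ?_
  rintro t₂ τ₂ A₂ ⟨ht₂, hclr, hcn₂⟩
  have hn₂ : τ₂.var vn = I.n := (A₂.v vn rfl).trans hn₁
  have hI₂ : I.In τ₂ := hI₁.of_eq (A₂.a aS rfl) (A₂.a aV rfl)
  rw [wp_seq]
  refine (fillClasses_spec hF hI₂ (s := s) hn₂ hsz (by omega) fun j hj => (hclr j hj).1).mono ?_
  rintro t₃ τ₃ A₃ ⟨ht₃, hfil, hcn₃, hcl₃⟩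
  obtain ⟨m, hm⟩ : ∃ m : ℕ → ℕ, ∀ j, m j = τ₃.arr aCN j 0 := ⟨_, fun _ => rfl⟩
  obtain ⟨a, ha⟩ : ∃ a : ℕ → ℕ → ℕ, a = τ₃.arr aCL := ⟨_, rfl⟩
  simp only [← hm, ← ha] at hfil
  have hI₃ : I.In τ₃ := hI₂.of_eq (A₃.a aS rfl) (A₃.a aV rfl)
  have hrow₃ : ListRow E I τ₃ 0 I.n id := by
    refine ⟨by omega, ?_, by omega, fun k hk => ?_, fun k hk => hk, fun _ _ _ _ h => h⟩
    · rw [hcn₃, hcn₂]; exact hrow₁.len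
    · rw [hcl₃, A₂.a aCL rfl]; exact hrow₁.elem k hk
  rw [wp_seq]
  refine (initRow_spec hF.live hWB (s := s) (pen := pen) ?_ ?_ (by omega)).mono ?_
  · rw [A₃.v vs rfl, A₂.v vs rfl, hs₁]
  · rw [A₃.v vpen rfl, A₂.v vpen rfl, hpen₁]
  rintro t₄ τ₄ A₄ ⟨ht₄, hF0⟩
  have hI₄ : I.In τ₄ := hI₃.of_eq (A₄.a aS rfl) (A₄.a aV rfl)
  have e1 : τ₄.var vt = cap := by
    rw [A₄.v vt rfl, A₃.v vt rfl, A₂.v vt rfl, A₁.v vt rfl, ht]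
  have e2 : τ₄.var vs = s := by rw [A₄.v vs rfl, A₃.v vs rfl, A₂.v vs rfl, hs₁]
  have e3 : τ₄.var vpen = pen := by rw [A₄.v vpen rfl, A₃.v vpen rfl, A₂.v vpen rfl, hpen₁]
  have e4 : τ₄.var vn = I.n := by rw [A₄.v vn rfl, A₃.v vn rfl, hn₂]
  have hmu₄ : I.Mult u τ₄ := hmu₁.of_eq (by rw [A₄.a aMU rfl, A₃.a aMU rfl, A₂.a aMU rfl])
  rw [wp_seq, wp_set, wp_seq, wp_set, wp_seq]
  refine ⟨by simp, by simp, ?_⟩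
  refine (greedy_spec hF (σ := (τ₄.set vrow _).set vgc _) (hI₄.of_eq rfl rfl)
    (hmu₄.of_eq rfl) ((hrow₃.of_eq (A₄.a aCN rfl) (A₄.a aCL rfl)).of_eq rfl rfl)
    (by simp) (cap := cap) (by simp [e1]) h.cap_lt h.sum_lt).mono ?_
  rintro t₅ τ₅ A₅ ⟨ht₅, hD, hgr, -⟩
  obtain ⟨p, hp⟩ : ∃ p : ℕ → ℕ, p = fun i => τ₅.arr aX i 0 := ⟨_, rfl⟩
  rw [← hp] at hgr
  have hpu : ∀ i < I.n, p i ≤ u i := hgr.le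
  have hD : τ₅.var vrem + ∑ i ∈ range I.n, I.sz i * p i = cap := by rw [hp]; exact hD
  have hI₅ : I.In τ₅ := hI₄.of_eq (A₅.a aS rfl) (A₅.a aV rfl)
  rw [wp_seq, wp_set, wp_seq]
  refine ⟨by simp, ?_⟩
  refine (countClasses_spec hF (σ := τ₅.set vD _) (hI₅.of_eq rfl rfl) (s := s) ?_ hsz (by omega)
    ?_ fun j hj => ?_).mono ?_
  · simp [A₅.v vn rfl, e4]
  · refine lt_of_le_of_lt (sum_le_sum fun i hi => ?_) h.sum_lt
    have h1 := hpu i (mem_range.1 hi)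
    rw [hp] at h1
    exact h1.trans (hu i (mem_range.1 hi))
  · have : τ₅.arr aCP = τ₂.arr aCP := by
      rw [A₅.a aCP rfl, Store.set_arr, Store.set_arr, A₄.a aCP rfl, A₃.a aCP rfl]
    rw [Store.set_arr, this]
    exact (hclr j hj).2
  rintro t₆ τ₆ A₆ ⟨ht₆, hcp⟩
  have hcp : ∀ j < s, τ₆.arr aCP (j + 1) 0 = classSum m a p (j + 1) := fun j hj => by
    rw [classSum, (hfil j hj).sum, hcp j hj, hp]; rfl
  have hC : ClassEnv E I u s pen (classSum m a p) m a := by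
    refine ⟨hF, hfil, fun i hi h0 => ?_, h.v_lt, fun j hj => ?_, h.sum_lt, hg, by omega⟩
    · have h1 : I.v i * u i ≤ I.value u := single_le_sum (f := fun i => I.v i * u i)
        (fun _ _ => Nat.zero_le _) (mem_range.2 hi)
      have h2 : I.v i ≤ I.v i * u i := Nat.le_mul_of_pos_right _ h0
      omega
    · rw [classSum, (hfil j hj).sum, mul_sum]
      refine lt_of_le_of_lt (sum_le_sum fun i hi => ?_) h.sum_lt
      simp only [id]
      split_ifs with h1
      · rw [← h1]; exact Nat.mul_le_mul_left _ (hpu i (mem_range.1 hi))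
      · simp
  have eS : τ₆.arr aS = τ₄.arr aS := by rw [A₆.a aS rfl, Store.set_arr, A₅.a aS rfl]; rfl
  have eV : τ₆.arr aV = τ₄.arr aV := by rw [A₆.a aV rfl, Store.set_arr, A₅.a aV rfl]; rfl
  have hI₆ : I.In τ₆ := hI₄.of_eq eS eV
  have hSt : ClassState E I s pen (classSum m a p) m a τ₆ := by
    refine ⟨hI₆, fun j hj => ⟨by omega, ?_, ?_, fun k hk => ?_, fun k hk => ?_,
      (hfil j hj).inj⟩, ?_, ?_, hcp⟩
    · rw [A₆.a aCN rfl, Store.set_arr, A₅.a aCN rfl, Store.set_arr, Store.set_arr, A₄.a aCN rfl, hm]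
    · have : m (j + 1) ≤ I.n := by
        rw [(hfil j hj).card]
        refine (sum_le_sum (g := fun _ => 1) fun i _ => ?_).trans (by simp)
        split_ifs <;> omega
      omega
    · rw [A₆.a aCL rfl, Store.set_arr, A₅.a aCL rfl, Store.set_arr, Store.set_arr, A₄.a aCL rfl, ha]
    · obtain ⟨_, i, hi, h1⟩ := (hfil j hj).mem k hk
      rw [h1]; exact hi
    · rw [A₆.v vs rfl]; simp [A₅.v vs rfl, e2]
    · rw [A₆.v vpen rfl]; simp [A₅.v vpen rfl, e3]
  have hF6 : τ₆.arr aF = τ₄.arr aF := by rw [A₆.a aF rfl, Store.set_arr, A₅.a aF rfl]; rfl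
  rw [← hF6] at hF0
  rw [wp_seq]
  refine (classLoop_spec hC hSt ⟨fun i hi => ?_⟩ hF0).mono ?_
  · rw [A₆.a aMU rfl, Store.set_arr, A₅.a aMU rfl]; exact hmu₄.M i hi
  rintro t₇ τ₇ A₇ ⟨ht₇, hF7, hdone⟩
  rw [← hF7] at hF0
  choose! L hL using hdone
  have e5 : τ₇.var vs = s := (A₇.v vs rfl).trans hSt.s_eq
  -- The lengths were chosen for `j < s`, whereas families are indexed by the size `j + 1`; hence
  -- the shift.
  have hfam := hC.family (y := fun i => τ₇.arr aY i 0) (e := τ₇.arr aE) (L := fun j => L (j - 1))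
    hsz fun j hj => (hL j hj).1
  have hcount := hfam.sum_classes fun _ => 1
  simp only [sum_const, card_range, smul_eq_mul, mul_one] at hcount
  rw [wp_seq]
  refine (traceback_spec hC (L := fun j => L (j - 1)) hs hsz hgr hpen hD e5 ?_ huB hF0 hL).mono ?_
  · rw [A₇.v vD rfl, A₆.v vD rfl]; simp
  rintro t₈ τ₈ A₈ ⟨ht₈, hopt⟩
  refine (output_spec hF (hI₆.of_eq ((A₈.a aS rfl).trans (A₇.a aS rfl))
    ((A₈.a aV rfl).trans (A₇.a aV rfl))) ?_ ?_).mono ?_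
  · rw [A₈.v vn rfl, A₇.v vn rfl, A₆.v vn rfl]; simp [A₅.v vn rfl, e4]
  · have := Items.value_le hopt.le
    omega
  rintro t₉ τ₉ A₉ ⟨ht₉, hval, hx⟩
  have hopt' := hopt.congr hx
  refine ⟨?_, hopt', ?_⟩
  -- The class lists have total length `n`, so the costs linear in the classes add up to `408 * n`;
  -- with the other passes over the items the coefficient of `n` becomes `615`, which exceeds that
  -- of `s ^ 3`.
  · rw [sum_add_distrib, ← mul_sum, hcount, sum_const, card_range, smul_eq_mul] at ht₇
    have h3 : s ^ 3 = s * (s * s) := by ring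
    have h4 : s * (66 * (s * s)) = 66 * s ^ 3 := by ring
    have h5 : s * (2 * s) = 2 * (s * s) := by ring
    have h6 : s * s ≤ s ^ 3 := by rw [h3]; exact Nat.le_mul_of_pos_left _ hs
    have h7 : s ≤ s * s := Nat.le_mul_of_pos_left _ hs
    omega
  · rw [hval]
    exact sum_congr rfl fun i hi => by beta_reduce; rw [hx i (mem_range.1 hi)]

end WordRAM


namespace WordRAM
open WordRAM.Expr WordRAM.Cmd

/-! ### The program -/

/-- Read the sum `S` of the input and compute `S ^ 8`. -/
def readSum : Cmd :=
  vn ::= ld 0 0 0 ;; vt ::= ld 0 1 0 ;; vz ::= §vn + §vt ;; vk ::= 0 ;;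
  whl (§vk ≺ 3 * §vn) (vz ::= §vz + ld 0 (§vk + 2) 0 ;; vk ::= §vk + 1) ;;
  vw ::= §vz * §vz ;; vw ::= §vw * §vw ;; vw ::= §vw * §vw

theorem readSum_spec {E : Env} (hWB : E.W ≤ E.B) {σ : Store} {n cap S : ℕ}
    (hn : σ.arr 0 0 0 = n) (hcap : σ.arr 0 1 0 = cap) (hnW : 3 * n + 4 < E.W)
    (hS : n + cap + ∑ x ∈ range (3 * n), σ.arr 0 (x + 2) 0 = S) (hSB : S ^ 8 < E.B) :
    wp E readSum σ (fun t τ => t ≤ 3 * n ∧ τ.var vn = n ∧ τ.var vt = cap ∧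
      τ.var vw = S ^ 8) := by
  have h1 : S ≤ S ^ 8 := Nat.le_self_pow (by omega) S
  have h2 : S * S ≤ S ^ 8 := by
    rcases Nat.eq_zero_or_pos S with rfl | h
    · simp
    · rw [← pow_two]; exact Nat.pow_le_pow_right h (by omega)
  have h4 : S * S * (S * S) ≤ S ^ 8 := by
    rcases Nat.eq_zero_or_pos S with rfl | h
    · simp
    · rw [show S * S * (S * S) = S ^ 4 by ring]; exact Nat.pow_le_pow_right h (by omega)
  have h8 : S * S * (S * S) * (S * S * (S * S)) = S ^ 8 := by ring
  simp only [readSum, wp_seq, wp_set]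
  refine ⟨by simp; omega, by simp; omega, by simp [hn, hcap]; omega, by simp, ?_⟩
  refine wp_for (3 * n) (fun k τ => τ.var vz = n + cap + ∑ x ∈ range k, σ.arr 0 (x + 2) 0)
    (fun _ => 0) (by simp) (by simp [hn, hcap]) ?_ ?_ ?_
  · intro k τ hA _
    have e1 : τ.var vn = n := (hA.v vn rfl).trans (by simp [hn])
    exact ⟨by simp [e1]; omega, by simp [e1]⟩
  · intro k τ hk hA hvk h
    have e1 : τ.arr 0 = σ.arr 0 := (hA.a 0 rfl).trans (by simp)
    have b : ∑ x ∈ range (k + 1), σ.arr 0 (x + 2) 0 ≤ ∑ x ∈ range (3 * n), σ.arr 0 (x + 2) 0 :=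
      sum_le_sum_of_subset (range_subset_range.2 hk)
    rw [sum_range_succ] at b
    simp [hvk, e1, h, sum_range_succ]
    omega
  · intro t τ hA _ h ht
    have e1 : τ.var vn = n := (hA.v vn rfl).trans (by simp [hn])
    have e2 : τ.var vt = cap := (hA.v vt rfl).trans (by simp [hcap])
    rw [hS] at h
    refine ⟨by simp [h]; omega, by simp [h]; omega, by simp [h]; omega, by simpa using ht,
      by simpa using e1, by simpa using e2, by simp [h, h8]⟩

/-- The first part uses raw memory only and computes the row width. The `mov` stores it in register
`0`, which makes the arrays available to the main part. -/
def knapsackProgram : Program :=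
  readSum.code 0 ++ ([Instr.mov 0 (2 * vw + 1)] ++ (solve.code (readSum.len + 1) ++ [Instr.halt]))

end WordRAM

/-! ### From instances to items, and the choice of the word size -/

namespace Knapsack
open WordRAM

variable {n : ℕ} (K : Knapsack n)

/-- Extension by zero. -/
def ext (f : Fin n → ℕ) (i : ℕ) : ℕ := if h : i < n then f ⟨i, h⟩ else 0

theorem ext_fin (f : Fin n → ℕ) (i : Fin n) : ext f i = f i := by simp [ext]

def items : Items := ⟨n, ext K.size, ext K.value⟩

theorem sum_ext (f g : Fin n → ℕ) (φ : ℕ → ℕ → ℕ) :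
    ∑ i ∈ range n, φ (ext f i) (ext g i) = ∑ i, φ (f i) (g i) := by
  rw [Finset.sum_range]
  exact sum_congr rfl fun i _ => by rw [ext_fin, ext_fin]

theorem ext_le_sum (f : Fin n → ℕ) (i : ℕ) : ext f i ≤ ∑ i, f i := by
  unfold ext
  split_ifs with h
  · exact single_le_sum (f := f) (fun _ _ => Nat.zero_le _) (mem_univ _)
  · exact Nat.zero_le _

theorem inputMem_size {i : ℕ} (hi : i < n) : K.inputMem (3 * i + 2) = ext K.size i := by
  have h : (3 * i + 2 - 2) / 3 = i := by omega
  have h' : (3 * i + 2 - 2) % 3 = 0 := by omega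
  simp only [inputMem, h, h', ext, hi, dif_pos]
  simp

theorem inputMem_value {i : ℕ} (hi : i < n) : K.inputMem (3 * i + 3) = ext K.value i := by
  have h : (3 * i + 3 - 2) / 3 = i := by omega
  have h' : (3 * i + 3 - 2) % 3 = 1 := by omega
  simp only [inputMem, h, h', ext, hi, dif_pos]
  simp

theorem inputMem_mult {i : ℕ} (hi : i < n) : K.inputMem (3 * i + 4) = ext K.mult i := by
  have h : (3 * i + 4 - 2) / 3 = i := by omega
  have h' : (3 * i + 4 - 2) % 3 = 2 := by omega
  simp only [inputMem, h, h', ext, hi, dif_pos]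
  simp

theorem inputSum_eq :
    K.inputSum = n + K.capacity + (∑ i, K.size i + ∑ i, K.value i + ∑ i, K.mult i) := by
  rw [inputSum, sum_add_distrib, sum_add_distrib]

theorem inputMem_le (x : ℕ) : K.inputMem x ≤ K.inputSum := by
  have h := K.inputSum_eq
  unfold inputMem
  split_ifs with h1 h2 h3 h4 h5
  · omega
  · omega
  · have := single_le_sum (f := K.size) (fun _ _ => Nat.zero_le _) (mem_univ ⟨(x - 2) / 3, h3⟩)
    omega
  · have := single_le_sum (f := K.value) (fun _ _ => Nat.zero_le _) (mem_univ ⟨(x - 2) / 3, h3⟩)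
    omega
  · have := single_le_sum (f := K.mult) (fun _ _ => Nat.zero_le _) (mem_univ ⟨(x - 2) / 3, h3⟩)
    omega
  · omega

theorem sum_range_three_mul (m : ℕ) (f : ℕ → ℕ) :
    ∑ x ∈ range (3 * m), f x = ∑ i ∈ range m, (f (3 * i) + f (3 * i + 1) + f (3 * i + 2)) := by
  induction m with
  | zero => rfl
  | succ m ih =>
    rw [show 3 * (m + 1) = 3 * m + 1 + 1 + 1 by ring, sum_range_succ, sum_range_succ,
      sum_range_succ, ih, sum_range_succ]
    ring

theorem sum_inputMem :
    n + K.capacity + ∑ x ∈ range (3 * n), K.inputMem (x + 2) = K.inputSum := by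
  rw [sum_range_three_mul, inputSum, Finset.sum_range]
  congr 1
  refine sum_congr rfl fun i _ => ?_
  rw [show 3 * (i : ℕ) + 1 + 2 = 3 * i + 3 by ring, show 3 * (i : ℕ) + 2 + 2 = 3 * i + 4 by ring,
    K.inputMem_size i.2, K.inputMem_value i.2, K.inputMem_mult i.2, ext_fin, ext_fin, ext_fin]

theorem maxSize_eq : (range n).sup (ext K.size) = K.maxSize := by
  refine le_antisymm (Finset.sup_le fun i hi => ?_) (Finset.sup_le fun i _ => ?_)
  · have : ext K.size i = K.size ⟨i, mem_range.1 hi⟩ := dif_pos (mem_range.1 hi)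
    rw [this]
    exact le_sup (f := K.size) (mem_univ _)
  · rw [← ext_fin K.size i]
    exact le_sup (f := ext K.size) (mem_range.2 i.2)

theorem value_items (z : ℕ → ℕ) : K.items.value z = K.totalValue fun i => z i := by
  have := Finset.sum_range (n := n) fun i => ext K.value i * z i
  simp only [ext_fin] at this
  exact this

theorem isOptimal_of_items {z : ℕ → ℕ} (h : K.items.Optimal (ext K.mult) K.capacity z) :
    K.IsOptimal fun i => z i := by
  refine ⟨⟨fun i => ?_, ?_⟩, fun y hy => ?_⟩
  · rw [← ext_fin K.mult i]; exact h.le i i.2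
  · have := h.cap_le
    rw [items, Finset.sum_range] at this
    simpa only [ext_fin] using this
  · have h1 := h.max (ext y) ⟨fun i hi => ?_, ?_⟩
    · rw [value_items, value_items] at h1
      simpa only [ext_fin] using h1
    · have := hy.1 ⟨i, hi⟩
      rw [← ext_fin K.mult, ← ext_fin y] at this
      exact this
    · have := hy.2
      rw [items, Finset.sum_range]
      simpa only [ext_fin] using this

/-- The row width and the value bound in terms of the sum of the input. -/
def env (live : Prop) : Env := ⟨K.inputSum ^ 8, K.inputSum ^ 24, live⟩

/-- As the input sum is at least `2`, constant factors can be traded for powers of it; all size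
estimates below rest on this. -/
theorem two_pow_mul_le {S : ℕ} (hS : 2 ≤ S) (a b : ℕ) : 2 ^ a * S ^ b ≤ S ^ (a + b) := by
  rw [pow_add]
  exact Nat.mul_le_mul_right _ (Nat.pow_le_pow_left hS a)

theorem two_le_inputSum (hn : 0 < n) (hK : ∀ i, 0 < K.size i) : 2 ≤ K.inputSum := by
  have h1 := K.inputSum_eq
  have h2 := single_le_sum (f := K.size) (fun _ _ => Nat.zero_le _) (mem_univ ⟨0, hn⟩)
  have h3 := hK ⟨0, hn⟩
  omega

theorem solveEnv (hn : 0 < n) (hK : ∀ i, 0 < K.size i) :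
    SolveEnv (K.env True) K.items (ext K.mult) K.capacity K.maxSize := by
  have hS := K.two_le_inputSum hn hK
  have hsum := K.inputSum_eq
  have hsz := ext_le_sum K.size
  have hv := ext_le_sum K.value
  have hu := ext_le_sum K.mult
  have hmax : K.maxSize ≤ ∑ i, K.size i :=
    Finset.sup_le fun i _ => single_le_sum (f := K.size) (fun _ _ => Nat.zero_le _) (mem_univ i)
  have hval : K.items.value (ext K.mult) ≤ (∑ i, K.value i) * ∑ i, K.mult i := by
    rw [value_items, sum_mul]
    refine sum_le_sum fun i _ => ?_
    exact Nat.mul_le_mul_left _ (hu i)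
  have hsu : ∑ i ∈ range n, ext K.size i * ext K.mult i ≤
      (∑ i, K.size i) * ∑ i, K.mult i := by
    rw [sum_ext K.size K.mult fun x y => x * y, sum_mul]
    exact sum_le_sum fun i _ => Nat.mul_le_mul_left _
      (single_le_sum (f := K.mult) (fun _ _ => Nat.zero_le _) (mem_univ i))
  generalize (∑ i, K.size i) = A at *
  generalize (∑ i, K.value i) = V at *
  generalize (∑ i, K.mult i) = U at *
  have e1 : (K.env True).W = K.inputSum ^ 8 := rfl
  have e2 : (K.env True).B = K.inputSum ^ 24 := rfl
  have e3 : K.items.n = n := rfl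
  have e4 : (range K.items.n).sup K.items.sz = K.maxSize := K.maxSize_eq
  generalize K.inputSum = S at *
  generalize K.maxSize = s at *
  have g1 := two_pow_mul_le hS 7 1
  have g2 := two_pow_mul_le hS 6 2
  have g3 := two_pow_mul_le hS 19 5
  have g4 := two_pow_mul_le hS 22 2
  have g5 : S ^ 8 ≤ S ^ 24 := Nat.pow_le_pow_right (by omega) (by omega)
  norm_num at g1 g2 g3 g4
  have q1 : S * S = S ^ 2 := (pow_two S).symm
  have q2 : 2 * S ≤ S ^ 2 := by rw [← q1]; exact Nat.mul_le_mul_right _ hS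
  have q3 : ∀ x y, x ≤ S → y ≤ S → x * y ≤ S ^ 2 := fun x y hx hy => by
    rw [← q1]; exact Nat.mul_le_mul hx hy
  have q4 : S ^ 2 ≤ S ^ 5 := Nat.pow_le_pow_right (by omega) (by omega)
  have hss := q3 s s (by omega) (by omega)
  have hVU := q3 V U (by omega) (by omega)
  have hAU := q3 A U (by omega) (by omega)
  have hpos : 0 < S ^ 5 := pow_pos (by omega) 5
  refine ⟨⟨trivial, by omega, by omega, fun i hi => ?_, fun i _ j _ => ?_⟩, hn, e4, by omega,
    by omega, fun i _ => ?_, ?_, by omega, ?_⟩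
  · have : ext K.size i = K.size ⟨i, hi⟩ := dif_pos hi
    exact (hK ⟨i, hi⟩).trans_le this.ge
  · have := q3 _ _ ((hv i).trans (by omega : V ≤ S)) ((hsz j).trans (by omega : A ≤ S))
    exact this.trans_lt (by omega)
  · have : K.items.v i ≤ V := hv i
    omega
  · exact hsu.trans_lt (by omega)
  · have hpen : K.items.value (ext K.mult) + 1 ≤ 2 * S ^ 2 := by omega
    generalize K.items.value (ext K.mult) + 1 = pen at *
    have h1 : gainBound s pen ≤ 20 * S ^ 4 := by
      have h2 : 3 * (2 * (s * s) + 1) + 2 * s ≤ 10 * S ^ 2 := by omega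
      calc gainBound s pen = (3 * (2 * (s * s) + 1) + 2 * s) * pen := by unfold gainBound; ring
        _ ≤ 10 * S ^ 2 * (2 * S ^ 2) := Nat.mul_le_mul h2 hpen
        _ = 20 * S ^ 4 := by ring
    have h3 : (s + 1) * gainBound s pen ≤ 20 * S ^ 5 :=
      calc (s + 1) * gainBound s pen ≤ S * (20 * S ^ 4) := Nat.mul_le_mul (by omega) h1
        _ = 20 * S ^ 5 := by ring
    omega

/-- The arrays occupy at most `W + 32 * W ^ 2` cells with `W = S ^ 8`, and `2 ^ 8 * S ^ 16 ≤ S ^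
24`. -/
theorem env_fits (hS : 2 ≤ K.inputSum) {w : ℕ} (hw : K.inputSum ^ 24 ≤ 2 ^ w) (live : Prop) :
    (K.env live).Fits w := by
  have e1 : (K.env live).W = K.inputSum ^ 8 := rfl
  have e2 : (K.env live).B = K.inputSum ^ 24 := rfl
  generalize K.inputSum = S at *
  have g1 := two_pow_mul_le hS 8 16
  have g2 := two_pow_mul_le hS 24 0
  have g3 : S ^ 8 ≤ S ^ 16 := Nat.pow_le_pow_right (by omega) (by omega)
  have g4 : S ^ 8 * S ^ 8 = S ^ 16 := by ring
  norm_num at g1 g2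
  refine ⟨by omega, by omega, ?_⟩
  rw [e1, g4]
  omega

/-- The store that represents the input. -/
def initStore : Store :=
  ⟨fun _ => 0, fun k i j => if k = 0 then K.inputMem i else K.inputMem ((K.env True).addr k i j)⟩

/-- Register `0` does not yet hold the row width, hence the environment without arrays. The cells of
the arrays start with whatever the memory contains there. -/
theorem sim_initStore (hS : 2 ≤ K.inputSum) {w : ℕ} (hw : K.inputSum ^ 24 ≤ 2 ^ w) :
    Sim (K.env False) w K.initStore K.initState := by
  have h1 : K.inputSum < K.inputSum ^ 24 := by
    have g1 := two_pow_mul_le hS 23 1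
    norm_num at g1
    omega
  refine ⟨fun _ => rfl, fun h => h.elim, fun i _ => by simp [initStore, initState],
    fun k i j hk _ _ _ => ?_, fun x => ?_, fun k i j => ?_⟩
  · simp only [initStore, if_neg hk.ne']
    rfl
  · exact Nat.two_pow_pos w
  · simp only [initStore]
    split_ifs <;> exact (K.inputMem_le _).trans_lt (h1.trans_le hw)

end Knapsack

open Knapsack WordRAM in
theorem theorem1 :
    ∃ (P : WordRAM.Program) (C k : ℕ), 0 < k ∧
      ∀ (n : ℕ) (K : Knapsack n) (w : ℕ),
        0 < n → (∀ i, 0 < K.size i) → K.inputSum ^ k ≤ 2 ^ w →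
        ∃ (T : ℕ) (τ : WordRAM.State),
          T ≤ C * (n + K.maxSize ^ 3) ∧
          WordRAM.HaltsIn w P K.initState T τ ∧
          K.CorrectOutput τ := by
  -- With `N = n + s ^ 3`, the first part makes at most `3 * n` iterations and the main part at most
  -- `615 * N`. The compiler adds one to each before multiplying by the code length, and `1 ≤ N`.
  -- The middle `1` is the `mov`.
  refine ⟨knapsackProgram, 4 * readSum.len + 1 + 616 * solve.len, 24, by omega, ?_⟩
  intro n K w hn hK hw
  have hS := K.two_le_inputSum hn hK
  have hE := K.solveEnv hn hK
  have hnW : 3 * n + 4 < K.inputSum ^ 8 := hE.n_lt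
  have hB : K.inputSum ^ 8 < K.inputSum ^ 24 := Nat.pow_lt_pow_right hS (by omega)
  obtain ⟨t₁, σ₁, r₁, ht₁, hn₁, hc₁, hw₁⟩ := readSum_spec (E := K.env False) (σ := K.initStore)
    (n := n) (cap := K.capacity) (S := K.inputSum) hB.le rfl rfl hnW K.sum_inputMem hB
  have A₁ := r₁.agree
  obtain ⟨T₁, ρ₁, s₁, l₁, m₁, p₁⟩ := r₁.compile (K.env_fits hS hw _) knapsackProgram 0 _
    (K.sim_initStore hS hw) rfl (codeAt_append [] _ _)
  have hraw : ∀ i, σ₁.arr 0 i 0 = K.inputMem i := fun i => by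
    rw [A₁.a 0 rfl]; rfl
  have hmov : knapsackProgram[ρ₁.pc]? = some (Instr.mov 0 (2 * vw + 1)) := by
    have := codeAt_append (readSum.code 0) [Instr.mov 0 (2 * vw + 1)]
      (solve.code (readSum.len + 1) ++ [Instr.halt]) 0 (by simp)
    rw [Cmd.length_code] at this
    rw [p₁]
    simpa [knapsackProgram] using this
  have e₂ := step_eq (w := w) hmov
  simp only [Instr.exec] at e₂
  obtain ⟨ρ₂, hρ₂⟩ : ∃ ρ₂, step w knapsackProgram ρ₁ = ρ₂ := ⟨_, rfl⟩
  -- The same store is now represented in the environment with arrays; the only new obligation is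
  -- the content of register `0`.
  have m₂ : Sim (K.env True) w σ₁ ρ₂ := by
    rw [← hρ₂, e₂]
    refine ⟨fun x => ?_, fun _ => ?_, m₁.raw, m₁.cells, m₁.bv, m₁.ba⟩
    · dsimp only
      rw [Function.update_of_ne (by omega)]
      exact m₁.vars x
    · dsimp only
      rw [Function.update_self, m₁.vars, hw₁]
      rfl
  have p₂ : ρ₂.pc = readSum.len + 1 := by rw [← hρ₂, e₂, p₁]; simp
  obtain ⟨t₃, σ₃, r₃, ht₃, hopt, hval⟩ := solve_spec hE (σ := σ₁) hn₁ hc₁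
    (fun i hi => by rw [hraw]; exact K.inputMem_size hi)
    (fun i hi => by rw [hraw]; exact K.inputMem_value hi)
    (fun i hi => by rw [hraw]; exact K.inputMem_mult hi)
  have hcode : CodeAt knapsackProgram (readSum.len + 1) (solve.code (readSum.len + 1)) := by
    have := codeAt_append (readSum.code 0 ++ [Instr.mov 0 (2 * vw + 1)])
      (solve.code (readSum.len + 1)) [Instr.halt]
    rw [List.length_append, Cmd.length_code] at this
    simpa [knapsackProgram] using this
  obtain ⟨T₃, ρ₃, s₃, l₃, m₃, p₃⟩ := r₃.compile (K.env_fits hS hw _) knapsackProgram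
    (readSum.len + 1) ρ₂ m₂ p₂ hcode
  have hhalt : knapsackProgram[ρ₃.pc]? = some Instr.halt := by
    have h1 : knapsackProgram = (readSum.code 0 ++ [Instr.mov 0 (2 * vw + 1)] ++
        solve.code (readSum.len + 1)) ++ [Instr.halt] := by simp [knapsackProgram]
    have h2 : (readSum.code 0 ++ [Instr.mov 0 (2 * vw + 1)] ++
        solve.code (readSum.len + 1)).length = ρ₃.pc := by
      rw [List.length_append, List.length_append, Cmd.length_code, Cmd.length_code, p₃]; rfl
    rw [h1, ← h2, List.getElem?_concat_length]
  refine ⟨T₃ + (1 + T₁), ρ₃, ?_, ⟨?_, .inl hhalt⟩, fun i => σ₃.arr 0 (i + 1) 0,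
    K.isOptimal_of_items hopt, ?_, fun i => ?_⟩
  · have ht₃ : t₃ ≤ 615 * (n + K.maxSize ^ 3) := ht₃
    obtain ⟨N, hN⟩ : ∃ N, N = n + K.maxSize ^ 3 := ⟨_, rfl⟩
    rw [← hN] at ht₃ ⊢
    have h1 : readSum.len * (t₁ + 1) ≤ readSum.len * (4 * N) := Nat.mul_le_mul_left _ (by omega)
    have h2 : solve.len * (t₃ + 1) ≤ solve.len * (616 * N) := Nat.mul_le_mul_left _ (by omega)
    calc T₃ + (1 + T₁) ≤ solve.len * (616 * N) + (N + readSum.len * (4 * N)) := by omega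
      _ = (4 * readSum.len + 1 + 616 * solve.len) * N := by ring
  · rw [Function.iterate_add_apply, Function.iterate_add_apply, s₁, Function.iterate_one, hρ₂, s₃]
  · rw [m₃.raw 0 (by show 0 < K.inputSum ^ 8; omega), hval, value_items]
  · rw [m₃.raw _ (by have := i.2; show 1 + (i : ℕ) < K.inputSum ^ 8; omega), add_comm]
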